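/- Let $d,n,m\ge 1$ be integers and $\mu>0$. There is a constant $\mu_0>0$ depending only on $d,n,m,\mu$ such that the following holds. Let $A=(A_{ij}^{\alpha\beta}(y,s))$, where $1\le i,j\le n$ and $\alpha,\beta$ run over the $d$-dimensional multi-indices of degree $m$, be real measurable coefficients on $\mathbb R^{d+1}$ such that for a.e. $(y,s)\in\mathbb R^{d+1}$ $$\sum_{|\alpha|=|\beta|=m}\sum_{i,j=1}^n A_{ij}^{\alpha\beta}(y,s)\,\xi_\alpha^i\xi_\beta^j\ \ge\ \mu\sum_{|\alpha|=m}|\xi_\alpha|^2\quad\text{for all }\xi=(\xi_\alpha)_{|\alpha|=m},\ \xi_\alpha\in\mathbb R^n,\qquad |A_{ij}^{\alpha\beta}(y,s)|\le \frac1\mu ,$$ and $A(y+z,s+k)=A(y,s)$ for all $(z,k)\in\mathbb Z^{d+1}$ and a.e. $(y,s)$. Put $Y=[-\frac12,\frac12)^{d+1}$. (i) For every multi-index $\gamma$ of degree $m$ and every $1\le j\le n$ there is exactly one (up to null sets) function $\chi_j^\gamma=(\chi_{1j}^\gamma,\dots,\chi_{nj}^\gamma):\mathbb R^{d+1}\to\mathbb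 R^n$, $1$-periodic in $(y,s)$, whose weak derivatives $D^\alpha_y\chi_j^\gamma$, $|\alpha|\le m$, are in $L^2(Y)$, with $\int_Y\chi_j^\gamma\,dy\,ds=0$, that solves weakly (in the sense of distributions on $\mathbb R^{d+1}$) $$\partial_s\chi_{ij}^\gamma+(-1)^m\sum_{|\alpha|=|\beta|=m}\sum_{k=1}^n D^\alpha\big(A_{ik}^{\alpha\beta}D^\beta\chi_{kj}^\gamma\big)=(-1)^{m+1}\sum_{|\alpha|=m}D^\alpha A_{ij}^{\alpha\gamma},\qquad 1\le i\le n .$$ (ii) The constants $$\bar A_{ij}^{\alpha\beta}=\int_Y\Big(A_{ij}^{\alpha\beta}+\sum_{|\gamma|=m}\sum_{\ell=1}^nA_{i\ell}^{\alpha\gamma}D^\gamma\chi_{\ell j}^\beta\Big)dy\,ds$$ are elliptic: $\sum\bar A_{ij}^{\alpha\beta}\xi_\alpha^i\xi_\beta^j\ge\mu\sum_{|\alpha|=m}|\xi_\alpha|^2$ for all $\xi$, and $|\bar A_{ij}^{\alpha\beta}|\le\mu_0$. (iii) Let $\Omega\subset\mathbb R^d$ be a bounded Lipschitz domain, $0<T<\infty$,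 $f\in L^2(0,T;H^{-m}(\Omega;\mathbb R^n))$ and $h\in L^2(\Omega;\mathbb R^n)$. For bounded measurable coefficients $a=(a_{ij}^{\alpha\beta}(x,t))$, a weak solution of the initial-Dirichlet problem $$\partial_tu+(-1)^m\sum_{|\alpha|=|\beta|=m}D^\alpha(a^{\alpha\beta}D^\beta u)=f\ \text{ in }\Omega\times(0,T),\qquad u=h\ \text{ at }t=0,$$ with homogeneous Dirichlet data is a $u\in L^2(0,T;H_0^m(\Omega;\mathbb R^n))\cap L^\infty(0,T;L^2(\Omega;\mathbb R^n))$ such that for all $\phi\in C_c^\infty(\Omega\times[0,T);\mathbb R^n)$ $$-\int_0^T\!\!\int_\Omega u\cdot\partial_t\phi\,dx\,dt+\sum_{|\alpha|=|\beta|=m}\sum_{i,j=1}^n\int_0^T\!\!\int_\Omega a_{ij}^{\alpha\beta}D^\beta u_j\,D^\alpha\phi_i\,dx\,dt=\int_0^T\langle f(t),\phi(t)\rangle_{H^{-m}\times H^m_0}\,dt+\int_\Omega h\cdot\phi(\cdot,0)\,dx .$$ There is exactly one weak solution $u_\varepsilon$ for $a(x,t)=A(x/\varepsilon,t/\varepsilon^{2m})$,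 for each $\varepsilon>0$, and exactly one weak solution $u_0$ for $a=\bar A$, and as $\varepsilon\to0^+$ $$u_\varepsilon\to u_0\quad\text{weakly in }L^2(0,T;H_0^m(\Omega))\ \text{ and strongly in }L^2(0,T;H^{m-1}(\Omega)).$$ -/

import Mathlib

open MeasureTheory Filter Topology Set
open scoped ContDiff NNReal ENNReal

noncomputable section

namespace ParabolicHomog

/-- Euclidean space `ℝ^d`. -/
abbrev Euc (d : ℕ) : Type := EuclideanSpace ℝ (Fin d)

/-! ### Multi-indices and classical derivatives -/

/-- `d`-dimensional multi-indices `α` with `|α| = m`. -/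
abbrev MIdx (d m : ℕ) : Type := {α : Fin d → ℕ // ∑ i, α i = m}

/-- `d`-dimensional multi-indices `α` with `|α| ≤ m`. -/
abbrev LIdx (d m : ℕ) : Type := {α : Fin d → ℕ // ∑ i, α i ≤ m}

theorem finite_LIdx (d m : ℕ) : Finite (LIdx d m) := by
  have : ({α : Fin d → ℕ | ∑ i, α i ≤ m}).Finite := by
    refine (Set.finite_Iic (fun _ : Fin d => m)).subset fun α hα i => ?_
    exact (Finset.single_le_sum (f := α) (fun _ _ => Nat.zero_le _) (Finset.mem_univ i)).trans hα
  exact this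

theorem finite_MIdx (d m : ℕ) : Finite (MIdx d m) :=
  have := finite_LIdx d m
  Finite.of_injective (fun α : MIdx d m => (⟨α.1, α.2.le⟩ : LIdx d m))
    fun _ _ h => Subtype.ext (Subtype.mk.inj h)

instance instFintypeLIdx (d m : ℕ) : Fintype (LIdx d m) := @Fintype.ofFinite _ (finite_LIdx d m)

instance instFintypeMIdx (d m : ℕ) : Fintype (MIdx d m) := @Fintype.ofFinite _ (finite_MIdx d m)

/-- A multi-index of degree `m`, regarded as one of degree at most `m`. -/
def MIdx.low {d m : ℕ} (α : MIdx d m) : LIdx d m := ⟨α.1, α.2.le⟩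

/-- The multi-index `0`. -/
def LIdx.zero (d m : ℕ) : LIdx d m := ⟨0, by simp⟩

/-- The classical partial derivative `D_{x_i} φ`. -/
def partialD {d n : ℕ} (i : Fin d) (φ : Euc d → Euc n) : Euc d → Euc n :=
  fun x => fderiv ℝ φ x (EuclideanSpace.single i (1 : ℝ))

/-- The classical derivative `D^α φ = D_{x_1}^{α_1} ⋯ D_{x_d}^{α_d} φ`. -/
def multiD {d n : ℕ} (α : Fin d → ℕ) (φ : Euc d → Euc n) : Euc d → Euc n :=
  (List.finRange d).foldr (fun i ψ => (partialD i)^[α i] ψ) φ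

/-- `D^α` acting on the space variable of a function of `(x, t)`. -/
def spaceD {d n : ℕ} (α : Fin d → ℕ) (φ : Euc d × ℝ → Euc n) : Euc d × ℝ → Euc n :=
  fun p => multiD α (fun x => φ (x, p.2)) p.1

/-- The derivative `∂_t` of a function of `(x, t)`. -/
def timeD {d n : ℕ} (φ : Euc d × ℝ → Euc n) : Euc d × ℝ → Euc n :=
  fun p => deriv (fun s => φ (p.1, s)) p.2

/-! ### Test functions -/

/-- `φ ∈ C_c^∞(U; W)`, for a function `φ` on the whole space. -/
structure IsTest {V W : Type*} [NormedAddCommGroup V] [NormedSpace ℝ V]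
    [NormedAddCommGroup W] [NormedSpace ℝ W] (U : Set V) (φ : V → W) : Prop where
  smooth : ContDiff ℝ ∞ φ
  compact : HasCompactSupport φ
  support : tsupport φ ⊆ U

theorem IsTest.partialD {d n : ℕ} {U : Set (Euc d)} {φ : Euc d → Euc n} (h : IsTest U φ)
    (i : Fin d) : IsTest U (partialD i φ) where
  smooth := (h.smooth.fderiv_right (m := ∞) (by simp)).clm_apply contDiff_const
  compact := h.compact.fderiv_apply (𝕜 := ℝ) _
  support := (tsupport_fderiv_apply_subset ℝ _).trans h.support

theorem IsTest.multiD {d n : ℕ} {U : Set (Euc d)} {φ : Euc d → Euc n} (h : IsTest U φ)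
    (α : Fin d → ℕ) : IsTest U (multiD α φ) := by
  have iter : ∀ (i : Fin d) (k : ℕ) (ψ : Euc d → Euc n), IsTest U ψ →
      IsTest U ((ParabolicHomog.partialD i)^[k] ψ) := by
    intro i k
    induction k with
    | zero => intro ψ hψ; exact hψ
    | succ k ih => intro ψ hψ; exact ih _ (hψ.partialD i)
  unfold ParabolicHomog.multiD
  induction List.finRange d with
  | nil => exact h
  | cons i l ih => exact iter i (α i) _ ih

/-- A smooth function on `Ω × [0, T)` with compact support is the restriction to `t ≥ 0` of some
`φ ∈ C_c^∞(Ω × (-∞, T))`; its time slices lie in `C_c^∞(Ω)`. -/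
theorem IsTest.slice {d n : ℕ} {Ω : Set (Euc d)} {I : Set ℝ} {φ : Euc d × ℝ → Euc n}
    (h : IsTest (Ω ×ˢ I) φ) (t : ℝ) : IsTest Ω (fun x => φ (x, t)) := by
  have hsub : tsupport (fun x => φ (x, t)) ⊆ {x | (x, t) ∈ tsupport φ} :=
    closure_minimal (fun x hx => subset_tsupport φ hx)
      ((isClosed_tsupport φ).preimage (by fun_prop : Continuous fun x : Euc d => (x, t)))
  refine ⟨h.smooth.comp (by fun_prop : ContDiff ℝ ∞ fun x : Euc d => (x, t)), ?_, ?_⟩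
  · exact (h.compact.isCompact.image continuous_fst).of_isClosed_subset (isClosed_tsupport _)
      fun x hx => ⟨(x, t), hsub hx, rfl⟩
  · exact fun x hx => (h.support (hsub hx)).1

theorem IsTest.memLp {d n : ℕ} {U Ω : Set (Euc d)} {φ : Euc d → Euc n} (h : IsTest U φ) :
    MemLp φ 2 (volume.restrict Ω) :=
  h.smooth.continuous.memLp_of_hasCompactSupport h.compact

/-! ### Sobolev spaces on `Ω` -/

/-- `L²(Ω; ℝ^n)`. -/
abbrev L2 (d n : ℕ) (Ω : Set (Euc d)) : Type := Lp (Euc n) 2 (volume.restrict Ω)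

/-- Families `(v_α)_{|α| ≤ m}` in `L²(Ω; ℝ^n)`, with the norm `(∑_α ‖v_α‖²)^{1/2}`. A Sobolev
function `v` is represented by the family `(D^α v)_{|α| ≤ m}` of its derivatives, so that this norm
is the `H^m(Ω)` norm. -/
abbrev JetSpace (d n m : ℕ) (Ω : Set (Euc d)) : Type :=
  PiLp 2 (fun _ : LIdx d m => L2 d n Ω)

/-- The family of derivatives of a test function. -/
def testJet {d n : ℕ} (m : ℕ) {Ω : Set (Euc d)} (φ : Euc d → Euc n) (h : IsTest Ω φ) :
    JetSpace d n m Ω :=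
  WithLp.toLp 2 fun α => ((h.multiD α.1).memLp (Ω := Ω)).toLp (multiD α.1 φ)

/-- `H^m_0(Ω; ℝ^n)`: the closure of `C_c^∞(Ω; ℝ^n)` in the `H^m` norm. -/
def H0 (d n m : ℕ) (Ω : Set (Euc d)) : Submodule ℝ (JetSpace d n m Ω) :=
  (Submodule.span ℝ
    {v | ∃ (φ : Euc d → Euc n) (h : IsTest Ω φ), v = testJet m φ h}).topologicalClosure

/-- A test function as an element of `H^m_0(Ω; ℝ^n)`. -/
def testH0 {d n : ℕ} (m : ℕ) {Ω : Set (Euc d)} (φ : Euc d → Euc n) (h : IsTest Ω φ) :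
    H0 d n m Ω :=
  ⟨testJet m φ h, Submodule.le_topologicalClosure _ (Submodule.subset_span ⟨φ, h, rfl⟩)⟩

/-- The derivative `D^α v ∈ L²(Ω; ℝ^n)` of `v ∈ H^m_0(Ω; ℝ^n)`, `|α| ≤ m`. -/
def H0.D {d n m : ℕ} {Ω : Set (Euc d)} (v : H0 d n m Ω) (α : LIdx d m) : L2 d n Ω := v.1 α

/-- The `H^k(Ω)` norm, `k ≤ m`, of `v ∈ H^m_0(Ω; ℝ^n)`. -/
def H0.sobolevNorm {d n m : ℕ} {Ω : Set (Euc d)} (k : ℕ) (v : H0 d n m Ω) : ℝ :=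
  Real.sqrt (∑ α : LIdx d m, if ∑ i, α.1 i ≤ k then ‖H0.D v α‖ ^ 2 else 0)

/-- `H^{-m}(Ω; ℝ^n)`, the dual of `H^m_0(Ω; ℝ^n)`. -/
abbrev Hneg (d n m : ℕ) (Ω : Set (Euc d)) : Type := StrongDual ℝ (H0 d n m Ω)

/-- `L²(0, T; X)`. -/
abbrev L2T (T : ℝ) (X : Type*) [NormedAddCommGroup X] : Type _ :=
  Lp X 2 (volume.restrict (Ioo (0 : ℝ) T))

/-- Bounded Lipschitz domains: bounded, open, connected, and near each boundary point, in suitable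
Cartesian coordinates (the last axis directed along the unit vector `ν`), the region above the graph
of a Lipschitz function of the remaining coordinates `x - ⟨ν, x⟩ ν`. -/
structure IsBoundedLipschitzDomain {d : ℕ} (Ω : Set (Euc d)) : Prop where
  isOpen : IsOpen Ω
  isConnected : IsConnected Ω
  isBounded : Bornology.IsBounded Ω
  lipschitz : ∀ x₀ ∈ frontier Ω, ∃ r : ℝ, 0 < r ∧ ∃ ν : Euc d, ‖ν‖ = 1 ∧
    ∃ (K : ℝ≥0) (g : Euc d → ℝ), LipschitzWith K g ∧
      ∀ x ∈ Metric.ball x₀ r, x ∈ Ω ↔ g (x - inner ℝ ν x • ν) < inner ℝ ν x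

/-! ### Coefficients -/

/-- Coefficient arrays `A_{ij}^{αβ}`, functions on `ℝ^{d+1}`; `A α β i j` is `A_{ij}^{αβ}`. -/
abbrev Coeff (d n m : ℕ) : Type :=
  MIdx d m → MIdx d m → Fin n → Fin n → Euc d × ℝ → ℝ

/-- Bounded measurable coefficients with ellipticity constant `μ` and bound `M`. The bound is put on
each entry, the weakest reading of `|A| ≤ M`. -/
structure IsElliptic {d n m : ℕ} (A : Coeff d n m) (μ M : ℝ) : Prop where
  measurable : ∀ α β i j, AEStronglyMeasurable (A α β i j) volume
  lower : ∀ᵐ p : Euc d × ℝ, ∀ ξ : MIdx d m → Euc n,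
    μ * ∑ α, ‖ξ α‖ ^ 2 ≤ ∑ α, ∑ β, ∑ i, ∑ j, A α β i j p * ξ α i * ξ β j
  upper : ∀ᵐ p : Euc d × ℝ, ∀ α β i j, |A α β i j p| ≤ M

/-- The point `(z, k) ∈ ℤ^{d+1} ⊆ ℝ^{d+1}`. -/
def latticePt {d : ℕ} (z : Fin d → ℤ) (k : ℤ) : Euc d × ℝ :=
  (WithLp.toLp 2 fun i => (z i : ℝ), (k : ℝ))

/-- `1`-periodicity in `(y, s)`. -/
def IsPeriodic {d : ℕ} {W : Type*} (F : Euc d × ℝ → W) : Prop :=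
  ∀ (z : Fin d → ℤ) (k : ℤ), ∀ᵐ p : Euc d × ℝ, F (p + latticePt z k) = F p

/-- The coefficients `A(x/ε, t/ε^{2m})`. -/
def oscillating {d n m : ℕ} (A : Coeff d n m) (ε : ℝ) : Coeff d n m :=
  fun α β i j p => A α β i j (ε⁻¹ • p.1, p.2 / ε ^ (2 * m))

/-! ### Correctors and homogenized coefficients -/

/-- The unit cell `Y = [-1/2, 1/2)^{d+1}`. -/
def cell (d : ℕ) : Set (Euc d × ℝ) :=
  {p | (∀ i, p.1 i ∈ Ico (-(1 / 2) : ℝ) (1 / 2)) ∧ p.2 ∈ Ico (-(1 / 2) : ℝ) (1 / 2)}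

/-- `v = (v_α)_{|α| ≤ m}` is the family of weak space derivatives `v_α = D^α v_0` of a `1`-periodic
function `v_0(y, s)` on `ℝ^{d+1}` that is locally in `L²(H^m)`. -/
structure IsPeriodicJet {d n m : ℕ} (v : LIdx d m → Euc d × ℝ → Euc n) : Prop where
  measurable : ∀ α, AEStronglyMeasurable (v α) volume
  periodic : ∀ α, IsPeriodic (v α)
  memLp : ∀ α, MemLp (v α) 2 (volume.restrict (cell d))
  weakDeriv : ∀ (α : LIdx d m) (φ : Euc d × ℝ → Euc n), IsTest univ φ →
    ∫ p, inner ℝ (v (LIdx.zero d m) p) (spaceD α.1 φ p)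
      = (-1) ^ (∑ i, α.1 i) * ∫ p, inner ℝ (v α p) (φ p)

/-- `X` is the matrix of correctors of `A`, together with its space derivatives: `X γ j α` is the
`ℝ^n`-valued function `D^α χ_j^γ`, with `k`-th component `D^α χ_{kj}^γ`. The cell problem
`∂_s χ_j^γ + (-1)^m ∑ D^α (A^{αβ} D^β χ_j^γ) = (-1)^{m+1} ∑ D^α (A^{αγ} e_j)` holds weakly. -/
structure IsCorrector {d n m : ℕ} (A : Coeff d n m)
    (X : MIdx d m → Fin n → LIdx d m → Euc d × ℝ → Euc n) : Prop where
  jet : ∀ γ j, IsPeriodicJet (X γ j)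
  mean : ∀ γ j, ∫ p in cell d, X γ j (LIdx.zero d m) p = 0
  equation : ∀ γ j (φ : Euc d × ℝ → Euc n), IsTest univ φ →
    -(∫ p, inner ℝ (X γ j (LIdx.zero d m) p) (timeD φ p))
        + ∑ α : MIdx d m, ∑ β : MIdx d m, ∑ i, ∑ k,
            ∫ p, A α β i k p * X γ j β.low p k * spaceD α.1 φ p i
      = -∑ α : MIdx d m, ∑ i, ∫ p, A α γ i j p * spaceD α.1 φ p i

/-- The homogenized coefficients
`Ā_{ij}^{αβ} = ∫_Y (A_{ij}^{αβ} + ∑_{γ,ℓ} A_{iℓ}^{αγ} D^γ χ_{ℓj}^β) dy ds`,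
as a constant coefficient array. -/
def homogenized {d n m : ℕ} (A : Coeff d n m)
    (X : MIdx d m → Fin n → LIdx d m → Euc d × ℝ → Euc n) : Coeff d n m :=
  fun α β i j _ =>
    ∫ p in cell d, (A α β i j p + ∑ γ : MIdx d m, ∑ l, A α γ i l p * X β j γ.low p l)

/-! ### Weak solutions -/

/-- `u ∈ L²(0,T; H^m_0(Ω)) ∩ L^∞(0,T; L²(Ω))` is a weak solution of
`∂_t u + (-1)^m ∑ D^α (a^{αβ} D^β u) = f` in `Ω × (0,T)`, with zero Dirichlet data
and `u = h` at `t = 0`. -/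
structure IsWeakSolution {d n m : ℕ} (Ω : Set (Euc d)) (T : ℝ) (a : Coeff d n m)
    (f : L2T T (Hneg d n m Ω)) (h : L2 d n Ω) (u : L2T T (H0 d n m Ω)) : Prop where
  bounded : MemLp (fun t => H0.D (u t) (LIdx.zero d m)) ∞ (volume.restrict (Ioo (0 : ℝ) T))
  equation : ∀ (φ : Euc d × ℝ → Euc n) (hφ : IsTest (Ω ×ˢ Iio T) φ),
    -(∫ t in Ioo (0 : ℝ) T, ∫ x in Ω, inner ℝ (H0.D (u t) (LIdx.zero d m) x) (timeD φ (x, t)))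
        + ∑ α : MIdx d m, ∑ β : MIdx d m, ∑ i, ∑ j,
            ∫ t in Ioo (0 : ℝ) T, ∫ x in Ω,
              a α β i j (x, t) * H0.D (u t) β.low x j * spaceD α.1 φ (x, t) i
      = (∫ t in Ioo (0 : ℝ) T, f t (testH0 m (fun x => φ (x, t)) (hφ.slice t)))
        + ∫ x in Ω, inner ℝ (h x) (φ (x, 0))

end ParabolicHomog

end

open ParabolicHomog

noncomputable section

namespace ParabolicHomog

open Finset (sum_congr mul_sum sum_eq_single sum_add_distrib sum_le_sum sum_comm single_le_sum sum_nonneg sum_mul sum_eq_zero)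
open Bornology (IsBounded)
open EuclideanSpace (single proj)
open ContinuousLinearMap (adjoint)
open MeasureTheory.MemLp (toLp_congr)
open MeasureTheory.L2 (inner_def)
open Complex (I real_smul)
open Function (Injective)
open Real (sqrt smoothTransition)
open Fintype (card card_fin sum_prod_type sum_prod_type')
open scoped ComplexConjugate Real

/-- Points `(x, t)` of space-time. -/
abbrev Pt (d : ℕ) : Type := Euc d × ℝ

notation "Smooth" => ContDiff ℝ ∞

notation "𝟎" => LIdx.zero _ _

/-! ### Calculus of the derivatives `D^α` -/

theorem multiIndex_induction {d} {P : (Fin d → ℕ) → Prop} (h0 : P 0)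
    (hs : ∀ α i, P α → P (α + Pi.single i 1)) (α) : P α := by
  obtain ⟨k, hk⟩ : ∃ k, ∑ i, α i = k := ⟨_, rfl⟩
  induction k generalizing α with
  | zero =>
    have : α = 0 := by
      funext i
      exact (Finset.sum_eq_zero_iff.1 hk) i (Finset.mem_univ i)
    exact this ▸ h0
  | succ k ih =>
    obtain ⟨i, hi⟩ : ∃ i, α i ≠ 0 := by
      by_contra! h
      simp [h] at hk
    have hα : α = (α - Pi.single i 1) + Pi.single i 1 := by
      funext j
      by_cases hj : j = i
      · subst hj; simp; omega
      · simp [hj]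
    rw [hα]
    refine hs _ i (ih _ ?_)
    have h2 : ∑ j, α j = ∑ j, (α - Pi.single i 1 : Fin d → ℕ) j + 1 := by
      conv_lhs => rw [hα]
      simp [sum_add_distrib]
    omega

theorem sum_add_single {d} (α : Fin d → ℕ) (i) :
    ∑ j, (α + Pi.single i 1 : Fin d → ℕ) j = ∑ j, α j + 1 := by
  simp [sum_add_distrib]

section calculus

variable {d n : ℕ} {φ ψ : Euc d → Euc n}

theorem contDiff_partialD (h : Smooth φ) (i) : Smooth (partialD i φ) :=
  (h.fderiv_right (m := ∞) (by simp)).clm_apply contDiff_const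

theorem partialD_comm (h : Smooth φ) (i j) :
    partialD i (partialD j φ) = partialD j (partialD i φ) := by
  have hd : Differentiable ℝ (fderiv ℝ φ) :=
    (h.fderiv_right (m := ∞) (by simp)).differentiable (by simp)
  have key : ∀ a b x, partialD a (partialD b φ) x
      = fderiv ℝ (fderiv ℝ φ) x (single a 1) (single b 1) := by
    intro a b x
    unfold partialD
    rw [fderiv_clm_apply (hd x) (differentiableAt_const _)]
    simp
  funext x
  rw [key, key]
  exact (h.contDiffAt (x := x)).isSymmSndFDerivAt (by simpa using ENat.LEInfty.out) _ _

theorem partialD_iterate_comm (h : Smooth φ) (i j k) : Smooth ((partialD j)^[k] φ) ∧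
      partialD i ((partialD j)^[k] φ) = (partialD j)^[k] (partialD i φ) := by
  induction k generalizing φ with
  | zero => exact ⟨h, rfl⟩
  | succ k ih =>
    have := ih (contDiff_partialD h j)
    refine ⟨this.1, ?_⟩
    rw [Function.iterate_succ_apply, Function.iterate_succ_apply, this.2, partialD_comm h]

theorem foldr_partialD (l : List (Fin d)) (α : Fin d → ℕ) (h : Smooth φ) (i) :
    Smooth (l.foldr (fun i ψ => (partialD i)^[α i] ψ) φ) ∧
      partialD i (l.foldr (fun i ψ => (partialD i)^[α i] ψ) φ)
        = l.foldr (fun i ψ => (partialD i)^[α i] ψ) (partialD i φ) := by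
  induction l with
  | nil => exact ⟨h, rfl⟩
  | cons j l ih =>
    simp only [List.foldr_cons]
    have := partialD_iterate_comm ih.1 i j (α j)
    exact ⟨this.1, by rw [this.2, ih.2]⟩

theorem contDiff_multiD (h : Smooth φ) (α) : Smooth (multiD α φ) := by
  unfold multiD
  induction List.finRange d with
  | nil => exact h
  | cons j l ih => exact (partialD_iterate_comm ih j j (α j)).1

theorem multiD_partialD (h : Smooth φ) (α i) :
    multiD α (partialD i φ) = partialD i (multiD α φ) :=
  (foldr_partialD _ α h i).2.symm

theorem multiD_zero (φ : Euc d → Euc n) : multiD 0 φ = φ := by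
  unfold multiD
  induction List.finRange d with
  | nil => rfl
  | cons j l ih => simp

theorem partialD_multiD (h : Smooth φ) (α i) :
    partialD i (multiD α φ) = multiD (α + Pi.single i 1) φ := by
  have key : ∀ l : List (Fin d), l.Nodup →
      (i ∈ l → l.foldr (fun j ψ => (partialD j)^[(α + Pi.single i 1 : Fin d → ℕ) j] ψ) φ
        = partialD i (l.foldr (fun j ψ => (partialD j)^[α j] ψ) φ)) ∧
      (i ∉ l → l.foldr (fun j ψ => (partialD j)^[(α + Pi.single i 1 : Fin d → ℕ) j] ψ) φ
        = l.foldr (fun j ψ => (partialD j)^[α j] ψ) φ) := by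
    intro l hl
    induction l with
    | nil => simp
    | cons j l ih =>
      have hl' := List.nodup_cons.1 hl
      simp only [List.foldr_cons, List.mem_cons]
      constructor
      · intro hi
        by_cases hij : i = j
        · subst hij
          rw [(ih hl'.2).2 hl'.1]
          simp only [Pi.add_apply, Pi.single_eq_same]
          rw [Function.iterate_succ_apply']
        · rw [(ih hl'.2).1 (hi.resolve_left hij)]
          have hj : (α + Pi.single i 1 : Fin d → ℕ) j = α j := by simp [Ne.symm hij]
          rw [hj, (partialD_iterate_comm (foldr_partialD l α h i).1 i j (α j)).2]
      · intro hi
        push Not at hi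
        rw [(ih hl'.2).2 hi.2]
        have hj : (α + Pi.single i 1 : Fin d → ℕ) j = α j := by simp [Ne.symm hi.1]
        rw [hj]
  exact ((key _ (List.nodup_finRange d)).1 (List.mem_finRange i)).symm

theorem partialD_add (h : Smooth φ) (h' : Smooth ψ) (i) :
    partialD i (φ + ψ) = partialD i φ + partialD i ψ := by
  funext x
  unfold partialD
  rw [fderiv_add (h.differentiable (by simp) x) (h'.differentiable (by simp) x)]
  rfl

theorem partialD_const_smul (h : Smooth φ) (c : ℝ) (i) :
    partialD i (c • φ) = c • partialD i φ := by
  funext x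
  unfold partialD
  rw [fderiv_const_smul (h.differentiable (by simp) x)]
  rfl

theorem multiD_add (h : Smooth φ) (h' : Smooth ψ) (α) :
    multiD α (φ + ψ) = multiD α φ + multiD α ψ := by
  induction α using multiIndex_induction with
  | h0 => simp [multiD_zero]
  | hs α i ih =>
    rw [← partialD_multiD (show Smooth (φ + ψ) from h.add h'), ih, partialD_add (contDiff_multiD h α)
      (contDiff_multiD h' α), partialD_multiD h, partialD_multiD h']

theorem multiD_const_smul (h : Smooth φ) (c : ℝ) (α) : multiD α (c • φ) = c • multiD α φ := by
  induction α using multiIndex_induction with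
  | h0 => simp [multiD_zero]
  | hs α i ih =>
    rw [← partialD_multiD (show Smooth (c • φ) from h.const_smul c), ih, partialD_const_smul (contDiff_multiD h α),
      partialD_multiD h]

theorem integral_inner_partialD {U} (hψ : Smooth ψ) (hφ : IsTest U φ) (i) :
    ∫ x, inner ℝ (ψ x) (partialD i φ x) = -∫ x, inner ℝ (partialD i ψ x) (φ x) := by
  have hitg : ∀ {a b : Euc d → Euc n}, Continuous a → Continuous b → HasCompactSupport b →
      Integrable fun x => (innerSL ℝ (E := Euc n)) (a x) (b x) := by
    intro a b ha hb hc
    refine Continuous.integrable_of_hasCompactSupport (by fun_prop) ?_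
    exact hc.mono fun x hx => by
      contrapose! hx
      simp only [Function.mem_support, not_not] at hx ⊢
      simp [hx]
  have := integral_bilinear_fderiv_right_eq_neg_left_of_integrable (μ := volume)
    (f := ψ) (g := φ) (v := single i (1 : ℝ)) (B := innerSL ℝ (E := Euc n))
    (hitg (contDiff_partialD hψ i).continuous hφ.smooth.continuous hφ.compact)
    (hitg hψ.continuous (hφ.partialD i).smooth.continuous (hφ.partialD i).compact)
    (hitg hψ.continuous hφ.smooth.continuous hφ.compact)
    (fun x _ => hψ.differentiable (by simp) x) (fun x _ => hφ.smooth.differentiable (by simp) x)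
  exact this

theorem integral_inner_multiD {U} (hψ : Smooth ψ) (hφ : IsTest U φ) (α) :
    ∫ x, inner ℝ (ψ x) (multiD α φ x) = (-1) ^ (∑ i, α i) * ∫ x, inner ℝ (multiD α ψ x) (φ x) := by
  induction α using multiIndex_induction generalizing ψ with
  | h0 => simp [multiD_zero]
  | hs α i ih =>
    rw [← partialD_multiD hφ.smooth, ← partialD_multiD hψ,
      integral_inner_partialD hψ (hφ.multiD α), ih (contDiff_partialD hψ i), sum_add_single,
      multiD_partialD hψ]
    ring

end calculus

/-! ### Plane waves -/

/-- The `ℝ^n`-valued plane wave `x ↦ Re (c e^{i ξ·x})`. -/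
def wave {d n : ℕ} (ξ : Fin d → ℝ) (c : Fin n → ℂ) : Euc d → Euc n :=
  fun x => WithLp.toLp 2 fun i => (c i * Complex.exp ((∑ j, ξ j * x j : ℝ) * I)).re

/-- The symbol `(iξ)^α` of `D^α`. -/
def symb {d : ℕ} (ξ : Fin d → ℝ) (α : Fin d → ℕ) : ℂ := ∏ j, (I * ξ j) ^ α j

section wave

variable {d n : ℕ} (ξ : Fin d → ℝ) (c : Fin n → ℂ)

theorem symb_zero : symb ξ 0 = 1 := by simp [symb]

theorem symb_add_single (α i) : symb ξ (α + Pi.single i 1) = I * ξ i * symb ξ α := by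
  unfold symb
  simp only [Pi.add_apply, pow_add, Finset.prod_mul_distrib]
  rw [mul_comm]
  congr 1
  rw [Finset.prod_eq_single i]
  · simp
  · intro j _ hj; simp [hj]
  · simp

theorem wave_apply (x i) : wave ξ c x i = (c i * Complex.exp ((∑ j, ξ j * x j : ℝ) * I)).re := rfl

theorem contDiff_phase : Smooth (fun x : Euc d => ∑ j, ξ j * x j) := by
  refine ContDiff.sum fun j _ => contDiff_const.mul ?_
  exact (proj (𝕜 := ℝ) j : Euc d →L[ℝ] ℝ).contDiff

theorem contDiff_wave : Smooth (wave ξ c) := by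
  rw [contDiff_euclidean]
  intro i
  simp only [wave_apply]
  refine Complex.reCLM.contDiff.comp (contDiff_const.mul (Complex.contDiff_exp.comp ?_))
  exact (Complex.ofRealCLM.contDiff.comp (contDiff_phase ξ)).mul contDiff_const

theorem partialD_wave (j) : partialD j (wave ξ c) = wave ξ fun i => I * ξ j * c i := by
  funext x
  ext i
  have h1 : HasFDerivAt (wave ξ c) (fderiv ℝ (wave ξ c) x) x :=
    ((contDiff_wave ξ c).differentiable (by simp) x).hasFDerivAt
  have h2 := ((proj (𝕜 := ℝ) i : Euc n →L[ℝ] ℝ).hasFDerivAt (x := wave ξ c x)).comp x h1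
  have h3 : HasDerivAt (fun s : ℝ => (proj (𝕜 := ℝ) i : Euc n →L[ℝ] ℝ)
      (wave ξ c (x + s • single j (1 : ℝ)))) _ 0 :=
    h2.hasLineDerivAt (single j (1 : ℝ))
  have h4 : HasDerivAt (fun s : ℝ => c i * Complex.exp (((∑ l, ξ l * x l : ℝ) + s * ξ j) * I))
      (c i * (Complex.exp (((∑ l, ξ l * x l : ℝ) + ((0 : ℝ) : ℂ) * ξ j) * I)
        * (((1 : ℝ) : ℂ) * ξ j * I))) (0 : ℝ) := by
    refine HasDerivAt.const_mul _ (HasDerivAt.cexp ?_)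
    exact ((((hasDerivAt_id (0 : ℝ)).ofReal_comp).mul_const (ξ j : ℂ)).const_add _).mul_const _
  have h5 := Complex.reCLM.hasFDerivAt.comp_hasDerivAt (0 : ℝ) h4
  have h6 : (fun s : ℝ => (proj (𝕜 := ℝ) i : Euc n →L[ℝ] ℝ) (wave ξ c (x + s • single j (1 : ℝ))))
      = Complex.reCLM ∘ fun s : ℝ => c i * Complex.exp (((∑ l, ξ l * x l : ℝ) + s * ξ j) * I) := by
    funext s
    refine (wave_apply ξ c _ i).trans ?_
    have : ∑ l, ξ l * (x + s • single j (1 : ℝ)) l = (∑ l, ξ l * x l) + s * ξ j := by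
      simp [mul_add, sum_add_distrib, mul_comm]
    rw [this]
    simp only [Function.comp, Complex.reCLM_apply]
    push_cast
    rfl
  have h7 := h3.unique (by convert h5 using 1)
  simp only [partialD, wave_apply]
  refine Eq.trans (h7) ?_
  simp only [Complex.reCLM_apply]
  congr 1
  push_cast
  ring_nf

theorem multiD_wave (α) : multiD α (wave ξ c) = wave ξ fun i => symb ξ α * c i := by
  induction α using multiIndex_induction with
  | h0 => simp [multiD_zero, symb_zero]
  | hs α i ih =>
    rw [← partialD_multiD (contDiff_wave ξ c), ih, partialD_wave]
    congr 1
    funext j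
    rw [symb_add_single]
    ring

end wave

/-! ### The product rule -/

section leibniz

variable {d n m : ℕ}

theorem partialD_smul {χ : Euc d → ℝ} {u : Euc d → Euc n} (hχ : Smooth χ)
    (hu : Smooth u) (i x) : partialD i (fun x => χ x • u x) x
      = χ x • partialD i u x + fderiv ℝ χ x (single i 1) • u x := by
  unfold partialD
  rw [fderiv_fun_smul (hχ.differentiable (by simp) x) (hu.differentiable (by simp) x)]
  simp

/-- `F` is a differential operator in `x` of order less than `k` (and at most `m`), with
smooth coefficients supported in `K`. -/
def IsLowerOrder (n m : ℕ) (K : Set (Pt d)) (k : ℕ)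
    (F : (Euc d → Euc n) → Pt d → Euc n) : Prop :=
  ∃ c : LIdx d m → Pt d → ℝ, (∀ γ, Smooth (c γ)) ∧ (∀ γ, tsupport (c γ) ⊆ K) ∧
    (∀ γ, k ≤ ∑ i, γ.1 i → c γ = 0) ∧
    ∀ u, Smooth u → ∀ p, F u p = ∑ γ, c γ p • multiD γ.1 u p.1

variable {K : Set (Pt d)} {k : ℕ} {F G : (Euc d → Euc n) → Pt d → Euc n}

theorem IsLowerOrder.add (hK : IsClosed K) (hF : IsLowerOrder n m K k F)
    (hG : IsLowerOrder n m K k G) : IsLowerOrder n m K k (F + G) := by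
  obtain ⟨c, c1, c2, c3, c4⟩ := hF
  obtain ⟨b, b1, b2, b3, b4⟩ := hG
  refine ⟨c + b, fun γ => (c1 γ).add (b1 γ), fun γ => ?_, fun γ h => ?_, fun u hu p => ?_⟩
  · refine closure_minimal (fun x hx => ?_) hK
    by_contra h
    have h1 : c γ x = 0 := image_eq_zero_of_notMem_tsupport fun h' => h (c2 γ h')
    have h2 : b γ x = 0 := image_eq_zero_of_notMem_tsupport fun h' => h (b2 γ h')
    simp [h1, h2] at hx
  · simp [c3 γ h, b3 γ h]
  · simp [c4 u hu, b4 u hu, add_smul, sum_add_distrib]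

theorem IsLowerOrder.zero : IsLowerOrder n m K k (fun _ _ => 0) :=
  ⟨0, fun _ => contDiff_const, by simp [tsupport_eq_empty_iff.2], by simp, by simp⟩

theorem IsLowerOrder.single {b : Pt d → ℝ} (hb : Smooth b) (hK : tsupport b ⊆ K)
    (γ) (hγ : ∑ i, γ i < k) (hm : ∑ i, γ i ≤ m) :
    IsLowerOrder n m K k (fun u p => b p • multiD γ u p.1) := by
  classical
  refine ⟨Pi.single ⟨γ, hm⟩ b, fun δ => ?_, fun δ => ?_, fun δ h => ?_, fun u hu p => ?_⟩
  · by_cases h : δ = ⟨γ, hm⟩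
    · subst h; simpa using hb
    · simp only [Pi.single_eq_of_ne h]; exact contDiff_const
  · by_cases h : δ = ⟨γ, hm⟩
    · subst h; simpa using hK
    · simp [h, tsupport_eq_empty_iff.2]
  · have : δ ≠ ⟨γ, hm⟩ := by rintro rfl; exact absurd hγ (not_lt.2 h)
    simp [this]
  · rw [sum_eq_single ⟨γ, hm⟩]
    · simp
    · intro δ _ h; simp [h]
    · simp

theorem IsLowerOrder.sum (hK : IsClosed K) {ι : Type*} (s) {F : ι → (Euc d → Euc n) → Pt d → Euc n}
    (h : ∀ i ∈ s, IsLowerOrder n m K k (F i)) : IsLowerOrder n m K k (∑ i ∈ s, F i) := by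
  classical
  induction s using Finset.induction_on with
  | empty => exact IsLowerOrder.zero
  | insert a s ha ih =>
    rw [Finset.sum_insert ha]
    exact (h a (by simp)).add hK (ih fun i hi => h i (by simp [hi]))

/-- The space derivative `∂_i b` of a function of `(x, t)`. -/
def sliceD {W : Type*} [NormedAddCommGroup W] [NormedSpace ℝ W] (i : Fin d)
    (b : Pt d → W) : Pt d → W :=
  fun p => fderiv ℝ b p (single i 1, 0)

section slice

variable {W : Type*} [NormedAddCommGroup W] [NormedSpace ℝ W]

theorem contDiff_sliceD {b : Pt d → W} (hb : Smooth b) (i) : Smooth (sliceD i b) :=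
  (hb.fderiv_right (m := ∞) (by simp)).clm_apply contDiff_const

theorem tsupport_sliceD (b : Pt d → W) (i) :
    tsupport (sliceD i b) ⊆ tsupport b := tsupport_fderiv_apply_subset ℝ _

theorem fderiv_slice {b : Pt d → W} (hb : Smooth b) (i x t) :
    fderiv ℝ (fun x => b (x, t)) x (single i 1) = sliceD i b (x, t) := by
  have h1 : HasFDerivAt (fun x => (x, t)) (ContinuousLinearMap.inl ℝ (Euc d) ℝ) x := by
    exact (hasFDerivAt_id (𝕜 := ℝ) x).prodMk (hasFDerivAt_const (𝕜 := ℝ) t x)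
  have h2 := ((hb.differentiable (by simp) (x, t)).hasFDerivAt).comp x h1
  unfold sliceD
  have h3 : fderiv ℝ (fun x => b (x, t)) x = _ := h2.fderiv
  rw [h3]
  simp

end slice

theorem contDiff_slice {W : Type*} [NormedAddCommGroup W] [NormedSpace ℝ W] {b : Pt d → W}
    (hb : Smooth b) (t) : Smooth (fun x => b (x, t)) :=
  hb.comp (by fun_prop : Smooth fun x => (x, t))

/-- The product rule for `D^α`, up to operators of lower order. -/
theorem exists_multiD_smul {χ : Pt d → ℝ} (hχ : Smooth χ) (α) (hα : ∑ i, α i ≤ m) :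
    ∃ F, IsLowerOrder n m (tsupport χ) (∑ i, α i) F ∧ ∀ u, Smooth u →
      ∀ x t, multiD α (fun x => χ (x, t) • u x) x = χ (x, t) • multiD α u x + F u (x, t) := by
  induction α using multiIndex_induction with
  | h0 => exact ⟨_, IsLowerOrder.zero, by simp [multiD_zero]⟩
  | hs α i ih =>
    rw [sum_add_single] at hα ⊢
    obtain ⟨F, ⟨c, c1, c2, c3, c4⟩, hF⟩ := ih (by omega)
    have hcl : IsClosed (tsupport χ) := isClosed_tsupport χ
    have h1 : IsLowerOrder n m (tsupport χ) (∑ j, α j + 1)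
        (fun u p => sliceD i χ p • multiD α u p.1) :=
      .single (contDiff_sliceD hχ i) (tsupport_sliceD χ i) α (by omega) (by omega)
    have h2 : ∀ γ, IsLowerOrder n m (tsupport χ) (∑ j, α j + 1)
        (fun u p => c γ p • multiD (γ.1 + Pi.single i 1) u p.1) := by
      intro γ
      by_cases h : ∑ j, γ.1 j < ∑ j, α j
      · exact .single (c1 γ) (c2 γ) _ (by rw [sum_add_single]; omega)
          (by rw [sum_add_single]; omega)
      · rw [c3 γ (not_lt.1 h)]
        simpa using IsLowerOrder.zero
    have h3 : ∀ γ, IsLowerOrder n m (tsupport χ) (∑ j, α j + 1)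
        (fun u p => sliceD i (c γ) p • multiD γ.1 u p.1) := by
      intro γ
      by_cases h : ∑ j, γ.1 j < ∑ j, α j
      · exact .single (contDiff_sliceD (c1 γ) i) ((tsupport_sliceD _ i).trans (c2 γ)) _
          (by omega) γ.2
      · rw [c3 γ (not_lt.1 h)]
        have : sliceD i (0 : Pt d → ℝ) = 0 := by funext p; simp [sliceD]
        simpa [this] using IsLowerOrder.zero
    refine ⟨_, (h1.add hcl (.sum hcl Finset.univ fun γ _ => h2 γ)).add hcl
      (.sum hcl Finset.univ fun γ _ => h3 γ), fun u hu x t => ?_⟩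
    have hsm : Smooth fun x => χ (x, t) • u x := (contDiff_slice hχ t).smul hu
    have hsum : ∀ γ, Smooth fun x => c γ (x, t) • multiD γ.1 u x :=
      fun γ => (contDiff_slice (c1 γ) t).smul (contDiff_multiD hu _)
    rw [← partialD_multiD hsm]
    have e1 : multiD α (fun x => χ (x, t) • u x)
        = (fun x => χ (x, t) • multiD α u x) + fun x => ∑ γ, c γ (x, t) • multiD γ.1 u x := by
      funext y
      rw [hF u hu, c4 u hu, Pi.add_apply]
    have e2 : partialD i (fun x => ∑ γ, c γ (x, t) • multiD γ.1 u x) x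
        = ∑ γ, partialD i (fun x => c γ (x, t) • multiD γ.1 u x) x := by
      unfold partialD
      rw [fderiv_fun_sum fun γ _ => (hsum γ).differentiable (by simp) x]
      simp
    have e0 : Smooth fun x => χ (x, t) • multiD α u x :=
      (contDiff_slice hχ t).smul (contDiff_multiD hu _)
    rw [e1, partialD_add e0 (ContDiff.sum fun γ _ => hsum γ), Pi.add_apply, e2,
      partialD_smul (contDiff_slice hχ t) (contDiff_multiD hu _), fderiv_slice hχ,
      partialD_multiD hu]
    have e3 : ∀ γ, partialD i (fun x => c γ (x, t) • multiD γ.1 u x) x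
        = c γ (x, t) • multiD (γ.1 + Pi.single i 1) u x + sliceD i (c γ) (x, t) • multiD γ.1 u x := by
      intro γ
      rw [partialD_smul (contDiff_slice (c1 γ) t) (contDiff_multiD hu _), fderiv_slice (c1 γ),
        partialD_multiD hu]
    simp only [e3, sum_add_distrib, Pi.add_apply, Finset.sum_apply]
    abel

end leibniz

/-! ### Fourier series on the unit cell -/

/-- Frequencies `k = (k', k_s) ∈ ℤ^d × ℤ`. -/
abbrev Freq (d : ℕ) : Type := (Fin d → ℤ) × ℤ

/-- The exponential `e_k(y, s) = exp (2πi (k'·y + k_s s))`. -/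
def ex {d : ℕ} (k : Freq d) (p : Pt d) : ℂ :=
  Complex.exp ((2 * π * (∑ j, k.1 j * p.1 j + k.2 * p.2) : ℝ) * I)

/-- The Fourier coefficient `∫_Y f e_k`. -/
def hat {d : ℕ} (f : Pt d → ℝ) (k : Freq d) : ℂ := ∫ p in cell d, f p • ex k p

instance instAddHaarSpaceTime (d : ℕ) : (volume : Measure (Pt d)).IsAddHaarMeasure :=
  Measure.prod.instIsAddHaarMeasure (volume : Measure (Euc d)) (volume : Measure ℝ)

section cell

variable {d : ℕ}

theorem continuous_ex (k : Freq d) : Continuous (ex k) := by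
  unfold ex
  fun_prop

theorem norm_ex (k : Freq d) (p) : ‖ex k p‖ = 1 := by
  unfold ex
  exact Complex.norm_exp_ofReal_mul_I _

theorem ex_neg (k : Freq d) (p) : ex (-k) p = conj (ex k p) := by
  unfold ex
  rw [← Complex.exp_conj]
  congr 1
  simp only [Prod.fst_neg, Prod.snd_neg, Pi.neg_apply, Int.cast_neg, neg_mul,
    Finset.sum_neg_distrib, map_mul, Complex.conj_ofReal, Complex.conj_I]
  push_cast
  ring

theorem ex_add (k l : Freq d) (p) : ex (k + l) p = ex k p * ex l p := by
  unfold ex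
  rw [← Complex.exp_add]
  congr 1
  simp only [Prod.fst_add, Prod.snd_add, Pi.add_apply, Int.cast_add, add_mul, sum_add_distrib]
  push_cast
  ring

theorem ex_zero (p) : ex (0 : Freq d) p = 1 := by simp [ex]

theorem ex_add_latticePt (k : Freq d) (p z l) : ex k (p + latticePt z l) = ex k p := by
  unfold ex
  rw [Complex.exp_eq_exp_iff_exists_int]
  refine ⟨∑ j, k.1 j * z j + k.2 * l, ?_⟩
  simp only [latticePt, Prod.fst_add, Prod.snd_add, PiLp.add_apply, mul_add, sum_add_distrib]
  push_cast
  ring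

theorem measurableSet_cell (d) : MeasurableSet (cell d) := by
  have : cell d = (⋂ i, (fun p : Pt d => p.1 i) ⁻¹' Ico (-(1 / 2) : ℝ) (1 / 2)) ∩
      Prod.snd ⁻¹' Ico (-(1 / 2) : ℝ) (1 / 2) := by
    ext p; simp [cell]
  rw [this]
  refine (MeasurableSet.iInter fun i => measurableSet_Ico.preimage ?_).inter
    (measurableSet_Ico.preimage measurable_snd)
  fun_prop

/-- Cartesian coordinates `(s, y)` on `ℝ^{d+1}`. -/
def coordMap (d : ℕ) (x : Fin (d + 1) → ℝ) : Pt d := (WithLp.toLp 2 fun i => x i.succ, x 0)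

theorem measurePreserving_coordMap (d) : MeasurePreserving (coordMap d) volume volume := by
  have h1 := volume_preserving_piFinSuccAbove (fun _ : Fin (d + 1) => ℝ) 0
  have h2 : MeasurePreserving (Prod.map id (WithLp.toLp 2) : ℝ × (Fin d → ℝ) → ℝ × Euc d)
      volume volume :=
    (MeasurePreserving.id volume).prod (PiLp.volume_preserving_toLp (Fin d))
  have h3 : MeasurePreserving (Prod.swap : ℝ × Euc d → Pt d) volume volume :=
    Measure.measurePreserving_swap
  exact (h3.comp h2).comp h1

/-- The cell with half-open intervals the other way round. -/
def cellBox (d : ℕ) : Set (Fin (d + 1) → ℝ) :=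
  {x | ∀ i, x i ∈ Ioc ((fun _ => -(1 / 2) : Fin (d + 1) → ℝ) i)
    ((fun _ => -(1 / 2) : Fin (d + 1) → ℝ) i + 1)}

theorem preimage_cell_ae_eq (d) : coordMap d ⁻¹' cell d =ᵐ[volume] cellBox d := by
  have h1 : coordMap d ⁻¹' cell d
      = Set.pi univ fun _ : Fin (d + 1) => Ico (-(1 / 2) : ℝ) (1 / 2) := by
    ext x
    simp only [coordMap, cell, mem_preimage, Set.mem_ofPred_eq, Set.mem_pi, mem_univ,
      forall_true_left, Fin.forall_fin_succ]
    tauto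
  have h2 : cellBox d = Set.pi univ fun _ : Fin (d + 1) => Ioc (-(1 / 2) : ℝ) (1 / 2) := by
    ext x
    simp only [cellBox, Set.mem_ofPred_eq, Set.mem_pi, mem_univ, forall_true_left]
    norm_num
  rw [h1, h2]
  exact Measure.univ_pi_Ico_ae_eq_Icc.trans Measure.univ_pi_Ioc_ae_eq_Icc.symm

/-- The representative in the cell of a point of the torus. -/
def cellRep (d : ℕ) (x : UnitAddTorus (Fin (d + 1))) : Pt d :=
  coordMap d (UnitAddTorus.measurableEquivPiIoc (fun _ => -(1 / 2)) x).1

/-- The normalised Haar measure on the torus. -/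
def torusVol (d : ℕ) : Measure (UnitAddTorus (Fin (d + 1))) :=
  Measure.pi fun _ => AddCircle.haarAddCircle

theorem measurePreserving_cellRep (d) :
    MeasurePreserving (cellRep d) (torusVol d) (volume.restrict (cell d)) := by
  have h1 := UnitAddTorus.measurePreserving_equivPiIoc (d := Fin (d + 1)) (fun _ => -(1 / 2))
  have hm : MeasurableSet (cellBox d) := MeasurableSet.univ_pi' fun i => measurableSet_Ioc
  have h2 : MeasurePreserving (Subtype.val : cellBox d → Fin (d + 1) → ℝ)
      (Measure.comap Subtype.val volume) (volume.restrict (cellBox d)) :=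
    measurePreserving_subtype_coe hm
  have h3 := (measurePreserving_coordMap d).restrict_preimage (measurableSet_cell d)
  rw [Measure.restrict_congr_set (preimage_cell_ae_eq d)] at h3
  exact h3.comp (h2.comp h1)

/-- The frequency `-k` as a multi-index on the torus. -/
def freqEquiv (d : ℕ) : Freq d ≃ (Fin (d + 1) → ℤ) where
  toFun k := -Fin.cons k.2 k.1
  invFun l := (fun i => -l i.succ, -l 0)
  left_inv k := by ext <;> simp
  right_inv l := by
    funext i
    refine Fin.cases ?_ (fun j => ?_) i <;> simp

theorem mFourier_freqEquiv (k x) :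
    UnitAddTorus.mFourier (-(freqEquiv d k)) x = ex k (cellRep d x) := by
  set y := (UnitAddTorus.measurableEquivPiIoc (fun _ : Fin (d + 1) => -(1 / 2 : ℝ)) x) with hy
  have hx : x = fun i => ((y.1 i : ℝ) : UnitAddCircle) := by
    rw [← UnitAddTorus.coe_symm_measurableEquivPiIoc_apply, hy, MeasurableEquiv.symm_apply_apply]
  have h0 : cellRep d x = coordMap d y.1 := rfl
  rw [h0]
  conv_lhs => rw [hx]
  simp only [UnitAddTorus.mFourier, ContinuousMap.coe_mk, freqEquiv, Equiv.coe_fn_mk, neg_neg,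
    fourier_coe_apply, ex, coordMap]
  rw [← Complex.exp_sum, Fin.sum_univ_succ]
  congr 1
  simp only [Fin.cons_zero, Fin.cons_succ]
  push_cast
  simp only [div_one, mul_add, add_mul, mul_sum, sum_mul]
  rw [add_comm]
  congr 1
  · exact sum_congr rfl fun i _ => by ring
  · ring

theorem measure_cell (d) : volume (cell d) = 1 := by
  have h := (measurePreserving_cellRep d).measure_preimage
    (s := univ) MeasurableSet.univ.nullMeasurableSet
  simp only [preimage_univ, Measure.restrict_apply_univ] at h
  rw [← h]
  simp [torusVol]

instance instProbCell (d : ℕ) : IsProbabilityMeasure (volume.restrict (cell d)) :=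
  ⟨by rw [Measure.restrict_apply_univ, measure_cell]⟩

/-- **Parseval's identity** on the cell. -/
theorem hasSum_hat {f g} (hf : MemLp f 2 (volume.restrict (cell d)))
    (hg : MemLp g 2 (volume.restrict (cell d))) :
    HasSum (fun k => hat f k * conj (hat g k)) ((∫ p in cell d, f p * g p : ℝ) : ℂ) := by
  have mp := measurePreserving_cellRep d
  have hF : ∀ {f : Pt d → ℝ}, MemLp f 2 (volume.restrict (cell d)) →
      MemLp (fun x => (f (cellRep d x) : ℂ)) 2 (torusVol d) := fun h =>
    (h.comp_measurePreserving mp).ofReal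
  have hc : ∀ {f : Pt d → ℝ} (h : MemLp f 2 (volume.restrict (cell d))) (k : Freq d),
      UnitAddTorus.mFourierCoeff (((hF h).toLp _ : Lp ℂ 2 (torusVol d)) : _ → ℂ) (freqEquiv d k)
        = hat f k := by
    intro f h k
    have e1 : UnitAddTorus.mFourierCoeff (((hF h).toLp _ : Lp ℂ 2 (torusVol d)) : _ → ℂ)
        (freqEquiv d k) = ∫ x, f (cellRep d x) • ex k (cellRep d x) ∂(torusVol d) := by
      refine integral_congr_ae ?_
      filter_upwards [(hF h).coeFn_toLp] with x hx
      rw [hx, mFourier_freqEquiv, smul_eq_mul, mul_comm, real_smul]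
    have e2 : AEStronglyMeasurable (fun p => f p • ex k p) (volume.restrict (cell d)) :=
      h.1.smul (continuous_ex k).aestronglyMeasurable
    rw [e1, hat, ← mp.map_eq, integral_map mp.measurable.aemeasurable (by rw [mp.map_eq]; exact e2)]
  have := UnitAddTorus.hasSum_prod_mFourierCoeff ((hF hg).toLp _ : Lp ℂ 2 (torusVol d))
    ((hF hf).toLp _ : Lp ℂ 2 (torusVol d))
  rw [← (freqEquiv d).hasSum_iff] at this
  have e1 : (∫ x, conj (((hF hg).toLp _ : Lp ℂ 2 (torusVol d)) x)
      * ((hF hf).toLp _ : Lp ℂ 2 (torusVol d)) x ∂(torusVol d))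
      = ((∫ p in cell d, f p * g p : ℝ) : ℂ) := by
    rw [← integral_complex_ofReal]
    have e2 : AEStronglyMeasurable (fun p => ((f p * g p : ℝ) : ℂ)) (volume.restrict (cell d)) :=
      Complex.continuous_ofReal.comp_aestronglyMeasurable (hf.1.mul hg.1)
    rw [← mp.map_eq, integral_map mp.measurable.aemeasurable (by rw [mp.map_eq]; exact e2)]
    refine integral_congr_ae ?_
    filter_upwards [(hF hf).coeFn_toLp, (hF hg).coeFn_toLp] with x h1 h2
    rw [h1, h2]
    simp [mul_comm]
  rw [← e1]
  refine HasSum.congr_fun this fun k => ?_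
  rw [← hc hf, ← hc hg]
  exact mul_comm _ _

theorem hasSum_hat_sq {f} (hf : MemLp f 2 (volume.restrict (cell d))) :
    HasSum (fun k => ‖hat f k‖ ^ 2) (∫ p in cell d, f p ^ 2) := by
  have := Complex.hasSum_re (hasSum_hat hf hf)
  simp only [Complex.ofReal_re] at this
  convert this using 2 with k
  · rw [Complex.mul_conj, Complex.ofReal_re, Complex.normSq_eq_norm_sq]
  · simp [pow_two]

theorem ae_eq_zero_of_hat_eq_zero {f} (hf : MemLp f 2 (volume.restrict (cell d)))
    (h : ∀ k, hat f k = 0) : f =ᵐ[volume.restrict (cell d)] 0 := by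
  have h1 := hasSum_hat_sq hf
  simp only [h, norm_zero, ne_eq, OfNat.ofNat_ne_zero, not_false_eq_true, zero_pow] at h1
  have h2 : ∫ p in cell d, f p ^ 2 = 0 := h1.unique hasSum_zero
  rw [integral_eq_zero_iff_of_nonneg (fun p => sq_nonneg _) hf.integrable_sq] at h2
  filter_upwards [h2] with p hp
  simpa using hp

theorem integrable_smul_ex {f : Pt d → ℝ} {ν : Measure (Pt d)} (hf : Integrable f ν)
    (k) : Integrable (fun p => f p • ex k p) ν := by
  refine hf.smul_of_top_left ?_ |>.congr (ae_of_all _ fun p => rfl)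
  exact memLp_top_of_bound (continuous_ex k).aestronglyMeasurable 1
    (ae_of_all _ fun p => (norm_ex k p).le)

theorem hat_sub {f g} (hf : MemLp f 2 (volume.restrict (cell d)))
    (hg : MemLp g 2 (volume.restrict (cell d))) (k) : hat (f - g) k = hat f k - hat g k := by
  unfold hat
  rw [← integral_sub (integrable_smul_ex (hf.integrable (by norm_num)) k)
    (integrable_smul_ex (hg.integrable (by norm_num)) k)]
  simp [sub_smul]

theorem ae_eq_of_hat_eq {f g} (hf : MemLp f 2 (volume.restrict (cell d)))
    (hg : MemLp g 2 (volume.restrict (cell d))) (h : ∀ k, hat f k = hat g k) :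
    f =ᵐ[volume.restrict (cell d)] g := by
  have := ae_eq_zero_of_hat_eq_zero (hf.sub hg) fun k => by rw [hat_sub hf hg, h, sub_self]
  filter_upwards [this] with p hp
  simpa [sub_eq_zero] using hp

/-! ### Unfolding integrals over the lattice -/

/-- The lattice `ℤ^{d+1}` as a group homomorphism. -/
def lat (d : ℕ) : Freq d →+ Pt d where
  toFun z := latticePt z.1 z.2
  map_zero' := by ext i <;> simp [latticePt]
  map_add' z w := by ext i <;> simp [latticePt]

theorem lat_injective (d) : Injective (lat d) := by
  intro z w h
  have h1 : ∀ i, (lat d z).1 i = (lat d w).1 i := fun i => by rw [h]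
  have h2 : (lat d z).2 = (lat d w).2 := by rw [h]
  ext i
  · exact Int.cast_injective (h1 i)
  · exact Int.cast_injective h2

theorem existsUnique_add_mem_Ico (x : ℝ) : ∃! k : ℤ, x + k ∈ Ico (-(1 / 2) : ℝ) (1 / 2) := by
  have := existsUnique_add_zsmul_mem_Ico (zero_lt_one' ℝ) x (-(1 / 2))
  convert this using 3 <;> norm_num

theorem isAddFundamentalDomain_cell (d) : IsAddFundamentalDomain (lat d).range (cell d) volume := by
  refine IsAddFundamentalDomain.mk' (measurableSet_cell d).nullMeasurableSet fun p => ?_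
  choose z hz hz' using fun i => existsUnique_add_mem_Ico (p.1 i)
  obtain ⟨l, hl, hl'⟩ := existsUnique_add_mem_Ico p.2
  refine ⟨⟨lat d (z, l), ⟨(z, l), rfl⟩⟩, ?_, ?_⟩
  · change lat d (z, l) + p ∈ cell d
    rw [add_comm]
    exact ⟨fun i => hz i, hl⟩
  · rintro ⟨_, ⟨⟨w, r⟩, rfl⟩⟩ hw
    change lat d (w, r) + p ∈ cell d at hw
    rw [add_comm] at hw
    have h1 : w = z := funext fun i => hz' i _ (hw.1 i)
    have h2 : r = l := hl' _ hw.2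
    rw [h1, h2]

instance instCountableLatRange (d : ℕ) : Countable (lat d).range :=
  (Set.countable_range (lat d)).to_subtype

theorem lintegral_eq_tsum_cell (f : Pt d → ℝ≥0∞) :
    ∫⁻ p, f p = ∑' z : Freq d, ∫⁻ p in cell d, f (p + lat d z) := by
  rw [(isAddFundamentalDomain_cell d).lintegral_eq_tsum'' f,
    ← ((AddMonoidHom.ofInjective (lat_injective d)).toEquiv).tsum_eq]
  refine tsum_congr fun z => lintegral_congr fun p => ?_
  change f (lat d z + p) = _
  rw [add_comm]

theorem integral_eq_tsum_cell {E : Type*} [NormedAddCommGroup E] [NormedSpace ℝ E] {f : Pt d → E}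
    (hf : Integrable f) : ∫ p, f p = ∑' z : Freq d, ∫ p in cell d, f (p + lat d z) := by
  rw [(isAddFundamentalDomain_cell d).integral_eq_tsum'' f hf,
    ← ((AddMonoidHom.ofInjective (lat_injective d)).toEquiv).tsum_eq]
  refine tsum_congr fun z => integral_congr_ae (ae_of_all _ fun p => ?_)
  change f (lat d z + p) = _
  rw [add_comm]

theorem measurePreserving_add_lat (z) : MeasurePreserving (fun p => p + lat d z) volume volume :=
  measurePreserving_add_right volume _

/-- `f` vanishes on the translates of the cell by lattice vectors outside `S`. -/
def CellSupp {E : Type*} [Zero E] (S : Finset (Freq d)) (f : Pt d → E) : Prop :=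
  ∀ z, z ∉ S → ∀ p ∈ cell d, f (p + lat d z) = 0

/-- The periodization of `f` on the cell. -/
def per (S : Finset (Freq d)) (f : Pt d → ℝ) : Pt d → ℝ :=
  fun p => ∑ z ∈ S, f (p + lat d z)

theorem memLp_translate {E : Type*} [NormedAddCommGroup E] {f : Pt d → E} {q} (hf : MemLp f q) (z) :
    MemLp (fun p => f (p + lat d z)) q (volume.restrict (cell d)) :=
  (hf.comp_measurePreserving (measurePreserving_add_lat z)).restrict _

theorem memLp_per {S f} (hf : MemLp f 2) : MemLp (per S f) 2 (volume.restrict (cell d)) :=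
  memLp_finsetSum S fun z _ => memLp_translate hf z

theorem integral_eq_sum_cell {E : Type*} [NormedAddCommGroup E] [NormedSpace ℝ E]
    {S} {f : Pt d → E} (hf : Integrable f) (hS : CellSupp S f) :
    ∫ p, f p = ∑ z ∈ S, ∫ p in cell d, f (p + lat d z) := by
  rw [integral_eq_tsum_cell hf]
  refine tsum_eq_sum fun z hz => ?_
  refine (setIntegral_congr_fun (measurableSet_cell d) fun p hp => hS z hz p hp).trans ?_
  simp

theorem integral_per_sq_le {S f} (hf : MemLp f 2) (hS : CellSupp S f) :
    ∫ p in cell d, per S f p ^ 2 ≤ S.card * ∫ p, f p ^ 2 := by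
  have h1 : ∫ p, f p ^ 2 = ∑ z ∈ S, ∫ p in cell d, f (p + lat d z) ^ 2 :=
    integral_eq_sum_cell hf.integrable_sq fun z hz p hp => by simp [hS z hz p hp]
  have h2 : ∀ z ∈ S, Integrable (fun p => f (p + lat d z) ^ 2) (volume.restrict (cell d)) :=
    fun z _ => (memLp_translate hf z).integrable_sq
  rw [h1, ← integral_finsetSum _ h2, ← integral_const_mul]
  refine integral_mono (memLp_per hf).integrable_sq ((integrable_finsetSum _ h2).const_mul _)
    fun p => ?_
  exact sq_sum_le_card_mul_sum_sq

theorem ae_periodic_lat {E : Type*} {F : Pt d → E} (hF : IsPeriodic F) (z) :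
    ∀ᵐ p ∂(volume.restrict (cell d)), F (p + lat d z) = F p :=
  ae_restrict_of_ae (hF z.1 z.2)

/-- Unfolding: the integral over `ℝ^{d+1}` against a periodic function. -/
theorem integral_smul_periodic {E : Type*} [NormedAddCommGroup E] [NormedSpace ℝ E] {S f}
    (hf : MemLp f 2) (hS : CellSupp S f) {F : Pt d → E} (hF : AEStronglyMeasurable F volume)
    (hF2 : MemLp F 2 (volume.restrict (cell d))) (hper : IsPeriodic F) :
    Integrable (fun p => f p • F p) ∧ ∫ p, f p • F p = ∫ p in cell d, per S f p • F p := by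
  have hz : ∀ z, Integrable (fun p => f (p + lat d z) • F p) (volume.restrict (cell d)) := fun z =>
    memLp_one_iff_integrable.1 (hF2.smul (memLp_translate hf z))
  have hae : ∀ z, (fun p => f (p + lat d z) • F (p + lat d z)) =ᵐ[volume.restrict (cell d)]
      fun p => f (p + lat d z) • F p := fun z => by
    filter_upwards [ae_periodic_lat hper z] with p hp
    rw [hp]
  have hitg : Integrable (fun p => f p • F p) := by
    refine ⟨hf.1.smul hF, ?_⟩
    rw [hasFiniteIntegral_iff_enorm, lintegral_eq_tsum_cell, tsum_eq_sum (s := S)]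
    · refine ENNReal.sum_lt_top.2 fun z _ => ?_
      have := (hz z).2
      rw [hasFiniteIntegral_iff_enorm] at this
      refine lt_of_eq_of_lt (lintegral_congr_ae ?_) this
      filter_upwards [hae z] with p hp
      exact congrArg _ hp
    · intro z hzS
      refine (setLIntegral_congr_fun (measurableSet_cell d) fun p hp => ?_).trans lintegral_zero
      simp [hS z hzS p hp]
  refine ⟨hitg, ?_⟩
  rw [integral_eq_sum_cell hitg fun z hzS p hp => by simp [hS z hzS p hp]]
  simp only [per, Finset.sum_smul]
  rw [integral_finsetSum _ fun z _ => hz z]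
  exact sum_congr rfl fun z _ => integral_congr_ae (hae z)

theorem isPeriodic_ex (k : Freq d) : IsPeriodic (ex k) :=
  fun z l => ae_of_all _ fun p => ex_add_latticePt k p z l

theorem memLp_ex (k) : MemLp (ex k) 2 (volume.restrict (cell d)) :=
  MemLp.of_bound (continuous_ex k).aestronglyMeasurable 1 (ae_of_all _ fun p => (norm_ex k p).le)

theorem hat_per {S f} (hf : MemLp f 2) (hS : CellSupp S f) (k : Freq d) :
    hat (per S f) k = ∫ p, f p • ex k p :=
  (integral_smul_periodic hf hS (continuous_ex k).aestronglyMeasurable (memLp_ex k)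
    (isPeriodic_ex k)).2.symm

/-- The box `{-N, …, N}^d × {-N', …, N'}` of lattice points. -/
def freqBox (d N N' : ℕ) : Finset (Freq d) :=
  (Fintype.piFinset fun _ : Fin d => Finset.Icc (-(N : ℤ)) N) ×ˢ Finset.Icc (-(N' : ℤ)) N'

theorem card_freqBox (d N N') : (freqBox d N N').card = (2 * N + 1) ^ d * (2 * N' + 1) := by
  have h : ∀ M : ℕ, ((M : ℤ) + 1 + (M : ℤ)).toNat = 2 * M + 1 := fun M => by omega
  simp [freqBox, Finset.card_product, Fintype.card_piFinset, h]

theorem cellSupp_freqBox {E : Type*} [Zero E] {f : Pt d → E} {N N' : ℕ}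
    (hf : ∀ p, f p ≠ 0 → (∀ i, |p.1 i| ≤ N) ∧ |p.2| ≤ N') : CellSupp (freqBox d N N') f := by
  intro z hz p hp
  by_contra h
  obtain ⟨h1, h2⟩ := hf _ h
  have key : ∀ (x : ℝ) (l : ℤ) (M : ℕ), x ∈ Ico (-(1 / 2) : ℝ) (1 / 2) → |x + l| ≤ M →
      -(M : ℤ) ≤ l ∧ l ≤ M := by
    intro x l M hx hl
    rw [abs_le] at hl
    constructor
    · have : (-(M : ℤ) : ℝ) < ((l + 1 : ℤ) : ℝ) := by push_cast; linarith [hx.2]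
      have : -(M : ℤ) < l + 1 := by exact_mod_cast this
      omega
    · have : (l : ℝ) < ((M + 1 : ℤ) : ℝ) := by push_cast; linarith [hx.1]
      have : l < (M : ℤ) + 1 := by exact_mod_cast this
      omega
  apply hz
  simp only [freqBox, Finset.mem_product, Fintype.mem_piFinset, Finset.mem_Icc]
  exact ⟨fun i => key _ _ _ (hp.1 i) (h1 i), key _ _ _ hp.2 h2⟩

theorem exists_cellSupp {E : Type*} [Zero E] {f : Pt d → E}
    (hf : HasCompactSupport f) : ∃ N, CellSupp (freqBox d N N) f := by
  obtain ⟨R, hR⟩ := hf.isCompact.isBounded.exists_norm_le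
  obtain ⟨N, hN⟩ := exists_nat_ge R
  refine ⟨N, cellSupp_freqBox fun p hp => ?_⟩
  have h1 : ‖p‖ ≤ N := (hR p (subset_tsupport f hp)).trans hN
  refine ⟨fun i => ?_, ?_⟩
  · exact ((PiLp.norm_apply_le p.1 i).trans (norm_fst_le p)).trans h1
  · exact (norm_snd_le p).trans h1

end cell

/-! ### Derivatives in space-time -/

section spacetime

variable {d n : ℕ} {φ ψ : Pt d → Euc n}

theorem spaceD_zero (φ : Pt d → Euc n) : spaceD 0 φ = φ := by
  funext p
  simp [spaceD, multiD_zero]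

theorem spaceD_add_single_and_contDiff (h : Smooth φ) (α) :
    Smooth (spaceD α φ) ∧ tsupport (spaceD α φ) ⊆ tsupport φ ∧
      ∀ i, spaceD (α + Pi.single i 1) φ = sliceD i (spaceD α φ) := by
  have key : ∀ α, Smooth (spaceD α φ) →
      ∀ i, spaceD (α + Pi.single i 1) φ = sliceD i (spaceD α φ) := by
    intro α hα i
    funext p
    rw [show p = (p.1, p.2) from rfl, ← fderiv_slice hα]
    simp only [spaceD]
    rw [← partialD_multiD (contDiff_slice h p.2)]
    rfl
  induction α using multiIndex_induction with
  | h0 =>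
    rw [spaceD_zero]
    refine ⟨h, subset_rfl, fun i => ?_⟩
    have := key 0 (by rwa [spaceD_zero]) i
    rwa [spaceD_zero] at this
  | hs α i ih =>
    have h1 : Smooth (spaceD (α + Pi.single i 1) φ) := by
      rw [ih.2.2 i]; exact contDiff_sliceD ih.1 i
    refine ⟨h1, ?_, key _ h1⟩
    rw [ih.2.2 i]
    exact (tsupport_sliceD _ i).trans ih.2.1

theorem contDiff_spaceD (h : Smooth φ) (α) : Smooth (spaceD α φ) :=
  (spaceD_add_single_and_contDiff h α).1

theorem spaceD_add_single (h : Smooth φ) (α i) :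
    spaceD (α + Pi.single i 1) φ = sliceD i (spaceD α φ) :=
  (spaceD_add_single_and_contDiff h α).2.2 i

theorem spaceD_sliceD (h : Smooth φ) (α i) :
    spaceD α (sliceD i φ) = sliceD i (spaceD α φ) := by
  rw [← spaceD_add_single h]
  funext p
  simp only [spaceD]
  rw [← partialD_multiD (contDiff_slice h p.2), ← multiD_partialD (contDiff_slice h p.2)]
  congr 1
  funext x
  rw [← fderiv_slice h]
  rfl

theorem timeD_eq (h : Smooth φ) : timeD φ = fun p => fderiv ℝ φ p (0, 1) := by
  funext p
  have h1 : HasDerivAt (fun s => (p.1, s)) ((0 : Euc d), (1 : ℝ)) p.2 :=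
    (hasDerivAt_const _ _).prodMk (hasDerivAt_id _)
  have h2 : HasFDerivAt φ (fderiv ℝ φ p) ((fun s => (p.1, s)) p.2) :=
    (h.differentiable (by simp) p).hasFDerivAt
  exact (h2.comp_hasDerivAt p.2 h1).deriv

theorem contDiff_timeD (h : Smooth φ) : Smooth (timeD φ) := by
  rw [timeD_eq h]
  exact (h.fderiv_right (m := ∞) (by simp)).clm_apply contDiff_const

theorem tsupport_timeD (h : Smooth φ) : tsupport (timeD φ) ⊆ tsupport φ := by
  rw [timeD_eq h]
  exact tsupport_fderiv_apply_subset ℝ _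

theorem IsTest.of_tsupport_subset {U} {W W' : Type*} [NormedAddCommGroup W] [NormedSpace ℝ W]
    [NormedAddCommGroup W'] [NormedSpace ℝ W'] {φ : Pt d → W} {ψ : Pt d → W'} (h : IsTest U φ)
    (hψ : Smooth ψ) (hs : tsupport ψ ⊆ tsupport φ) : IsTest U ψ :=
  ⟨hψ, h.compact.of_isClosed_subset (isClosed_tsupport _) hs, hs.trans h.support⟩

theorem IsTest.spaceD {U : Set (Pt d)} (h : IsTest U φ) (α : Fin d → ℕ) : IsTest U (spaceD α φ) :=
  h.of_tsupport_subset (contDiff_spaceD h.smooth α) (spaceD_add_single_and_contDiff h.smooth α).2.1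

theorem IsTest.timeD {U : Set (Pt d)} (h : IsTest U φ) : IsTest U (timeD φ) :=
  h.of_tsupport_subset (contDiff_timeD h.smooth) (tsupport_timeD h.smooth)

theorem integral_inner_fderiv_right {U} (hψ : Smooth ψ) (hφ : IsTest U φ) (v) :
    ∫ p, inner ℝ (ψ p) (fderiv ℝ φ p v) = -∫ p, inner ℝ (fderiv ℝ ψ p v) (φ p) := by
  have hitg : ∀ {a b : Pt d → Euc n}, Continuous a → Continuous b → HasCompactSupport b →
      Integrable fun x => (innerSL ℝ (E := Euc n)) (a x) (b x) := by
    intro a b ha hb hc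
    refine Continuous.integrable_of_hasCompactSupport (by fun_prop) ?_
    exact hc.mono fun x hx => by
      contrapose! hx
      simp only [Function.mem_support, not_not] at hx ⊢
      simp [hx]
  have hc : ∀ {f : Pt d → Euc n}, Smooth f → Continuous fun p => fderiv ℝ f p v :=
    fun h => ((h.fderiv_right (m := ∞) (by simp)).clm_apply contDiff_const).continuous
  exact integral_bilinear_fderiv_right_eq_neg_left_of_integrable (μ := volume)
    (f := ψ) (g := φ) (v := v) (B := innerSL ℝ (E := Euc n))
    (hitg (hc hψ) hφ.smooth.continuous hφ.compact)
    (hitg hψ.continuous (hc hφ.smooth) (hφ.compact.fderiv_apply (𝕜 := ℝ) _))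
    (hitg hψ.continuous hφ.smooth.continuous hφ.compact)
    (fun x _ => hψ.differentiable (by simp) x) (fun x _ => hφ.smooth.differentiable (by simp) x)

theorem integral_inner_timeD {U} (hψ : Smooth ψ) (hφ : IsTest U φ) :
    ∫ p, inner ℝ (ψ p) (timeD φ p) = -∫ p, inner ℝ (timeD ψ p) (φ p) := by
  rw [timeD_eq hψ, timeD_eq hφ.smooth]
  exact integral_inner_fderiv_right hψ hφ _

theorem integral_inner_spaceD {U} (hψ : Smooth ψ) (hφ : IsTest U φ) (α) :
    ∫ p, inner ℝ (ψ p) (spaceD α φ p) = (-1) ^ (∑ i, α i) * ∫ p, inner ℝ (spaceD α ψ p) (φ p) := by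
  induction α using multiIndex_induction generalizing ψ with
  | h0 => simp [spaceD_zero]
  | hs α i ih =>
    have h1 : ∫ p, inner ℝ (ψ p) (sliceD i (spaceD α φ) p)
        = -∫ p, inner ℝ (sliceD i ψ p) (spaceD α φ p) :=
      integral_inner_fderiv_right hψ (hφ.spaceD α) _
    rw [spaceD_add_single hφ.smooth, spaceD_add_single hψ, h1, ih (contDiff_sliceD hψ i),
      sum_add_single, spaceD_sliceD hψ]
    ring

/-! ### Space-time plane waves -/

/-- The plane wave `(x, t) ↦ Re (c e^{i (ξ·x + τ t)})`. -/
def stWave (ξ : Fin d → ℝ) (τ : ℝ) (c : Fin n → ℂ) : Pt d → Euc n :=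
  fun p => WithLp.toLp 2 fun i => (c i * Complex.exp ((∑ j, ξ j * p.1 j + τ * p.2 : ℝ) * I)).re

theorem stWave_slice (ξ : Fin d → ℝ) (τ) (c : Fin n → ℂ) (t) : (fun x => stWave ξ τ c (x, t))
      = wave ξ fun i => c i * Complex.exp ((τ * t : ℝ) * I) := by
  funext x
  ext i
  simp only [stWave, wave]
  congr 1
  rw [mul_assoc, ← Complex.exp_add]
  push_cast
  ring_nf

theorem contDiff_stWave (ξ : Fin d → ℝ) (τ) (c : Fin n → ℂ) : Smooth (stWave ξ τ c) := by
  rw [contDiff_euclidean]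
  intro i
  refine Complex.reCLM.contDiff.comp (contDiff_const.mul (Complex.contDiff_exp.comp ?_))
  refine (Complex.ofRealCLM.contDiff.comp ?_).mul contDiff_const
  exact ((contDiff_phase ξ).comp contDiff_fst).add (contDiff_const.mul contDiff_snd)

theorem spaceD_stWave (ξ τ) (c : Fin n → ℂ) (α : Fin d → ℕ) :
    spaceD α (stWave ξ τ c) = stWave ξ τ fun i => symb ξ α * c i := by
  funext p
  simp only [spaceD]
  rw [stWave_slice, multiD_wave]
  have := congrFun (stWave_slice ξ τ (fun i => symb ξ α * c i) p.2) p.1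
  refine Eq.trans ?_ this.symm
  simp only [mul_assoc]

theorem timeD_stWave (ξ : Fin d → ℝ) (τ) (c : Fin n → ℂ) :
    timeD (stWave ξ τ c) = stWave ξ τ fun i => I * τ * c i := by
  funext p
  simp only [timeD]
  have : HasDerivAt (fun s => stWave ξ τ c (p.1, s)) (stWave ξ τ (fun i => I * τ * c i) p) p.2 := by
    refine (PiLp.continuousLinearEquiv 2 ℝ (fun _ => ℝ)).symm.toContinuousLinearMap
      |>.hasFDerivAt.comp_hasDerivAt p.2 (f := fun s i => stWave ξ τ c (p.1, s) i)
      (f' := fun i => stWave ξ τ (fun i => I * τ * c i) p i) (hasDerivAt_pi.2 fun i => ?_)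
    have h1 : HasDerivAt (fun s : ℝ => c i * Complex.exp (((∑ j, ξ j * p.1 j : ℝ) + τ * s) * I))
        (c i * (Complex.exp (((∑ j, ξ j * p.1 j : ℝ) + τ * p.2) * I)
          * (τ * ((1 : ℝ) : ℂ) * I))) p.2 := by
      refine HasDerivAt.const_mul _ (HasDerivAt.cexp ?_)
      exact ((((hasDerivAt_id p.2).ofReal_comp).const_mul (τ : ℂ)).const_add _).mul_const _
    have h2 := Complex.reCLM.hasFDerivAt.comp_hasDerivAt p.2 h1
    convert h2 using 1
    · funext s
      simp only [stWave, Function.comp, Complex.reCLM_apply]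
      push_cast
      rfl
    · simp only [stWave, Complex.reCLM_apply]
      congr 1
      push_cast
      ring
  exact this.deriv

/-- The wave `Re (c e_k)`. -/
def exWave (k : Freq d) (c : Fin n → ℂ) : Pt d → Euc n :=
  stWave (fun j => 2 * π * k.1 j) (2 * π * k.2) c

theorem exWave_apply (k : Freq d) (c p) (i : Fin n) : exWave k c p i = (c i * ex k p).re := by
  simp only [exWave, stWave, ex]
  congr 4
  rw [mul_add, mul_sum]
  simp only [mul_assoc]

/-- The symbol `(2πi k')^α`. -/
def symK (k : Freq d) (α : Fin d → ℕ) : ℂ := symb (fun j => 2 * π * k.1 j) α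

theorem conj_symb (ξ) (α : Fin d → ℕ) :
    conj (symb ξ α) = (-1) ^ (∑ i, α i) * symb ξ α := by
  simp only [symb, map_prod, map_pow, map_mul, Complex.conj_I, Complex.conj_ofReal]
  rw [← Finset.prod_pow_eq_pow_sum, ← Finset.prod_mul_distrib]
  refine Finset.prod_congr rfl fun i _ => ?_
  rw [← mul_pow]
  ring

theorem symb_neg (ξ) (α : Fin d → ℕ) : symb (-ξ) α = conj (symb ξ α) := by
  simp only [symb, map_prod, map_pow, map_mul, Complex.conj_I, Complex.conj_ofReal]
  refine Finset.prod_congr rfl fun i _ => ?_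
  simp

theorem symK_neg (k : Freq d) (α) : symK (-k) α = conj (symK k α) := by
  rw [symK, symK, ← symb_neg]
  congr 1
  funext j
  simp

theorem conj_symK (k : Freq d) (α) :
    conj (symK k α) = (-1) ^ (∑ i, α i) * symK k α := conj_symb _ α

theorem spaceD_exWave (k : Freq d) (c : Fin n → ℂ) (α) :
    spaceD α (exWave k c) = exWave k fun i => symK k α * c i := spaceD_stWave _ _ c α

theorem timeD_exWave (k : Freq d) (c : Fin n → ℂ) :
    timeD (exWave k c) = exWave k fun i => I * (2 * π * k.2 : ℝ) * c i :=
  timeD_stWave _ _ c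

theorem contDiff_exWave (k : Freq d) (c : Fin n → ℂ) : Smooth (exWave k c) :=
  contDiff_stWave _ _ c

theorem exWave_add_lat (k) (c : Fin n → ℂ) (p z) : exWave k c (p + lat d z) = exWave k c p := by
  ext i
  rw [exWave_apply, exWave_apply]
  congr 2
  exact ex_add_latticePt k p z.1 z.2

theorem integral_inner_exWave {ν : Measure (Pt d)} {f : Pt d → Euc n}
    (hf : ∀ i, Integrable (fun p => f p i) ν) (k c) :
    ∫ p, inner ℝ (exWave k c p) (f p) ∂ν = ∑ i, (c i * ∫ p, f p i • ex k p ∂ν).re := by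
  have h1 : ∀ i, Integrable (fun p => c i * (f p i • ex k p)) ν := fun i =>
    (integrable_smul_ex (hf i) k).const_mul _
  have h2 : ∀ i, (c i * ∫ p, f p i • ex k p ∂ν).re = ∫ p, (c i * (f p i • ex k p)).re ∂ν := by
    intro i
    rw [← integral_const_mul]
    exact (integral_re (h1 i)).symm
  simp only [h2]
  have h3 : ∀ i ∈ Finset.univ, Integrable (fun p => (c i * (f p i • ex k p)).re) ν :=
    fun i _ => (h1 i).re
  rw [← integral_finsetSum _ h3]
  refine integral_congr_ae (ae_of_all _ fun p => ?_)
  simp only [PiLp.inner_apply, exWave_apply]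
  refine sum_congr rfl fun i _ => ?_
  simp [real_smul]
  ring

theorem eq_of_forall_re_mul {z w} (h : ∀ c : ℂ, (c * z).re = (c * w).re) : z = w := by
  have h1 := h 1
  have h2 := h I
  simp at h1 h2
  exact Complex.ext h1 h2

theorem IsTest.integrable_apply {U} (h : IsTest U φ) (i) : Integrable fun p => φ p i := by
  refine Continuous.integrable_of_hasCompactSupport
    ((proj (𝕜 := ℝ) i : Euc n →L[ℝ] ℝ).continuous.comp h.smooth.continuous) ?_
  exact h.compact.mono fun x hx => by
    contrapose! hx
    simp only [Function.mem_support, not_not] at hx ⊢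
    simp [hx]

theorem IsTest.memLp_apply {U} (h : IsTest U φ) (i) : MemLp (fun p => φ p i) 2 := by
  refine Continuous.memLp_of_hasCompactSupport
    ((proj (𝕜 := ℝ) i : Euc n →L[ℝ] ℝ).continuous.comp h.smooth.continuous) ?_
  exact h.compact.mono fun x hx => by
    contrapose! hx
    simp only [Function.mem_support, not_not] at hx ⊢
    simp [hx]

theorem integral_spaceD_smul_ex {U} (hφ : IsTest U φ) (α i k) :
    ∫ p, spaceD α φ p i • ex k p = conj (symK k α) * ∫ p, φ p i • ex k p := by
  classical
  refine eq_of_forall_re_mul fun c => ?_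
  have h1 := integral_inner_exWave (fun j => (hφ.spaceD α).integrable_apply j) k (Pi.single i c)
  have h2 := integral_inner_exWave (fun j => hφ.integrable_apply j) k
    (fun j => symK k α * (Pi.single i c : Fin n → ℂ) j)
  rw [integral_inner_spaceD (contDiff_exWave k _) hφ, spaceD_exWave, h2,
    sum_eq_single i, sum_eq_single i] at h1
  · rw [Pi.single_eq_same] at h1
    rw [← h1, conj_symK]
    have : (((-1 : ℝ) ^ (∑ j, α j) : ℝ) : ℂ) = (-1) ^ (∑ j, α j) := by push_cast; rfl
    rw [← Complex.re_ofReal_mul, this]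
    congr 1
    ring
  all_goals simp +contextual

theorem integral_timeD_smul_ex {U} (hφ : IsTest U φ) (i k) : ∫ p, timeD φ p i • ex k p
      = -(I * (2 * π * k.2 : ℝ)) * ∫ p, φ p i • ex k p := by
  classical
  refine eq_of_forall_re_mul fun c => ?_
  have h1 := integral_inner_exWave (fun j => hφ.timeD.integrable_apply j) k (Pi.single i c)
  have h2 := integral_inner_exWave (fun j => hφ.integrable_apply j) k
    (fun j => I * (2 * π * k.2 : ℝ) * (Pi.single i c : Fin n → ℂ) j)
  rw [integral_inner_timeD (contDiff_exWave k _) hφ, timeD_exWave, h2,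
    sum_eq_single i, sum_eq_single i] at h1
  · rw [Pi.single_eq_same] at h1
    rw [← h1, ← Complex.neg_re]
    congr 1
    ring
  all_goals simp +contextual

theorem integral_cell_ex (k) : ∫ p in cell d, ex k p = if k = 0 then 1 else 0 := by
  have mp := measurePreserving_cellRep d
  rw [← mp.map_eq, integral_map mp.measurable.aemeasurable (continuous_ex k).aestronglyMeasurable]
  have h := (orthonormal_iff_ite.1 (UnitAddTorus.orthonormal_mFourier (d := Fin (d + 1))))
    (freqEquiv d k) 0
  simp only [ContinuousMap.inner_toLp, ← UnitAddTorus.mFourier_neg,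
    ← UnitAddTorus.mFourier_add, zero_add] at h
  have h0 : freqEquiv d k = 0 ↔ k = 0 := by
    rw [← (freqEquiv d).apply_eq_iff_eq (x := k) (y := 0)]
    have : freqEquiv d 0 = 0 := by
      funext i
      refine Fin.cases ?_ (fun j => ?_) i <;> simp [freqEquiv]
    rw [this]
  simp only [h0] at h
  rw [← h]
  refine integral_congr_ae (ae_of_all _ fun x => ?_)
  exact (mFourier_freqEquiv k x).symm

theorem re_mul_smul_ex (c) (k l : Freq d) (p) : (c * ex k p).re • ex l p
      = c / 2 * ex (k + l) p + conj c / 2 * ex (-k + l) p := by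
  rw [real_smul, Complex.re_eq_add_conj, ex_add, ex_add, ex_neg, map_mul]
  ring

theorem integrable_ex (k) : Integrable (ex k) (volume.restrict (cell d)) :=
  (memLp_ex k).integrable (by norm_num)

theorem hat_exWave (k l : Freq d) (c) (i : Fin n) :
    hat (fun p => exWave k c p i) l = (if k + l = 0 then c i / 2 else 0)
      + (if -k + l = 0 then conj (c i) / 2 else 0) := by
  simp only [hat, exWave_apply, re_mul_smul_ex]
  rw [integral_add ((integrable_ex _).const_mul _) ((integrable_ex _).const_mul _),
    integral_const_mul, integral_const_mul, integral_cell_ex, integral_cell_ex]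
  simp

theorem hat_spaceD_exWave (k l : Freq d) (c) (i : Fin n) (α) :
    hat (fun p => spaceD α (exWave k c) p i) l
      = conj (symK l α) * hat (fun p => exWave k c p i) l := by
  rw [spaceD_exWave, hat_exWave, hat_exWave, mul_add]
  congr 1
  · split_ifs with h
    · rw [show l = -k from (neg_eq_of_add_eq_zero_right h).symm, symK_neg, Complex.conj_conj]
      ring
    · simp
  · split_ifs with h
    · rw [show l = k from by rw [neg_add_eq_zero] at h; exact h.symm, map_mul]
      ring
    · simp

theorem hat_timeD_exWave (k l : Freq d) (c) (i : Fin n) : hat (fun p => timeD (exWave k c) p i) l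
      = -(I * (2 * π * l.2 : ℝ)) * hat (fun p => exWave k c p i) l := by
  rw [timeD_exWave, hat_exWave, hat_exWave, mul_add]
  congr 1
  · split_ifs with h
    · rw [show l = -k from (neg_eq_of_add_eq_zero_right h).symm]
      simp
      ring
    · simp
  · split_ifs with h
    · rw [show l = k from by rw [neg_add_eq_zero] at h; exact h.symm]
      simp only [map_mul, Complex.conj_I, Complex.conj_ofReal]
      ring
    · simp

theorem norm_exWave_le (k : Freq d) (c p) (i : Fin n) : ‖exWave k c p i‖ ≤ ‖c i‖ := by
  rw [exWave_apply, Real.norm_eq_abs]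
  refine (Complex.abs_re_le_norm _).trans ?_
  rw [norm_mul, norm_ex, mul_one]

theorem continuous_exWave (k : Freq d) (c : Fin n → ℂ) : Continuous (exWave k c) :=
  (contDiff_exWave k c).continuous

theorem continuous_exWave_apply (k : Freq d) (c) (i : Fin n) : Continuous fun p => exWave k c p i :=
  (proj (𝕜 := ℝ) i : Euc n →L[ℝ] ℝ).continuous.comp (continuous_exWave k c)

theorem memLp_exWave_apply (k c) (i : Fin n) :
    MemLp (fun p => exWave k c p i) 2 (volume.restrict (cell d)) :=
  MemLp.of_bound (continuous_exWave_apply k c i).aestronglyMeasurable ‖c i‖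
    (ae_of_all _ fun p => norm_exWave_le k c p i)

/-! ### A smooth partition of unity on the lattice -/

/-- A smooth function on `ℝ` with support in `[-1, 1]` whose integer translates sum to `1`. -/
def hatFun (x : ℝ) : ℝ := smoothTransition (x + 1) - smoothTransition x

theorem contDiff_hatFun : Smooth hatFun :=
  (smoothTransition.contDiff.comp (contDiff_id.add contDiff_const)).sub smoothTransition.contDiff

theorem hatFun_eq_zero {x} (hx : 1 < |x|) : hatFun x = 0 := by
  unfold hatFun
  rcases lt_abs.1 hx with h | h
  · rw [smoothTransition.one_of_one_le (by linarith),
      smoothTransition.one_of_one_le (by linarith), sub_self]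
  · rw [smoothTransition.zero_of_nonpos (by linarith),
      smoothTransition.zero_of_nonpos (by linarith), sub_self]

theorem sum_hatFun {x} (hx : x ∈ Ico (-(1 / 2) : ℝ) (1 / 2)) :
    ∑ l ∈ Finset.Icc (-((2 : ℕ) : ℤ)) (2 : ℕ), hatFun (x + l) = 1 := by
  have : Finset.Icc (-((2 : ℕ) : ℤ)) (2 : ℕ) = {-2, -1, 0, 1, 2} := by decide
  rw [this]
  have e1 : smoothTransition (x + 2 + 1) = 1 := smoothTransition.one_of_one_le (by linarith [hx.1])
  have e2 : smoothTransition (x - 2) = 0 := smoothTransition.zero_of_nonpos (by linarith [hx.2])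
  simp only [hatFun, Finset.mem_insert, Finset.mem_singleton, Finset.sum_insert,
    Finset.sum_singleton, show ((-2 : ℤ) = -1) = False by decide,
    show ((-2 : ℤ) = 0) = False by decide, show ((-2 : ℤ) = 1) = False by decide,
    show ((-2 : ℤ) = 2) = False by decide, show ((-1 : ℤ) = 0) = False by decide,
    show ((-1 : ℤ) = 1) = False by decide, show ((-1 : ℤ) = 2) = False by decide,
    show ((0 : ℤ) = 1) = False by decide, show ((0 : ℤ) = 2) = False by decide,
    show ((1 : ℤ) = 2) = False by decide, or_self, not_false_eq_true]
  push_cast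
  rw [e1]
  have e3 : x + -2 + 1 = x + -1 := by ring
  have e4 : x + -1 + 1 = x + 0 := by ring
  have e5 : x + 0 + 1 = x + 1 := by ring
  have e6 : x + 1 + 1 = x + 2 := by ring
  rw [e3, e4, e5, e6, show x + -2 = x - 2 by ring, e2]
  ring

/-- A smooth compactly supported function on `ℝ^{d+1}` whose lattice translates sum to `1`. -/
def latCut (d : ℕ) (p : Pt d) : ℝ := (∏ j, hatFun (p.1 j)) * hatFun p.2

theorem contDiff_latCut (d) : Smooth (latCut d) := by
  unfold latCut
  refine ContDiff.mul ?_ (contDiff_hatFun.comp contDiff_snd)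
  refine contDiff_prod fun j _ => contDiff_hatFun.comp ?_
  exact (proj (𝕜 := ℝ) j : Euc d →L[ℝ] ℝ).contDiff.comp contDiff_fst

theorem latCut_ne_zero {p} (hp : latCut d p ≠ 0) : (∀ i, |p.1 i| ≤ 1) ∧ |p.2| ≤ 1 := by
  constructor
  · intro i
    by_contra! h
    exact hp (by rw [latCut, Finset.prod_eq_zero (Finset.mem_univ i) (hatFun_eq_zero h), zero_mul])
  · by_contra! h
    exact hp (by rw [latCut, hatFun_eq_zero h, mul_zero])

theorem hasCompactSupport_latCut (d) : HasCompactSupport (latCut d) := by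
  have hc : IsCompact ((WithLp.toLp 2 '' (Set.pi univ fun _ => Icc (-1 : ℝ) 1))
      ×ˢ Icc (-1 : ℝ) 1 : Set (Pt d)) := by
    refine IsCompact.prod ((isCompact_univ_pi fun _ => isCompact_Icc).image ?_) isCompact_Icc
    exact PiLp.continuous_toLp 2 _
  refine HasCompactSupport.intro hc fun p hp => ?_
  by_contra h
  obtain ⟨h1, h2⟩ := latCut_ne_zero h
  exact hp ⟨⟨p.1.ofLp, fun i _ => abs_le.1 (h1 i), rfl⟩, abs_le.1 h2⟩

theorem per_latCut {p} (hp : p ∈ cell d) : per (freqBox d 2 2) (latCut d) p = 1 := by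
  have h1 : ∀ z, latCut d (p + lat d z)
      = (∏ j, hatFun (p.1 j + z.1 j)) * hatFun (p.2 + z.2) := fun z => rfl
  simp only [per, h1, freqBox]
  rw [Finset.sum_product]
  simp only [← mul_sum]
  rw [sum_hatFun hp.2]
  simp only [mul_one]
  rw [← Finset.prod_univ_sum (fun _ => Finset.Icc (-((2 : ℕ) : ℤ)) (2 : ℕ))
    (fun j l => hatFun (p.1 j + l))]
  exact Finset.prod_eq_one fun j _ => sum_hatFun (hp.1 j)

/-- The compactly supported test function obtained by cutting off a wave. -/
theorem isTest_cutWave (k) (c : Fin n → ℂ) : IsTest univ (fun p => latCut d p • exWave k c p) :=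
  ⟨(contDiff_latCut d).smul (contDiff_exWave k c),
    (hasCompactSupport_latCut d).smul_right, subset_univ _⟩

theorem hat_cutWave (k l c) (i : Fin n) :
    ∫ p, (latCut d p • exWave k c p) i • ex l p = hat (fun p => exWave k c p i) l := by
  have hS : CellSupp (freqBox d 2 2) (latCut d) := cellSupp_freqBox fun p hp => by
    obtain ⟨h1, h2⟩ := latCut_ne_zero hp
    exact ⟨fun i => (h1 i).trans (by norm_num), h2.trans (by norm_num)⟩
  have h1 := (integral_smul_periodic (F := fun p => exWave k c p i • ex l p)
    ((contDiff_latCut d).continuous.memLp_of_hasCompactSupport (hasCompactSupport_latCut d)) hS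
    ((continuous_exWave_apply k c i).smul (continuous_ex l)).aestronglyMeasurable
    (MemLp.of_bound ((continuous_exWave_apply k c i).smul (continuous_ex l)).aestronglyMeasurable
      ‖c i‖ (ae_of_all _ fun p => by
        rw [norm_smul, norm_ex, mul_one]; exact norm_exWave_le k c p i))
    (fun z r => ae_of_all _ fun p => by
      have e1 := exWave_add_lat k c p (z, r)
      change exWave k c (p + latticePt z r) = _ at e1
      simp only [e1, ex_add_latticePt])).2
  simp only [PiLp.smul_apply, smul_eq_mul, mul_smul, hat]
  rw [h1]
  refine setIntegral_congr_fun (measurableSet_cell d) fun p hp => ?_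
  simp only [per_latCut hp, one_smul]

end spacetime

section l2

variable {X E : Type*} [MeasurableSpace X] {ν : Measure X} [NormedAddCommGroup E]
  [InnerProductSpace ℝ E]

theorem inner_eq_integral {f g : Lp E 2 ν} {f' g'} (hf : f =ᵐ[ν] f') (hg : g =ᵐ[ν] g') :
    inner ℝ f g = ∫ x, inner ℝ (f' x) (g' x) ∂ν := by
  rw [inner_def]
  refine integral_congr_ae ?_
  filter_upwards [hf, hg] with x h1 h2
  rw [h1, h2]

theorem norm_sq_eq_integral (f : Lp E 2 ν) : ‖f‖ ^ 2 = ∫ x, ‖f x‖ ^ 2 ∂ν := by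
  simp only [← real_inner_self_eq_norm_sq, inner_def]

end l2

/-! ### Abstract Hilbert space lemmas -/

section hilbert

variable {E : Type*} [NormedAddCommGroup E] [InnerProductSpace ℝ E]

/-- Lions' projection lemma: a functional `L` with `|L φ| ≤ C ‖K φ‖` is of the form
`φ ↦ ⟪u, K φ⟫`. -/
theorem exists_inner_eq_of_le_norm [CompleteSpace E] {Φ : Type*} [AddCommGroup Φ] [Module ℝ Φ]
    (K : Φ →ₗ[ℝ] E) (L : Φ →ₗ[ℝ] ℝ) (C) (h : ∀ φ, |L φ| ≤ C * ‖K φ‖) :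
    ∃ u, ∀ φ, inner ℝ u (K φ) = L φ := by
  have hker : LinearMap.ker K.rangeRestrict ≤ LinearMap.ker L := by
    intro φ hφ
    rw [LinearMap.ker_rangeRestrict, LinearMap.mem_ker] at hφ
    rw [LinearMap.mem_ker, ← abs_nonpos_iff]
    simpa [hφ] using h φ
  let e := K.rangeRestrict.quotKerEquivOfSurjective K.surjective_rangeRestrict
  let f : LinearMap.range K →ₗ[ℝ] ℝ := ((LinearMap.ker K.rangeRestrict).liftQ L hker).comp
    e.symm.toLinearMap
  have hf : ∀ φ, f (K.rangeRestrict φ) = L φ := by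
    intro φ
    have : e.symm (K.rangeRestrict φ) = Submodule.Quotient.mk φ := by
      rw [LinearEquiv.symm_apply_eq]; rfl
    simp only [f, LinearMap.comp_apply, LinearEquiv.coe_coe, this]
    rfl
  have hb : ∀ y, ‖f y‖ ≤ C * ‖y‖ := by
    intro y
    obtain ⟨φ, rfl⟩ := K.surjective_rangeRestrict y
    rw [hf]
    exact h φ
  obtain ⟨g, hg, -⟩ := exists_extension_norm_eq (LinearMap.range K) (f.mkContinuous C hb)
  refine ⟨(InnerProductSpace.toDual ℝ E).symm g, fun φ => ?_⟩
  rw [InnerProductSpace.toDual_symm_apply]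
  exact (hg (K.rangeRestrict φ)).trans (hf φ)

/-- Weak convergence of a bounded family may be tested on a set with dense span. -/
theorem tendsto_inner_of_dense {ι : Type*} {l} {x : ι → E} {y C} (hb : ∀ᶠ i in l, ‖x i‖ ≤ C) {s}
    (hs : Dense (Submodule.span ℝ s : Set E))
    (h : ∀ v ∈ s, Tendsto (fun i => inner ℝ (x i) v) l (𝓝 (inner ℝ y v))) (v) :
    Tendsto (fun i => inner ℝ (x i) v) l (𝓝 (inner ℝ y v)) := by
  have hspan : ∀ v ∈ Submodule.span ℝ s,
      Tendsto (fun i => inner ℝ (x i) v) l (𝓝 (inner ℝ y v)) := by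
    intro v hv
    induction hv using Submodule.span_induction with
    | mem v hv => exact h v hv
    | zero => simpa using tendsto_const_nhds
    | add a b _ _ ha hb => simpa [inner_add_right] using ha.add hb
    | smul c a _ ha => simpa [inner_smul_right] using ha.const_mul c
  rw [Metric.tendsto_nhds]
  intro ε hε
  have hC : 0 < |C| + ‖y‖ + 1 := by positivity
  obtain ⟨w, hw, hvw⟩ := Metric.dense_iff.1 hs v (ε / (2 * (|C| + ‖y‖ + 1))) (by positivity)
  have hw' := (Metric.tendsto_nhds.1 (hspan w hvw)) (ε / 2) (by positivity)
  filter_upwards [hb, hw'] with i h1 h2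
  rw [Real.dist_eq] at h2 ⊢
  have hd : ‖v - w‖ < ε / (2 * (|C| + ‖y‖ + 1)) := by rw [← dist_eq_norm, dist_comm]; exact hw
  have e : inner ℝ (x i) v - inner ℝ y v
      = inner ℝ (x i) (v - w) - inner ℝ y (v - w) + (inner ℝ (x i) w - inner ℝ y w) := by
    simp only [inner_sub_right]; ring
  have b1 := abs_real_inner_le_norm (x i) (v - w)
  have b2 := abs_real_inner_le_norm y (v - w)
  have b3 : ‖x i‖ * ‖v - w‖ + ‖y‖ * ‖v - w‖ ≤ ε / 2 := by
    rw [← add_mul]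
    have : ‖x i‖ + ‖y‖ ≤ |C| + ‖y‖ + 1 := by linarith [le_abs_self C]
    calc (‖x i‖ + ‖y‖) * ‖v - w‖ ≤ (|C| + ‖y‖ + 1) * (ε / (2 * (|C| + ‖y‖ + 1))) := by gcongr
      _ = ε / 2 := by field_simp
  rw [e]
  calc |inner ℝ (x i) (v - w) - inner ℝ y (v - w) + (inner ℝ (x i) w - inner ℝ y w)|
      ≤ |inner ℝ (x i) (v - w) - inner ℝ y (v - w)| + |inner ℝ (x i) w - inner ℝ y w| :=
        abs_add_le _ _
    _ ≤ (|inner ℝ (x i) (v - w)| + |inner ℝ y (v - w)|) + |inner ℝ (x i) w - inner ℝ y w| := by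
        gcongr; exact abs_sub _ _
    _ < ε := by linarith

end hilbert

/-! ### Multiplication by the coefficients -/

/-- The space of values `(ξ_α^i)` of the derivatives of order `m`. -/
abbrev Top (d n m : ℕ) : Type := EuclideanSpace ℝ (MIdx d m × Fin n)

/-- The vector `(∑_{β,j} A_{ij}^{αβ} ξ_β^j)_{α,i}`. -/
def flux {d n m : ℕ} (A : Coeff d n m) (ξ : Pt d → Top d n m) : Pt d → Top d n m :=
  fun p => WithLp.toLp 2 fun a => ∑ β, ∑ j, A a.1 β a.2 j p * ξ p (β, j)

/-- Coefficients bounded and measurable with respect to `ν`. -/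
structure IsBddCoeff {d n m : ℕ} (A : Coeff d n m) (M : ℝ) (ν : Measure (Pt d)) : Prop where
  measurable : ∀ α β i j, AEStronglyMeasurable (A α β i j) ν
  bound : ∀ᵐ p ∂ν, ∀ α β i j, |A α β i j p| ≤ M

theorem IsElliptic.isBddCoeff {d n m} {A : Coeff d n m} {μ M} (h : IsElliptic A μ M)
    {ν : Measure (Pt d)} (hν : ν ≪ volume) : IsBddCoeff A M ν :=
  ⟨fun α β i j => (h.measurable α β i j).mono_ac hν, hν.ae_le h.upper⟩

section flux

variable {d n m : ℕ} {A : Coeff d n m} {M : ℝ} {ν : Measure (Pt d)}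

theorem inner_flux (A ξ) (ζ : Top d n m) (p) :
    inner ℝ (flux A ξ p) ζ = ∑ α, ∑ β, ∑ i, ∑ j, A α β i j p * ξ p (β, j) * ζ (α, i) := by
  simp only [PiLp.inner_apply, flux, sum_prod_type]
  refine sum_congr rfl fun α _ => ?_
  rw [sum_comm]
  refine sum_congr rfl fun i _ => ?_
  simp only [RCLike.inner_apply, conj_trivial, mul_sum]
  refine sum_congr rfl fun β _ => sum_congr rfl fun j _ => ?_
  ring

theorem aestronglyMeasurable_top {ι : Type*} [Fintype ι] {X : Type*} [MeasurableSpace X] {κ : Measure X}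
    {f : X → EuclideanSpace ℝ ι} (hf : ∀ a, AEStronglyMeasurable (fun x => f x a) κ) :
    AEStronglyMeasurable f κ := by
  classical
  have : f = fun x => ∑ a, f x a • single a (1 : ℝ) := by
    funext x
    ext b
    simp [Pi.single_apply]
  rw [this]
  exact Finset.aestronglyMeasurable_fun_sum _ fun a _ => (hf a).smul_const _

theorem aestronglyMeasurable_coord {ι : Type*} [Fintype ι] {X : Type*} [MeasurableSpace X] {κ : Measure X}
    {f : X → EuclideanSpace ℝ ι} (hf : AEStronglyMeasurable f κ) (a) :
    AEStronglyMeasurable (fun x => f x a) κ :=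
  (proj (𝕜 := ℝ) a : EuclideanSpace ℝ ι →L[ℝ] ℝ).continuous.comp_aestronglyMeasurable hf

theorem memLp_coord {ι : Type*} [Fintype ι] {X : Type*} [MeasurableSpace X] {κ : Measure X}
    {f : X → EuclideanSpace ℝ ι} {q} (hf : MemLp f q κ) (a) : MemLp (fun x => f x a) q κ :=
  hf.of_le (aestronglyMeasurable_coord hf.1 a) (ae_of_all _ fun x => PiLp.norm_apply_le (f x) a)

theorem memLp_of_coord {ι : Type*} [Fintype ι] {X : Type*} [MeasurableSpace X] {κ : Measure X}
    {f : X → EuclideanSpace ℝ ι} {q} (hf : ∀ a, MemLp (fun x => f x a) q κ) : MemLp f q κ := by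
  classical
  have : f = fun x => ∑ a, f x a • single a (1 : ℝ) := by
    funext x
    ext b
    simp [Pi.single_apply]
  rw [this]
  refine memLp_finsetSum _ fun a _ => ?_
  refine MemLp.of_le_mul (c := 1) (hf a) ((hf a).1.smul_const _) (ae_of_all _ fun x => ?_)
  rw [norm_smul]
  simp

/-- A constant bounding the norm of multiplication by coefficients bounded by `M`. -/
def fluxConst (d n m : ℕ) (M : ℝ) : ℝ :=
  (card (MIdx d m × Fin n) : ℝ) ^ 2 * |M|

theorem fluxConst_nonneg (d n m M) : 0 ≤ fluxConst d n m M := by unfold fluxConst; positivity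

theorem norm_flux_le {ξ p} (h : ∀ α β i j, |A α β i j p| ≤ M) :
    ‖flux A ξ p‖ ≤ fluxConst d n m M * ‖ξ p‖ := by
  have h1 : ‖flux A ξ p‖ ≤ ∑ a, ‖flux A ξ p a‖ := by
    classical
    have e : flux A ξ p = ∑ a, flux A ξ p a • single a (1 : ℝ) := by
      ext b
      simp [Pi.single_apply]
    conv_lhs => rw [e]
    refine (norm_sum_le _ _).trans (sum_le_sum fun a _ => ?_)
    rw [norm_smul]
    simp
  have h2 : ∀ a, ‖flux A ξ p a‖ ≤ ∑ b : MIdx d m × Fin n, |M| * ‖ξ p‖ := by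
    intro a
    simp only [flux]
    rw [← sum_prod_type' (f := fun β j => A a.1 β a.2 j p * ξ p (β, j))]
    refine (norm_sum_le _ _).trans (sum_le_sum fun b _ => ?_)
    rw [norm_mul]
    exact mul_le_mul ((h _ _ _ _).trans (le_abs_self M)) (PiLp.norm_apply_le (ξ p) b)
      (norm_nonneg _) (abs_nonneg _)
  refine (h1.trans (sum_le_sum fun a _ => h2 a)).trans (le_of_eq ?_)
  simp only [Finset.sum_const, Finset.card_univ, nsmul_eq_mul, fluxConst]
  ring

theorem memLp_flux (hA : IsBddCoeff A M ν) {ξ} (hξ : MemLp ξ 2 ν) : MemLp (flux A ξ) 2 ν := by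
  refine hξ.of_le_mul (c := fluxConst d n m M) (aestronglyMeasurable_top fun a => ?_) ?_
  · refine Finset.aestronglyMeasurable_fun_sum _ fun β _ =>
      Finset.aestronglyMeasurable_fun_sum _ fun j _ => ?_
    exact (hA.measurable _ _ _ _).mul (aestronglyMeasurable_coord hξ.1 _)
  · filter_upwards [hA.bound] with p hp
    exact norm_flux_le hp

/-- Multiplication by bounded coefficients as an operator on `L²`. -/
def mulOp (hA : IsBddCoeff A M ν) : Lp (Top d n m) 2 ν →L[ℝ] Lp (Top d n m) 2 ν :=
  LinearMap.mkContinuous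
    { toFun := fun ξ => (memLp_flux hA (Lp.memLp ξ)).toLp _
      map_add' := fun ξ ζ => by
        rw [← MemLp.toLp_add]
        refine toLp_congr _ _ ?_
        filter_upwards [Lp.coeFn_add ξ ζ] with p hp
        ext a
        simp only [flux, hp, Pi.add_apply, PiLp.add_apply, mul_add, sum_add_distrib]
      map_smul' := fun c ξ => by
        rw [RingHom.id_apply, ← MemLp.toLp_const_smul]
        refine toLp_congr _ _ ?_
        filter_upwards [Lp.coeFn_smul c ξ] with p hp
        ext a
        simp only [flux, hp, Pi.smul_apply, PiLp.smul_apply, smul_eq_mul, mul_sum]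
        refine sum_congr rfl fun β _ => sum_congr rfl fun j _ => ?_
        ring }
    (fluxConst d n m M) (fun ξ => by
      refine Lp.norm_le_mul_norm_of_ae_le_mul ?_
      filter_upwards [hA.bound, (memLp_flux hA (Lp.memLp ξ)).coeFn_toLp] with p hp hq
      simp only [LinearMap.coe_mk, AddHom.coe_mk, hq]
      exact norm_flux_le hp)

theorem coeFn_mulOp (hA : IsBddCoeff A M ν) (ξ) :
    mulOp hA ξ =ᵐ[ν] flux A ξ := (memLp_flux hA (Lp.memLp ξ)).coeFn_toLp

theorem norm_mulOp_le (hA : IsBddCoeff A M ν) (ξ) : ‖mulOp hA ξ‖ ≤ fluxConst d n m M * ‖ξ‖ :=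
  ContinuousLinearMap.le_of_opNorm_le _
    (LinearMap.mkContinuous_norm_le _ (fluxConst_nonneg d n m M) _) ξ

theorem inner_mulOp (hA : IsBddCoeff A M ν) (ξ ζ) : inner ℝ (mulOp hA ξ) ζ
      = ∫ p, ∑ α, ∑ β, ∑ i, ∑ j, A α β i j p * ξ p (β, j) * ζ p (α, i) ∂ν := by
  rw [inner_eq_integral (coeFn_mulOp hA ξ) .rfl]
  simp only [inner_flux]

theorem inner_mulOp_self_ge (hA : IsBddCoeff A M ν) {μ} (hlow : ∀ᵐ p ∂ν, ∀ ξ : MIdx d m → Euc n,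
      μ * ∑ α, ‖ξ α‖ ^ 2 ≤ ∑ α, ∑ β, ∑ i, ∑ j, A α β i j p * ξ α i * ξ β j)
    (ξ) : μ * ‖ξ‖ ^ 2 ≤ inner ℝ (mulOp hA ξ) ξ := by
  rw [← real_inner_self_eq_norm_sq, inner_def, inner_def, ← integral_const_mul]
  refine integral_mono_ae ((L2.integrable_inner ξ ξ).const_mul μ) (L2.integrable_inner _ _) ?_
  filter_upwards [coeFn_mulOp hA ξ, hlow] with p hp hl
  rw [hp, inner_flux]
  refine le_trans (le_of_eq ?_) ((hl fun α => WithLp.toLp 2 fun i => ξ p (α, i)).trans (le_of_eq ?_))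
  · rw [real_inner_self_eq_norm_sq, EuclideanSpace.norm_sq_eq, sum_prod_type]
    simp only [EuclideanSpace.norm_sq_eq]
  · refine sum_congr rfl fun α _ => sum_congr rfl fun β _ =>
      sum_congr rfl fun i _ => sum_congr rfl fun j _ => ?_
    ring

end flux

/-! ### Jets in `L²` and their top order part -/

/-- Families `(v_α)_{|α| ≤ m}` in `L²(ν; ℝ^n)`. -/
abbrev Jets {X : Type*} [MeasurableSpace X] (d n m : ℕ) (ν : Measure X) : Type _ :=
  PiLp 2 (fun _ : LIdx d m => Lp (Euc n) 2 ν)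

section jets

variable {X : Type*} [MeasurableSpace X] {d n m : ℕ} {ν : Measure X}

/-- The inclusion of the `α`-component. -/
def topIncl (n : ℕ) (α : MIdx d m) : Euc n →L[ℝ] Top d n m :=
  LinearMap.toContinuousLinearMap
    { toFun := fun x => WithLp.toLp 2 fun a => if a.1 = α then x a.2 else 0
      map_add' := fun x y => by ext a; simp only [PiLp.add_apply]; split_ifs <;> simp
      map_smul' := fun c x => by ext a; simp }

theorem topIncl_apply (α : MIdx d m) (x : Euc n) (a : MIdx d m × Fin n) :
    topIncl n α x a = if a.1 = α then x a.2 else 0 := rfl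

/-- The top order part `(v_α)_{|α| = m}` of a jet. -/
def topPart (d n m : ℕ) (ν : Measure X) : Jets d n m ν →L[ℝ] Lp (Top d n m) 2 ν :=
  ∑ α : MIdx d m, ((topIncl n α).compLpL 2 ν).comp (PiLp.proj 2 _ α.low)

theorem coeFn_topPart (v) : ∀ᵐ x ∂ν, ∀ a, topPart d n m ν v x a = v a.1.low x a.2 := by
  have h1 : topPart d n m ν v = ∑ α, (topIncl n α).compLpL 2 ν (v α.low) := by simp [topPart]
  rw [h1]
  have h2 := Lp.coeFn_finsetSum (p := 2) (μ := ν) Finset.univ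
    (fun α => (topIncl n α).compLpL 2 ν (v α.low))
  have h3 : ∀ᵐ x ∂ν, ∀ α, (topIncl n α).compLpL 2 ν (v α.low) x = topIncl n α (v α.low x) :=
    ae_all_iff.2 fun α => (topIncl n α).coeFn_compLpL (v α.low)
  filter_upwards [h2, h3] with x hx hy a
  rw [hx]
  simp [hy, topIncl_apply]

theorem norm_sq_topPart (v) : ‖topPart d n m ν v‖ ^ 2 = ∑ α : MIdx d m, ‖v α.low‖ ^ 2 := by
  simp only [norm_sq_eq_integral]
  rw [← integral_finsetSum _ fun α _ => (Lp.memLp (v α.low)).integrable_norm_pow (by norm_num)]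
  refine integral_congr_ae ?_
  filter_upwards [coeFn_topPart v] with x hx
  rw [EuclideanSpace.norm_sq_eq, sum_prod_type]
  simp only [hx, EuclideanSpace.norm_sq_eq]

end jets

/-! ### Periodic jets and the cell problem -/

/-- Lebesgue measure on the cell. -/
abbrev cellM (d : ℕ) : Measure (Pt d) := volume.restrict (cell d)

section hat

variable {d n m : ℕ}

theorem hat_congr_ae {f g} (h : f =ᵐ[cellM d] g) (k) : hat f k = hat g k := by
  unfold hat
  refine integral_congr_ae ?_
  filter_upwards [h] with p hp
  rw [hp]

theorem hat_coord_congr {ι : Type*} [Fintype ι] {f g : Pt d → EuclideanSpace ℝ ι}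
    (h : f =ᵐ[cellM d] g) (i k) : hat (fun p => f p i) k = hat (fun p => g p i) k :=
  hat_congr_ae (h.fun_comp fun x => x i) k

theorem hat_add {f g} (hf : MemLp f 2 (cellM d)) (hg : MemLp g 2 (cellM d))
    (k) : hat (fun p => f p + g p) k = hat f k + hat g k := by
  unfold hat
  rw [← integral_add (integrable_smul_ex (hf.integrable (by norm_num)) k)
    (integrable_smul_ex (hg.integrable (by norm_num)) k)]
  simp [add_mul]

theorem hat_const_mul (c f) (k : Freq d) : hat (fun p => c * f p) k = c * hat f k := by
  unfold hat
  rw [← integral_const_mul]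
  simp [mul_assoc]

/-- The Fourier coefficient as a linear map. -/
def hatL {ι : Type*} [Fintype ι] (i : ι) (k : Freq d) :
    Lp (EuclideanSpace ℝ ι) 2 (cellM d) →ₗ[ℝ] ℂ where
  toFun f := hat (fun p => f p i) k
  map_add' f g := by
    rw [← hat_add (memLp_coord (Lp.memLp f) i) (memLp_coord (Lp.memLp g) i)]
    exact hat_coord_congr (Lp.coeFn_add f g) i k
  map_smul' c f := by
    rw [RingHom.id_apply, real_smul, ← hat_const_mul]
    exact hat_coord_congr (Lp.coeFn_smul c f) i k

theorem hatL_apply {ι : Type*} [Fintype ι] (i : ι) (k : Freq d) (f) :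
    hatL i k f = hat (fun p => f p i) k := rfl

theorem integral_inner_eq_sum {X ι : Type*} [Fintype ι] [MeasurableSpace X] {ν : Measure X}
    {f g : X → EuclideanSpace ℝ ι} (hf : MemLp f 2 ν) (hg : MemLp g 2 ν) :
    ∫ x, inner ℝ (f x) (g x) ∂ν = ∑ i, ∫ x, f x i * g x i ∂ν := by
  have h : ∀ i ∈ Finset.univ, Integrable (fun x => f x i * g x i) ν := fun i _ =>
    (memLp_coord hf i).integrable_mul (memLp_coord hg i)
  rw [← integral_finsetSum _ h]
  refine integral_congr_ae (ae_of_all _ fun x => ?_)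
  simp [PiLp.inner_apply, mul_comm]

theorem norm_sq_eq_sum {X ι : Type*} [Fintype ι] [MeasurableSpace X] {ν : Measure X}
    (f : Lp (EuclideanSpace ℝ ι) 2 ν) : ‖f‖ ^ 2 = ∑ i, ∫ x, f x i ^ 2 ∂ν := by
  rw [← real_inner_self_eq_norm_sq, inner_def, integral_inner_eq_sum (Lp.memLp f) (Lp.memLp f)]
  simp [pow_two]

/-- The wave `Re (c e_k)` in `L²` of the cell. -/
def exL (k : Freq d) (c : Fin n → ℂ) : Lp (Euc n) 2 (cellM d) :=
  (memLp_of_coord fun i => memLp_exWave_apply k c i).toLp (exWave k c)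

theorem coeFn_exL (k : Freq d) (c : Fin n → ℂ) : exL k c =ᵐ[cellM d] exWave k c :=
  MemLp.coeFn_toLp _

theorem inner_exL (k : Freq d) (c : Fin n → ℂ) (f) :
    inner ℝ (exL k c) f = ∑ i, (c i * hat (fun p => f p i) k).re := by
  rw [inner_eq_integral (coeFn_exL k c) .rfl]
  exact integral_inner_exWave (fun i => (memLp_coord (Lp.memLp f) i).integrable (by norm_num)) k c

theorem continuous_hat_coord (i k) :
    Continuous fun f : Lp (Euc n) 2 (cellM d) => hat (fun p => f p i) k := by
  classical
  have : ∀ f : Lp (Euc n) 2 (cellM d), hat (fun p => f p i) k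
      = ((inner ℝ (exL k (Pi.single i 1)) f : ℝ) : ℂ)
        - I * ((inner ℝ (exL k (Pi.single i I)) f : ℝ) : ℂ) := by
    intro f
    rw [inner_exL, inner_exL, sum_eq_single i, sum_eq_single i]
    · rw [Pi.single_eq_same, Pi.single_eq_same]
      apply Complex.ext <;> simp
    all_goals simp +contextual
  simp only [this]
  fun_prop

theorem symK_eq_zero {k : Freq d} (hk : k.1 = 0) {α} (hα : 0 < ∑ i, α i) : symK k α = 0 := by
  obtain ⟨i, -, hi⟩ := Finset.exists_ne_zero_of_sum_ne_zero hα.ne'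
  unfold symK symb
  refine Finset.prod_eq_zero (Finset.mem_univ i) ?_
  simp [hk, hi]

theorem norm_symK_le {k} (hk : k.1 ≠ 0) {α} (hα : ∑ i, α i ≤ m) :
    ∃ β : MIdx d m, ‖symK k α‖ ≤ ‖symK k β.1‖ := by
  classical
  obtain ⟨j, hj⟩ : ∃ j, ∀ i, |k.1 i| ≤ |k.1 j| := by
    obtain ⟨i, -⟩ := Function.ne_iff.1 hk
    have : Nonempty (Fin d) := ⟨i⟩
    exact Finite.exists_max fun i => |k.1 i|
  have hj1 : 1 ≤ |k.1 j| := by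
    obtain ⟨i, hi⟩ := Function.ne_iff.1 hk
    exact (Int.one_le_abs hi).trans (hj i)
  refine ⟨⟨Pi.single j m, by simp⟩, ?_⟩
  have hn : ∀ i, ‖I * ((2 * π * k.1 i : ℝ) : ℂ)‖ = 2 * π * |(k.1 i : ℝ)| := by
    intro i
    rw [norm_mul, Complex.norm_I, one_mul, Complex.norm_real, norm_mul, norm_mul]
    simp [abs_of_pos Real.pi_pos]
  have h1 : ‖symK k (Pi.single j m)‖ = (2 * π * |(k.1 j : ℝ)|) ^ m := by
    unfold symK symb
    rw [norm_prod, Finset.prod_eq_single j]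
    · rw [Pi.single_eq_same, norm_pow, hn]
    · intro i _ hi; simp [hi]
    · simp
  have hge : 1 ≤ 2 * π * |(k.1 j : ℝ)| := by
    have : (1 : ℝ) ≤ |(k.1 j : ℝ)| := by exact_mod_cast hj1
    nlinarith [Real.pi_gt_three]
  rw [h1]
  unfold symK symb
  rw [norm_prod]
  calc ∏ i, ‖(I * ((2 * π * k.1 i : ℝ) : ℂ)) ^ α i‖
      ≤ ∏ i, (2 * π * |(k.1 j : ℝ)|) ^ α i := by
        refine Finset.prod_le_prod (fun i _ => norm_nonneg _) fun i _ => ?_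
        rw [norm_pow, hn]
        have : |(k.1 i : ℝ)| ≤ |(k.1 j : ℝ)| := by exact_mod_cast hj i
        gcongr
    _ = (2 * π * |(k.1 j : ℝ)|) ^ (∑ i, α i) := Finset.prod_pow_eq_pow_sum _ _ _
    _ ≤ _ := pow_le_pow_right₀ hge hα

end hat

/-- The periodic jets `(D^α w)_{|α| ≤ m}` in `L²` of the cell, of functions `w` whose mean in the
space variable vanishes, described by their Fourier coefficients. -/
def perJets (d n m : ℕ) : Submodule ℝ (Jets d n m (cellM d)) where
  carrier := {w | (∀ (α : LIdx d m) i k, hat (fun p => w α p i) k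
      = conj (symK k α.1) * hat (fun p => w 𝟎 p i) k) ∧
    ∀ (k : Freq d) i, k.1 = 0 → hat (fun p => w 𝟎 p i) k = 0}
  zero_mem' := by simp [← hatL_apply]
  add_mem' := by
    intro v w hv hw
    simp only [← hatL_apply, Set.mem_ofPred_eq, PiLp.add_apply, map_add] at *
    refine ⟨fun α i k => ?_, fun k i hk => ?_⟩
    · rw [hv.1, hw.1, mul_add]
    · rw [hv.2 k i hk, hw.2 k i hk, add_zero]
  smul_mem' := by
    intro c v hv
    simp only [← hatL_apply, Set.mem_ofPred_eq, PiLp.smul_apply, map_smul, real_smul] at *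
    refine ⟨fun α i k => ?_, fun k i hk => ?_⟩
    · rw [hv.1]; ring
    · rw [hv.2 k i hk, mul_zero]

section perJets

variable {d n m : ℕ}

theorem isClosed_perJets : IsClosed (perJets d n m : Set (Jets d n m (cellM d))) := by
  have hc : ∀ α i k,
      Continuous fun w : Jets d n m (cellM d) => hat (fun p => w α p i) k := fun α i k =>
    (continuous_hat_coord i k).comp (PiLp.continuous_apply 2 _ α)
  have : (perJets d n m : Set (Jets d n m (cellM d)))
      = (⋂ (α : LIdx d m) (i : Fin n) (k : Freq d), {w | hat (fun p => w α p i) k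
        = conj (symK k α.1) * hat (fun p => w 𝟎 p i) k}) ∩
        ⋂ (k : Freq d) (i : Fin n) (_ : k.1 = 0), {w | hat (fun p => w 𝟎 p i) k = 0} := by
    ext w
    simp only [mem_inter_iff, mem_iInter, Set.mem_ofPred_eq, SetLike.mem_coe]
    rfl
  rw [this]
  refine IsClosed.inter ?_ ?_
  · exact isClosed_iInter fun α => isClosed_iInter fun i => isClosed_iInter fun k =>
      isClosed_eq (hc α i k) (continuous_const.mul (hc _ i k))
  · exact isClosed_iInter fun k => isClosed_iInter fun i => isClosed_iInter fun _ =>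
      isClosed_eq (hc _ i k) continuous_const

instance instCompletePerJets : CompleteSpace (perJets d n m) :=
  isClosed_perJets.completeSpace_coe

/-- The function `w` underlying a periodic jet. -/
def perVal (d n m : ℕ) : perJets d n m →L[ℝ] Lp (Euc n) 2 (cellM d) :=
  (PiLp.proj 2 _ 𝟎).comp (perJets d n m).subtypeL

/-- The derivatives of order `m` of a periodic jet. -/
def perTop (d n m : ℕ) : perJets d n m →L[ℝ] Lp (Top d n m) 2 (cellM d) :=
  (topPart d n m (cellM d)).comp (perJets d n m).subtypeL

notation "𝒢" => perTop _ _ _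

/-- **Poincaré's inequality** on the cell. -/
theorem norm_sq_le_perTop (w) : ‖w‖ ^ 2 ≤ card (LIdx d m) * ‖perTop d n m w‖ ^ 2 := by
  have hs : ∀ (α : LIdx d m), ‖w.1 α‖ ^ 2 ≤ ∑ β : MIdx d m, ‖w.1 β.low‖ ^ 2 := by
    intro α
    simp only [norm_sq_eq_sum]
    rw [sum_comm]
    refine sum_le_sum fun i _ => ?_
    have h1 := hasSum_hat_sq (memLp_coord (Lp.memLp (w.1 α)) i)
    have h2 : HasSum (fun k => ∑ β : MIdx d m, ‖hat (fun p => w.1 β.low p i) k‖ ^ 2)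
        (∑ β : MIdx d m, ∫ p in cell d, w.1 β.low p i ^ 2) :=
      hasSum_sum fun β _ => hasSum_hat_sq (memLp_coord (Lp.memLp (w.1 β.low)) i)
    refine hasSum_le (fun k => ?_) h1 h2
    by_cases hk : k.1 = 0
    · rw [w.2.1, w.2.2 k i hk]
      simp only [mul_zero, norm_zero, ne_eq, OfNat.ofNat_ne_zero, not_false_eq_true, zero_pow]
      positivity
    · obtain ⟨β, hβ⟩ := norm_symK_le hk α.2
      refine le_trans ?_ (single_le_sum
        (f := fun β : MIdx d m => ‖hat (fun p => w.1 β.low p i) k‖ ^ 2)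
        (fun _ _ => by positivity) (Finset.mem_univ β))
      simp only
      rw [w.2.1 α, w.2.1 β.low, norm_mul, norm_mul, RCLike.norm_conj, RCLike.norm_conj]
      gcongr
      exact hβ
  have h0 : ‖𝒢 w‖ ^ 2 = ∑ β : MIdx d m, ‖w.1 β.low‖ ^ 2 := norm_sq_topPart w.1
  have h1 : ‖w‖ ^ 2 = ∑ α : LIdx d m, ‖w.1 α‖ ^ 2 := PiLp.norm_sq_eq_of_L2 _ w.1
  rw [h1, h0]
  refine (sum_le_sum fun α _ => hs α).trans ?_
  simp

/-- The Fourier form of `∂_s w + (-1)^m ∑ D^α g_α = 0`. -/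
def CoeffEq (w : Pt d → Euc n) (g : Pt d → Top d n m) : Prop :=
  ∀ k : Freq d, k.1 ≠ 0 → ∀ i, I * (2 * π * k.2 : ℝ) * hat (fun p => w p i) k
    = ∑ α : MIdx d m, symK k α.1 * hat (fun p => g p (α, i)) k

/-- Testing the equation with the solution. -/
theorem inner_perTop_eq_zero (w) (g : Lp (Top d n m) 2 (cellM d))
    (h : CoeffEq (w.1 𝟎) g) : inner ℝ g (𝒢 w) = 0 := by
  have h1 : inner ℝ g (𝒢 w) = ∑ a, ∫ p in cell d, g p a * w.1 a.1.low p a.2 := by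
    rw [inner_def, integral_inner_eq_sum (Lp.memLp g) (Lp.memLp _)]
    refine sum_congr rfl fun a _ => integral_congr_ae ?_
    filter_upwards [coeFn_topPart w.1] with p hp
    rw [← hp a]
    rfl
  have h2 := hasSum_sum (s := Finset.univ) fun a _ =>
    Complex.hasSum_re (hasSum_hat (memLp_coord (Lp.memLp g) a)
      (memLp_coord (Lp.memLp (w.1 a.1.low)) a.2))
  have h3 : ∀ k, ∑ a, (hat (fun p => g p a) k
      * conj (hat (fun p => w.1 a.1.low p a.2) k)).re = 0 := by
    intro k
    rw [sum_prod_type, sum_comm]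
    refine sum_eq_zero fun i _ => ?_
    rw [← Complex.re_sum]
    have e : ∀ α, hat (fun p => g p (α, i)) k * conj (hat (fun p => w.1 α.low p i) k)
        = symK k α.1 * hat (fun p => g p (α, i)) k
          * conj (hat (fun p => w.1 𝟎 p i) k) := by
      intro α
      rw [w.2.1 α.low, map_mul, Complex.conj_conj]
      change _ * (symK k α.1 * _) = _
      ring
    simp only [e]
    rw [← sum_mul]
    by_cases hk : k.1 = 0
    · rw [w.2.2 k i hk]; simp
    · rw [← h k hk i, mul_assoc, Complex.mul_conj]
      simp
  simp only [h3, Complex.ofReal_re] at h2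
  rw [h1]
  exact h2.unique hasSum_zero

/-- Testing the equation with a function given by its Fourier coefficients `b`. -/
theorem CoeffEq.test (hm : 0 < m) {w g} (hw : MemLp w 2 (cellM d)) (hg : MemLp g 2 (cellM d))
    (h : CoeffEq w g) (h0 : ∀ (k : Freq d) i, k.1 = 0 → hat (fun p => w p i) k = 0)
    {τ : Fin n → Pt d → ℝ} {f : MIdx d m → Fin n → Pt d → ℝ} {b : Fin n → Freq d → ℂ}
    (hτ : ∀ i, MemLp (τ i) 2 (cellM d)) (hf : ∀ α i, MemLp (f α i) 2 (cellM d))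
    (hτb : ∀ i k, hat (τ i) k = -(I * (2 * π * k.2 : ℝ)) * b i k)
    (hfb : ∀ α i k, hat (f α i) k = conj (symK k α.1) * b i k) :
    -(∑ i, ∫ p in cell d, w p i * τ i p) + ∑ α, ∑ i, ∫ p in cell d, g p (α, i) * f α i p = 0 := by
  have h1 := hasSum_sum (s := Finset.univ) fun (i : Fin n) _ => hasSum_hat (memLp_coord hw i) (hτ i)
  have h2 := hasSum_sum (s := Finset.univ) fun (α : MIdx d m) _ =>
    hasSum_sum (s := Finset.univ) fun (i : Fin n) _ => hasSum_hat (memLp_coord hg (α, i)) (hf α i)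
  have h3 := h1.neg.add h2
  have h4 : ∀ k : Freq d, -(∑ i, hat (fun p => w p i) k * conj (hat (τ i) k))
      + ∑ α, ∑ i, hat (fun p => g p (α, i)) k * conj (hat (f α i) k) = 0 := by
    intro k
    rw [sum_comm, ← Finset.sum_neg_distrib, ← sum_add_distrib]
    refine sum_eq_zero fun i _ => ?_
    simp only [hτb, hfb, map_mul, map_neg, Complex.conj_I, Complex.conj_ofReal, Complex.conj_conj]
    by_cases hk : k.1 = 0
    · rw [h0 k i hk]
      have : ∀ α : MIdx d m, symK k α.1 = 0 := fun α => symK_eq_zero hk (by rw [α.2]; exact hm)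
      simp [this]
    · have e : ∑ α : MIdx d m, hat (fun p => g p (α, i)) k * (symK k α.1 * conj (b i k))
          = (∑ α : MIdx d m, symK k α.1 * hat (fun p => g p (α, i)) k)
            * conj (b i k) := by
        rw [sum_mul]
        exact sum_congr rfl fun α _ => by ring
      rw [e, ← h k hk i]
      ring
  simp only [h4] at h3
  have h5 := h3.unique hasSum_zero
  exact_mod_cast h5

end perJets

/-! ### Smooth periodic test functions -/

/-- Smooth periodic functions with vanishing mean in the space variable, together with the
behaviour of their Fourier coefficients under differentiation. -/
structure IsCellTest {d n : ℕ} (ψ : Pt d → Euc n) : Prop where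
  smooth : Smooth ψ
  per_space : ∀ (α : Fin d → ℕ) p z, spaceD α ψ (p + lat d z) = spaceD α ψ p
  per_time : ∀ p z, timeD ψ (p + lat d z) = timeD ψ p
  hat_space : ∀ (α : Fin d → ℕ) i k, hat (fun p => spaceD α ψ p i) k
    = conj (symK k α) * hat (fun p => ψ p i) k
  hat_time : ∀ i k, hat (fun p => timeD ψ p i) k
    = -(I * (2 * π * k.2 : ℝ)) * hat (fun p => ψ p i) k
  hat_zero : ∀ (k : Freq d) i, k.1 = 0 → hat (fun p => ψ p i) k = 0

section cellTests

variable {d n m : ℕ} {φ ψ : Pt d → Euc n}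

theorem exists_lat_add_mem_cell (p) : ∃ z, p + lat d z ∈ cell d := by
  choose z hz _ using fun i => existsUnique_add_mem_Ico (p.1 i)
  obtain ⟨l, hl, -⟩ := existsUnique_add_mem_Ico p.2
  exact ⟨(z, l), fun i => hz i, hl⟩

theorem exists_bound_of_periodic {W : Type*} [NormedAddCommGroup W] {f : Pt d → W}
    (hf : Continuous f) (hp : ∀ p z, f (p + lat d z) = f p) : ∃ C, 0 ≤ C ∧ ∀ p, ‖f p‖ ≤ C := by
  have hc : IsCompact ((WithLp.toLp 2 '' (Set.pi univ fun _ => Icc (-1 : ℝ) 1))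
      ×ˢ Icc (-1 : ℝ) 1 : Set (Pt d)) := by
    refine IsCompact.prod ((isCompact_univ_pi fun _ => isCompact_Icc).image ?_) isCompact_Icc
    exact PiLp.continuous_toLp 2 _
  obtain ⟨C, hC⟩ := hc.exists_bound_of_continuousOn hf.continuousOn
  refine ⟨max C 0, le_max_right _ _, fun p => ?_⟩
  obtain ⟨z, hz⟩ := exists_lat_add_mem_cell p
  rw [← hp p z]
  refine (hC _ ⟨⟨(p + lat d z).1.ofLp, fun i _ => ?_, rfl⟩, ?_⟩).trans (le_max_left _ _)
  · have := hz.1 i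
    exact ⟨by linarith [this.1], by linarith [this.2]⟩
  · have := hz.2
    exact ⟨by linarith [this.1], by linarith [this.2]⟩

theorem memLp_cell_of_periodic {W : Type*} [NormedAddCommGroup W] {f : Pt d → W}
    [SecondCountableTopology W] (hf : Continuous f) (hp : ∀ p z, f (p + lat d z) = f p) :
    MemLp f 2 (cellM d) := by
  obtain ⟨C, -, hC⟩ := exists_bound_of_periodic hf hp
  exact MemLp.of_bound hf.aestronglyMeasurable C (ae_of_all _ hC)

theorem IsCellTest.memLp_space (h : IsCellTest ψ) (α) : MemLp (spaceD α ψ) 2 (cellM d) :=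
  memLp_cell_of_periodic (contDiff_spaceD h.smooth α).continuous (h.per_space α)

theorem IsCellTest.memLp_time (h : IsCellTest ψ) : MemLp (timeD ψ) 2 (cellM d) :=
  memLp_cell_of_periodic (contDiff_timeD h.smooth).continuous h.per_time

theorem IsCellTest.memLp (h : IsCellTest ψ) : MemLp ψ 2 (cellM d) := by
  simpa [spaceD_zero] using h.memLp_space 0

theorem spaceD_add (h : Smooth φ) (h' : Smooth ψ) (α) :
    spaceD α (φ + ψ) = spaceD α φ + spaceD α ψ := by
  funext p
  exact congrFun (multiD_add (contDiff_slice h p.2) (contDiff_slice h' p.2) α) p.1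

theorem spaceD_const_smul (h : Smooth φ) (c : ℝ) (α) : spaceD α (c • φ) = c • spaceD α φ := by
  funext p
  exact congrFun (multiD_const_smul (contDiff_slice h p.2) c α) p.1

theorem timeD_add (h : Smooth φ) (h' : Smooth ψ) :
    timeD (φ + ψ) = timeD φ + timeD ψ := by
  rw [timeD_eq h, timeD_eq h', timeD_eq (show Smooth (φ + ψ) from h.add h')]
  funext p
  rw [fderiv_add (h.differentiable (by simp) p) (h'.differentiable (by simp) p)]
  rfl

theorem timeD_const_smul (h : Smooth φ) (c : ℝ) : timeD (c • φ) = c • timeD φ := by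
  rw [timeD_eq h, timeD_eq (show Smooth (c • φ) from h.const_smul c)]
  funext p
  rw [fderiv_const_smul (h.differentiable (by simp) p)]
  rfl

theorem IsCellTest.add (h : IsCellTest φ) (h' : IsCellTest ψ) : IsCellTest (φ + ψ) where
  smooth := h.smooth.add h'.smooth
  per_space α p z := by
    rw [spaceD_add h.smooth h'.smooth]
    simp only [Pi.add_apply, h.per_space, h'.per_space]
  per_time p z := by
    rw [timeD_add h.smooth h'.smooth]
    simp only [Pi.add_apply, h.per_time, h'.per_time]
  hat_space α i k := by
    rw [spaceD_add h.smooth h'.smooth]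
    simp only [Pi.add_apply, PiLp.add_apply]
    rw [hat_add (memLp_coord (h.memLp_space α) i) (memLp_coord (h'.memLp_space α) i),
      hat_add (memLp_coord h.memLp i) (memLp_coord h'.memLp i), h.hat_space, h'.hat_space, mul_add]
  hat_time i k := by
    rw [timeD_add h.smooth h'.smooth]
    simp only [Pi.add_apply, PiLp.add_apply]
    rw [hat_add (memLp_coord h.memLp_time i) (memLp_coord h'.memLp_time i),
      hat_add (memLp_coord h.memLp i) (memLp_coord h'.memLp i), h.hat_time, h'.hat_time, mul_add]
  hat_zero k i hk := by
    simp only [Pi.add_apply, PiLp.add_apply]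
    rw [hat_add (memLp_coord h.memLp i) (memLp_coord h'.memLp i), h.hat_zero k i hk,
      h'.hat_zero k i hk, add_zero]

theorem IsCellTest.const_smul (h : IsCellTest φ) (c : ℝ) : IsCellTest (c • φ) where
  smooth := h.smooth.const_smul c
  per_space α p z := by
    rw [spaceD_const_smul h.smooth]
    simp only [Pi.smul_apply, h.per_space]
  per_time p z := by
    rw [timeD_const_smul h.smooth]
    simp only [Pi.smul_apply, h.per_time]
  hat_space α i k := by
    rw [spaceD_const_smul h.smooth]
    simp only [Pi.smul_apply, PiLp.smul_apply, smul_eq_mul]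
    rw [hat_const_mul, hat_const_mul, h.hat_space]
    ring
  hat_time i k := by
    rw [timeD_const_smul h.smooth]
    simp only [Pi.smul_apply, PiLp.smul_apply, smul_eq_mul]
    rw [hat_const_mul, hat_const_mul, h.hat_time]
    ring
  hat_zero k i hk := by
    simp only [Pi.smul_apply, PiLp.smul_apply, smul_eq_mul]
    rw [hat_const_mul, h.hat_zero k i hk, mul_zero]

theorem isCellTest_exWave {k : Freq d} (hk : k.1 ≠ 0) (c : Fin n → ℂ) : IsCellTest (exWave k c) where
  smooth := contDiff_exWave k c
  per_space α p z := by rw [spaceD_exWave, exWave_add_lat]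
  per_time p z := by rw [timeD_exWave, exWave_add_lat]
  hat_space α i l := hat_spaceD_exWave k l c i α
  hat_time i l := hat_timeD_exWave k l c i
  hat_zero l i hl := by
    rw [hat_exWave, if_neg, if_neg, add_zero]
    · intro h
      apply hk
      have := congrArg Prod.fst h
      simpa [hl] using this
    · intro h
      apply hk
      have := congrArg Prod.fst h
      simpa [hl] using this

/-- The space of smooth periodic test functions. -/
def cellTests (d n : ℕ) : Submodule ℝ (Pt d → Euc n) where
  carrier := {ψ | IsCellTest ψ}
  zero_mem' := by
    rcases Nat.eq_zero_or_pos d with rfl | hd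
    · have hD : ∀ α : Fin 0 → ℕ, α = 0 := fun α => Subsingleton.elim _ _
      have ht : timeD (0 : Euc 0 × ℝ → Euc n) = 0 := by funext p; simp [timeD]
      have h0 : ∀ (i : Fin n) (k : Freq 0),
          hat (fun p => (0 : Euc 0 × ℝ → Euc n) p i) k = 0 := fun i k => by simp [hat]
      refine ⟨contDiff_const, fun α p z => ?_, fun p z => by simp [ht], fun α i k => ?_,
        fun i k => ?_, fun k i _ => h0 i k⟩
      · rw [hD α, spaceD_zero]; rfl
      · rw [hD α, spaceD_zero, h0, mul_zero]
      · rw [ht, h0, mul_zero]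
    · have : IsCellTest ((0 : ℝ) • exWave (n := n) ((fun _ => 1, 0) : Freq d) 0) :=
        (isCellTest_exWave (fun h => by simpa using congrFun h ⟨0, hd⟩) 0).const_smul 0
      rwa [zero_smul] at this
  add_mem' := fun h h' => h.add h'
  smul_mem' := fun c _ h => h.const_smul c

/-- The jet of a smooth periodic function. -/
def cellJet (d n m : ℕ) : cellTests d n →ₗ[ℝ] perJets d n m where
  toFun ψ := ⟨WithLp.toLp 2 fun α => (IsCellTest.memLp_space ψ.2 α.1).toLp _, by
    have h : ∀ (α : LIdx d m) (i : Fin n) (k : Freq d),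
        hat (fun p => ((IsCellTest.memLp_space ψ.2 α.1).toLp (spaceD α.1 ψ.1)) p i) k
          = hat (fun p => spaceD α.1 ψ.1 p i) k := by
      intro α i k
      exact hat_coord_congr (MemLp.coeFn_toLp _) i k
    have h0 : spaceD (LIdx.zero d m).1 ψ.1 = ψ.1 := spaceD_zero _
    refine ⟨fun α i k => ?_, fun k i hk => ?_⟩
    · simp only
      rw [h, h, h0]
      exact IsCellTest.hat_space ψ.2 α.1 i k
    · simp only
      rw [h, h0]
      exact IsCellTest.hat_zero ψ.2 k i hk⟩
  map_add' φ ψ := by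
    ext1
    refine PiLp.ext fun α => ?_
    change (IsCellTest.memLp_space (φ + ψ).2 α.1).toLp (spaceD α.1 (φ + ψ).1)
      = (IsCellTest.memLp_space φ.2 α.1).toLp (spaceD α.1 φ.1)
        + (IsCellTest.memLp_space ψ.2 α.1).toLp (spaceD α.1 ψ.1)
    rw [← MemLp.toLp_add]
    exact toLp_congr _ _ (ae_of_all _ fun p => congrFun
      (spaceD_add (IsCellTest.smooth φ.2) (IsCellTest.smooth ψ.2) α.1) p)
  map_smul' c φ := by
    ext1
    refine PiLp.ext fun α => ?_
    change (IsCellTest.memLp_space (c • φ).2 α.1).toLp (spaceD α.1 (c • φ).1)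
      = c • (IsCellTest.memLp_space φ.2 α.1).toLp (spaceD α.1 φ.1)
    rw [← MemLp.toLp_const_smul]
    exact toLp_congr _ _ (ae_of_all _ fun p => congrFun
      (spaceD_const_smul (IsCellTest.smooth φ.2) c α.1) p)

/-- The time derivative of a smooth periodic function. -/
def cellTime (d n : ℕ) : cellTests d n →ₗ[ℝ] Lp (Euc n) 2 (cellM d) where
  toFun ψ := (IsCellTest.memLp_time ψ.2).toLp _
  map_add' φ ψ := by
    rw [← MemLp.toLp_add]
    exact toLp_congr _ _ (ae_of_all _ fun p => congrFun
      (timeD_add (IsCellTest.smooth φ.2) (IsCellTest.smooth ψ.2)) p)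
  map_smul' c φ := by
    rw [RingHom.id_apply, ← MemLp.toLp_const_smul]
    exact toLp_congr _ _ (ae_of_all _ fun p => congrFun
      (timeD_const_smul (IsCellTest.smooth φ.2) c) p)

theorem coeFn_cellTime (ψ) : cellTime d n ψ =ᵐ[cellM d] timeD ψ.1 :=
  (IsCellTest.memLp_time ψ.2).coeFn_toLp

theorem coeFn_cellJet (ψ α) : (cellJet d n m ψ).1 α =ᵐ[cellM d] spaceD α.1 ψ.1 :=
  (IsCellTest.memLp_space ψ.2 α.1).coeFn_toLp

theorem coeFn_perTop_cellJet (ψ) :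
    ∀ᵐ p ∂(cellM d), ∀ a, 𝒢 (cellJet d n m ψ) p a = spaceD a.1.1 ψ.1 p a.2 := by
  have h : ∀ᵐ p ∂(cellM d), ∀ α, (cellJet d n m ψ).1 α p = spaceD α.1 ψ.1 p :=
    ae_all_iff.2 fun α => coeFn_cellJet ψ α
  filter_upwards [coeFn_topPart (cellJet d n m ψ).1, h] with p hp hq a
  have := hp a
  rw [hq] at this
  exact this

theorem inner_lp_eq_sum {X ι : Type*} [Fintype ι] [MeasurableSpace X] {ν : Measure X} (f)
    {g : Lp (EuclideanSpace ℝ ι) 2 ν} {g' : X → ι → ℝ} (hg : ∀ᵐ x ∂ν, ∀ a, g x a = g' x a) :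
    inner ℝ f g = ∑ a, ∫ x, f x a * g' x a ∂ν := by
  rw [inner_def, integral_inner_eq_sum (Lp.memLp f) (Lp.memLp g)]
  refine sum_congr rfl fun a _ => integral_congr_ae ?_
  filter_upwards [hg] with x hx
  rw [hx]

theorem inner_cellTime (f ψ) :
    inner ℝ f (cellTime d n ψ) = ∑ i, ∫ p in cell d, f p i * timeD ψ.1 p i :=
  inner_lp_eq_sum f (by
    filter_upwards [coeFn_cellTime ψ] with p hp a
    rw [hp])

theorem inner_perTop_cellJet (g ψ) : inner ℝ g (𝒢 (cellJet d n m ψ))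
      = ∑ α, ∑ i, ∫ p in cell d, g p (α, i) * spaceD α.1 ψ.1 p i := by
  rw [inner_lp_eq_sum g (coeFn_perTop_cellJet ψ), sum_prod_type]

theorem inner_perVal_cellTime (ψ) :
    inner ℝ (perVal d n m (cellJet d n m ψ)) (cellTime d n ψ) = 0 := by
  have h0 : perVal d n m (cellJet d n m ψ) =ᵐ[cellM d] ψ.1 := by
    have := coeFn_cellJet ψ (LIdx.zero d m)
    have e : spaceD (LIdx.zero d m).1 ψ.1 = ψ.1 := spaceD_zero _
    rwa [e] at this
  have h1 : inner ℝ (perVal d n m (cellJet d n m ψ)) (cellTime d n ψ)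
      = ∑ i, ∫ p in cell d, ψ.1 p i * timeD ψ.1 p i := by
    rw [inner_cellTime]
    refine sum_congr rfl fun i _ => integral_congr_ae ?_
    filter_upwards [h0] with p hp
    rw [hp]
  rw [h1]
  refine sum_eq_zero fun i _ => ?_
  have h2 := Complex.hasSum_re (hasSum_hat (memLp_coord (IsCellTest.memLp ψ.2) i)
    (memLp_coord (IsCellTest.memLp_time ψ.2) i))
  have h3 : ∀ k, (hat (fun p => ψ.1 p i) k
      * conj (hat (fun p => timeD ψ.1 p i) k)).re = 0 := by
    intro k
    rw [IsCellTest.hat_time ψ.2, map_mul, mul_left_comm, Complex.mul_conj]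
    simp
  simp only [h3, Complex.ofReal_re] at h2
  exact h2.unique hasSum_zero

theorem integral_mul_exWave {ν : Measure (Pt d)} {f} (hf : Integrable f ν) (k c) (i : Fin n) :
    ∫ p, f p * exWave k c p i ∂ν = (c i * ∫ p, f p • ex k p ∂ν).re := by
  have h1 : Integrable (fun p => c i * (f p • ex k p)) ν := (integrable_smul_ex hf k).const_mul _
  rw [← integral_const_mul]
  refine Eq.trans ?_ (integral_re h1)
  refine integral_congr_ae (ae_of_all _ fun p => ?_)
  simp only [exWave_apply]
  simp [real_smul]
  ring

/-- The Fourier form of the equation follows by testing with waves. -/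
theorem coeffEq_of_exWave {w : Pt d → Euc n} {g : Pt d → Top d n m}
    (hw : MemLp w 2 (cellM d)) (hg : MemLp g 2 (cellM d)) {k}
    (h : ∀ c : Fin n → ℂ, -(∑ i, ∫ p in cell d, w p i * timeD (exWave k c) p i)
      + ∑ α : MIdx d m, ∑ i, ∫ p in cell d, g p (α, i) * spaceD α.1 (exWave k c) p i = 0) (i) :
    I * (2 * π * k.2 : ℝ) * hat (fun p => w p i) k
      = ∑ α, symK k α.1 * hat (fun p => g p (α, i)) k := by
  classical
  refine eq_of_forall_re_mul fun c => ?_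
  have h1 := h (Pi.single i c)
  have hi : ∀ j, Integrable (fun p => w p j) (cellM d) := fun j =>
    (memLp_coord hw j).integrable (by norm_num)
  have hgi : ∀ a, Integrable (fun p => g p a) (cellM d) := fun a =>
    (memLp_coord hg a).integrable (by norm_num)
  simp only [timeD_exWave, spaceD_exWave, integral_mul_exWave (hi _),
    integral_mul_exWave (hgi _)] at h1
  rw [sum_eq_single i (by simp +contextual) (by simp)] at h1
  have h2 : ∀ α, ∑ j, (symK k α.1 * (Pi.single i c : Fin n → ℂ) j
      * ∫ p in cell d, g p (α, j) • ex k p).re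
      = (c * (symK k α.1 * hat (fun p => g p (α, i)) k)).re := by
    intro α
    rw [sum_eq_single i (by simp +contextual) (by simp), Pi.single_eq_same]
    congr 1
    unfold hat
    ring
  simp only [h2] at h1
  rw [← Complex.re_sum, ← mul_sum, Pi.single_eq_same] at h1
  rw [← neg_add_eq_zero, ← h1]
  congr 2
  unfold hat
  ring_nf

/-- The operator `T` with `⟪w, T x⟫ = -⟪P w, τ x⟫ + ⟪C (B w), y x⟫`. -/
def adjointPair {Φ W X Y : Type*} [AddCommGroup Φ] [Module ℝ Φ]
    [NormedAddCommGroup W] [InnerProductSpace ℝ W] [CompleteSpace W]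
    [NormedAddCommGroup X] [InnerProductSpace ℝ X] [CompleteSpace X]
    [NormedAddCommGroup Y] [InnerProductSpace ℝ Y] [CompleteSpace Y]
    (P : W →L[ℝ] X) (B : W →L[ℝ] Y) (C : Y →L[ℝ] Y) (τ : Φ →ₗ[ℝ] X) (y : Φ →ₗ[ℝ] Y) :
    Φ →ₗ[ℝ] W :=
  (adjoint (C.comp B)).toLinearMap.comp y - (adjoint P).toLinearMap.comp τ

theorem inner_adjointPair {Φ W X Y : Type*} [AddCommGroup Φ] [Module ℝ Φ] [NormedAddCommGroup W]
    [InnerProductSpace ℝ W] [CompleteSpace W] [NormedAddCommGroup X] [InnerProductSpace ℝ X]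
    [CompleteSpace X] [NormedAddCommGroup Y] [InnerProductSpace ℝ Y] [CompleteSpace Y]
    (P : W →L[ℝ] X) (B C τ) (y : Φ →ₗ[ℝ] Y) (w x) :
    inner ℝ w (adjointPair P B C τ y x) = -inner ℝ (P w) (τ x) + inner ℝ (C (B w)) (y x) := by
  have : adjointPair P B C τ y x = adjoint (C.comp B) (y x) - adjoint P (τ x) := rfl
  rw [this, inner_sub_right, ContinuousLinearMap.adjoint_inner_right,
    ContinuousLinearMap.adjoint_inner_right, ContinuousLinearMap.comp_apply]
  ring

/-- The operator `K` with `⟪w, K ψ⟫ = -∫ w·∂_s ψ + ∫ A D^m w · D^m ψ`. -/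
def cellOp {A : Coeff d n m} {M : ℝ} (hA : IsBddCoeff A M (cellM d)) :
    cellTests d n →ₗ[ℝ] perJets d n m :=
  adjointPair (perVal d n m) (perTop d n m) (mulOp hA) (cellTime d n)
    ((perTop d n m).toLinearMap.comp (cellJet d n m))

variable {A : Coeff d n m} {M : ℝ}

theorem inner_cellOp (hA : IsBddCoeff A M (cellM d)) (w ψ) :
    inner ℝ w (cellOp hA ψ) = -inner ℝ (perVal d n m w) (cellTime d n ψ)
      + inner ℝ (mulOp hA (𝒢 w)) (𝒢 (cellJet d n m ψ)) :=
  inner_adjointPair _ _ _ _ _ w ψ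

/-- Ellipticity on the support of `ν`. -/
def LowerBound (A : Coeff d n m) (μ : ℝ) (ν : Measure (Pt d)) : Prop :=
  ∀ᵐ p ∂ν, ∀ ξ : MIdx d m → Euc n,
      μ * ∑ α, ‖ξ α‖ ^ 2 ≤ ∑ α, ∑ β, ∑ i, ∑ j, A α β i j p * ξ α i * ξ β j

theorem norm_cellJet_le (hA : IsBddCoeff A M (cellM d)) {μ} (hμ : 0 < μ)
    (hl : LowerBound A μ (cellM d)) (ψ) :
    μ * ‖cellJet d n m ψ‖ ≤ card (LIdx d m) * ‖cellOp hA ψ‖ := by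
  have h1 : μ * ‖𝒢 (cellJet d n m ψ)‖ ^ 2 ≤ inner ℝ (cellJet d n m ψ) (cellOp hA ψ) := by
    rw [inner_cellOp, inner_perVal_cellTime, neg_zero, zero_add]
    exact inner_mulOp_self_ge hA hl _
  have h2 := norm_sq_le_perTop (cellJet d n m ψ)
  have h3 := real_inner_le_norm (cellJet d n m ψ) (cellOp hA ψ)
  have hc : (0 : ℝ) ≤ card (LIdx d m) := by positivity
  rcases eq_or_lt_of_le (norm_nonneg (cellJet d n m ψ)) with h0 | h0
  · rw [← h0, mul_zero]; positivity
  · refine le_of_mul_le_mul_right ?_ h0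
    calc μ * ‖cellJet d n m ψ‖ * ‖cellJet d n m ψ‖ = μ * ‖cellJet d n m ψ‖ ^ 2 := by ring
      _ ≤ μ * (card (LIdx d m) * ‖𝒢 (cellJet d n m ψ)‖ ^ 2) := by gcongr
      _ = card (LIdx d m) * (μ * ‖𝒢 (cellJet d n m ψ)‖ ^ 2) := by ring
      _ ≤ card (LIdx d m) * (‖cellJet d n m ψ‖ * ‖cellOp hA ψ‖) := by
          exact mul_le_mul_of_nonneg_left (h1.trans h3) hc
      _ = _ := by ring

/-- Existence for the cell problem, in weak form. -/
theorem exists_cellSolution (hA : IsBddCoeff A M (cellM d)) {μ} (hμ : 0 < μ)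
    (hl : LowerBound A μ (cellM d)) (g) : ∃ w,
      CoeffEq (w.1 𝟎) (mulOp hA (𝒢 w) + g : Lp (Top d n m) 2 (cellM d)) := by
  obtain ⟨w, hw⟩ := exists_inner_eq_of_le_norm (cellOp hA)
    (-((innerSL ℝ g).toLinearMap.comp ((perTop d n m).toLinearMap.comp (cellJet d n m))))
    (‖g‖ * (‖perTop d n m‖ * (card (LIdx d m) / μ))) (fun ψ => by
      have h1 : ‖cellJet d n m ψ‖ ≤ card (LIdx d m) / μ * ‖cellOp hA ψ‖ := by
        have := norm_cellJet_le hA hμ hl ψ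
        rw [div_mul_eq_mul_div, le_div_iff₀ hμ]
        linarith
      have h2 : |inner ℝ g (𝒢 (cellJet d n m ψ))|
          ≤ ‖g‖ * (‖perTop d n m‖ * (card (LIdx d m) / μ * ‖cellOp hA ψ‖)) := by
        refine (abs_real_inner_le_norm _ _).trans ?_
        gcongr
        exact ((perTop d n m).le_opNorm _).trans (by gcongr)
      rw [LinearMap.neg_apply, abs_neg]
      refine h2.trans (le_of_eq ?_)
      ring)
  refine ⟨w, fun k hk i => coeffEq_of_exWave (Lp.memLp _) (Lp.memLp _) (fun c => ?_) i⟩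
  let ψ : cellTests d n := ⟨exWave k c, isCellTest_exWave hk c⟩
  have h1 := hw ψ
  rw [inner_cellOp] at h1
  have h2 : -inner ℝ (perVal d n m w) (cellTime d n ψ)
      + inner ℝ (mulOp hA (𝒢 w) + g) (𝒢 (cellJet d n m ψ)) = 0 := by
    rw [inner_add_left, ← add_assoc, h1]
    exact neg_add_cancel _
  rw [inner_cellTime, inner_perTop_cellJet] at h2
  exact h2

theorem eq_zero_of_coeffEq (hA : IsBddCoeff A M (cellM d)) {μ} (hμ : 0 < μ)
    (hl : LowerBound A μ (cellM d)) (w)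
    (h : CoeffEq (w.1 𝟎) (mulOp hA (𝒢 w) : Lp (Top d n m) 2 (cellM d))) : w = 0 := by
  have h1 := inner_perTop_eq_zero w _ h
  have h2 := inner_mulOp_self_ge hA hl (𝒢 w)
  have h3 : ‖𝒢 w‖ ^ 2 = 0 := by
    have : 0 ≤ ‖𝒢 w‖ ^ 2 := by positivity
    nlinarith
  have h4 := norm_sq_le_perTop w
  rw [h3, mul_zero] at h4
  have : ‖w‖ = 0 := by
    have := sq_nonneg ‖w‖
    exact pow_eq_zero_iff (two_ne_zero) |>.1 (le_antisymm h4 this)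
  exact norm_eq_zero.1 this

/-- Approximate solutions of the adjoint cell problem by smooth functions. -/
theorem exists_cellOp_near (hA : IsBddCoeff A M (cellM d)) {μ} (hμ : 0 < μ)
    (hl : LowerBound A μ (cellM d)) (v) {δ} (hδ : 0 < δ) : ∃ ψ, ‖cellOp hA ψ - v‖ < δ := by
  have hd : Dense (LinearMap.range (cellOp hA) : Set (perJets d n m)) := by
    rw [Submodule.dense_iff_topologicalClosure_eq_top, Submodule.topologicalClosure_eq_top_iff,
      Submodule.eq_bot_iff]
    intro w hw
    refine eq_zero_of_coeffEq hA hμ hl w fun k hk i =>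
      coeffEq_of_exWave (Lp.memLp _) (Lp.memLp _) (fun c => ?_) i
    let ψ : cellTests d n := ⟨exWave k c, isCellTest_exWave hk c⟩
    have h1 : inner ℝ w (cellOp hA ψ) = 0 := by
      rw [real_inner_comm]
      exact hw _ ⟨ψ, rfl⟩
    rw [inner_cellOp, inner_cellTime, inner_perTop_cellJet] at h1
    exact h1
  obtain ⟨_, ⟨hx1, ⟨ψ, rfl⟩⟩⟩ := Metric.dense_iff.1 hd v δ hδ
  exact ⟨ψ, by rw [← dist_eq_norm]; exact hx1⟩

end cellTests

/-! ### Periodic functions on `ℝ^{d+1}` and functions on the cell -/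

section periodic

variable {d n m : ℕ}

/-- The representative in the cell of a point modulo the lattice. -/
def wrap (d : ℕ) (p : Pt d) : Pt d :=
  (WithLp.toLp 2 fun i => Int.fract (p.1 i + 1 / 2) - 1 / 2, Int.fract (p.2 + 1 / 2) - 1 / 2)

theorem measurable_wrap (d) : Measurable (wrap d) := by
  unfold wrap
  refine Measurable.prodMk ?_ ?_
  · refine (PiLp.continuous_toLp 2 _).measurable.comp (measurable_pi_lambda _ fun i => ?_)
    exact (measurable_fract.comp (by fun_prop)).sub_const _
  · exact (measurable_fract.comp (by fun_prop)).sub_const _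

theorem wrap_add_lat (p z) : wrap d (p + lat d z) = wrap d p := by
  have h : ∀ (x : ℝ) (l : ℤ), Int.fract (x + l + 1 / 2) = Int.fract (x + 1 / 2) := fun x l => by
    rw [add_right_comm, Int.fract_add_intCast]
  refine Prod.ext ?_ ?_
  · ext i
    change Int.fract (p.1 i + (z.1 i : ℝ) + 1 / 2) - 1 / 2 = _
    rw [h]; rfl
  · change Int.fract (p.2 + (z.2 : ℝ) + 1 / 2) - 1 / 2 = _
    rw [h]; rfl

theorem wrap_of_mem_cell {p} (hp : p ∈ cell d) : wrap d p = p := by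
  have h : ∀ x ∈ Ico (-(1 / 2) : ℝ) (1 / 2), Int.fract (x + 1 / 2) - 1 / 2 = x := fun x hx => by
    rw [Int.fract_eq_self.2 ⟨by linarith [hx.1], by linarith [hx.2]⟩]; ring
  refine Prod.ext ?_ (h _ hp.2)
  ext i
  exact h _ (hp.1 i)

theorem ae_eq_of_ae_eq_cell {W : Type*} {F G : Pt d → W} (hF : IsPeriodic F)
    (hG : IsPeriodic G) (h : F =ᵐ[cellM d] G) : F =ᵐ[volume] G := by
  have h1 : ∀ᵐ p : Pt d, ∀ z, p + lat d z ∈ cell d →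
      F (p + lat d z) = G (p + lat d z) := ae_all_iff.2 fun z =>
    (measurePreserving_add_lat z).quasiMeasurePreserving.ae
      ((ae_restrict_iff' (measurableSet_cell d)).1 h)
  have h2 : ∀ᵐ p : Pt d, ∀ z, F (p + lat d z) = F p := ae_all_iff.2 fun z => hF z.1 z.2
  have h3 : ∀ᵐ p : Pt d, ∀ z, G (p + lat d z) = G p := ae_all_iff.2 fun z => hG z.1 z.2
  filter_upwards [h1, h2, h3] with p hp1 hp2 hp3
  obtain ⟨z, hz⟩ := exists_lat_add_mem_cell p
  rw [← hp2 z, ← hp3 z, hp1 z hz]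

theorem IsPeriodic.map {W W' : Type*} {F : Pt d → W} (hF : IsPeriodic F) (g : W → W') :
    IsPeriodic fun p => g (F p) := fun z k => by
  filter_upwards [hF z k] with p hp
  rw [hp]

/-- Unfolding of the pairing of a periodic function with a compactly supported one. -/
theorem integral_inner_periodic {ι : Type*} [Fintype ι] {S} {φ F : Pt d → EuclideanSpace ℝ ι}
    (hφ : ∀ i, MemLp (fun p => φ p i) 2) (hS : CellSupp S φ) (hF : AEStronglyMeasurable F volume)
    (hF2 : MemLp F 2 (cellM d)) (hper : IsPeriodic F) :
    Integrable (fun p => inner ℝ (F p) (φ p)) ∧ (∀ i, Integrable fun p => F p i * φ p i) ∧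
    (∀ i, ∫ p, F p i * φ p i = ∫ p in cell d, F p i * per S (fun p => φ p i) p) ∧
    ∫ p, inner ℝ (F p) (φ p) = ∑ i, ∫ p in cell d, F p i * per S (fun p => φ p i) p := by
  have h := fun i => integral_smul_periodic (hφ i) (S := S)
    (fun z hz p hp => by rw [hS z hz p hp]; rfl) (aestronglyMeasurable_coord hF i)
    (memLp_coord hF2 i) (hper.map fun x => x i)
  have h : ∀ i, Integrable (fun p => F p i * φ p i) ∧
      ∫ p, F p i * φ p i = ∫ p in cell d, F p i * per S (fun p => φ p i) p := fun i => by
    simpa only [smul_eq_mul, mul_comm (F _ i)] using h i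
  have hin : ∀ p, inner ℝ (F p) (φ p) = ∑ i, F p i * φ p i := fun p => by
    simp [PiLp.inner_apply, mul_comm]
  simp only [hin]
  refine ⟨integrable_finsetSum _ fun i _ => (h i).1, fun i => (h i).1, fun i => (h i).2, ?_⟩
  rw [integral_finsetSum _ fun i _ => (h i).1]
  exact sum_congr rfl fun i _ => (h i).2

theorem CellSupp.of_tsupport {W W' : Type*} [NormedAddCommGroup W] [NormedAddCommGroup W']
    {S} {φ : Pt d → W} {ψ : Pt d → W'} (h : tsupport φ ⊆ tsupport ψ)
    (hψ : ∀ z, z ∉ S → ∀ p ∈ cell d, p + lat d z ∉ tsupport ψ) : CellSupp S φ :=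
  fun z hz p hp => image_eq_zero_of_notMem_tsupport fun hx => hψ z hz p hp (h hx)

theorem exists_cellSupp_tsupport {W : Type*} [NormedAddCommGroup W] {ψ : Pt d → W}
    (hψ : HasCompactSupport ψ) :
    ∃ S : Finset (Freq d), ∀ z, z ∉ S → ∀ p ∈ cell d, p + lat d z ∉ tsupport ψ := by
  classical
  have hc : HasCompactSupport (fun p => if p ∈ tsupport ψ then (1 : ℝ) else 0) := by
    refine HasCompactSupport.intro hψ.isCompact fun x hx => if_neg hx
  obtain ⟨N, hN⟩ := exists_cellSupp hc
  refine ⟨freqBox d N N, fun z hz p hp hx => ?_⟩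
  have := hN z hz p hp
  simp [hx] at this

theorem hat_per_spaceD {S φ} (hφ : IsTest univ φ)
    (hS : ∀ z, z ∉ S → ∀ p ∈ cell d, p + lat d z ∉ tsupport φ) (α) (i : Fin n) (k) :
    hat (per S fun p => spaceD α φ p i) k = conj (symK k α) * ∫ p, φ p i • ex k p := by
  rw [hat_per ((hφ.spaceD α).memLp_apply i), integral_spaceD_smul_ex hφ]
  intro z hz p hp
  simp only
  rw [CellSupp.of_tsupport (spaceD_add_single_and_contDiff hφ.smooth α).2.1 hS z hz p hp]
  rfl

theorem hat_per_timeD {S φ} (hφ : IsTest univ φ)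
    (hS : ∀ z, z ∉ S → ∀ p ∈ cell d, p + lat d z ∉ tsupport φ) (i : Fin n) (k) :
    hat (per S fun p => timeD φ p i) k = -(I * (2 * π * k.2 : ℝ)) * ∫ p, φ p i • ex k p := by
  rw [hat_per (hφ.timeD.memLp_apply i), integral_timeD_smul_ex hφ]
  intro z hz p hp
  simp only
  rw [CellSupp.of_tsupport (tsupport_timeD hφ.smooth) hS z hz p hp]
  rfl

/-- The periodization of a wave cut off by the partition of unity, and of its derivatives. -/
theorem exists_cutWave (k c) : ∃ (φ : Pt d → Euc n) (S : Finset (Freq d)), IsTest univ φ ∧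
      (∀ z, z ∉ S → ∀ p ∈ cell d, p + lat d z ∉ tsupport φ) ∧
      (∀ α i, (per S fun p => spaceD α φ p i) =ᵐ[cellM d] fun p => spaceD α (exWave k c) p i) ∧
      ∀ i, (per S fun p => timeD φ p i) =ᵐ[cellM d] fun p => timeD (exWave k c) p i := by
  have ht := isTest_cutWave (d := d) k c
  obtain ⟨S, hS⟩ := exists_cellSupp_tsupport ht.compact
  refine ⟨_, S, ht, hS, fun α i => ?_, fun i => ?_⟩
  · refine ae_eq_of_hat_eq (memLp_per ((ht.spaceD α).memLp_apply i)) ?_ fun l => ?_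
    · rw [spaceD_exWave]
      exact memLp_exWave_apply k _ i
    · rw [hat_per_spaceD ht hS, hat_cutWave, hat_spaceD_exWave]
  · refine ae_eq_of_hat_eq (memLp_per (ht.timeD.memLp_apply i)) ?_ fun l => ?_
    · rw [timeD_exWave]
      exact memLp_exWave_apply k _ i
    · rw [hat_per_timeD ht hS, hat_cutWave, hat_timeD_exWave]

/-- The top order part of a family of functions. -/
def topFun {X : Type*} (v : LIdx d m → X → Euc n) (p : X) : Top d n m :=
  WithLp.toLp 2 fun a => v a.1.low p a.2

theorem topFun_apply {X : Type*} (v) (p : X) (a : MIdx d m × Fin n) :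
    topFun v p a = v a.1.low p a.2 := rfl

theorem memLp_topFun {X : Type*} [MeasurableSpace X] {ν : Measure X} {v : LIdx d m → X → Euc n}
    (hv : ∀ α, MemLp (v α) 2 ν) : MemLp (topFun v) 2 ν :=
  memLp_of_coord fun a => memLp_coord (hv a.1.low) a.2

theorem IsPeriodicJet.periodic_topFun {v : LIdx d m → Pt d → Euc n} (hv : IsPeriodicJet v) :
    IsPeriodic (topFun v) := fun z k => by
  have : ∀ᵐ p : Pt d, ∀ α, v α (p + latticePt z k) = v α p :=
    ae_all_iff.2 fun α => hv.periodic α z k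
  filter_upwards [this] with p hp
  ext a
  simp only [topFun_apply, hp]

theorem isPeriodic_flux {A : Coeff d n m} (hA : ∀ α β i j, IsPeriodic (A α β i j))
    {ξ} (hξ : IsPeriodic ξ) : IsPeriodic (flux A ξ) := fun z k => by
  have : ∀ᵐ p : Pt d, ∀ α β i j, A α β i j (p + latticePt z k) = A α β i j p := by
    simp only [ae_all_iff]
    exact fun α β i j => hA α β i j z k
  filter_upwards [this, hξ z k] with p hp hq
  ext a
  simp only [flux, hp, hq]

theorem aestronglyMeasurable_flux {A : Coeff d n m} {ν : Measure (Pt d)}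
    (hA : ∀ α β i j, AEStronglyMeasurable (A α β i j) ν) {ξ}
    (hξ : AEStronglyMeasurable ξ ν) : AEStronglyMeasurable (flux A ξ) ν :=
  aestronglyMeasurable_top fun _ => Finset.aestronglyMeasurable_fun_sum _ fun _ _ =>
    Finset.aestronglyMeasurable_fun_sum _ fun _ _ =>
      (hA _ _ _ _).mul (aestronglyMeasurable_coord hξ _)

/-- The Fourier characterisation of weak derivatives. -/
theorem IsPeriodicJet.hat_eq {v} (hv : IsPeriodicJet v) (α) (i : Fin n) (k) :
    hat (fun p => v α p i) k
      = conj (symK k α.1) * hat (fun p => v (LIdx.zero d m) p i) k := by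
  classical
  have key : symK k α.1 * hat (fun p => v 𝟎 p i) k
      = (-1) ^ (∑ i, α.1 i) * hat (fun p => v α p i) k := by
    refine eq_of_forall_re_mul fun c => ?_
    obtain ⟨φ, S, hφ, hS, h1, -⟩ := exists_cutWave (d := d) k (Pi.single i c : Fin n → ℂ)
    have h2 := hv.weakDeriv α φ hφ
    rw [(integral_inner_periodic (S := S) (fun i => (hφ.spaceD α.1).memLp_apply i)
      (CellSupp.of_tsupport (spaceD_add_single_and_contDiff hφ.smooth α.1).2.1 hS)
      (hv.measurable _) (hv.memLp _) (hv.periodic _)).2.2.2,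
      (integral_inner_periodic (S := S) (fun i => hφ.memLp_apply i)
      (CellSupp.of_tsupport subset_rfl hS)
      (hv.measurable _) (hv.memLp _) (hv.periodic _)).2.2.2] at h2
    have hi : ∀ β j, Integrable (fun p => v β p j) (cellM d) := fun β j =>
      (memLp_coord (hv.memLp β) j).integrable (by norm_num)
    have e1 : ∀ j, ∫ p in cell d, v 𝟎 p j * per S (fun p => spaceD α.1 φ p j) p
        = (symK k α.1 * (Pi.single i c : Fin n → ℂ) j * hat (fun p => v 𝟎 p j) k).re := by
      intro j
      refine (integral_congr_ae ?_).trans (integral_mul_exWave (hi _ j) k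
        (fun i' => symK k α.1 * (Pi.single i c : Fin n → ℂ) i') j)
      filter_upwards [h1 α.1 j] with p hp
      rw [hp, spaceD_exWave]
    have e2 : ∀ j, ∫ p in cell d, v α p j * per S (fun p => φ p j) p
        = ((Pi.single i c : Fin n → ℂ) j * hat (fun p => v α p j) k).re := by
      intro j
      refine (integral_congr_ae ?_).trans (integral_mul_exWave (hi _ j) k
        (Pi.single i c : Fin n → ℂ) j)
      filter_upwards [h1 0 j] with p hp
      rw [spaceD_zero, spaceD_zero] at hp
      rw [hp]
    simp only [e1, e2] at h2
    rw [sum_eq_single i (by simp +contextual) (by simp),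
      sum_eq_single i (by simp +contextual) (by simp), Pi.single_eq_same] at h2
    rw [show c * (symK k α.1 * hat (fun p => v 𝟎 p i) k)
      = symK k α.1 * c * hat (fun p => v 𝟎 p i) k by ring, h2]
    rcases neg_one_pow_eq_or ℝ (∑ i, α.1 i) with h | h
    · rcases neg_one_pow_eq_or ℂ (∑ i, α.1 i) with h' | h'
      · simp [h, h']
      · exfalso
        have : (((-1 : ℝ) ^ (∑ i, α.1 i) : ℝ) : ℂ) = (-1) ^ (∑ i, α.1 i) := by push_cast; rfl
        rw [h, h'] at this; norm_num at this
    · rcases neg_one_pow_eq_or ℂ (∑ i, α.1 i) with h' | h'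
      · exfalso
        have : (((-1 : ℝ) ^ (∑ i, α.1 i) : ℝ) : ℂ) = (-1) ^ (∑ i, α.1 i) := by push_cast; rfl
        rw [h, h'] at this; norm_num at this
      · simp [h, h']
  rw [conj_symK, mul_assoc, key, ← mul_assoc, ← mul_pow]
  simp

end periodic

/-! ### Correctors -/

section correctors

variable {d n m : ℕ} {A : Coeff d n m} {M : ℝ}

theorem hat_at_zero (f) : hat f (0 : Freq d) = ((∫ p in cell d, f p : ℝ) : ℂ) := by
  simp [hat, ex_zero, integral_complex_ofReal]

/-- Functions on the cell extended periodically. -/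
def extend (w : Jets d n m (cellM d)) (α : LIdx d m) (p : Pt d) : Euc n := w α (wrap d p)

theorem isPeriodic_extend (w : Jets d n m (cellM d)) (α) :
    IsPeriodic (extend w α) := fun z k => ae_of_all _ fun p => by
  unfold extend
  rw [← wrap_add_lat p (z, k)]
  rfl

theorem extend_ae_eq (w : Jets d n m (cellM d)) (α) : extend w α =ᵐ[cellM d] w α := by
  filter_upwards [ae_restrict_mem (measurableSet_cell d)] with p hp
  rw [extend, wrap_of_mem_cell hp]

theorem aestronglyMeasurable_extend (w : Jets d n m (cellM d)) (α) :
    AEStronglyMeasurable (extend w α) volume :=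
  ((Lp.stronglyMeasurable (w α)).comp_measurable (measurable_wrap d)).aestronglyMeasurable

theorem isPeriodicJet_extend (w : perJets d n m) : IsPeriodicJet (extend w.1) where
  measurable := aestronglyMeasurable_extend w.1
  periodic := isPeriodic_extend w.1
  memLp α := (memLp_congr_ae (extend_ae_eq w.1 α)).2 (Lp.memLp _)
  weakDeriv α φ hφ := by
    have hm : ∀ β, MemLp (extend w.1 β) 2 (cellM d) := fun β =>
      (memLp_congr_ae (extend_ae_eq w.1 β)).2 (Lp.memLp _)
    have hh := fun β => hat_coord_congr (extend_ae_eq w.1 β)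
    obtain ⟨S, hS⟩ := exists_cellSupp_tsupport hφ.compact
    rw [(integral_inner_periodic (S := S) (fun i => (hφ.spaceD α.1).memLp_apply i)
      (CellSupp.of_tsupport (spaceD_add_single_and_contDiff hφ.smooth α.1).2.1 hS)
      (aestronglyMeasurable_extend w.1 _) (hm _) (isPeriodic_extend w.1 _)).2.2.2,
      (integral_inner_periodic (S := S) (fun i => hφ.memLp_apply i)
      (CellSupp.of_tsupport subset_rfl hS)
      (aestronglyMeasurable_extend w.1 _) (hm _) (isPeriodic_extend w.1 _)).2.2.2, mul_sum]
    refine sum_congr rfl fun i _ => ?_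
    have h1 := hasSum_hat (memLp_coord (hm 𝟎) i)
      (memLp_per (S := S) ((hφ.spaceD α.1).memLp_apply i))
    have h2 := (hasSum_hat (memLp_coord (hm α) i)
      (memLp_per (S := S) (hφ.memLp_apply i))).mul_left ((-1 : ℂ) ^ (∑ i, α.1 i))
    have h0 : ∀ k, hat (per S fun p => φ p i) k = ∫ p, φ p i • ex k p := fun k => by
      have := hat_per_spaceD hφ hS 0 i k
      rwa [spaceD_zero, symK, symb_zero, map_one, one_mul] at this
    have h3 : ∀ k, hat (fun p => extend w.1 𝟎 p i) k
        * conj (hat (per S fun p => spaceD α.1 φ p i) k)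
        = (-1 : ℂ) ^ (∑ i, α.1 i) * (hat (fun p => extend w.1 α p i) k
          * conj (hat (per S fun p => φ p i) k)) := by
      intro k
      rw [hat_per_spaceD hφ hS, h0, hh, hh, w.2.1 α, map_mul, Complex.conj_conj, conj_symK]
      have : ((-1 : ℂ) ^ (∑ i, α.1 i)) * (-1) ^ (∑ i, α.1 i) = 1 := by rw [← mul_pow]; simp
      linear_combination (-symK k α.1 * hat (fun p => w.1 𝟎 p i) k
        * conj (∫ p, φ p i • ex k p)) * this
    simp only [h3] at h1
    exact_mod_cast h1.unique h2

/-- The unit vector `e_{γ j}`. -/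
def unitTop (γ : MIdx d m) (j : Fin n) : Top d n m := by
  classical exact single (γ, j) 1

theorem unitTop_apply (γ : MIdx d m) (j : Fin n) (a) :
    unitTop γ j a = if a = (γ, j) then 1 else 0 := by
  classical
  simp [unitTop]

theorem sum_smul_unitTop (ξ : Top d n m) : ∑ a, ξ a • unitTop a.1 a.2 = ξ := by
  ext b
  simp [unitTop_apply]

theorem norm_unitTop (γ : MIdx d m) (j : Fin n) : ‖unitTop γ j‖ = 1 := by
  classical
  simp [unitTop]

theorem inner_unitTop (x) (γ : MIdx d m) (j : Fin n) : inner ℝ x (unitTop γ j) = x (γ, j) := by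
  simp [PiLp.inner_apply, unitTop_apply]

/-- The total gradient `e_{γj} + D^m v`. -/
def totalTop (γ : MIdx d m) (j : Fin n) (v : LIdx d m → Pt d → Euc n) :
    Pt d → Top d n m := fun p => topFun v p + unitTop γ j

theorem flux_totalTop (γ j v p a) : flux A (totalTop γ j v) p a
      = (∑ β, ∑ k, A a.1 β a.2 k p * v β.low p k) + A a.1 γ a.2 j p := by
  simp only [flux, totalTop, PiLp.add_apply, topFun_apply, unitTop_apply, mul_add, sum_add_distrib]
  congr 1
  rw [sum_eq_single γ, sum_eq_single j] <;> simp +contextual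

theorem memLp_totalTop (γ : MIdx d m) (j : Fin n) {v}
    (hv : ∀ α, MemLp (v α) 2 (cellM d)) : MemLp (totalTop γ j v) 2 (cellM d) :=
  (memLp_topFun hv).add (memLp_const _)

theorem IsPeriodicJet.periodic_totalTop (γ : MIdx d m) (j : Fin n)
    {v} (hv : IsPeriodicJet v) : IsPeriodic (totalTop γ j v) :=
  hv.periodic_topFun.map fun x => x + unitTop γ j

theorem IsPeriodicJet.measurable_totalTop (γ : MIdx d m) (j : Fin n) {v} (hv : IsPeriodicJet v) :
    AEStronglyMeasurable (totalTop γ j v) volume :=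
  (aestronglyMeasurable_top fun a => aestronglyMeasurable_coord (hv.measurable a.1.low) a.2).add
    aestronglyMeasurable_const

theorem IsBddCoeff.restrict (hA : IsBddCoeff A M volume) : IsBddCoeff A M (cellM d) :=
  ⟨fun α β i j => (hA.measurable α β i j).mono_measure Measure.restrict_le_self,
    ae_restrict_of_ae hA.bound⟩

/-- The cell problem tested with `φ`, in terms of integrals over the cell. -/
theorem equation_iff (hAm : IsBddCoeff A M volume) (hAp : ∀ α β i j, IsPeriodic (A α β i j)) {v}
    (hv : IsPeriodicJet v) (γ j) {φ} (hφ : IsTest univ φ) {S}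
    (hS : ∀ z, z ∉ S → ∀ p ∈ cell d, p + lat d z ∉ tsupport φ) :
    (-(∫ p, inner ℝ (v 𝟎 p) (timeD φ p)) + ∑ α : MIdx d m, ∑ β : MIdx d m, ∑ i, ∑ k,
            ∫ p, A α β i k p * v β.low p k * spaceD α.1 φ p i
      = -∑ α : MIdx d m, ∑ i, ∫ p, A α γ i j p * spaceD α.1 φ p i) ↔
    -(∑ i, ∫ p in cell d, v 𝟎 p i * per S (fun p => timeD φ p i) p)
      + ∑ α : MIdx d m, ∑ i, ∫ p in cell d, flux A (totalTop γ j v) p (α, i)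
          * per S (fun p => spaceD α.1 φ p i) p = 0 := by
  have hAc := hAm.restrict
  have hsp : ∀ α : MIdx d m, CellSupp S (spaceD α.1 φ) := fun α =>
    CellSupp.of_tsupport (spaceD_add_single_and_contDiff hφ.smooth α.1).2.1 hS
  have hspi : ∀ (α : MIdx d m) i, CellSupp S (fun p => spaceD α.1 φ p i) := fun α i z hz p hp => by
    simp only
    rw [hsp α z hz p hp]; rfl
  have hA1 : ∀ α β i k, MemLp (A α β i k) ∞ (cellM d) := fun α β i k =>
    memLp_top_of_bound (hAc.measurable α β i k) M (by
      filter_upwards [hAc.bound] with p hp using hp α β i k)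
  have i1 : ∀ (α β : MIdx d m) i k,
      Integrable (fun p => A α β i k p * v β.low p k * spaceD α.1 φ p i) := fun α β i k => by
    have := (integral_smul_periodic ((hφ.spaceD α.1).memLp_apply i) (hspi α i)
      (F := fun p => A α β i k p * v β.low p k)
      ((hAm.measurable α β i k).mul (aestronglyMeasurable_coord (hv.measurable β.low) k))
      ((memLp_coord (hv.memLp β.low) k).mul (hA1 α β i k)) (fun z l => by
        filter_upwards [hAp α β i k z l, hv.periodic β.low z l] with p h1 h2
        rw [h1, h2])).1
    refine this.congr (ae_of_all _ fun p => ?_)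
    simp only [smul_eq_mul]; ring
  have i2 : ∀ (α : MIdx d m) i, Integrable (fun p => A α γ i j p * spaceD α.1 φ p i) := fun α i => by
    have := (integral_smul_periodic ((hφ.spaceD α.1).memLp_apply i) (hspi α i)
      (hAm.measurable α γ i j) ((hA1 α γ i j).mono_exponent le_top) (hAp α γ i j)).1
    refine this.congr (ae_of_all _ fun p => ?_)
    simp only [smul_eq_mul]; ring
  have e1 := (integral_inner_periodic (S := S) (fun i => hφ.timeD.memLp_apply i)
      (CellSupp.of_tsupport (tsupport_timeD hφ.smooth) hS)
      (hv.measurable 𝟎) (hv.memLp _) (hv.periodic _)).2.2.2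
  have e2 : ∀ (α : MIdx d m) (i : Fin n), ∫ p in cell d, flux A (totalTop γ j v) p (α, i)
          * per S (fun p => spaceD α.1 φ p i) p
      = (∑ β : MIdx d m, ∑ k, ∫ p, A α β i k p * v β.low p k * spaceD α.1 φ p i)
        + ∫ p, A α γ i j p * spaceD α.1 φ p i := by
    intro α i
    have hfl : MemLp (flux A (totalTop γ j v)) 2 (cellM d) :=
      memLp_flux hAc (memLp_totalTop γ j hv.memLp)
    have := (integral_smul_periodic ((hφ.spaceD α.1).memLp_apply i) (hspi α i)
      (aestronglyMeasurable_coord (aestronglyMeasurable_flux hAm.measurable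
        (hv.measurable_totalTop γ j)) (α, i)) (memLp_coord hfl (α, i))
      ((isPeriodic_flux hAp (hv.periodic_totalTop γ j)).map fun x => x (α, i))).2
    simp only [smul_eq_mul, mul_comm (per S _ _), mul_comm (spaceD _ _ _ _)] at this
    rw [← this]
    simp only [flux_totalTop, add_mul, sum_mul]
    rw [integral_add (integrable_finsetSum _ fun β _ => integrable_finsetSum _ fun k _ =>
      i1 α β i k) (i2 α i), integral_finsetSum _ fun β _ => integrable_finsetSum _ fun k _ =>
      i1 α β i k]
    congr 1
    exact sum_congr rfl fun β _ => integral_finsetSum _ fun k _ => i1 α β i k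
  rw [e1]
  simp only [e2, sum_add_distrib]
  have e3 : ∀ α : MIdx d m, ∑ β : MIdx d m, ∑ i, ∑ k,
      ∫ p, A α β i k p * v β.low p k * spaceD α.1 φ p i
      = ∑ i, ∑ β : MIdx d m, ∑ k, ∫ p, A α β i k p * v β.low p k * spaceD α.1 φ p i :=
    fun α => sum_comm
  simp only [e3]
  constructor <;> intro h <;> linarith

theorem CoeffEq.congr {w w'} {g g' : Pt d → Top d n m}
    (h : CoeffEq w g) (hw : w =ᵐ[cellM d] w') (hg : g =ᵐ[cellM d] g') : CoeffEq w' g' := by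
  intro k hk i
  simp only [← hat_coord_congr hw, ← hat_coord_congr hg]
  exact h k hk i

/-- The constant function with value `ξ`. -/
def constTop (d n m : ℕ) : Top d n m →L[ℝ] Lp (Top d n m) 2 (cellM d) := Lp.constL 2 (cellM d) ℝ

notation "𝒞" => constTop _ _ _

theorem coeFn_constTop (ξ) : constTop d n m ξ =ᵐ[cellM d] fun _ => ξ :=
  Lp.coeFn_const (p := 2) (μ := cellM d) ξ

/-- The cell problem for `χ_j^γ` on the cell. -/
def IsCellCorrector (hA : IsBddCoeff A M (cellM d)) (γ : MIdx d m) (j : Fin n)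
    (w : perJets d n m) : Prop :=
  CoeffEq (w.1 𝟎) (mulOp hA (𝒢 w + 𝒞 (unitTop γ j)) : Lp (Top d n m) 2 (cellM d))

theorem coeFn_total {v w} (h : ∀ α, w.1 α =ᵐ[cellM d] v α) (γ j) :
    (perTop d n m w + constTop d n m (unitTop γ j) : Lp (Top d n m) 2 (cellM d))
      =ᵐ[cellM d] totalTop γ j v := by
  have h' : ∀ᵐ p ∂(cellM d), ∀ α, w.1 α p = v α p := ae_all_iff.2 h
  filter_upwards [h', coeFn_topPart w.1, coeFn_constTop (unitTop γ j),
    Lp.coeFn_add (𝒢 w) (𝒞 (unitTop γ j))] with p h1 h2 h3 h4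
  rw [h4, Pi.add_apply, h3]
  unfold totalTop
  congr 1
  ext a
  rw [topFun_apply, ← h1, ← h2 a]
  rfl

theorem coeFn_mulOp_total (hA : IsBddCoeff A M (cellM d)) {v w} (h : ∀ α, w.1 α =ᵐ[cellM d] v α)
    (γ j) : mulOp hA (𝒢 w + 𝒞 (unitTop γ j)) =ᵐ[cellM d] flux A (totalTop γ j v) := by
  filter_upwards [coeFn_mulOp hA (𝒢 w + 𝒞 (unitTop γ j)), coeFn_total h γ j] with p h1 h2
  rw [h1]
  ext a
  simp only [flux, h2]

theorem exists_isCellCorrector (hA : IsBddCoeff A M (cellM d)) {μ} (hμ : 0 < μ)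
    (hl : LowerBound A μ (cellM d)) (γ j) : ∃ w, IsCellCorrector hA γ j w := by
  obtain ⟨w, hw⟩ := exists_cellSolution hA hμ hl (mulOp hA (𝒞 (unitTop γ j)))
  refine ⟨w, ?_⟩
  rw [← map_add] at hw
  exact hw

theorem isCorrector_extend (hm : 0 < m) (hA : IsBddCoeff A M volume)
    (hAp : ∀ α β i j, IsPeriodic (A α β i j)) {w : MIdx d m → Fin n → perJets d n m}
    (hw : ∀ γ j, IsCellCorrector hA.restrict γ j (w γ j)) :
    IsCorrector A fun γ j => extend (w γ j).1 where
  jet γ j := isPeriodicJet_extend (w γ j)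
  mean γ j := by
    have hmem := (isPeriodicJet_extend (w γ j)).memLp 𝟎
    ext i
    have h0 := (w γ j).2.2 0 i rfl
    rw [← hat_coord_congr (extend_ae_eq (w γ j).1 𝟎), hat_at_zero] at h0
    have h2 := Complex.ofReal_eq_zero.1 h0
    have h3 := (proj (𝕜 := ℝ) i : Euc n →L[ℝ] ℝ).integral_comp_comm (hmem.integrable (by norm_num))
    exact h3.symm.trans h2
  equation γ j φ hφ := by
    obtain ⟨S, hS⟩ := exists_cellSupp_tsupport hφ.compact
    have hj := isPeriodicJet_extend (w γ j)
    rw [equation_iff hA hAp hj γ j hφ hS]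
    have hae : ∀ α, (w γ j).1 α =ᵐ[cellM d] extend (w γ j).1 α := fun α =>
      (extend_ae_eq (w γ j).1 α).symm
    have hC : CoeffEq (extend (w γ j).1 𝟎) (flux A (totalTop γ j (extend (w γ j).1))) :=
      (hw γ j).congr (hae _) (coeFn_mulOp_total hA.restrict hae γ j)
    refine hC.test hm (hj.memLp _) (memLp_flux hA.restrict (memLp_totalTop γ j hj.memLp))
      (fun k i hk => ?_) (fun i => memLp_per (hφ.timeD.memLp_apply i))
      (fun α i => memLp_per ((hφ.spaceD α.1).memLp_apply i))
      (b := fun i k => ∫ p, φ p i • ex k p)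
      (fun i k => hat_per_timeD hφ hS i k) (fun α i k => hat_per_spaceD hφ hS α.1 i k)
    rw [← hat_coord_congr (hae 𝟎), (w γ j).2.2 k i hk]

/-- A corrector restricted to the cell. -/
theorem IsCorrector.exists_perJets (hm : 0 < m) (hA : IsBddCoeff A M volume)
    (hAp : ∀ α β i j, IsPeriodic (A α β i j)) {X} (hX : IsCorrector A X) (γ j) :
    ∃ w : perJets d n m, (∀ α, w.1 α =ᵐ[cellM d] X γ j α) ∧ IsCellCorrector hA.restrict γ j w := by
  have hj := hX.jet γ j
  have hfl : MemLp (flux A (totalTop γ j (X γ j))) 2 (cellM d) :=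
    memLp_flux hA.restrict (memLp_totalTop γ j hj.memLp)
  have key : ∀ k i, I * (2 * π * k.2 : ℝ) * hat (fun p => X γ j 𝟎 p i) k
      = ∑ α : MIdx d m, symK k α.1 * hat (fun p => flux A (totalTop γ j (X γ j)) p (α, i)) k := by
    intro k i
    refine coeffEq_of_exWave (hj.memLp _) hfl (fun c => ?_) i
    obtain ⟨φ, S, hφ, hS, h1, h2⟩ := exists_cutWave (d := d) k c
    have h3 := (equation_iff hA hAp hj γ j hφ hS).1 (hX.equation γ j φ hφ)
    refine Eq.trans (congrArg₂ (fun a b => -a + b) ?_ ?_) h3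
    · refine sum_congr rfl fun i _ => integral_congr_ae ?_
      filter_upwards [h2 i] with p hp
      rw [hp]
    · refine sum_congr rfl fun α _ => sum_congr rfl fun i _ => integral_congr_ae ?_
      filter_upwards [h1 α.1 i] with p hp
      rw [hp]
  let w : Jets d n m (cellM d) := WithLp.toLp 2 fun α => (hj.memLp α).toLp _
  have hw : ∀ α, w α =ᵐ[cellM d] X γ j α := fun α => (hj.memLp α).coeFn_toLp
  have hh := fun α => hat_coord_congr (hw α)
  have hmem : w ∈ perJets d n m := by
    refine ⟨fun α i k => ?_, fun k i hk => ?_⟩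
    · rw [hh, hh]; exact hj.hat_eq α i k
    · rw [hh]
      by_cases hk2 : k.2 = 0
      · have hk0 : k = 0 := Prod.ext hk hk2
        have h3 := ContinuousLinearMap.integral_comp_comm
          (proj (𝕜 := ℝ) i : Euc n →L[ℝ] ℝ) ((hj.memLp 𝟎).integrable (by norm_num))
        have h4 : ∫ p in cell d, X γ j 𝟎 p i = 0 := by
          refine h3.trans ?_
          have h5 := hX.mean γ j
          rw [h5, map_zero]
        rw [hk0, hat_at_zero, h4, Complex.ofReal_zero]
      · have h1 := key k i
        have : ∀ α : MIdx d m, symK k α.1 = 0 := fun α => symK_eq_zero hk (by rw [α.2]; exact hm)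
        simp only [this, zero_mul, Finset.sum_const_zero] at h1
        refine (mul_eq_zero.1 h1).resolve_left ?_
        have : (2 * π * k.2 : ℝ) ≠ 0 := by
          have := Real.pi_ne_zero
          have : (k.2 : ℝ) ≠ 0 := by exact_mod_cast hk2
          positivity
        exact mul_ne_zero Complex.I_ne_zero (by exact_mod_cast this)
  refine ⟨⟨w, hmem⟩, hw, ?_⟩
  have hC : CoeffEq (X γ j 𝟎) (flux A (totalTop γ j (X γ j))) := fun k _ i => key k i
  exact hC.congr (hw _).symm (coeFn_mulOp_total (w := ⟨w, hmem⟩) hA.restrict hw γ j).symm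

/-- The pairs `(w, g)` that satisfy the Fourier form of the equation. -/
def coeffPairs (d n m : ℕ) :
    Submodule ℝ (Lp (Euc n) 2 (cellM d) × Lp (Top d n m) 2 (cellM d)) where
  carrier := {q | CoeffEq q.1 q.2}
  zero_mem' k hk i := by
    simp only [← hatL_apply, Prod.fst_zero, Prod.snd_zero, map_zero, mul_zero,
      Finset.sum_const_zero]
  add_mem' h h' k hk i := by
    simp only [← hatL_apply, Prod.fst_add, Prod.snd_add, map_add, mul_add, sum_add_distrib]
    exact congrArg₂ _ (h k hk i) (h' k hk i)
  smul_mem' c q h k hk i := by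
    simp only [← hatL_apply, Prod.smul_fst, Prod.smul_snd, map_smul, real_smul,
      mul_left_comm _ (c : ℂ), ← mul_sum]
    exact congrArg _ (h k hk i)

theorem IsCellCorrector.unique {hA : IsBddCoeff A M (cellM d)} {μ} (hμ : 0 < μ)
    (hl : LowerBound A μ (cellM d)) {γ j w w'} (hw : IsCellCorrector hA γ j w)
    (hw' : IsCellCorrector hA γ j w') : w = w' := by
  rw [← sub_eq_zero]
  refine eq_zero_of_coeffEq hA hμ hl (w - w') ?_
  have h := (coeffPairs d n m).sub_mem (x := (_, _)) (y := (_, _)) hw hw'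
  rw [Prod.mk_sub_mk, ← map_sub, add_sub_add_right_eq_sub, ← map_sub] at h
  exact h

theorem IsCorrector.unique (hm : 0 < m) (hA : IsBddCoeff A M volume) {μ} (hμ : 0 < μ)
    (hl : LowerBound A μ (cellM d)) (hAp : ∀ α β i j, IsPeriodic (A α β i j)) {X X'}
    (hX : IsCorrector A X) (hX' : IsCorrector A X') (γ j α) : X γ j α =ᵐ[volume] X' γ j α := by
  obtain ⟨w, h1, h2⟩ := hX.exists_perJets hm hA hAp γ j
  obtain ⟨w', h1', h2'⟩ := hX'.exists_perJets hm hA hAp γ j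
  obtain rfl := h2.unique hμ hl h2'
  exact ae_eq_of_ae_eq_cell ((hX.jet γ j).periodic α) ((hX'.jet γ j).periodic α)
    ((h1 α).symm.trans (h1' α))

theorem exists_isCorrector (hm : 0 < m) (hA : IsBddCoeff A M volume) {μ} (hμ : 0 < μ)
    (hl : LowerBound A μ (cellM d)) (hAp : ∀ α β i j, IsPeriodic (A α β i j)) :
    ∃ X, IsCorrector A X := by
  choose w hw using exists_isCellCorrector hA.restrict hμ hl
  exact ⟨_, isCorrector_extend hm hA hAp hw⟩

/-! ### The homogenized coefficients -/

theorem inner_constTop (f ξ) : inner ℝ f (constTop d n m ξ) = ∑ a, ξ a * ∫ p in cell d, f p a := by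
  rw [inner_lp_eq_sum f (g' := fun _ a => ξ a) (by
    filter_upwards [coeFn_constTop ξ] with p hp a
    rw [hp])]
  exact sum_congr rfl fun a _ => by rw [integral_mul_const, mul_comm]

theorem inner_constTop_unitTop (f α i) :
    inner ℝ f (constTop d n m (unitTop α i)) = ∫ p in cell d, f p (α, i) := by
  rw [inner_constTop, sum_eq_single (α, i)]
  · simp [unitTop_apply]
  · intro a _ ha; simp [unitTop_apply, ha]
  · simp

theorem norm_constTop (ξ) : ‖constTop d n m ξ‖ = ‖ξ‖ := by
  have := Lp.norm_const (p := 2) (μ := cellM d) (c := ξ) (by norm_num)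
  refine this.trans ?_
  simp

theorem inner_perTop_constTop (w ξ) : inner ℝ (perTop d n m w) (constTop d n m ξ) = 0 := by
  rw [inner_constTop]
  refine sum_eq_zero fun a _ => ?_
  have h1 := w.2.1 a.1.low a.2 0
  rw [w.2.2 0 a.2 rfl, mul_zero] at h1
  have h2 : (fun p => w.1 a.1.low p a.2) =ᵐ[cellM d] fun p => 𝒢 w p a :=
    (coeFn_topPart w.1).mono fun p hp => (hp a).symm
  rw [hat_congr_ae h2, hat_at_zero, Complex.ofReal_eq_zero] at h1
  rw [h1, mul_zero]

/-- The total gradient of the corrector in `L²`. -/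
def totalL (w : MIdx d m → Fin n → perJets d n m) (γ : MIdx d m) (j : Fin n) :
    Lp (Top d n m) 2 (cellM d) := 𝒢 (w γ j) + 𝒞 (unitTop γ j)

theorem homogenized_eq (hA : IsBddCoeff A M (cellM d)) {X w}
    (hw : ∀ γ j α, (w γ j).1 α =ᵐ[cellM d] X γ j α) (α β i j p) : homogenized A X α β i j p
      = inner ℝ (mulOp hA (totalL w β j)) (constTop d n m (unitTop α i)) := by
  rw [inner_constTop_unitTop]
  refine integral_congr_ae ?_
  filter_upwards [coeFn_mulOp_total hA (hw β j) β j] with p hp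
  unfold totalL
  rw [hp, flux_totalTop, add_comm]

/-- The combination `∑ ξ_β^j (e_{βj} + D^m χ_j^β)`, and its energy identity. -/
theorem energy_total {hA : IsBddCoeff A M (cellM d)} {w}
    (hw : ∀ γ j, IsCellCorrector hA γ j (w γ j)) (ξ : Top d n m) :
    ∃ P : Lp (Top d n m) 2 (cellM d), P = ∑ a, ξ a • totalL w a.1 a.2 ∧
      inner ℝ (mulOp hA P) (constTop d n m ξ) = inner ℝ (mulOp hA P) P ∧ ‖ξ‖ ≤ ‖P‖ := by
  set v : perJets d n m := ∑ a, ξ a • w a.1 a.2 with hv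
  have hP : ∑ a, ξ a • totalL w a.1 a.2 = 𝒢 v + 𝒞 ξ := by
    conv_rhs => rw [← sum_smul_unitTop ξ]
    simp only [totalL, smul_add, sum_add_distrib, hv, map_sum, map_smul]
  have hmem : ((perVal d n m v, mulOp hA (∑ a, ξ a • totalL w a.1 a.2)) :
      Lp (Euc n) 2 (cellM d) × Lp (Top d n m) 2 (cellM d)) ∈ coeffPairs d n m := by
    have h1 := (coeffPairs d n m).sum_mem (t := Finset.univ)
      (f := fun a => ξ a • (perVal d n m (w a.1 a.2), mulOp hA (totalL w a.1 a.2)))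
      fun a _ => (coeffPairs d n m).smul_mem _ (hw a.1 a.2)
    convert h1 using 1
    refine Prod.ext ?_ ?_
    · simp only [hv, map_sum, map_smul, Prod.fst_sum, Prod.smul_fst]
    · simp only [map_sum, map_smul, Prod.snd_sum, Prod.smul_snd]
  have h0 : inner ℝ (mulOp hA (∑ a, ξ a • totalL w a.1 a.2)) (𝒢 v) = 0 :=
    inner_perTop_eq_zero v _ hmem
  refine ⟨_, rfl, ?_, ?_⟩
  · conv_rhs => rw [hP, inner_add_right, ← hP, h0, zero_add]
  · rw [hP]
    have h1 := norm_add_sq_real (𝒢 v) (𝒞 ξ)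
    rw [inner_perTop_constTop, mul_zero, add_zero, norm_constTop] at h1
    exact abs_le_of_sq_le_sq' (by nlinarith [sq_nonneg ‖𝒢 v‖]) (norm_nonneg _) |>.2

theorem norm_totalL_le {hA : IsBddCoeff A M (cellM d)} {μ} (hμ : 0 < μ)
    (hl : LowerBound A μ (cellM d)) {w} (hw : ∀ γ j, IsCellCorrector hA γ j (w γ j)) (γ j) :
    ‖totalL w γ j‖ ≤ fluxConst d n m M / μ := by
  obtain ⟨P, hP, h1, -⟩ := energy_total hw (unitTop γ j)
  have hP' : P = totalL w γ j := by
    rw [hP, sum_eq_single (γ, j)]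
    · simp [unitTop_apply]
    · intro a _ ha; simp [unitTop_apply, ha]
    · simp
  subst hP'
  have h2 := inner_mulOp_self_ge hA hl (totalL w γ j)
  rw [← h1] at h2
  have h3 := (real_inner_le_norm (mulOp hA (totalL w γ j)) (constTop d n m (unitTop γ j))).trans
    (mul_le_mul_of_nonneg_right (norm_mulOp_le hA _) (norm_nonneg _))
  rw [norm_constTop, norm_unitTop, mul_one] at h3
  have hF := fluxConst_nonneg d n m M
  rw [le_div_iff₀ hμ]
  by_contra! hlt
  have hpos : 0 < ‖totalL w γ j‖ := by
    by_contra! h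
    have : ‖totalL w γ j‖ = 0 := le_antisymm h (norm_nonneg _)
    rw [this, zero_mul] at hlt
    linarith
  nlinarith

theorem isElliptic_homogenized (hm : 0 < m) (hA : IsBddCoeff A M volume) {μ} (hμ : 0 < μ)
    (hl : LowerBound A μ (cellM d)) (hAp : ∀ α β i j, IsPeriodic (A α β i j)) {X}
    (hX : IsCorrector A X) : IsElliptic (homogenized A X) μ (fluxConst d n m M ^ 2 / μ) := by
  choose w hw1 hw2 using hX.exists_perJets hm hA hAp
  have hh := homogenized_eq hA.restrict hw1
  refine ⟨fun α β i j => aestronglyMeasurable_const, ae_of_all _ fun p ξ => ?_,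
    ae_of_all _ fun p α β i j => ?_⟩
  · let ξ' : Top d n m := WithLp.toLp 2 fun a => ξ a.1 a.2
    obtain ⟨P, hP, h1, h2⟩ := energy_total hw2 ξ'
    have h3 : ∑ α, ∑ β, ∑ i, ∑ j, homogenized A X α β i j p * ξ α i * ξ β j
        = inner ℝ (mulOp hA.restrict P) (constTop d n m ξ') := by
      rw [← sum_smul_unitTop ξ', hP]
      simp only [map_sum, map_smul, inner_sum, sum_inner, inner_smul_right, inner_smul_left,
        sum_prod_type, ← hh _ _ _ _ p]
      refine sum_congr rfl fun α _ => ?_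
      rw [sum_comm]
      refine sum_congr rfl fun i _ => ?_
      simp only [mul_sum]
      refine sum_congr rfl fun β _ => sum_congr rfl fun j _ => ?_
      simp only [ξ', conj_trivial]
      ring
    have h4 : ∑ α, ‖ξ α‖ ^ 2 = ‖ξ'‖ ^ 2 := by
      rw [EuclideanSpace.norm_sq_eq, sum_prod_type]
      simp only [EuclideanSpace.norm_sq_eq, ξ']
    rw [h3, h1, h4]
    refine le_trans ?_ (inner_mulOp_self_ge hA.restrict hl P)
    gcongr
  · rw [hh α β i j p]
    refine (abs_real_inner_le_norm _ _).trans ?_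
    rw [norm_constTop, norm_unitTop, mul_one]
    refine (norm_mulOp_le _ _).trans ?_
    rw [pow_two, mul_div_assoc]
    exact mul_le_mul_of_nonneg_left (norm_totalL_le hμ hl hw2 β j) (fluxConst_nonneg d n m M)

/-- The corrector equation tested with a smooth periodic function. -/
theorem IsCellCorrector.inner_test (hm : 0 < m) {hA : IsBddCoeff A M (cellM d)} {γ j w}
    (hw : IsCellCorrector hA γ j w) (ψ) : inner ℝ (mulOp hA (𝒞 (unitTop γ j))) (𝒢 (cellJet d n m ψ))
      = -inner ℝ w (cellOp hA ψ) := by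
  have h1 := CoeffEq.test hm (Lp.memLp _) (Lp.memLp _) hw w.2.2
    (τ := fun i p => timeD ψ.1 p i) (f := fun α i p => spaceD α.1 ψ.1 p i)
    (b := fun i k => hat (fun p => ψ.1 p i) k)
    (fun i => memLp_coord (IsCellTest.memLp_time ψ.2) i)
    (fun α i => memLp_coord (IsCellTest.memLp_space ψ.2 α.1) i)
    (fun i k => IsCellTest.hat_time ψ.2 i k) (fun α i k => IsCellTest.hat_space ψ.2 α.1 i k)
  have h2 : -inner ℝ (perVal d n m w) (cellTime d n ψ) + inner ℝ (mulOp hA (𝒢 w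
      + 𝒞 (unitTop γ j))) (𝒢 (cellJet d n m ψ)) = 0 := by
    rw [inner_cellTime, inner_perTop_cellJet]
    exact h1
  rw [map_add, inner_add_left] at h2
  rw [inner_cellOp]
  linarith

/-- The averages of `(A^* (e_{α i} + D^m ψ))_{β j}` for approximate solutions `ψ` of the adjoint
cell problem. -/
theorem exists_adjoint_corrector (hm : 0 < m) (hA : IsBddCoeff A M volume) {μ} (hμ : 0 < μ)
    (hl : LowerBound A μ (cellM d)) (hAp : ∀ α β i j, IsPeriodic (A α β i j)) {X}
    (hX : IsCorrector A X) (α i) {δ} (hδ : 0 < δ) : ∃ ψ,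
      (∀ w, |-inner ℝ (perVal d n m w) (cellTime d n ψ) + inner ℝ (mulOp hA.restrict (𝒢 w))
            (𝒢 (cellJet d n m ψ) + 𝒞 (unitTop α i))| ≤ δ * ‖w‖) ∧
      ∀ β j p, |inner ℝ (mulOp hA.restrict (𝒞 (unitTop β j)))
          (𝒢 (cellJet d n m ψ) + 𝒞 (unitTop α i))
        - homogenized A X α β i j p| ≤ δ := by
  choose w hw1 hw2 using hX.exists_perJets hm hA hAp
  have hA' := hA.restrict
  let v : perJets d n m := -(adjoint ((mulOp hA').comp (perTop d n m)) (𝒞 (unitTop α i)))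
  have hv : ∀ u, inner ℝ u v = -inner ℝ (mulOp hA' (𝒢 u)) (𝒞 (unitTop α i)) := by
    intro u
    rw [inner_neg_right, ContinuousLinearMap.adjoint_inner_right]
    rfl
  obtain ⟨C, hC0, hC⟩ : ∃ C, 0 ≤ C ∧ ∀ β j, ‖w β j‖ ≤ C := by
    refine ⟨∑ β, ∑ j, ‖w β j‖, by positivity, fun β j => ?_⟩
    refine le_trans ?_ (single_le_sum (f := fun β => ∑ j, ‖w β j‖)
      (fun _ _ => by positivity) (Finset.mem_univ β))
    exact single_le_sum (f := fun j => ‖w β j‖) (fun _ _ => norm_nonneg _) (Finset.mem_univ j)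
  obtain ⟨ψ, hψ⟩ := exists_cellOp_near hA' hμ hl v (δ := δ / (C + 1)) (by positivity)
  have hδ' : δ / (C + 1) ≤ δ := div_le_self hδ.le (by linarith)
  have key : ∀ u, |inner ℝ u (cellOp hA' ψ - v)| ≤ ‖u‖ * (δ / (C + 1)) := fun u =>
    (abs_real_inner_le_norm _ _).trans (by gcongr)
  refine ⟨ψ, fun u => ?_, fun β j p => ?_⟩
  · have h1 := key u
    rw [inner_sub_right, hv, inner_cellOp, sub_neg_eq_add, add_assoc, ← inner_add_right] at h1
    refine h1.trans ?_
    rw [mul_comm]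
    gcongr
  · rw [homogenized_eq hA' hw1, totalL, map_add, inner_add_left, inner_add_right,
      (hw2 β j).inner_test hm]
    have h1 := key (w β j)
    rw [inner_sub_right, hv] at h1
    refine le_trans (le_of_eq ?_) (h1.trans ?_)
    · rw [← abs_neg]
      congr 1
      ring
    · calc ‖w β j‖ * (δ / (C + 1)) ≤ (C + 1) * (δ / (C + 1)) := by
            gcongr
            linarith [hC β j]
        _ = δ := by field_simp

end correctors

/-! ### Dilations and the weak limit of oscillating functions -/

/-- The dilation `(x, t) ↦ (a x, b t)`. -/
def dil {d : ℕ} (a b : ℝ) (p : Pt d) : Pt d := (a • p.1, b * p.2)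

section dilation

variable {d : ℕ} {a b : ℝ}

theorem dil_dil_inv (ha : a ≠ 0) (hb : b ≠ 0) (p : Pt d) : dil a b (dil a⁻¹ b⁻¹ p) = p := by
  refine Prod.ext ?_ ?_
  · simp [dil, smul_smul, mul_inv_cancel₀ ha]
  · simp [dil, mul_inv_cancel_left₀ hb]

theorem dil_inv_dil (ha : a ≠ 0) (hb : b ≠ 0) (p : Pt d) : dil a⁻¹ b⁻¹ (dil a b p) = p := by
  have := dil_dil_inv (inv_ne_zero ha) (inv_ne_zero hb) p
  rwa [inv_inv, inv_inv] at this

theorem continuous_dil (a b) : Continuous (dil a b : Pt d → Pt d) := by unfold dil; fun_prop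

/-- The dilation as a homeomorphism. -/
def dilHomeo (d : ℕ) (ha : a ≠ 0) (hb : b ≠ 0) : Pt d ≃ₜ Pt d where
  toFun := dil a b
  invFun := dil a⁻¹ b⁻¹
  left_inv := dil_inv_dil ha hb
  right_inv := dil_dil_inv ha hb
  continuous_toFun := continuous_dil a b
  continuous_invFun := continuous_dil _ _

theorem map_dil (ha : 0 < a) (hb : 0 < b) :
    Measure.map (dil a b) (volume : Measure (Pt d)) = ENNReal.ofReal (a ^ d * b)⁻¹ • volume := by
  let L : Pt d →ₗ[ℝ] Pt d := LinearMap.prodMap (a • LinearMap.id) (b • LinearMap.id)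
  have hdet : LinearMap.det L = a ^ d * b := by
    rw [LinearMap.det_prodMap, LinearMap.det_smul, LinearMap.det_smul]
    simp
  have hL : (L : Pt d → Pt d) = dil a b := by funext p; simp [L, dil]
  have := Measure.map_linearMap_addHaar_eq_smul_addHaar (μ := (volume : Measure (Pt d)))
    (f := L) (by rw [hdet]; positivity)
  rw [hdet, hL, abs_of_pos (by positivity)] at this
  exact this

theorem integral_dil {E : Type*} [NormedAddCommGroup E] [NormedSpace ℝ E] (ha : 0 < a) (hb : 0 < b)
    (f : Pt d → E) : ∫ p, f (dil a b p) = (a ^ d * b)⁻¹ • ∫ p, f p := by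
  have h := (dilHomeo d ha.ne' hb.ne').measurableEmbedding.integral_map
    (μ := (volume : Measure (Pt d))) f
  change ∫ y, f y ∂(Measure.map (dil a b) volume) = ∫ x, f (dil a b x) at h
  rw [← h, map_dil ha hb, integral_smul_measure, ENNReal.toReal_ofReal (by positivity)]

theorem memLp_dil {E : Type*} [NormedAddCommGroup E] (ha : 0 < a) (hb : 0 < b)
    {f : Pt d → E} (hf : MemLp f 2) : MemLp (fun p => f (dil a b p)) 2 := by
  have h := (dilHomeo d ha.ne' hb.ne').measurableEmbedding.memLp_map_measure_iff
    (μ := (volume : Measure (Pt d))) (g := f) (p := 2)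
  refine h.1 ?_
  change MemLp f 2 (Measure.map (dil a b) volume)
  rw [map_dil ha hb]
  exact hf.smul_measure ENNReal.ofReal_ne_top

theorem quasiMeasurePreserving_dil (ha : 0 < a) (hb : 0 < b) :
    Measure.QuasiMeasurePreserving (dil a b : Pt d → Pt d) volume volume := by
  refine ⟨(continuous_dil a b).measurable, ?_⟩
  rw [map_dil ha hb]
  exact Measure.smul_absolutelyContinuous

/-- `f` vanishes outside the box `|x_i|, |t| ≤ R`. -/
def BoxSupp {E : Type*} [Zero E] (R : ℝ) (f : Pt d → E) : Prop :=
  ∀ p, f p ≠ 0 → (∀ i, |p.1 i| ≤ R) ∧ |p.2| ≤ R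

/-- The lattice points needed to periodize `g ∘ dil a b`. -/
def dilBox (d : ℕ) (R a b : ℝ) : Finset (Freq d) := freqBox d ⌈R / a⌉₊ ⌈R / b⌉₊

theorem cellSupp_dil {E : Type*} [Zero E] {R} {g : Pt d → E} (hg : BoxSupp R g)
    (ha : 0 < a) (hb : 0 < b) : CellSupp (dilBox d R a b) (fun p => g (dil a b p)) := by
  refine cellSupp_freqBox fun p hp => ?_
  obtain ⟨h1, h2⟩ := hg _ hp
  refine ⟨fun i => le_trans ?_ (Nat.le_ceil _), le_trans ?_ (Nat.le_ceil _)⟩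
  · have := h1 i
    rw [show (dil a b p).1 i = a * p.1 i from rfl, abs_mul, abs_of_pos ha] at this
    rw [le_div_iff₀ ha]; linarith
  · rw [show (dil a b p).2 = b * p.2 from rfl, abs_mul, abs_of_pos hb] at h2
    rw [le_div_iff₀ hb]; linarith

theorem card_dilBox {R} (hR : 0 ≤ R) (ha : 0 < a) (hb : 0 < b) (ha1 : a ≤ 1) (hb1 : b ≤ 1) :
    a ^ d * b * (dilBox d R a b).card ≤ (2 * R + 3) ^ d * (2 * R + 3) := by
  have key : ∀ c, 0 < c → c ≤ 1 → c * (2 * (⌈R / c⌉₊ : ℝ) + 1) ≤ 2 * R + 3 := by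
    intro c hc hc1
    have h := (Nat.ceil_lt_add_one (div_nonneg hR hc.le)).le
    have h2 : c * (R / c) = R := by field_simp
    nlinarith
  rw [dilBox, card_freqBox]
  push_cast
  calc a ^ d * b * ((2 * (⌈R / a⌉₊ : ℝ) + 1) ^ d * (2 * (⌈R / b⌉₊ : ℝ) + 1))
      = (a * (2 * (⌈R / a⌉₊ : ℝ) + 1)) ^ d * (b * (2 * (⌈R / b⌉₊ : ℝ) + 1)) := by rw [mul_pow]; ring
    _ ≤ _ := by gcongr <;> apply key <;> assumption

/-- The rescaled periodization of `g`. -/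
def perDil (R a b : ℝ) (g : Pt d → ℝ) (p : Pt d) : ℝ :=
  a ^ d * b * per (dilBox d R a b) (fun q => g (dil a b q)) p

theorem memLp_perDil {R g} (hg : MemLp g 2) (ha : 0 < a) (hb : 0 < b) :
    MemLp (perDil R a b g) 2 (cellM d) :=
  (memLp_per (memLp_dil ha hb hg)).const_mul _

theorem integral_perDil {E : Type*} [NormedAddCommGroup E] [NormedSpace ℝ E] {R g} (hg : MemLp g 2)
    (hs : BoxSupp R g) (ha : 0 < a) (hb : 0 < b) {F : Pt d → E} (hF : AEStronglyMeasurable F volume)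
    (hF2 : MemLp F 2 (cellM d)) (hper : IsPeriodic F) :
    Integrable (fun p => g p • F (dil a⁻¹ b⁻¹ p)) ∧
    ∫ p, g p • F (dil a⁻¹ b⁻¹ p) = ∫ p in cell d, perDil R a b g p • F p := by
  obtain ⟨h1, h2⟩ := integral_smul_periodic (memLp_dil ha hb hg) (cellSupp_dil hs ha hb) hF hF2 hper
  constructor
  · have h := (dilHomeo d (inv_ne_zero ha.ne') (inv_ne_zero hb.ne')).measurableEmbedding
      |>.integrable_map_iff (μ := (volume : Measure (Pt d)))
        (g := fun p => g (dil a b p) • F p)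
    change Integrable _ (Measure.map (dil a⁻¹ b⁻¹) volume)
      ↔ Integrable (fun p => g (dil a b (dil a⁻¹ b⁻¹ p)) • F (dil a⁻¹ b⁻¹ p)) volume at h
    simp only [dil_dil_inv ha.ne' hb.ne'] at h
    refine h.1 ?_
    rw [map_dil (inv_pos.2 ha) (inv_pos.2 hb)]
    exact h1.smul_measure ENNReal.ofReal_ne_top
  · have h := integral_dil ha hb (fun p => g p • F (dil a⁻¹ b⁻¹ p))
    simp only [dil_inv_dil ha.ne' hb.ne'] at h
    rw [h2] at h
    simp only [perDil, mul_smul _ _ (F _)]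
    rw [integral_smul, h, smul_smul, mul_inv_cancel₀ (by positivity), one_smul]

theorem hat_perDil {R g} (hg : MemLp g 2) (hs : BoxSupp R g) (ha : 0 < a) (hb : 0 < b)
    (k : Freq d) : hat (perDil R a b g) k = ∫ p, g p • ex k (dil a⁻¹ b⁻¹ p) :=
  (integral_perDil hg hs ha hb (continuous_ex k).aestronglyMeasurable (memLp_ex k)
    (isPeriodic_ex k)).2.symm

theorem integral_perDil_sq_le {R} (hR : 0 ≤ R) {g} (hg : MemLp g 2)
    (hs : BoxSupp R g) (ha : 0 < a) (hb : 0 < b) (ha1 : a ≤ 1) (hb1 : b ≤ 1) :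
    ∫ p in cell d, perDil R a b g p ^ 2 ≤ (2 * R + 3) ^ d * (2 * R + 3) * ∫ p, g p ^ 2 := by
  have h1 := integral_per_sq_le (memLp_dil ha hb hg) (cellSupp_dil hs ha hb)
  have h2 := integral_dil ha hb fun p => g p ^ 2
  rw [h2, smul_eq_mul] at h1
  have hJ : 0 < a ^ d * b := by positivity
  have h3 : 0 ≤ ∫ p, g p ^ 2 := integral_nonneg fun p => sq_nonneg _
  simp only [perDil, mul_pow (a ^ d * b)]
  rw [integral_const_mul]
  calc (a ^ d * b) ^ 2 * ∫ p in cell d, per (dilBox d R a b) (fun q => g (dil a b q)) p ^ 2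
      ≤ (a ^ d * b) ^ 2 * ((dilBox d R a b).card * ((a ^ d * b)⁻¹ * ∫ p, g p ^ 2)) := by gcongr
    _ = (a ^ d * b * (dilBox d R a b).card) * ∫ p, g p ^ 2 := by field_simp
    _ ≤ _ := mul_le_mul_of_nonneg_right (card_dilBox hR ha hb ha1 hb1) h3

/-- **Riemann–Lebesgue** for the oscillating exponentials. -/
theorem tendsto_integral_smul_ex {m} (hm : 0 < m) {g : Pt d → ℝ} {k}
    (hk : k ≠ 0) : Tendsto (fun ε : ℝ => ∫ p, g p • ex k (dil ε⁻¹ (ε ^ (2 * m))⁻¹ p))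
      (𝓝[>] 0) (𝓝 0) := by
  let w : ℝ → StrongDual ℝ (Pt d) := fun ε =>
    -(∑ j, ((k.1 j : ℝ) * ε⁻¹) • ((proj j : Euc d →L[ℝ] ℝ).comp
        (ContinuousLinearMap.fst ℝ (Euc d) ℝ))
      + ((k.2 : ℝ) * (ε ^ (2 * m))⁻¹) • ContinuousLinearMap.snd ℝ (Euc d) ℝ)
  have hw : ∀ ε p, w ε p = -(∑ j, k.1 j * (dil ε⁻¹ (ε ^ (2 * m))⁻¹ p).1 j
      + k.2 * (dil ε⁻¹ (ε ^ (2 * m))⁻¹ p).2) := by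
    intro ε p
    simp [w, dil, mul_assoc]
  have h1 : Tendsto w (𝓝[>] 0) (cocompact _) := by
    rw [← Metric.cobounded_eq_cocompact, ← tendsto_norm_atTop_iff_cobounded]
    have h2 : Tendsto (fun ε : ℝ => ε⁻¹) (𝓝[>] 0) atTop := tendsto_inv_nhdsGT_zero
    refine tendsto_atTop_mono' _ ?_ h2
    have : ∀ᶠ ε : ℝ in 𝓝[>] 0, ε ∈ Ioo (0 : ℝ) 1 := Ioo_mem_nhdsGT one_pos
    filter_upwards [this] with ε hε
    have hi : 0 < ε⁻¹ := inv_pos.2 hε.1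
    have hle : ε⁻¹ ≤ (ε ^ (2 * m))⁻¹ := by
      have : ε ^ (2 * m) ≤ ε := pow_le_of_le_one hε.1.le hε.2.le (by omega)
      exact inv_anti₀ (pow_pos hε.1 _) this
    have hitg : ∀ z : ℤ, z ≠ 0 → (1 : ℝ) ≤ |(z : ℝ)| := fun z hz => by
      exact_mod_cast Int.one_le_abs hz
    by_cases hk1 : k.1 = 0
    · have hk2 : k.2 ≠ 0 := fun h => hk (Prod.ext hk1 h)
      have h3 := (w ε).le_opNorm (0, 1)
      rw [hw] at h3
      have h4 : ‖((0 : Euc d), (1 : ℝ))‖ = 1 := by simp [Prod.norm_def]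
      rw [h4, mul_one] at h3
      refine le_trans ?_ h3
      simp only [dil, hk1, smul_zero, Pi.zero_apply, Int.cast_zero, zero_mul,
        Finset.sum_const_zero, mul_one, zero_add, norm_neg, norm_mul, Real.norm_eq_abs]
      rw [abs_of_pos (hi.trans_le hle)]
      calc ε⁻¹ ≤ 1 * (ε ^ (2 * m))⁻¹ := by rw [one_mul]; exact hle
        _ ≤ _ := mul_le_mul_of_nonneg_right (hitg _ hk2) (hi.le.trans hle)
    · obtain ⟨j, hj⟩ := Function.ne_iff.1 hk1
      have h3 := (w ε).le_opNorm (single j 1, 0)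
      rw [hw] at h3
      have h4 : ‖((single j 1 : Euc d), (0 : ℝ))‖ = 1 := by simp [Prod.norm_def]
      rw [h4, mul_one] at h3
      refine le_trans ?_ h3
      have h5 : ∑ i, (k.1 i : ℝ) * (dil ε⁻¹ (ε ^ (2 * m))⁻¹
          ((single j 1 : Euc d), (0 : ℝ))).1 i = k.1 j * ε⁻¹ := by
        rw [sum_eq_single j]
        · simp [dil]
        · intro i _ hi; simp [dil, hi]
        · simp
      rw [h5]
      simp only [dil, mul_zero, add_zero, norm_neg, norm_mul, Real.norm_eq_abs]
      rw [abs_of_pos hi]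
      calc ε⁻¹ = 1 * ε⁻¹ := by rw [one_mul]
        _ ≤ _ := mul_le_mul_of_nonneg_right (hitg _ hj) hi.le
  have h2 := (tendsto_integral_exp_smul_cocompact (fun p => (g p : ℂ))
    (volume : Measure (Pt d))).comp h1
  refine h2.congr fun ε => ?_
  refine integral_congr_ae (ae_of_all _ fun p => ?_)
  have h3 : (Real.fourierChar (-w ε p) : ℂ) = ex k (dil ε⁻¹ (ε ^ (2 * m))⁻¹ p) := by
    rw [hw, Real.fourierChar_apply, ex]
    congr 1
    push_cast
    ring
  simp only [Circle.smul_def, h3, smul_eq_mul, real_smul, mul_comm]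

/-- The real parts of the exponentials in `L²` of the cell. -/
def reEx (k : Freq d) : Lp ℝ 2 (cellM d) := ((memLp_ex k).re).toLp _

/-- The imaginary parts of the exponentials in `L²` of the cell. -/
def imEx (k : Freq d) : Lp ℝ 2 (cellM d) := ((memLp_ex k).im).toLp _

theorem inner_ex_eq {f : Pt d → ℝ} (hf : MemLp f 2 (cellM d)) (k) :
    inner ℝ (hf.toLp f) (reEx k) = (hat f k).re ∧ inner ℝ (hf.toLp f) (imEx k) = (hat f k).im := by
  have hi := integrable_smul_ex (hf.integrable (by norm_num)) k
  have h1 : (hat f k).re = ∫ p in cell d, (f p • ex k p).re := (integral_re hi).symm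
  have h2 : (hat f k).im = ∫ p in cell d, (f p • ex k p).im := (integral_im hi).symm
  rw [h1, h2]
  constructor
  · rw [reEx, inner_eq_integral hf.coeFn_toLp (MemLp.coeFn_toLp _)]
    simp [mul_comm]
  · rw [imEx, inner_eq_integral hf.coeFn_toLp (MemLp.coeFn_toLp _)]
    simp [mul_comm]

theorem dense_span_ex : Dense (Submodule.span ℝ (range (reEx (d := d)) ∪ range (imEx (d := d))) :
    Set (Lp ℝ 2 (cellM d))) := by
  rw [Submodule.dense_iff_topologicalClosure_eq_top, Submodule.topologicalClosure_eq_top_iff,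
    Submodule.eq_bot_iff]
  intro f hf
  rw [Submodule.mem_orthogonal'] at hf
  have h : ∀ k, hat f k = 0 := by
    intro k
    have e := inner_ex_eq (Lp.memLp f) k
    rw [Lp.toLp_coeFn, hf _ (Submodule.subset_span (Or.inl ⟨k, rfl⟩)),
      hf _ (Submodule.subset_span (Or.inr ⟨k, rfl⟩))] at e
    exact Complex.ext e.1.symm e.2.symm
  exact (Lp.eq_zero_iff_ae_eq_zero).2 (ae_eq_zero_of_hat_eq_zero (Lp.memLp f) h)

theorem hat_const (c) (k : Freq d) : hat (fun _ => c) k = if k = 0 then (c : ℂ) else 0 := by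
  unfold hat
  rw [integral_smul, integral_cell_ex]
  split_ifs <;> simp

/-- Oscillating periodic functions converge weakly to their mean. -/
theorem tendsto_integral_oscillating {m} (hm : 0 < m) {R} (hR : 0 ≤ R)
    {g} (hg : MemLp g 2) (hs : BoxSupp R g) {Θ : Pt d → ℝ}
    (hΘ : AEStronglyMeasurable Θ volume) (hΘ2 : MemLp Θ 2 (cellM d)) (hper : IsPeriodic Θ) :
    Tendsto (fun ε => ∫ p, g p * Θ (dil ε⁻¹ (ε ^ (2 * m))⁻¹ p)) (𝓝[>] 0)
      (𝓝 ((∫ p in cell d, Θ p) * ∫ p, g p)) := by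
  have hev : ∀ᶠ ε : ℝ in 𝓝[>] 0, ε ∈ Ioo (0 : ℝ) 1 := Ioo_mem_nhdsGT one_pos
  have hpw : ∀ ε ∈ Ioo (0 : ℝ) 1, 0 < ε ^ (2 * m) ∧ ε ^ (2 * m) ≤ 1 := fun ε hε =>
    ⟨pow_pos hε.1 _, pow_le_one₀ hε.1.le hε.2.le⟩
  classical
  let x : ℝ → Lp ℝ 2 (cellM d) := fun ε => if h : ε ∈ Ioo (0 : ℝ) 1 then
    (memLp_perDil (R := R) hg h.1 (hpw ε h).1).toLp _ else 0
  have hx : ∀ ε (h : ε ∈ Ioo (0 : ℝ) 1), x ε = (memLp_perDil (R := R) hg h.1 (hpw ε h).1).toLp _ :=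
    fun ε h => dif_pos h
  have hy : MemLp (fun _ => ∫ p, g p) 2 (cellM d) := memLp_const _
  have hb : ∀ᶠ ε in 𝓝[>] 0, ‖x ε‖ ≤ sqrt ((2 * R + 3) ^ d * (2 * R + 3) * ∫ p, g p ^ 2) := by
    filter_upwards [hev] with ε hε
    rw [hx ε hε]
    refine Real.le_sqrt_of_sq_le ?_
    refine le_trans (le_of_eq ?_) (integral_perDil_sq_le hR hg hs hε.1 (hpw ε hε).1 hε.2.le
      (hpw ε hε).2)
    rw [← real_inner_self_eq_norm_sq, inner_eq_integral (MemLp.coeFn_toLp _) (MemLp.coeFn_toLp _)]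
    simp [pow_two]
  have hhat : ∀ k, Tendsto (fun ε => hat (perDil R ε (ε ^ (2 * m)) g) k) (𝓝[>] 0)
      (𝓝 (hat (fun _ => ∫ p, g p) k)) := by
    intro k
    have he : ∀ᶠ ε : ℝ in 𝓝[>] 0, hat (perDil R ε (ε ^ (2 * m)) g) k
        = ∫ p, g p • ex k (dil ε⁻¹ (ε ^ (2 * m))⁻¹ p) := by
      filter_upwards [hev] with ε hε
      exact hat_perDil hg hs hε.1 (hpw ε hε).1 k
    rw [tendsto_congr' he, hat_const]
    split_ifs with hk
    · subst hk
      simp only [ex_zero, real_smul, mul_one]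
      rw [integral_complex_ofReal]
      exact tendsto_const_nhds
    · exact tendsto_integral_smul_ex hm hk
  have key := tendsto_inner_of_dense hb dense_span_ex (y := hy.toLp _) (by
    rintro v (⟨k, rfl⟩ | ⟨k, rfl⟩)
    · rw [(inner_ex_eq hy k).1]
      refine ((Complex.continuous_re.tendsto _).comp (hhat k)).congr' ?_
      filter_upwards [hev] with ε hε
      rw [hx ε hε, (inner_ex_eq _ k).1]
      rfl
    · rw [(inner_ex_eq hy k).2]
      refine ((Complex.continuous_im.tendsto _).comp (hhat k)).congr' ?_
      filter_upwards [hev] with ε hε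
      rw [hx ε hε, (inner_ex_eq _ k).2]
      rfl) (hΘ2.toLp _)
  have e1 : inner ℝ (hy.toLp _) (hΘ2.toLp _) = (∫ p in cell d, Θ p) * ∫ p, g p := by
    rw [inner_eq_integral hy.coeFn_toLp hΘ2.coeFn_toLp, ← integral_mul_const]
    simp
  rw [e1] at key
  refine key.congr' ?_
  filter_upwards [hev] with ε hε
  have h2 := (integral_perDil hg hs hε.1 (hpw ε hε).1 hΘ hΘ2 hper).2
  simp only [smul_eq_mul] at h2
  rw [h2, hx ε hε, inner_eq_integral (MemLp.coeFn_toLp _) hΘ2.coeFn_toLp]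
  simp [mul_comm]

end dilation

/-! ### Testing with oscillating solutions of the adjoint cell problem -/

section adjoint

variable {d n m : ℕ} {A : Coeff d n m} {M : ℝ}

/-- Functions of the time variable only. -/
def timeModes (d n : ℕ) : Submodule ℝ (Lp (Euc n) 2 (cellM d)) :=
  ⨅ (k : Freq d) (_ : k.1 ≠ 0) (i : Fin n), LinearMap.ker (hatL i k)

theorem mem_timeModes {f} : f ∈ timeModes d n ↔ ∀ k, k.1 ≠ 0 → ∀ i, hat (fun p => f p i) k = 0 := by
  simp [timeModes, Submodule.mem_iInf, hatL_apply]

theorem isClosed_timeModes : IsClosed (timeModes d n : Set (Lp (Euc n) 2 (cellM d))) := by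
  have : (timeModes d n : Set (Lp (Euc n) 2 (cellM d)))
      = ⋂ (k : Freq d) (_ : k.1 ≠ 0) (i : Fin n), {f | hat (fun p => f p i) k = 0} := by
    ext f
    simp only [SetLike.mem_coe, mem_timeModes, mem_iInter, Set.mem_ofPred_eq]
  rw [this]
  exact isClosed_iInter fun k => isClosed_iInter fun _ => isClosed_iInter fun i =>
    isClosed_eq (continuous_hat_coord i k) continuous_const

/-- A periodic jet, up to a function of the time variable only, lies in `perJets`. -/
theorem exists_perJets_of_hat (hm : 0 < m) (v) (hv : ∀ (α : LIdx d m) i k, hat (fun p => v α p i) k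
      = conj (symK k α.1) * hat (fun p => v 𝟎 p i) k) :
    ∃ w : perJets d n m, perTop d n m w = topPart d n m (cellM d) v ∧
      ∀ ψ, inner ℝ (perVal d n m w) (cellTime d n ψ) = inner ℝ (v 𝟎) (cellTime d n ψ) := by
  classical
  have : CompleteSpace (timeModes d n) := isClosed_timeModes.completeSpace_coe
  set K := timeModes d n with hK
  set f := v 𝟎 with hf
  set q : Lp (Euc n) 2 (cellM d) := K.starProjection f with hq
  have hqK : q ∈ K := Submodule.starProjection_apply_mem K f
  have horth : ∀ x ∈ K, inner ℝ x (f - q) = 0 := fun x hx =>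
    (Submodule.mem_orthogonal K _).1 (K.sub_starProjection_mem_orthogonal f) x hx
  have hhat : ∀ i (k : Freq d), hat (fun p => (f - q : Lp (Euc n) 2 (cellM d)) p i) k
      = if k.1 = 0 then 0 else hat (fun p => f p i) k := by
    intro i k
    split_ifs with hk
    · have hx : ∀ c : Fin n → ℂ, exL k c ∈ K := by
        intro c
        rw [hK, mem_timeModes]
        intro l hl j
        rw [hat_coord_congr (coeFn_exL k c), hat_exWave, if_neg, if_neg, add_zero]
        · intro h
          have := congrArg Prod.fst h
          simp only [Prod.fst_add, Prod.fst_neg, hk, neg_zero, zero_add, Prod.fst_zero] at this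
          exact hl this
        · intro h
          have := congrArg Prod.fst h
          simp only [Prod.fst_add, hk, zero_add, Prod.fst_zero] at this
          exact hl this
      refine eq_of_forall_re_mul fun c => ?_
      have h1 := horth _ (hx (Pi.single i c))
      rw [inner_exL, sum_eq_single i (by simp +contextual) (by simp), Pi.single_eq_same] at h1
      simpa using h1
    · have h1 := mem_timeModes.1 hqK k hk i
      have h2 := map_sub (hatL i k) f q
      rw [hatL_apply, hatL_apply, hatL_apply, h1, sub_zero] at h2
      exact h2
  let w : Jets d n m (cellM d) := WithLp.toLp 2 (Function.update (fun α => v α) 𝟎 (f - q))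
  have hw0 : w 𝟎 = f - q := Function.update_self _ _ _
  have hw : ∀ α, α ≠ 𝟎 → w α = v α := fun α hα => Function.update_of_ne hα _ _
  have hpos : ∀ α : LIdx d m, α ≠ 𝟎 → 0 < ∑ i, α.1 i := by
    intro α hα
    by_contra h
    apply hα
    have h0 : ∑ i, α.1 i = 0 := by omega
    refine Subtype.ext (funext fun i => ?_)
    exact (Finset.sum_eq_zero_iff.1 h0) i (Finset.mem_univ i)
  have hmem : w ∈ perJets d n m := by
    refine ⟨fun α i k => ?_, fun k i hk => ?_⟩
    · rw [hw0, hhat]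
      by_cases hα : α = 𝟎
      · subst hα
        rw [hw0, hhat, show symK k 𝟎.1 = 1 from symb_zero _, map_one, one_mul]
      · rw [hw α hα, hv α]
        split_ifs with hk
        · rw [symK_eq_zero hk (hpos α hα)]; simp
        · rfl
    · rw [hw0, hhat, if_pos hk]
  refine ⟨⟨w, hmem⟩, ?_, fun ψ => ?_⟩
  · have h1 : ∀ γ : MIdx d m, w γ.low = v γ.low := fun γ => hw _ fun h => by
      have h2 : ∑ i, γ.low.1 i = m := γ.2
      rw [h] at h2
      simp [LIdx.zero] at h2
      omega
    change topPart d n m (cellM d) w = _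
    simp only [topPart, sum_apply, ContinuousLinearMap.comp_apply, PiLp.proj_apply, h1]
  · have h1 : cellTime d n ψ ∈ Kᗮ := by
      rw [Submodule.mem_orthogonal]
      intro x hx
      rw [inner_cellTime]
      refine sum_eq_zero fun i _ => ?_
      have h2 := hasSum_hat (memLp_coord (Lp.memLp x) i) (memLp_coord (IsCellTest.memLp_time ψ.2) i)
      have h3 : ∀ k, hat (fun p => x p i) k
          * conj (hat (fun p => timeD ψ.1 p i) k) = 0 := by
        intro k
        by_cases hk : k.1 = 0
        · rw [IsCellTest.hat_time ψ.2, IsCellTest.hat_zero ψ.2 k i hk]; simp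
        · rw [mem_timeModes.1 hx k hk i, zero_mul]
      simp only [h3] at h2
      exact Complex.ofReal_eq_zero.1 (h2.unique hasSum_zero)
    have h2 : perVal d n m ⟨w, hmem⟩ = f - q := hw0
    rw [h2, inner_sub_left, (Submodule.mem_orthogonal _ _).1 h1 q hqK, sub_zero]

/-- The transposed coefficients. -/
def transp (A : Coeff d n m) : Coeff d n m := fun α β i j => A β α j i

theorem IsBddCoeff.transp {ν : Measure (Pt d)} (hA : IsBddCoeff A M ν) :
    IsBddCoeff (transp A) M ν :=
  ⟨fun α β i j => hA.measurable β α j i, by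
    filter_upwards [hA.bound] with p hp using fun α β i j => hp β α j i⟩

theorem inner_flux_transp (A : Coeff d n m) (ξ ζ p) :
    inner ℝ (flux A ξ p) (ζ p) = inner ℝ (ξ p) (flux (transp A) ζ p) := by
  rw [real_inner_comm (flux (transp A) ζ p), inner_flux, inner_flux, sum_comm]
  refine sum_congr rfl fun α _ => sum_congr rfl fun β _ => ?_
  rw [sum_comm]
  refine sum_congr rfl fun i _ => sum_congr rfl fun j _ => ?_
  simp only [transp]
  ring

/-- The field `A^* (e_{αi} + D^m ψ)`. -/
def adjField (A : Coeff d n m) (α : MIdx d m) (i : Fin n) (ψ : cellTests d n) :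
    Pt d → Top d n m :=
  flux (transp A) (totalTop α i fun γ => spaceD γ.1 ψ.1)

theorem isPeriodic_totalTop_cellTest (α i) (ψ : cellTests d n) :
    IsPeriodic (totalTop α i fun γ : LIdx d m => spaceD γ.1 ψ.1) := fun z k =>
  ae_of_all _ fun p => by
    have : ∀ γ : LIdx d m, spaceD γ.1 ψ.1 (p + latticePt z k) = spaceD γ.1 ψ.1 p := fun γ =>
      IsCellTest.per_space ψ.2 γ.1 p (z, k)
    ext a
    simp only [totalTop, PiLp.add_apply, topFun_apply, this]

theorem continuous_totalTop_cellTest (α i) (ψ : cellTests d n) :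
    Continuous (totalTop α i fun γ : LIdx d m => spaceD γ.1 ψ.1) := by
  unfold totalTop topFun
  refine Continuous.add ((PiLp.continuous_toLp 2 _).comp (continuous_pi fun a => ?_))
    continuous_const
  exact (proj (𝕜 := ℝ) a.2 : Euc n →L[ℝ] ℝ).continuous.comp
    (contDiff_spaceD (IsCellTest.smooth ψ.2) a.1.low.1).continuous

theorem exists_bound_totalTop (α i) (ψ : cellTests d n) :
    ∃ C, 0 ≤ C ∧ ∀ p, ‖totalTop α i (fun γ : LIdx d m => spaceD γ.1 ψ.1) p‖ ≤ C := by
  refine exists_bound_of_periodic (continuous_totalTop_cellTest α i ψ) fun p z => ?_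
  have : ∀ γ : LIdx d m, spaceD γ.1 ψ.1 (p + lat d z) = spaceD γ.1 ψ.1 p := fun γ =>
    IsCellTest.per_space ψ.2 γ.1 p z
  ext a
  simp only [totalTop, PiLp.add_apply, topFun_apply, this]

theorem isPeriodic_adjField (hAp : ∀ α β i j, IsPeriodic (A α β i j)) (α i ψ) :
    IsPeriodic (adjField A α i ψ) :=
  isPeriodic_flux (fun α β i j => hAp β α j i) (isPeriodic_totalTop_cellTest α i ψ)

theorem aestronglyMeasurable_adjField (hA : IsBddCoeff A M volume) (α i ψ) :
    AEStronglyMeasurable (adjField A α i ψ) volume :=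
  aestronglyMeasurable_flux hA.transp.measurable
    (continuous_totalTop_cellTest α i ψ).aestronglyMeasurable

theorem exists_bound_adjField (hA : IsBddCoeff A M volume) (α i ψ) :
    ∃ C, 0 ≤ C ∧ ∀ᵐ p, ‖adjField A α i ψ p‖ ≤ C := by
  obtain ⟨C, hC0, hC⟩ := exists_bound_totalTop (m := m) α i ψ
  refine ⟨fluxConst d n m M * C, mul_nonneg (fluxConst_nonneg d n m M) hC0, ?_⟩
  filter_upwards [hA.transp.bound] with p hp
  exact (norm_flux_le hp).trans (mul_le_mul_of_nonneg_left (hC p) (fluxConst_nonneg d n m M))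

theorem memLp_adjField (hA : IsBddCoeff A M volume) (α i ψ) :
    MemLp (adjField A α i ψ) 2 (cellM d) := by
  obtain ⟨C, -, hC⟩ := exists_bound_adjField hA α i ψ
  exact MemLp.of_bound (aestronglyMeasurable_adjField hA α i ψ).restrict C (ae_restrict_of_ae hC)

theorem coeFn_cellTotal (α i ψ) :
    (𝒢 (cellJet d n m ψ) + 𝒞 (unitTop α i) : Lp (Top d n m) 2 (cellM d))
      =ᵐ[cellM d] totalTop α i fun γ => spaceD γ.1 ψ.1 :=
  coeFn_total (fun γ => coeFn_cellJet ψ γ) α i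

theorem inner_mulOp_cellTotal (hA : IsBddCoeff A M volume) (ξ α i ψ) : inner ℝ (mulOp hA.restrict ξ)
        (𝒢 (cellJet d n m ψ) + 𝒞 (unitTop α i))
      = ∑ a, ∫ p in cell d, ξ p a * adjField A α i ψ p a := by
  rw [← integral_inner_eq_sum (Lp.memLp ξ) (memLp_adjField hA α i ψ), inner_def]
  refine integral_congr_ae ?_
  filter_upwards [coeFn_mulOp hA.restrict ξ, coeFn_cellTotal α i ψ] with p h1 h2
  rw [h1, h2]
  exact inner_flux_transp A ξ (totalTop α i fun γ => spaceD γ.1 ψ.1) p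

theorem integral_adjField (hA : IsBddCoeff A M volume) (α β i j ψ) :
    inner ℝ (mulOp hA.restrict (𝒞 (unitTop β j))) (𝒢 (cellJet d n m ψ) + 𝒞 (unitTop α i))
      = ∫ p in cell d, adjField A α i ψ p (β, j) := by
  rw [inner_mulOp_cellTotal hA, sum_eq_single (β, j)]
  · refine integral_congr_ae ?_
    filter_upwards [coeFn_constTop (unitTop β j)] with p hp
    rw [hp, unitTop_apply, if_pos rfl, one_mul]
  · intro a _ ha
    refine (integral_congr_ae (g := fun _ => (0 : ℝ)) ?_).trans (by simp)
    filter_upwards [coeFn_constTop (unitTop β j)] with p hp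
    rw [hp, unitTop_apply, if_neg ha, zero_mul]
  · simp

/-- The constant in the bound for rescaled periodizations. -/
def boxConst (d : ℕ) (R : ℝ) : ℝ := (2 * R + 3) ^ d * (2 * R + 3)

/-- Weak derivatives of a compactly supported function, tested with oscillating exponentials. -/
def HasOscDeriv (m : ℕ) (ε : ℝ) (W : LIdx d m → Pt d → Euc n) : Prop :=
  ∀ (α : LIdx d m) i (k : Freq d), ((ε ^ (∑ i, α.1 i) : ℝ) : ℂ)
      * ∫ p, W α p i • ex k (dil ε⁻¹ (ε ^ (2 * m))⁻¹ p)
    = conj (symK k α.1) * ∫ p, W 𝟎 p i • ex k (dil ε⁻¹ (ε ^ (2 * m))⁻¹ p)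

/-- The adjoint cell problem at scale `ε`. -/
theorem abs_oscillating_le (hm : 0 < m) (hA : IsBddCoeff A M volume)
    (hAp : ∀ α β i j, IsPeriodic (A α β i j)) {α} {i} {δ} (hδ : 0 < δ)
    {ψ}
    (hψ : ∀ w : perJets d n m, |-inner ℝ (perVal d n m w) (cellTime d n ψ)
        + inner ℝ (mulOp hA.restrict (perTop d n m w))
            (perTop d n m (cellJet d n m ψ) + constTop d n m (unitTop α i))| ≤ δ * ‖w‖)
    {R} (hR : 0 ≤ R) {ε} (hε : ε ∈ Ioo (0 : ℝ) 1) {W}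
    (hW : ∀ γ, MemLp (W γ) 2) (hs : ∀ γ, BoxSupp R (W γ)) (hD : HasOscDeriv m ε W) :
    |-((ε ^ m)⁻¹ * ∑ j, ∫ p, W 𝟎 p j * timeD ψ.1 (dil ε⁻¹ (ε ^ (2 * m))⁻¹ p) j)
      + ∑ a, ∫ p, topFun W p a * adjField A α i ψ (dil ε⁻¹ (ε ^ (2 * m))⁻¹ p) a|
      ≤ δ * sqrt (card (LIdx d m) * (boxConst d R * ∫ p, ‖topFun W p‖ ^ 2)) := by
  have hε2 : 0 < ε ^ (2 * m) := pow_pos hε.1 _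
  have hε2' : ε ^ (2 * m) ≤ 1 := pow_le_one₀ hε.1.le hε.2.le
  have hWi : ∀ γ j, MemLp (fun p => W γ p j) 2 volume := fun γ j => memLp_coord (hW γ) j
  have hsi : ∀ γ j, BoxSupp R (fun p => W γ p j) := fun γ j p hp => hs γ p fun h => hp (by simp [h])
  have hv : ∀ γ : LIdx d m, MemLp (fun p => (WithLp.toLp 2 fun j => ε ^ (∑ i, γ.1 i)
      * perDil R ε (ε ^ (2 * m)) (fun q => W γ q j) p : Euc n)) 2 (cellM d) := fun γ =>
    memLp_of_coord fun j => (memLp_perDil (hWi γ j) hε.1 hε2).const_mul _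
  let v : Jets d n m (cellM d) := WithLp.toLp 2 fun γ => (hv γ).toLp _
  have hvae : ∀ γ, ∀ᵐ p ∂(cellM d), ∀ j, v γ p j = ε ^ (∑ i, γ.1 i)
      * perDil R ε (ε ^ (2 * m)) (fun q => W γ q j) p := by
    intro γ
    filter_upwards [(hv γ).coeFn_toLp] with p hp j
    exact congrArg (fun x : Euc n => x j) hp
  have hzero : ∑ i, (LIdx.zero d m).1 i = 0 := by simp [LIdx.zero]
  have hhat : ∀ (γ : LIdx d m) j k, hat (fun p => v γ p j) k = ((ε ^ (∑ i, γ.1 i) : ℝ) : ℂ)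
      * ∫ p, W γ p j • ex k (dil ε⁻¹ (ε ^ (2 * m))⁻¹ p) := by
    intro γ j k
    rw [← hat_perDil (hWi γ j) (hsi γ j) hε.1 hε2, ← hat_const_mul]
    refine hat_congr_ae ?_ k
    filter_upwards [hvae γ] with p hp
    exact hp j
  obtain ⟨w, hw1, hw2⟩ := exists_perJets_of_hat hm v fun γ j k => by
    rw [hhat, hhat, hD γ j k, hzero, pow_zero, Complex.ofReal_one, one_mul]
  have h1 := hψ w
  rw [hw1, hw2, inner_cellTime, inner_mulOp_cellTotal hA] at h1
  have e1 : ∀ j, ∫ p in cell d, v 𝟎 p j * timeD ψ.1 p j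
      = ∫ p, W 𝟎 p j * timeD ψ.1 (dil ε⁻¹ (ε ^ (2 * m))⁻¹ p) j := by
    intro j
    have h2 := (integral_perDil (hWi 𝟎 j) (hsi _ j) hε.1 hε2 (F := fun p => timeD ψ.1 p j)
      ((proj (𝕜 := ℝ) j : Euc n →L[ℝ] ℝ).continuous.comp
        (contDiff_timeD (IsCellTest.smooth ψ.2)).continuous).aestronglyMeasurable
      (memLp_coord (IsCellTest.memLp_time ψ.2) j)
      (fun z k => ae_of_all _ fun p => by
        simp only
        rw [show timeD ψ.1 (p + latticePt z k) = timeD ψ.1 p from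
          IsCellTest.per_time ψ.2 p (z, k)])).2
    simp only [smul_eq_mul] at h2
    rw [h2]
    refine integral_congr_ae ?_
    filter_upwards [hvae 𝟎] with p hp
    rw [hp j, hzero, pow_zero, one_mul]
  have e2 : ∀ a : MIdx d m × Fin n, ∫ p in cell d, topPart d n m (cellM d) v p a
        * adjField A α i ψ p a
      = ε ^ m * ∫ p, topFun W p a * adjField A α i ψ (dil ε⁻¹ (ε ^ (2 * m))⁻¹ p) a := by
    intro a
    have h2 := (integral_perDil (hWi a.1.low a.2) (hsi _ a.2) hε.1 hε2
      (aestronglyMeasurable_coord (aestronglyMeasurable_adjField hA α i ψ) a)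
      (memLp_coord (memLp_adjField hA α i ψ) a)
      ((isPeriodic_adjField hAp α i ψ).map fun x => x a)).2
    simp only [smul_eq_mul] at h2
    simp only [topFun_apply]
    rw [h2, ← integral_const_mul]
    refine integral_congr_ae ?_
    filter_upwards [hvae a.1.low, coeFn_topPart v] with p hp hq
    rw [hq a, hp a.2, show ∑ i, a.1.low.1 i = m from a.1.2]
    ring
  simp only [e1, e2] at h1
  rw [← mul_sum] at h1
  have h3 : ‖w‖ ≤ ε ^ m * sqrt (card (LIdx d m)
      * (boxConst d R * ∫ p, ‖topFun W p‖ ^ 2)) := by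
    refine abs_le_of_sq_le_sq' ?_ (by have := hε.1; positivity) |>.2
    have hI : ∫ p, ‖topFun W p‖ ^ 2 = ∑ a : MIdx d m × Fin n, ∫ p, W a.1.low p a.2 ^ 2 := by
      simp only [EuclideanSpace.norm_sq_eq, topFun_apply, Real.norm_eq_abs, sq_abs]
      rw [integral_finsetSum _ fun a _ => (hWi a.1.low a.2).integrable_sq]
    have hB : 0 ≤ boxConst d R := by unfold boxConst; positivity
    have hI0 : 0 ≤ ∫ p, ‖topFun W p‖ ^ 2 := integral_nonneg fun p => by positivity
    rw [mul_pow, Real.sq_sqrt (by positivity)]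
    refine (norm_sq_le_perTop w).trans ?_
    rw [hw1, ← mul_assoc, mul_comm (_ ^ 2), mul_assoc]
    refine mul_le_mul_of_nonneg_left ?_ (by positivity)
    rw [norm_sq_eq_sum, hI, mul_sum, mul_sum]
    refine sum_le_sum fun a _ => ?_
    have h4 := integral_perDil_sq_le hR (hWi a.1.low a.2) (hsi _ a.2) hε.1 hε2 hε.2.le hε2'
    refine le_trans (le_of_eq ?_) (mul_le_mul_of_nonneg_left h4 (sq_nonneg (ε ^ m)))
    rw [← integral_const_mul]
    refine integral_congr_ae ?_
    filter_upwards [hvae a.1.low, coeFn_topPart v] with p hp hq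
    rw [hq a, hp a.2, show ∑ i, a.1.low.1 i = m from a.1.2]
    ring
  have hεm : 0 < ε ^ m := pow_pos hε.1 m
  have h4 := h1.trans (mul_le_mul_of_nonneg_left h3 hδ.le)
  refine le_of_mul_le_mul_left ?_ hεm
  refine le_trans (le_of_eq ?_) (h4.trans (le_of_eq (by ring)))
  rw [← abs_of_pos hεm, ← abs_mul, abs_of_pos hεm]
  congr 1
  rw [mul_add, mul_neg, ← mul_assoc, mul_inv_cancel₀ hεm.ne', one_mul]

end adjoint

/-! ### Abstract evolution equations -/

section regularization

variable {V H : Type*} [NormedAddCommGroup V] [InnerProductSpace ℝ V] [CompleteSpace V]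
  [NormedAddCommGroup H] [InnerProductSpace ℝ H] [CompleteSpace H]

/-- The operator `S = ι^* ι`. -/
def gram (ι : V →L[ℝ] H) : V →L[ℝ] V := (adjoint ι).comp ι

theorem inner_gram (ι : V →L[ℝ] H) (x y) : inner ℝ (gram ι x) y = inner ℝ (ι x) (ι y) := by
  rw [gram, ContinuousLinearMap.comp_apply, ContinuousLinearMap.adjoint_inner_left]

theorem inner_gram_comm (ι : V →L[ℝ] H) (x y) : inner ℝ (gram ι x) y = inner ℝ x (gram ι y) := by
  rw [inner_gram, real_inner_comm, ← inner_gram, real_inner_comm]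

theorem dense_range_gram {ι : V →L[ℝ] H} (hι : Injective ι) :
    Dense (LinearMap.range (gram ι).toLinearMap : Set V) := by
  rw [Submodule.dense_iff_topologicalClosure_eq_top, Submodule.topologicalClosure_eq_top_iff,
    Submodule.eq_bot_iff]
  intro x hx
  rw [Submodule.mem_orthogonal'] at hx
  have h := hx (gram ι x) ⟨x, rfl⟩
  rw [← inner_gram_comm, inner_gram] at h
  have h1 : inner ℝ (ι x) (ι x) = 0 := by
    have := hx (gram ι x) ⟨x, rfl⟩
    rwa [← inner_gram_comm, inner_gram_comm, real_inner_comm, inner_gram] at this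
  exact hι ((inner_self_eq_zero.1 h1).trans (map_zero ι).symm)

/-- The resolvent `Q = (S + l)⁻¹`. -/
theorem exists_resolvent (ι : V →L[ℝ] H) {l : ℝ} (hl : 0 < l) : ∃ Q : V →L[ℝ] V,
    (∀ x, gram ι (Q x) + l • Q x = x) ∧ (∀ x, Q (gram ι x) + l • Q x = x) ∧
    ∀ x y, inner ℝ (Q x) y = inner ℝ x (Q y) := by
  let B : V →L[ℝ] V →L[ℝ] ℝ := (innerSL ℝ).comp (gram ι + l • ContinuousLinearMap.id ℝ V)
  have hB : ∀ x y, B x y = inner ℝ (gram ι x) y + l * inner ℝ x y := by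
    intro x y
    change inner ℝ (gram ι x + l • x) y = _
    rw [inner_add_left, inner_smul_left]
    simp
  have hc : IsCoercive B := ⟨l, hl, fun x => by
    rw [hB, inner_gram, real_inner_self_eq_norm_sq, real_inner_self_eq_norm_sq]
    nlinarith [sq_nonneg ‖ι x‖]⟩
  let E := hc.continuousLinearEquivOfBilin
  have hE : ∀ x, E x = gram ι x + l • x := by
    intro x
    refine ext_inner_right ℝ fun y => ?_
    have := hc.continuousLinearEquivOfBilin_apply x y
    rw [this, hB, inner_add_left, inner_smul_left]
    simp
  have hs : ∀ x y, inner ℝ (E x) y = inner ℝ x (E y) := by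
    intro x y
    rw [hE, hE, inner_add_left, inner_add_right, inner_gram_comm, inner_smul_left, inner_smul_right]
    simp
  refine ⟨E.symm.toContinuousLinearMap, fun x => ?_, fun x => ?_, fun x y => ?_⟩
  · rw [← hE]; exact E.apply_symm_apply x
  · rw [← map_smul, ← map_add, ← hE]; exact E.symm_apply_apply x
  · have := hs (E.symm x) (E.symm y)
    rw [E.apply_symm_apply, E.apply_symm_apply] at this
    exact this.symm

variable {ι : V →L[ℝ] H} {l : ℝ} {Q : V →L[ℝ] V}

theorem norm_resolvent_gram_le (hl : 0 < l) (h1 : ∀ x, gram ι (Q x) + l • Q x = x) (x) :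
    ‖Q (gram ι x)‖ ≤ ‖x‖ := by
  set v := Q (gram ι x) with hv
  have h2 := h1 (gram ι x)
  rw [← hv] at h2
  have h3 : inner ℝ (gram ι (v - x)) (v - x) + l * inner ℝ v (v - x) = 0 := by
    have : gram ι (v - x) + l • v = 0 := by rw [map_sub, sub_add_eq_add_sub, h2, sub_self]
    have h4 := congrArg (fun z => inner ℝ z (v - x)) this
    simpa only [inner_add_left, inner_smul_left, inner_zero_left, conj_trivial] using h4
  rw [inner_gram, real_inner_self_eq_norm_sq, inner_sub_right, real_inner_self_eq_norm_sq] at h3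
  have h4 : ‖v‖ ^ 2 ≤ inner ℝ v x := by
    by_contra! hlt
    nlinarith [sq_nonneg ‖ι (v - x)‖]
  have h5 := real_inner_le_norm v x
  rcases eq_or_lt_of_le (norm_nonneg v) with h0 | h0
  · rw [← h0]; exact norm_nonneg x
  · nlinarith

theorem inner_resolvent_adjoint_le (hl : 0 < l) (h1 : ∀ x, gram ι (Q x) + l • Q x = x) (h : H) :
    inner ℝ (Q (adjoint ι h)) (adjoint ι h) ≤ ‖h‖ ^ 2 := by
  set v := Q (adjoint ι h) with hv
  have h2 := h1 (adjoint ι h)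
  rw [← hv] at h2
  rw [ContinuousLinearMap.adjoint_inner_right]
  have h3 : ‖ι v‖ ^ 2 + l * ‖v‖ ^ 2 = inner ℝ (ι v) h := by
    have h4 := congrArg (fun z => inner ℝ z v) h2
    simp only [inner_add_left, inner_smul_left, conj_trivial, inner_gram,
      real_inner_self_eq_norm_sq, ContinuousLinearMap.adjoint_inner_left] at h4
    rw [h4, real_inner_comm]
  have h5 := real_inner_le_norm (ι v) h
  have h6 : ‖ι v‖ ≤ ‖h‖ := by
    by_contra! hlt
    nlinarith [sq_nonneg ‖v‖, norm_nonneg h]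
  nlinarith [norm_nonneg h, norm_nonneg (ι v)]

theorem norm_resolvent_gram_sub_le (hl : 0 < l) (h1 : ∀ x, gram ι (Q x) + l • Q x = x)
    (h2 : ∀ x, Q (gram ι x) + l • Q x = x) (x y) :
    ‖Q (gram ι x) - x‖ ≤ 2 * ‖x - gram ι y‖ + l * ‖y‖ := by
  have e : Q (gram ι x) - x = Q (gram ι (x - gram ι y)) - (x - gram ι y) - l • Q (gram ι y) := by
    have := h2 (gram ι y)
    rw [map_sub, map_sub, eq_sub_of_add_eq this]
    abel
  rw [e]
  have a1 := norm_resolvent_gram_le hl h1 (x - gram ι y)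
  have a2 := norm_resolvent_gram_le hl h1 y
  calc ‖Q (gram ι (x - gram ι y)) - (x - gram ι y) - l • Q (gram ι y)‖
      ≤ ‖Q (gram ι (x - gram ι y))‖ + ‖x - gram ι y‖ + ‖l • Q (gram ι y)‖ :=
        (norm_sub_le _ _).trans (add_le_add_left (norm_sub_le _ _) _)
    _ ≤ _ := by
      rw [norm_smul, Real.norm_eq_abs, abs_of_pos hl]
      nlinarith

/-- The resolvents `Q_l S` converge strongly to the identity. -/
theorem tendsto_resolvent_gram (hι : Injective ι) {l : ℕ → ℝ} (hl : ∀ k, 0 < l k)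
    (hl0 : Tendsto l atTop (𝓝 0)) {Q : ℕ → V →L[ℝ] V} (h1 : ∀ k x, gram ι (Q k x) + l k • Q k x = x)
    (h2 : ∀ k x, Q k (gram ι x) + l k • Q k x = x) (x) :
    Tendsto (fun k => Q k (gram ι x)) atTop (𝓝 x) := by
  rw [Metric.tendsto_atTop]
  intro ε hε
  obtain ⟨_, hy, ⟨y, rfl⟩⟩ := Metric.dense_iff.1 (dense_range_gram hι) x (ε / 4) (by positivity)
  have hy' : ‖x - gram ι y‖ < ε / 4 := by rw [← dist_eq_norm, dist_comm]; exact hy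
  have h3 : Tendsto (fun k => l k * ‖y‖) atTop (𝓝 0) := by simpa using hl0.mul_const ‖y‖
  obtain ⟨N, hN⟩ := Metric.tendsto_atTop.1 h3 (ε / 2) (by positivity)
  refine ⟨N, fun k hk => ?_⟩
  have h4 := hN k hk
  rw [Real.dist_eq, sub_zero] at h4
  rw [dist_eq_norm]
  refine (norm_resolvent_gram_sub_le (hl k) (h1 k) (h2 k) x y).trans_lt ?_
  have := (abs_lt.1 h4).2
  linarith

end regularization

section evolution

variable {V H : Type*} [NormedAddCommGroup V] [InnerProductSpace ℝ V] [CompleteSpace V]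
  [NormedAddCommGroup H] [InnerProductSpace ℝ H] [CompleteSpace H] {T : ℝ}

theorem L2T.integrable {X : Type*} [NormedAddCommGroup X] (f : L2T T X) :
    IntegrableOn f (Ioo 0 T) volume := (Lp.memLp f).integrable (by norm_num)

theorem L2T.intervalIntegrable {X : Type*} [NormedAddCommGroup X] (f : L2T T X) {t}
    (ht : t ∈ Icc 0 T) : IntervalIntegrable f volume 0 t := by
  rw [intervalIntegrable_iff_integrableOn_Ioo_of_le ht.1]
  exact (L2T.integrable f).mono_set (Ioo_subset_Ioo_right ht.2)

theorem AbsolutelyContinuousOnInterval.of_dist_le {X Y : Type*} [PseudoMetricSpace X]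
    [PseudoMetricSpace Y] {f : ℝ → X} {g : ℝ → Y} {a b C}
    (hg : AbsolutelyContinuousOnInterval g a b)
    (h : ∀ s ∈ uIcc a b, ∀ t ∈ uIcc a b, dist (f s) (f t) ≤ C * dist (g s) (g t)) :
    AbsolutelyContinuousOnInterval f a b := by
  have h0 := Tendsto.const_mul C hg
  rw [mul_zero] at h0
  refine squeeze_zero' (Eventually.of_forall fun E => sum_nonneg fun i _ => dist_nonneg) ?_ h0
  have : ∀ᶠ E in (AbsolutelyContinuousOnInterval.totalLengthFilter ⊓
      𝓟 (AbsolutelyContinuousOnInterval.disjWithin a b)),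
      E ∈ AbsolutelyContinuousOnInterval.disjWithin a b :=
    eventually_inf_principal.2 (Eventually.of_forall fun _ h => h)
  filter_upwards [this] with E hE
  rw [mul_sum]
  exact sum_le_sum fun i hi => h _ (hE.1 i hi).1 _ (hE.1 i hi).2

/-- The energy identity for a primitive. -/
theorem inner_primitive_eq {Q : V →L[ℝ] V} (hQ : ∀ x y, inner ℝ (Q x) y = inner ℝ x (Q y)) {G τ}
    (hG : IntervalIntegrable G volume 0 τ) (w) :
    inner ℝ (Q (w + ∫ s in (0 : ℝ)..τ, G s)) (w + ∫ s in (0 : ℝ)..τ, G s)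
      = inner ℝ (Q w) w + 2 * ∫ t in (0 : ℝ)..τ, inner ℝ (Q (w + ∫ s in (0 : ℝ)..t, G s)) (G t) := by
  set W : ℝ → V := fun t => w + ∫ s in (0 : ℝ)..t, G s with hW
  set e : ℝ → ℝ := fun t => inner ℝ (Q (W t)) (W t) with he
  have hsub : ∀ s ∈ uIcc 0 τ, ∀ t ∈ uIcc 0 τ, W t - W s = ∫ r in s..t, G r := by
    intro s hs t ht
    simp only [hW, add_sub_add_left_eq_sub]
    exact intervalIntegral.integral_interval_sub_left
      (hG.mono_set (uIcc_subset_uIcc_left ht)) (hG.mono_set (uIcc_subset_uIcc_left hs))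
  have hN := (hG.norm).absolutelyContinuousOnInterval_intervalIntegral (c := 0) left_mem_uIcc
  have hWd : ∀ s ∈ uIcc 0 τ, ∀ t ∈ uIcc 0 τ, dist (W s) (W t)
      ≤ dist (∫ r in (0 : ℝ)..s, ‖G r‖) (∫ r in (0 : ℝ)..t, ‖G r‖) := by
    intro s hs t ht
    rw [dist_eq_norm, hsub t ht s hs, dist_eq_norm, intervalIntegral.integral_interval_sub_left
        (hG.norm.mono_set (uIcc_subset_uIcc_left hs)) (hG.norm.mono_set (uIcc_subset_uIcc_left ht))]
    exact intervalIntegral.norm_integral_le_abs_integral_norm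
  have hWac : AbsolutelyContinuousOnInterval W 0 τ :=
    AbsolutelyContinuousOnInterval.of_dist_le (C := 1) hN fun s hs t ht => by
      rw [one_mul]; exact hWd s hs t ht
  obtain ⟨C, hC⟩ := hWac.exists_bound
  have heac : AbsolutelyContinuousOnInterval e 0 τ := by
    refine AbsolutelyContinuousOnInterval.of_dist_le (C := 2 * ‖Q‖ * C) hWac fun s hs t ht => ?_
    have e1 : e s - e t = inner ℝ (Q (W s - W t)) (W s) + inner ℝ (Q (W t)) (W s - W t) := by
      simp only [he, map_sub, inner_sub_left, inner_sub_right]; ring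
    rw [Real.dist_eq, e1, dist_eq_norm]
    have b1 : |inner ℝ (Q (W s - W t)) (W s)| ≤ ‖Q‖ * ‖W s - W t‖ * C :=
      (abs_real_inner_le_norm _ _).trans (mul_le_mul (Q.le_opNorm _) (hC s hs) (norm_nonneg _)
        (by positivity))
    have b2 : |inner ℝ (Q (W t)) (W s - W t)| ≤ ‖Q‖ * C * ‖W s - W t‖ :=
      (abs_real_inner_le_norm _ _).trans (mul_le_mul_of_nonneg_right
        ((Q.le_opNorm _).trans (mul_le_mul_of_nonneg_left (hC t ht) (norm_nonneg _)))
        (norm_nonneg _))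
    refine (abs_add_le _ _).trans ((add_le_add b1 b2).trans (le_of_eq (by ring)))
  have hd := heac.integral_deriv_eq_sub
  have hderiv : ∫ t in (0 : ℝ)..τ, deriv e t = 2 * ∫ t in (0 : ℝ)..τ, inner ℝ (Q (W t)) (G t) := by
    rw [← intervalIntegral.integral_const_mul]
    refine intervalIntegral.integral_congr_ae ?_
    filter_upwards [hG.ae_hasDerivAt_integral] with t ht htm
    have h1 : HasDerivAt W (G t) t := by
      have := ht (uIoc_subset_uIcc htm) 0 left_mem_uIcc
      exact this.const_add w
    have h2 : HasDerivAt (fun t => Q (W t)) (Q (G t)) t := Q.hasFDerivAt.comp_hasDerivAt t h1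
    have h3 := (h2.inner ℝ h1).deriv
    rw [he, h3, hQ (G t), real_inner_comm (Q (W t)) (G t)]
    ring
  rw [hderiv] at hd
  have e0 : e 0 = inner ℝ (Q w) w := by simp [he, hW]
  rw [e0] at hd
  change e τ = _
  linarith

/-- The weak form of `(ι^* ι u)' = G`, `ι u (0) = h`. -/
def EvolEq (ι : V →L[ℝ] H) (u G : L2T T V) (h : H) : Prop :=
  ∀ θ : ℝ → ℝ, Smooth θ → HasCompactSupport θ → tsupport θ ⊆ Iio T → ∀ v : V,
    -(∫ t in Ioo (0 : ℝ) T, deriv θ t * inner ℝ (ι (u t)) (ι v))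
      = (∫ t in Ioo (0 : ℝ) T, θ t * inner ℝ (G t) v) + θ 0 * inner ℝ h (ι v)

/-- A compactly supported smooth function with prescribed derivative on `[0, T]`. -/
theorem exists_primitive (T) {η} (hη : Smooth η)
    (hc : HasCompactSupport η) (hs : tsupport η ⊆ Ioo 0 T) :
    ∃ θ : ℝ → ℝ, Smooth θ ∧ HasCompactSupport θ ∧ tsupport θ ⊆ Iio T ∧
      ∀ t, 0 < t → deriv θ t = η t := by
  obtain ⟨b, hb, hbT⟩ : ∃ b, (∀ t, b ≤ t → η t = 0) ∧ b < T := by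
    rcases (tsupport η).eq_empty_or_nonempty with he | hne
    · refine ⟨T - 1, fun t _ => image_eq_zero_of_notMem_tsupport (by simp [he]), by linarith⟩
    · obtain ⟨x, hx, hmax⟩ := hc.isCompact.exists_isMaxOn hne continuousOn_id
      obtain ⟨y, hy1, hy2⟩ := exists_between (hs hx).2
      exact ⟨y, fun t ht => image_eq_zero_of_notMem_tsupport fun h =>
        absurd (hmax h) (not_le.2 (hy1.trans_le ht)), hy2⟩
  let P : ℝ → ℝ := fun t => ∫ s in b..t, η s
  have hPd : ∀ t, HasDerivAt P (η t) t := fun t =>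
    intervalIntegral.integral_hasDerivAt_right (hη.continuous.intervalIntegrable _ _)
      hη.continuous.stronglyMeasurable.stronglyMeasurableAtFilter hη.continuous.continuousAt
  have hP : Smooth P := by
    rw [contDiff_infty_iff_deriv]
    refine ⟨fun t => (hPd t).differentiableAt, ?_⟩
    rw [show deriv P = η from funext fun t => (hPd t).deriv]
    exact hη
  have hP0 : ∀ t, b ≤ t → P t = 0 := fun t ht => by
    refine (intervalIntegral.integral_congr (g := fun _ => (0 : ℝ)) fun s hs => ?_).trans (by simp)
    rw [uIcc_of_le ht] at hs
    exact hb s hs.1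
  let κ : ℝ → ℝ := fun t => smoothTransition (t + 2)
  have hκ : Smooth κ := smoothTransition.contDiff.comp (by fun_prop)
  have hzero : ∀ t, t ∉ Icc (-2) b → κ t * P t = 0 := by
    intro t ht
    rcases lt_or_ge t (-2) with h | h
    · rw [show κ t = 0 from smoothTransition.zero_of_nonpos (by linarith), zero_mul]
    · have : b < t := by
        by_contra! hh
        exact ht ⟨h, hh⟩
      rw [hP0 t this.le, mul_zero]
  have hts : tsupport (fun t => κ t * P t) ⊆ Icc (-2) b := closure_minimal (fun t ht => by
      by_contra h
      exact ht (hzero t h)) isClosed_Icc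
  refine ⟨fun t => κ t * P t, hκ.mul hP, HasCompactSupport.intro isCompact_Icc hzero,
    fun t ht => (hts ht).2.trans_lt hbT, fun t ht => ?_⟩
  have : (fun t => κ t * P t) =ᶠ[𝓝 t] P := by
    filter_upwards [lt_mem_nhds ht] with s hs
    rw [show κ s = 1 from smoothTransition.one_of_one_le (by linarith), one_mul]
  rw [this.deriv_eq, (hPd t).deriv]

theorem setIntegral_Ioo_eq {E : Type*} [NormedAddCommGroup E] [NormedSpace ℝ E] {T}
    (hT : 0 ≤ T) (f : ℝ → E) : ∫ t in Ioo 0 T, f t = ∫ t in (0 : ℝ)..T, f t := by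
  rw [intervalIntegral.integral_of_le hT, integral_Ioc_eq_integral_Ioo]

/-- The integrated form of the evolution equation. -/
theorem EvolEq.integral_eq {ι} {u G : L2T T V} {h : H} (hT : 0 < T)
    (hu : EvolEq ι u G h) : ∀ᵐ t ∂(volume.restrict (Ioo 0 T)),
      gram ι (u t) = adjoint ι h + ∫ s in (0 : ℝ)..t, G s := by
  have hGi : IntervalIntegrable G volume 0 T := L2T.intervalIntegrable G ⟨hT.le, le_rfl⟩
  have hcont : ContinuousOn (fun t => ∫ s in (0 : ℝ)..t, G s) (Icc 0 T) := by
    have := intervalIntegral.continuousOn_primitive_interval (a := 0) (b := T) (f := G)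
      (μ := volume) (by
        rw [uIcc_of_le hT.le, integrableOn_Icc_iff_integrableOn_Ioo]
        exact L2T.integrable G)
    rwa [uIcc_of_le hT.le] at this
  have hgi : IntegrableOn (fun t => gram ι (u t)) (Ioo 0 T) := (gram ι).integrable_comp
    (L2T.integrable u)
  have hpi : IntegrableOn (fun t => adjoint ι h + ∫ s in (0 : ℝ)..t, G s) (Ioo 0 T) :=
    ((continuousOn_const.add hcont).integrableOn_Icc).mono_set Ioo_subset_Icc_self
  have hw : IntegrableOn (fun t => gram ι (u t) - (adjoint ι h
      + ∫ s in (0 : ℝ)..t, G s)) (Ioo 0 T) := hgi.sub hpi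
  have key := IsOpen.ae_eq_zero_of_integral_contDiff_smul_eq_zero (μ := (volume : Measure ℝ))
    (U := Ioo 0 T) isOpen_Ioo hw.locallyIntegrableOn (fun η hη hc hs => by
      obtain ⟨θ, h1, h2, h3, h4⟩ := exists_primitive T hη hc hs
      have hηi : ∀ {f : ℝ → V}, IntegrableOn f (Ioo 0 T) →
          IntegrableOn (fun t => η t • f t) (Ioo 0 T) := fun hf => by
        obtain ⟨C, hC⟩ := hη.continuous.bounded_above_of_compact_support hc
        exact Integrable.bdd_smul hf C hη.continuous.aestronglyMeasurable (ae_of_all _ hC)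
      have hsupp : ∫ t, η t • (gram ι (u t) - (adjoint ι h
          + ∫ s in (0 : ℝ)..t, G s)) = ∫ t in Ioo 0 T, η t • (gram ι (u t)
          - (adjoint ι h + ∫ s in (0 : ℝ)..t, G s)) := by
        rw [setIntegral_eq_integral_of_forall_compl_eq_zero]
        intro t ht
        rw [image_eq_zero_of_notMem_tsupport fun h => ht (hs h), zero_smul]
      rw [hsupp]
      refine ext_inner_right ℝ fun v => ?_
      rw [inner_zero_left, real_inner_comm, ← integral_inner (hηi hw)]
      have hθT : θ T = 0 := image_eq_zero_of_notMem_tsupport fun h => lt_irrefl T (h3 h)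
      have hvi : IntervalIntegrable (fun t => inner ℝ (G t) v) volume 0 T := by
        rw [intervalIntegrable_iff_integrableOn_Ioo_of_le hT.le]
        exact (L2T.integrable G).inner_const v
      have hθc : ContinuousOn (deriv θ) (uIcc 0 T) := (h1.continuous_deriv (by simp)).continuousOn
      have hparts : ∫ t in (0 : ℝ)..T, θ t * inner ℝ (G t) v
          = -∫ t in (0 : ℝ)..T, deriv θ t * ∫ s in (0 : ℝ)..t, inner ℝ (G s) v := by
        have hac := hvi.absolutelyContinuousOnInterval_intervalIntegral (c := 0) left_mem_uIcc
        have hθac : AbsolutelyContinuousOnInterval θ 0 T :=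
          (h1.of_le (by simp)).contDiffOn.absolutelyContinuousOnInterval
        have := hθac.integral_mul_deriv_eq_deriv_mul hac
        rw [hθT, intervalIntegral.integral_same, zero_mul, mul_zero, sub_zero, zero_sub] at this
        rw [← this]
        refine intervalIntegral.integral_congr_ae ?_
        filter_upwards [hvi.ae_hasDerivAt_integral] with t ht htm
        rw [(ht (uIoc_subset_uIcc htm) 0 left_mem_uIcc).deriv]
      have hprim : ∀ t ∈ Ioo 0 T, inner ℝ (∫ s in (0 : ℝ)..t, G s) v
          = ∫ s in (0 : ℝ)..t, inner ℝ (G s) v := by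
        intro t ht
        have hi : IntervalIntegrable G volume 0 t := L2T.intervalIntegrable G ⟨ht.1.le, ht.2.le⟩
        rw [intervalIntegral.integral_of_le ht.1.le, intervalIntegral.integral_of_le ht.1.le,
          real_inner_comm, ← integral_inner hi.1]
        exact integral_congr_ae (ae_of_all _ fun s => real_inner_comm _ _)
      have hθint : ∫ t in (0 : ℝ)..T, deriv θ t = -θ 0 := by
        rw [intervalIntegral.integral_deriv_eq_sub (fun t _ => h1.differentiable (by simp) t)
          hθc.intervalIntegrable, hθT, zero_sub]
      have hev := hu θ h1 h2 h3 v
      rw [setIntegral_Ioo_eq hT.le (fun t => θ t * _), hparts] at hev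
      have hbd : ∀ {f : ℝ → ℝ}, IntegrableOn f (Ioo 0 T) →
          IntegrableOn (fun t => deriv θ t * f t) (Ioo 0 T) := fun {f} hf => by
        have : IntervalIntegrable f volume 0 T := by
          rwa [intervalIntegrable_iff_integrableOn_Ioo_of_le hT.le]
        have := this.continuousOn_mul hθc
        rwa [intervalIntegrable_iff_integrableOn_Ioo_of_le hT.le] at this
      have i1 : IntegrableOn (fun t => deriv θ t * inner ℝ (ι (u t)) (ι v)) (Ioo 0 T) :=
        hbd ((ι.integrable_comp (L2T.integrable u)).inner_const (ι v))
      have i2 : IntegrableOn (fun t => deriv θ t * inner ℝ h (ι v)) (Ioo 0 T) := hbd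
        (integrableOn_const (by simp))
      have i3 : IntegrableOn (fun t => deriv θ t * ∫ s in (0 : ℝ)..t, inner ℝ (G s) v)
          (Ioo 0 T) := hbd (by
        have := (hvi.absolutelyContinuousOnInterval_intervalIntegral (c := 0)
          left_mem_uIcc).continuousOn
        rw [uIcc_of_le hT.le] at this
        exact this.integrableOn_Icc.mono_set Ioo_subset_Icc_self)
      have e1 : ∫ t in Ioo 0 T, inner ℝ v (η t • (gram ι (u t) - (adjoint ι h
          + ∫ s in (0 : ℝ)..t, G s))) = ∫ t in Ioo 0 T, (deriv θ t * inner ℝ (ι (u t)) (ι v)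
          - (deriv θ t * inner ℝ h (ι v) + deriv θ t * ∫ s in (0 : ℝ)..t, inner ℝ (G s) v)) := by
        refine setIntegral_congr_fun measurableSet_Ioo fun t ht => ?_
        rw [h4 t ht.1, ← hprim t ht, real_inner_comm, inner_smul_left, inner_sub_left,
          inner_add_left, inner_gram, ContinuousLinearMap.adjoint_inner_left]
        simp only [conj_trivial]
        ring
      have i4 : IntegrableOn (fun t => deriv θ t * inner ℝ h (ι v)
          + deriv θ t * ∫ s in (0 : ℝ)..t, inner ℝ (G s) v) (Ioo 0 T) := i2.add i3
      rw [e1, integral_sub i1 i4, integral_add i2 i3, integral_mul_const,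
        setIntegral_Ioo_eq hT.le (deriv θ), hθint,
        setIntegral_Ioo_eq hT.le (fun t => deriv θ t * ∫ s in (0 : ℝ)..t, inner ℝ (G s) v)]
      linarith)
  rw [ae_restrict_iff' measurableSet_Ioo]
  filter_upwards [key] with t ht htm
  exact sub_eq_zero.1 (ht htm)

/-- **Energy inequality**. -/
theorem EvolEq.norm_sq_le {ι : V →L[ℝ] H} (hι : Injective ι) {u G : L2T T V} {h : H}
    (hT : 0 < T) (hu : EvolEq ι u G h) : ∀ᵐ τ ∂(volume.restrict (Ioo 0 T)),
      ‖ι (u τ)‖ ^ 2 ≤ ‖h‖ ^ 2 + 2 * ∫ t in (0 : ℝ)..τ, inner ℝ (G t) (u t) := by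
  have hitg := hu.integral_eq hT
  have hitg' : ∀ᵐ t, t ∈ Ioo 0 T → gram ι (u t) = adjoint ι h + ∫ s in (0 : ℝ)..t, G s :=
    (ae_restrict_iff' measurableSet_Ioo).1 hitg
  choose Q hQ1 hQ2 hQ3 using fun k : ℕ => exists_resolvent ι (l := 1 / ((k : ℝ) + 1)) (by positivity)
  have hl : ∀ k : ℕ, (0 : ℝ) < 1 / ((k : ℝ) + 1) := fun k => by positivity
  have hlim := tendsto_resolvent_gram hι hl tendsto_one_div_add_atTop_nhds_zero_nat hQ1 hQ2
  filter_upwards [hitg, ae_restrict_mem measurableSet_Ioo] with τ hτ hτm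
  have hGi : IntervalIntegrable G volume 0 τ := L2T.intervalIntegrable G ⟨hτm.1.le, hτm.2.le⟩
  have hineq : ∀ k, inner ℝ (Q k (gram ι (u τ))) (gram ι (u τ)) ≤ ‖h‖ ^ 2
      + 2 * ∫ t in (0 : ℝ)..τ, inner ℝ (Q k (gram ι (u t))) (G t) := by
    intro k
    rw [hτ, inner_primitive_eq (hQ3 k) hGi]
    refine add_le_add (inner_resolvent_adjoint_le (hl k) (hQ1 k) h) (le_of_eq ?_)
    congr 1
    refine intervalIntegral.integral_congr_ae ?_
    filter_upwards [hitg'] with t ht htm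
    rw [uIoc_of_le hτm.1.le] at htm
    rw [ht ⟨htm.1, htm.2.trans_lt hτm.2⟩]
  have hL : Tendsto (fun k => inner ℝ (Q k (gram ι (u τ))) (gram ι (u τ))) atTop
      (𝓝 (‖ι (u τ)‖ ^ 2)) := by
    have := (hlim (u τ)).inner (𝕜 := ℝ) (tendsto_const_nhds (x := gram ι (u τ)))
    rwa [← inner_gram_comm, inner_gram, real_inner_self_eq_norm_sq] at this
  have hbound : IntervalIntegrable (fun t => ‖u t‖ * ‖G t‖) volume 0 τ := by
    rw [intervalIntegrable_iff_integrableOn_Ioo_of_le hτm.1.le]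
    have : IntegrableOn (fun t => ‖u t‖ * ‖G t‖) (Ioo 0 T) :=
      (Lp.memLp u).norm.integrable_mul (Lp.memLp G).norm
    exact this.mono_set (Ioo_subset_Ioo_right hτm.2.le)
  have hsub : Ioc 0 τ ⊆ Ioo 0 T := fun t ht => ⟨ht.1, ht.2.trans_lt hτm.2⟩
  have hR : Tendsto (fun k => ∫ t in (0 : ℝ)..τ, inner ℝ (Q k (gram ι (u t))) (G t)) atTop
      (𝓝 (∫ t in (0 : ℝ)..τ, inner ℝ (G t) (u t))) := by
    refine intervalIntegral.tendsto_integral_filter_of_dominated_convergence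
      (fun t => ‖u t‖ * ‖G t‖) (Eventually.of_forall fun k => ?_)
      (Eventually.of_forall fun k => ae_of_all _ fun t _ => ?_) hbound
      (ae_of_all _ fun t _ => ?_)
    · rw [uIoc_of_le hτm.1.le]
      have h1 : AEStronglyMeasurable u (volume.restrict (Ioc 0 τ)) :=
        (Lp.aestronglyMeasurable u).mono_measure (Measure.restrict_mono_set _ hsub)
      have h2 : AEStronglyMeasurable G (volume.restrict (Ioc 0 τ)) :=
        (Lp.aestronglyMeasurable G).mono_measure (Measure.restrict_mono_set _ hsub)
      exact AEStronglyMeasurable.inner (𝕜 := ℝ)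
        (((Q k).comp (gram ι)).continuous.comp_aestronglyMeasurable h1) h2
    · exact (norm_inner_le_norm (𝕜 := ℝ) _ _).trans (mul_le_mul_of_nonneg_right
        (norm_resolvent_gram_le (hl k) (hQ1 k) _) (norm_nonneg _))
    · have := (hlim (u t)).inner (𝕜 := ℝ) (tendsto_const_nhds (x := G t))
      rwa [real_inner_comm] at this
  exact le_of_tendsto_of_tendsto' hL ((hR.const_mul 2).const_add (‖h‖ ^ 2)) hineq

theorem integral_inner_eq_inner (u G : L2T T V) :
    ∫ t in Ioo 0 T, inner ℝ (G t) (u t) = inner ℝ G u := by rw [inner_def]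

/-- The solution is bounded in time. -/
theorem EvolEq.norm_sq_le_const {ι : V →L[ℝ] H} (hι : Injective ι) {u G : L2T T V} {h : H}
    (hT : 0 < T) (hu : EvolEq ι u G h) : ∀ᵐ τ ∂(volume.restrict (Ioo 0 T)),
      ‖ι (u τ)‖ ^ 2 ≤ ‖h‖ ^ 2 + 2 * (‖G‖ * ‖u‖) := by
  filter_upwards [hu.norm_sq_le hι hT, ae_restrict_mem measurableSet_Ioo] with τ h1 hτ
  refine h1.trans ?_
  have hi : IntegrableOn (fun t => ‖G t‖ * ‖u t‖) (Ioo 0 T) :=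
    (Lp.memLp G).norm.integrable_mul (Lp.memLp u).norm
  have h2 : ∫ t in (0 : ℝ)..τ, inner ℝ (G t) (u t) ≤ ∫ t in Ioo 0 T, ‖G t‖ * ‖u t‖ := by
    rw [← setIntegral_Ioo_eq hτ.1.le]
    calc ∫ t in Ioo 0 τ, inner ℝ (G t) (u t) ≤ ∫ t in Ioo 0 τ, ‖G t‖ * ‖u t‖ :=
          integral_mono_ae ((L2.integrable_inner (𝕜 := ℝ) G u).mono_measure
            (Measure.restrict_mono_set _ (Ioo_subset_Ioo_right hτ.2.le)))
            (hi.mono_set (Ioo_subset_Ioo_right hτ.2.le))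
            (ae_of_all _ fun t => real_inner_le_norm _ _)
      _ ≤ _ := setIntegral_mono_set hi (ae_of_all _ fun t => by positivity)
          (Ioo_subset_Ioo_right hτ.2.le).eventuallyLE
  have h3 : ∫ t in Ioo 0 T, ‖G t‖ * ‖u t‖ ≤ ‖G‖ * ‖u‖ := by
    have := real_inner_le_norm ((Lp.memLp G).norm.toLp _) ((Lp.memLp u).norm.toLp _)
    rw [inner_def, Lp.norm_toLp, Lp.norm_toLp, eLpNorm_norm, eLpNorm_norm, ← Lp.norm_def,
      ← Lp.norm_def] at this
    refine le_trans (le_of_eq (integral_congr_ae ?_)) this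
    filter_upwards [(Lp.memLp G).norm.coeFn_toLp, (Lp.memLp u).norm.coeFn_toLp] with t h5 h6
    rw [h5, h6]
    simp [mul_comm]
  linarith

/-- The energy inequality on the whole interval. -/
theorem EvolEq.inner_nonneg {ι : V →L[ℝ] H} (hι : Injective ι) {u G : L2T T V} {h : H}
    (hT : 0 < T) (hu : EvolEq ι u G h) : 0 ≤ ‖h‖ ^ 2 + 2 * inner ℝ G u := by
  have h1 := hu.norm_sq_le hι hT
  have h2 : Tendsto (fun τ => ‖h‖ ^ 2 + 2 * ∫ t in (0 : ℝ)..τ, inner ℝ (G t) (u t)) (𝓝[<] T)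
      (𝓝 (‖h‖ ^ 2 + 2 * inner ℝ G u)) := by
    refine Tendsto.const_add _ (Tendsto.const_mul 2 ?_)
    have hi : IntegrableOn (fun t => (inner ℝ (G t) (u t) : ℝ)) (Ioo 0 T) :=
      L2.integrable_inner (𝕜 := ℝ) G u
    have hc : ContinuousOn (fun τ => ∫ t in (0 : ℝ)..τ, (inner ℝ (G t) (u t) : ℝ)) (Icc 0 T) := by
      have := intervalIntegral.continuousOn_primitive_interval (a := 0) (b := T)
        (f := fun t => (inner ℝ (G t) (u t) : ℝ)) (μ := volume) (by
          rw [uIcc_of_le hT.le, integrableOn_Icc_iff_integrableOn_Ioo]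
          exact hi)
      rwa [uIcc_of_le hT.le] at this
    have h3 := hc T ⟨hT.le, le_rfl⟩
    rw [← integral_inner_eq_inner, setIntegral_Ioo_eq hT.le]
    refine h3.mono_left ?_
    rw [← nhdsWithin_Ioo_eq_nhdsLT hT]
    exact nhdsWithin_mono _ Ioo_subset_Icc_self
  refine ge_of_tendsto_of_frequently h2 ?_
  intro hev
  obtain ⟨l, hl, hsub⟩ := (mem_nhdsLT_iff_exists_Ioo_subset' hT).1 hev
  rw [ae_restrict_iff' measurableSet_Ioo] at h1
  have h5 : volume (Ioo (max 0 l) T) = 0 := by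
    refine measure_mono_null (t := {τ | ¬ (τ ∈ Ioo 0 T → ‖ι (u τ)‖ ^ 2 ≤ ‖h‖ ^ 2
      + 2 * ∫ t in (0 : ℝ)..τ, inner ℝ (G t) (u t))}) (fun τ hτ hc => ?_) h1
    have hτ' := max_lt_iff.1 hτ.1
    exact hsub ⟨hτ'.2, hτ.2⟩ ((sq_nonneg _).trans (hc ⟨hτ'.1, hτ.2⟩))
  rw [Real.volume_Ioo, ENNReal.ofReal_eq_zero, sub_nonpos] at h5
  exact absurd h5 (not_le.2 (max_lt hT hl))

end evolution

/-! ### The space `H^m_0(Ω)` -/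

section H0

variable {d n m : ℕ} {Ω : Set (Euc d)}

instance instCompleteSpaceH0 (d n m : ℕ) (Ω : Set (Euc d)) : CompleteSpace (H0 d n m Ω) :=
  (Submodule.isClosed_topologicalClosure _).completeSpace_coe

theorem IsTest.add' {φ ψ : Euc d → Euc n} (hφ : IsTest Ω φ) (hψ : IsTest Ω ψ) : IsTest Ω (φ + ψ) :=
  ⟨hφ.smooth.add hψ.smooth, hφ.compact.add hψ.compact,
    (tsupport_add φ ψ).trans (union_subset hφ.support hψ.support)⟩

theorem IsTest.const_smul' {φ : Euc d → Euc n} (hφ : IsTest Ω φ) (c : ℝ) : IsTest Ω (c • φ) :=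
  ⟨hφ.smooth.const_smul c, hφ.compact.mono fun x hx h => hx (by simp [h]),
    (tsupport_smul_subset_right (fun _ => c) φ).trans hφ.support⟩

/-- The derivative `D^α` as a bounded operator on `H^m_0(Ω)`. -/
def H0.DL (α : LIdx d m) : H0 d n m Ω →L[ℝ] L2 d n Ω :=
  (PiLp.proj 2 (fun _ : LIdx d m => L2 d n Ω) α).comp (H0 d n m Ω).subtypeL

theorem H0.DL_apply (α) (v : H0 d n m Ω) : H0.DL α v = H0.D v α := rfl

theorem H0.norm_sq (v : H0 d n m Ω) : ‖v‖ ^ 2 = ∑ α, ‖H0.DL α v‖ ^ 2 := PiLp.norm_sq_eq_of_L2 _ v.1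

theorem H0.norm_DL_le (α) (v : H0 d n m Ω) : ‖H0.DL α v‖ ≤ ‖v‖ := PiLp.norm_apply_le v.1 α

theorem H0.DL_test (α) {φ : Euc d → Euc n} (h : IsTest Ω φ) :
    H0.DL α (testH0 m φ h) = ((h.multiD α.1).memLp (Ω := Ω)).toLp (multiD α.1 φ) := rfl

theorem H0.ext_D {v w : H0 d n m Ω} (h : ∀ α, H0.DL α v = H0.DL α w) : v = w :=
  Subtype.ext (PiLp.ext h)

/-- A closed property that holds for test functions holds on `H^m_0(Ω)`. -/
theorem H0.induction {p : H0 d n m Ω → Prop} (hc : IsClosed {v | p v})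
    (ht : ∀ φ (h : IsTest Ω φ), p (testH0 m φ h)) (v) : p v := by
  have hspan : ∀ w ∈ Submodule.span ℝ {v | ∃ (φ : Euc d → Euc n) (h : IsTest Ω φ),
      v = testJet m φ h}, ∃ (φ : Euc d → Euc n) (h : IsTest Ω φ), w = testJet m φ h := by
    intro w hw
    induction hw using Submodule.span_induction with
    | mem x hx => exact hx
    | zero =>
      have h0 : IsTest Ω (0 : Euc d → Euc n) := ⟨contDiff_const, HasCompactSupport.zero, by simp⟩
      refine ⟨0, h0, ?_⟩
      have := multiD_const_smul (φ := (0 : Euc d → Euc n)) contDiff_const (0 : ℝ)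
      refine (PiLp.ext fun α => ?_).symm
      refine (toLp_congr ((h0.multiD α.1).memLp) (MemLp.zero' (p := 2)) ?_).trans
        (MemLp.toLp_zero MemLp.zero')
      have h1 := this α.1
      rw [smul_zero, zero_smul] at h1
      rw [h1]
      rfl
    | add x y _ _ hx hy =>
      obtain ⟨φ, hφ, rfl⟩ := hx
      obtain ⟨ψ, hψ, rfl⟩ := hy
      refine ⟨φ + ψ, hφ.add' hψ, (PiLp.ext fun α => ?_).symm⟩
      refine (toLp_congr (((hφ.add' hψ).multiD α.1).memLp)
        (((hφ.multiD α.1).memLp).add ((hψ.multiD α.1).memLp)) ?_).trans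
        (MemLp.toLp_add ((hφ.multiD α.1).memLp) ((hψ.multiD α.1).memLp))
      rw [multiD_add hφ.smooth hψ.smooth]
    | smul c x _ hx =>
      obtain ⟨φ, hφ, rfl⟩ := hx
      refine ⟨c • φ, hφ.const_smul' c, (PiLp.ext fun α => ?_).symm⟩
      refine (toLp_congr (((hφ.const_smul' c).multiD α.1).memLp)
        (((hφ.multiD α.1).memLp).const_smul c) ?_).trans
        (MemLp.toLp_const_smul c ((hφ.multiD α.1).memLp))
      rw [multiD_const_smul hφ.smooth]
  obtain ⟨s, hs1, hs2⟩ := mem_closure_iff_seq_limit.1 (show v.1 ∈ closure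
    ((Submodule.span ℝ {v | ∃ (φ : Euc d → Euc n) (h : IsTest Ω φ),
      v = testJet m φ h} : Submodule ℝ (JetSpace d n m Ω)) : Set (JetSpace d n m Ω)) from v.2)
  choose φ hφ hs using fun k => hspan _ (hs1 k)
  refine hc.mem_of_tendsto (f := fun k => testH0 m (φ k) (hφ k)) (b := atTop) ?_
    (Eventually.of_forall fun k => ht _ _)
  rw [tendsto_subtype_rng]
  exact hs2.congr hs

theorem isFiniteMeasure_restrict (hb : IsBounded Ω) : IsFiniteMeasure (volume.restrict Ω) :=
  ⟨by simpa using hb.measure_lt_top⟩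

theorem memLp_of_continuous (hb : IsBounded Ω) {W : Type*} [NormedAddCommGroup W]
    {g : Euc d → W} (hg : Continuous g) : MemLp g 2 (volume.restrict Ω) := by
  obtain ⟨C, hC⟩ := hb.isCompact_closure.exists_bound_of_continuousOn hg.continuousOn
  have := isFiniteMeasure_restrict hb
  refine MemLp.of_bound hg.aestronglyMeasurable C ?_
  have h1 : ∀ᵐ x ∂(volume.restrict (closure Ω)), x ∈ closure Ω :=
    ae_restrict_mem isClosed_closure.measurableSet
  filter_upwards [ae_mono (Measure.restrict_mono_set volume subset_closure) h1] with x hx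
  exact hC x hx

theorem inner_toLp_DL {g : Euc d → Euc n} (hg : MemLp g 2 (volume.restrict Ω)) (α : LIdx d m)
    (v) : inner ℝ (hg.toLp g) (H0.DL α v) = ∫ x in Ω, inner ℝ (g x) (H0.D v α x) :=
  inner_eq_integral hg.coeFn_toLp .rfl

theorem setIntegral_inner_test {g φ : Euc d → Euc n} (hφ : IsTest Ω φ) :
    ∫ x in Ω, inner ℝ (g x) (φ x) = ∫ x, inner ℝ (g x) (φ x) :=
  setIntegral_eq_integral_of_forall_compl_eq_zero fun x hx => by
    rw [image_eq_zero_of_notMem_tsupport fun h => hx (hφ.support h), inner_zero_right]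

theorem inner_toLp_test {g φ : Euc d → Euc n} (hg : MemLp g 2 (volume.restrict Ω))
    (hφ : IsTest Ω φ) :
    inner ℝ (hg.toLp g) ((hφ.memLp (Ω := Ω)).toLp φ) = ∫ x, inner ℝ (g x) (φ x) := by
  rw [← setIntegral_inner_test hφ]
  exact inner_eq_integral hg.coeFn_toLp (hφ.memLp (Ω := Ω)).coeFn_toLp

/-- Integration by parts. -/
theorem H0.integral_inner_D (hb : IsBounded Ω) {g} (hg : Smooth g) (α) (v : H0 d n m Ω) :
    ∫ x in Ω, inner ℝ (g x) (H0.D v α x)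
      = (-1) ^ (∑ i, α.1 i) * ∫ x in Ω, inner ℝ (multiD α.1 g x) (H0.D v 𝟎 x) := by
  have h1 := memLp_of_continuous hb hg.continuous
  have h2 := memLp_of_continuous hb (contDiff_multiD hg α.1).continuous
  rw [← inner_toLp_DL h1, ← inner_toLp_DL h2]
  refine H0.induction (p := fun v => inner ℝ (h1.toLp g) (H0.DL α v)
      = (-1) ^ (∑ i, α.1 i) * inner ℝ (h2.toLp _) (H0.DL 𝟎 v)) ?_ ?_ v
  · exact isClosed_eq (by fun_prop) (by fun_prop)
  · intro φ hφ
    rw [H0.DL_test, H0.DL_test, inner_toLp_test _ (hφ.multiD _),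
      inner_toLp_test _ (hφ.multiD _), integral_inner_multiD hg hφ]
    simp only [LIdx.zero, multiD_zero]

/-- The embedding `H^m_0(Ω) → L²(Ω)` is injective. -/
theorem H0.injective_DL_zero (ho : IsOpen Ω) (hb : IsBounded Ω) :
    Injective (H0.DL 𝟎 : H0 d n m Ω →L[ℝ] L2 d n Ω) := by
  rw [injective_iff_map_eq_zero]
  intro v hv
  refine H0.ext_D fun α => ?_
  rw [map_zero]
  have h0 : ∀ g, Smooth g → ∫ x in Ω, inner ℝ (g x) (H0.D v α x) = 0 := by
    intro g hg
    rw [H0.integral_inner_D hb hg,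
      ← inner_toLp_DL (memLp_of_continuous hb (contDiff_multiD hg α.1).continuous), hv,
      inner_zero_right, mul_zero]
  have := isFiniteMeasure_restrict hb
  have hitg : IntegrableOn (H0.D v α) Ω := (Lp.memLp (H0.D v α)).integrable (by norm_num)
  have key := ho.ae_eq_zero_of_integral_contDiff_smul_eq_zero hitg.locallyIntegrableOn
    (fun η hη hc hs => by
      have hi : IntegrableOn (fun x => η x • H0.D v α x) Ω := by
        obtain ⟨C, hC⟩ := hη.continuous.bounded_above_of_compact_support hc
        exact Integrable.bdd_smul hitg C hη.continuous.aestronglyMeasurable (ae_of_all _ hC)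
      rw [← setIntegral_eq_integral_of_forall_compl_eq_zero (s := Ω) fun x hx => by
        rw [image_eq_zero_of_notMem_tsupport fun h => hx (hs h), zero_smul]]
      refine ext_inner_left ℝ fun c => ?_
      rw [inner_zero_right, ← integral_inner hi]
      refine Eq.trans (integral_congr_ae (ae_of_all _ fun x => ?_))
        (h0 (fun x => η x • c) (hη.smul contDiff_const))
      simp only [inner_smul_left, inner_smul_right, conj_trivial])
  rw [Lp.eq_zero_iff_ae_eq_zero]
  exact (ae_restrict_iff' ho.measurableSet).2 key

/-- **Poincaré's inequality** in one direction. -/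
theorem norm_test_le_partialD {R : ℝ} (hR0 : 0 ≤ R) (hR : ∀ x ∈ Ω, ∀ i, |x i| ≤ R)
    {φ : Euc d → Euc n} (hφ : IsTest Ω φ) (i) :
    ‖(hφ.memLp (Ω := Ω)).toLp φ‖ ≤ 2 * R * ‖((hφ.partialD i).memLp (Ω := Ω)).toLp _‖ := by
  have hci : Smooth fun x : Euc d => x i := (proj (𝕜 := ℝ) i : Euc d →L[ℝ] ℝ).contDiff
  have hg : Smooth fun x : Euc d => x i • φ x := hci.smul hφ.smooth
  have hgm : MemLp (fun x : Euc d => x i • φ x) 2 (volume.restrict Ω) :=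
    hg.continuous.memLp_of_hasCompactSupport (hφ.compact.mono fun x hx h => hx (by simp [h]))
  have hD : ∀ x, inner ℝ (partialD i (fun x : Euc d => x i • φ x) x) (φ x)
      = inner ℝ (x i • φ x) (partialD i φ x) + inner ℝ (φ x) (φ x) := fun x => by
    have : fderiv ℝ (fun x : Euc d => x i) x (single i 1) = 1 := by
      have : HasFDerivAt (fun x : Euc d => x i) (proj i : Euc d →L[ℝ] ℝ) x :=
        (proj (𝕜 := ℝ) i : Euc d →L[ℝ] ℝ).hasFDerivAt
      rw [this.fderiv]
      simp
    rw [partialD_smul hci hφ.smooth, this, one_smul, inner_add_left, real_inner_smul_left,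
      real_inner_smul_left, real_inner_comm]
  have hitg : ∀ {f g : Euc d → Euc n}, Continuous f → Continuous g → HasCompactSupport g →
      Integrable fun x => (inner ℝ (f x) (g x) : ℝ) := fun {f g} hf hg' hc =>
    (Continuous.inner hf hg').integrable_of_hasCompactSupport
      (hc.mono fun x hx h => hx (by simp only [h, inner_zero_right]))
  have h1 := integral_inner_partialD hg hφ i
  simp only [hD] at h1
  rw [integral_add (hitg hg.continuous (hφ.partialD i).smooth.continuous (hφ.partialD i).compact)
    (hitg hφ.smooth.continuous hφ.smooth.continuous hφ.compact),
    ← inner_toLp_test hgm (hφ.partialD i), ← inner_toLp_test hφ.memLp hφ,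
    real_inner_self_eq_norm_sq] at h1
  have h2 : ‖hgm.toLp _‖ ≤ R * ‖(hφ.memLp (Ω := Ω)).toLp φ‖ := by
    refine Lp.norm_le_mul_norm_of_ae_le_mul ?_
    filter_upwards [hgm.coeFn_toLp, (hφ.memLp (Ω := Ω)).coeFn_toLp] with x h3 h4
    rw [h3, h4, norm_smul]
    by_cases hx : x ∈ Ω
    · exact mul_le_mul_of_nonneg_right (hR x hx i) (norm_nonneg _)
    · rw [image_eq_zero_of_notMem_tsupport fun h => hx (hφ.support h), norm_zero, mul_zero,
        mul_zero]
  have h3 := (abs_le.1 (abs_real_inner_le_norm (hgm.toLp _)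
    (((hφ.partialD i).memLp (Ω := Ω)).toLp _))).1
  have key : ∀ {a b c p : ℝ}, 0 ≤ b → p = -(p + a ^ 2) → -(c * b) ≤ p → c ≤ R * a →
      a ≤ 2 * R * b := by
    intro a b c p hb h1 h2 h3
    by_contra! hlt
    nlinarith [mul_nonneg hR0 hb, mul_le_mul_of_nonneg_right h3 hb]
  exact key (norm_nonneg _) h1 h3 h2

/-- **Poincaré's inequality** on `H^m_0(Ω)`. -/
theorem H0.exists_norm_sq_le (hd : 0 < d) (hb : IsBounded Ω) :
    ∃ C : ℝ, 0 < C ∧ ∀ v : H0 d n m Ω, ‖v‖ ^ 2 ≤ C * ∑ β : MIdx d m, ‖H0.DL β.low v‖ ^ 2 := by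
  classical
  obtain ⟨R, hRpos, hR⟩ : ∃ R : ℝ, 0 < R ∧ ∀ x ∈ Ω, ∀ i, |x i| ≤ R := by
    obtain ⟨R, hR⟩ := hb.exists_norm_le
    exact ⟨max R 1, by positivity, fun x hx i =>
      (PiLp.norm_apply_le x i).trans ((hR x hx).trans (le_max_left _ _))⟩
  set K : ℝ := max (2 * R) 1 with hK
  have hK1 : 1 ≤ K := le_max_right _ _
  have hstep : ∀ (α : LIdx d m), ∃ β : MIdx d m, ∀ φ (hφ : IsTest Ω φ),
      ‖H0.DL α (testH0 (n := n) m φ hφ)‖ ≤ K ^ m * ‖H0.DL β.low (testH0 (n := n) m φ hφ)‖ := by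
    intro α
    let i0 : Fin d := ⟨0, hd⟩
    have hr : ∀ r : ℕ, ∀ α : LIdx d m, ∀ h : ∑ i, α.1 i + r = m, ∃ β : MIdx d m,
        ∀ φ (hφ : IsTest Ω φ), ‖H0.DL α (testH0 (n := n) m φ hφ)‖
          ≤ K ^ r * ‖H0.DL β.low (testH0 (n := n) m φ hφ)‖ := by
      intro r
      induction r with
      | zero => exact fun α h => ⟨⟨α.1, h⟩, fun φ hφ => by rw [pow_zero, one_mul]; rfl⟩
      | succ r ih =>
        intro α h
        have hs := sum_add_single α.1 i0
        obtain ⟨β, hβ⟩ := ih ⟨α.1 + Pi.single i0 1, by rw [hs]; omega⟩ (by simp only [hs]; omega)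
        refine ⟨β, fun φ hφ => ?_⟩
        have h1 := norm_test_le_partialD hRpos.le hR (hφ.multiD α.1) i0
        have h2 : ((((hφ.multiD α.1).partialD i0).memLp (Ω := Ω)).toLp _ : L2 d n Ω)
            = H0.DL ⟨α.1 + Pi.single i0 1, by rw [hs]; omega⟩ (testH0 m φ hφ) := by
          rw [H0.DL_test]
          refine toLp_congr _ _ ?_
          rw [partialD_multiD hφ.smooth]
        rw [h2] at h1
        calc ‖H0.DL α (testH0 (n := n) m φ hφ)‖ ≤ 2 * R * _ := h1
          _ ≤ K * (K ^ r * ‖H0.DL β.low (testH0 (n := n) m φ hφ)‖) :=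
            mul_le_mul (le_max_left _ _) (hβ φ hφ) (norm_nonneg _) (by positivity)
          _ = _ := by ring
    obtain ⟨β, hβ⟩ := hr (m - ∑ i, α.1 i) α (by have := α.2; omega)
    exact ⟨β, fun φ hφ => (hβ φ hφ).trans (mul_le_mul_of_nonneg_right
      (pow_le_pow_right₀ hK1 (Nat.sub_le _ _)) (norm_nonneg _))⟩
  refine ⟨card (LIdx d m) * (K ^ m) ^ 2 + 1, by positivity, fun v => ?_⟩
  refine H0.induction (p := fun v => ‖v‖ ^ 2 ≤ (card (LIdx d m) * (K ^ m) ^ 2 + 1)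
    * ∑ β : MIdx d m, ‖H0.DL β.low v‖ ^ 2) ?_ ?_ v
  · exact isClosed_le (by fun_prop) (by fun_prop)
  · intro φ hφ
    set S := ∑ β : MIdx d m, ‖H0.DL β.low (testH0 (n := n) m φ hφ)‖ ^ 2 with hS
    have hS0 : 0 ≤ S := sum_nonneg fun _ _ => by positivity
    have h1 : ∀ α : LIdx d m, ‖H0.DL α (testH0 (n := n) m φ hφ)‖ ^ 2 ≤ (K ^ m) ^ 2 * S := by
      intro α
      obtain ⟨β, hβ⟩ := hstep α
      calc _ ≤ (K ^ m * ‖H0.DL β.low (testH0 (n := n) m φ hφ)‖) ^ 2 :=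
            pow_le_pow_left₀ (norm_nonneg _) (hβ φ hφ) 2
        _ = (K ^ m) ^ 2 * ‖H0.DL β.low (testH0 (n := n) m φ hφ)‖ ^ 2 := by ring
        _ ≤ _ := mul_le_mul_of_nonneg_left
          (single_le_sum (f := fun β : MIdx d m => ‖H0.DL β.low (testH0 (n := n) m φ hφ)‖ ^ 2)
            (fun _ _ => by positivity) (Finset.mem_univ β)) (by positivity)
    rw [H0.norm_sq]
    refine (sum_le_sum fun α _ => h1 α).trans ?_
    rw [Finset.sum_const, Finset.card_univ, nsmul_eq_mul]
    nlinarith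

end H0

/-! ### Compactness of the embedding of `H^m_0(Ω)` -/

section ehrling

variable {d n m : ℕ} {Ω : Set (Euc d)}

theorem ex_eq_mul (k : Freq d) (p) : ex k p = ex k (p.1, 0) * ex k (0, p.2) := by
  unfold ex
  rw [← Complex.exp_add]
  congr 1
  simp only [PiLp.zero_apply, mul_zero, Finset.sum_const_zero, zero_add, add_zero]
  push_cast
  ring

theorem integral_scaled_mul {f : Euc d → ℝ} {θ : ℝ → ℝ} {R} (hR : 0 < R) :
    ∫ p : Pt d, f (R • p.1) * θ p.2 = (R ^ d)⁻¹ * (∫ x, f x) * ∫ s, θ s := by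
  rw [Measure.volume_eq_prod, integral_prod_mul (fun x => f (R • x)) θ, Measure.integral_comp_smul]
  simp only [finrank_euclideanSpace, card_fin, smul_eq_mul]
  rw [abs_of_pos (by positivity)]

/-- A test function of `x`, localised in time and rescaled. -/
def scaled (R : ℝ) (θ : ℝ → ℝ) (w : Euc d → Euc n) : Pt d → Euc n :=
  fun p => θ p.2 • w (R • p.1)

theorem isTest_scaled {R} (hR : 0 < R) {θ} (hθ : Smooth θ) (hθc : HasCompactSupport θ)
    {w : Euc d → Euc n} (hw : IsTest Ω w) : IsTest univ (scaled R θ w) where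
  smooth := (hθ.comp contDiff_snd).smul (hw.smooth.comp (contDiff_fst.const_smul R))
  compact := by
    refine HasCompactSupport.intro ((hw.compact.isCompact.image
      (continuous_const_smul R⁻¹)).prod hθc.isCompact) fun p hp => ?_
    rw [mem_prod, not_and_or] at hp
    rcases hp with h | h
    · rw [scaled, image_eq_zero_of_notMem_tsupport (f := w), smul_zero]
      exact fun hc => h ⟨_, hc, by simp [smul_smul, hR.ne']⟩
    · rw [scaled, image_eq_zero_of_notMem_tsupport h, zero_smul]
  support := subset_univ _

theorem spaceD_scaled {R θ} {w : Euc d → Euc n} (hw : IsTest Ω w) (i) :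
    spaceD (Pi.single i 1) (scaled R θ w) = fun p => R • scaled R θ (partialD i w) p := by
  funext p
  have hs : Smooth fun x => θ p.2 • w (R • x) :=
    (hw.smooth.comp (contDiff_id.const_smul R)).const_smul (θ p.2)
  have h1 := partialD_multiD hs 0 i
  rw [multiD_zero, zero_add] at h1
  simp only [spaceD, scaled]
  rw [← h1]
  have h2 : HasFDerivAt (fun x => R • x) (R • ContinuousLinearMap.id ℝ (Euc d)) p.1 :=
    (hasFDerivAt_id p.1).const_smul R
  have h3 := (((hw.smooth.differentiable (by simp)) (R • p.1)).hasFDerivAt.comp p.1 h2).const_smul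
    (θ p.2)
  unfold partialD
  rw [show (fun x => θ p.2 • w (R • x)) = (θ p.2 • (w ∘ fun x => R • x)) from rfl, h3.fderiv]
  simp [smul_smul, mul_comm]

theorem timeD_scaled {R θ} (hθ : Smooth θ) (w : Euc d → Euc n) :
    timeD (scaled R θ w) = scaled R (deriv θ) w := by
  funext p
  simp only [timeD, scaled]
  exact (((hθ.differentiable (by simp)) p.2).hasDerivAt.smul_const _).deriv

theorem integral_cell_scaled_sq {R} (hR : 0 < R) {θ w} (hs : ∀ p, scaled R θ w p ≠ 0 → p ∈ cell d)
    (j : Fin n) : ∫ p in cell d, scaled R θ w p j ^ 2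
      = (R ^ d)⁻¹ * (∫ x, w x j ^ 2) * ∫ s, θ s ^ 2 := by
  rw [setIntegral_eq_integral_of_forall_compl_eq_zero, ← integral_scaled_mul hR]
  · refine integral_congr_ae (ae_of_all _ fun p => ?_)
    simp only [scaled, PiLp.smul_apply, smul_eq_mul]
    ring
  · intro p hp
    rw [show scaled R θ w p = 0 by
      by_contra h
      exact hp (hs p h)]
    simp

theorem norm_hat_scaled_le {R} (hR : 0 < R) {θ w} (hs : ∀ p, scaled R θ w p ≠ 0 → p ∈ cell d)
    (j : Fin n) (k) : ‖hat (fun p => scaled R θ w p j) k‖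
      ≤ (R ^ d)⁻¹ * ‖∫ x, w x j • ex k (R⁻¹ • x, 0)‖ * ∫ s, |θ s| := by
  have h1 : hat (fun p => scaled R θ w p j) k
      = (∫ y, w (R • y) j • ex k (y, 0)) * ∫ s, (θ s : ℂ) * ex k (0, s) := by
    rw [hat, setIntegral_eq_integral_of_forall_compl_eq_zero,
      ← integral_prod_mul (μ := (volume : Measure (Euc d))) (ν := (volume : Measure ℝ)),
      ← Measure.volume_eq_prod]
    · refine integral_congr_ae (ae_of_all _ fun p => ?_)
      simp only [scaled, PiLp.smul_apply, smul_eq_mul]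
      rw [ex_eq_mul k p, real_smul, real_smul]
      push_cast
      ring
    · intro p hp
      rw [show scaled R θ w p = 0 by
        by_contra h
        exact hp (hs p h)]
      simp
  have h2 : ∫ y, w (R • y) j • ex k (y, 0) = (R ^ d)⁻¹ • ∫ x, w x j • ex k (R⁻¹ • x, 0) := by
    have := Measure.integral_comp_smul (volume : Measure (Euc d))
      (fun x => w x j • ex k (R⁻¹ • x, 0)) R
    simp only [finrank_euclideanSpace, card_fin, smul_smul, inv_mul_cancel₀ hR.ne',
      one_smul] at this
    rw [this, abs_of_pos (by positivity)]
  rw [h1, h2, norm_mul, norm_smul, Real.norm_of_nonneg (by positivity)]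
  refine mul_le_mul_of_nonneg_left ((norm_integral_le_integral_norm _).trans (le_of_eq ?_))
    (by positivity)
  refine integral_congr_ae (ae_of_all _ fun s => ?_)
  simp [norm_ex]

theorem mem_freqBox {N N' k} : k ∈ freqBox d N N' ↔ (∀ i, |k.1 i| ≤ N) ∧ |k.2| ≤ N' := by
  simp [freqBox, Finset.mem_product, Fintype.mem_piFinset, Finset.mem_Icc, abs_le]

theorem le_low_frequencies {N} (hN : 0 < N) {k} {h t : ℝ} {S : Fin d → ℝ} (hh : 0 ≤ h)
    (hS : ∀ i, S i = (2 * π * k.1 i) ^ 2 * h) (ht : t = (2 * π * k.2) ^ 2 * h) :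
    h ≤ (if k ∈ freqBox d N N then h else 0) + ((N : ℝ) ^ 2)⁻¹ * ((∑ i, S i) + t) := by
  have hN' : (0 : ℝ) < N := Nat.cast_pos.2 hN
  have hfar : ∀ a, (N : ℤ) < |a| → (N : ℝ) ^ 2 ≤ (2 * π * a) ^ 2 := by
    intro a ha
    have h1 : (N : ℝ) ≤ |(a : ℝ)| := by
      have : ((N : ℤ) : ℝ) ≤ ((|a| : ℤ) : ℝ) := Int.cast_le.2 ha.le
      rwa [Int.cast_abs, Int.cast_natCast] at this
    have h2 : (N : ℝ) ≤ |2 * π * a| := by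
      rw [abs_mul, abs_of_pos Real.two_pi_pos]
      nlinarith [Real.pi_gt_three, abs_nonneg (a : ℝ)]
    rw [← sq_abs (2 * π * a)]
    exact pow_le_pow_left₀ hN'.le h2 2
  have hS0 : ∀ i ∈ Finset.univ, 0 ≤ S i := fun i _ => by rw [hS]; positivity
  have hS1 := sum_nonneg hS0
  have ht0 : 0 ≤ t := by rw [ht]; positivity
  split_ifs with hk
  · have : 0 ≤ ((N : ℝ) ^ 2)⁻¹ * ((∑ i, S i) + t) := by positivity
    linarith
  · rw [zero_add, ← div_eq_inv_mul, le_div_iff₀ (by positivity)]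
    rw [mem_freqBox, not_and_or] at hk
    rcases hk with h' | h'
    · push Not at h'
      obtain ⟨i, hi⟩ := h'
      have h1 := single_le_sum hS0 (Finset.mem_univ i)
      have h2 := mul_le_mul_of_nonneg_right (hfar _ hi) hh
      rw [← hS] at h2
      linarith
    · push Not at h'
      have h2 := mul_le_mul_of_nonneg_right (hfar _ h') hh
      rw [← ht] at h2
      linarith

/-- Parseval's identity, with the high frequencies estimated by the first derivatives. -/
theorem integral_sq_le_low_frequencies {U} {g : Pt d → Euc n}
    (hg : IsTest U g) (hs : tsupport g ⊆ cell d) {N} (hN : 0 < N) (j) :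
    ∫ p in cell d, g p j ^ 2 ≤ (∑ k ∈ freqBox d N N, ‖hat (fun p => g p j) k‖ ^ 2)
      + ((N : ℝ) ^ 2)⁻¹ * ((∑ i, ∫ p in cell d, spaceD (Pi.single i 1) g p j ^ 2)
        + ∫ p in cell d, timeD g p j ^ 2) := by
  classical
  have hall : ∀ f : Pt d → Euc n, tsupport f ⊆ tsupport g → ∀ k,
      hat (fun p => f p j) k = ∫ p, f p j • ex k p := fun f hf k =>
    setIntegral_eq_integral_of_forall_compl_eq_zero fun p hp => by
      have : f p = 0 := image_eq_zero_of_notMem_tsupport fun h => hp (hs (hf h))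
      simp only [this, PiLp.zero_apply, zero_smul]
  have hmem : ∀ {f : Pt d → Euc n}, IsTest U f → MemLp (fun p => f p j) 2 (cellM d) :=
    fun hf => (hf.memLp_apply j).restrict _
  have hpt : ∀ k, ‖hat (fun p => g p j) k‖ ^ 2
      ≤ (if k ∈ freqBox d N N then ‖hat (fun p => g p j) k‖ ^ 2 else 0)
        + ((N : ℝ) ^ 2)⁻¹ * ((∑ i, ‖hat (fun p => spaceD (Pi.single i 1) g p j) k‖ ^ 2)
          + ‖hat (fun p => timeD g p j) k‖ ^ 2) := by
    intro k
    have hsp : ∀ i, ‖hat (fun p => spaceD (Pi.single i 1) g p j) k‖ ^ 2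
        = (2 * π * k.1 i) ^ 2 * ‖hat (fun p => g p j) k‖ ^ 2 := by
      intro i
      rw [hall _ (spaceD_add_single_and_contDiff hg.smooth _).2.1,
        integral_spaceD_smul_ex hg, ← hall g subset_rfl, norm_mul, mul_pow, RCLike.norm_conj]
      congr 1
      have := symb_add_single (fun j => 2 * π * k.1 j) 0 i
      rw [zero_add, symb_zero, mul_one] at this
      rw [symK, this, norm_mul, Complex.norm_I, one_mul, Complex.norm_real, Real.norm_eq_abs,
        sq_abs]
    have htm : ‖hat (fun p => timeD g p j) k‖ ^ 2
        = (2 * π * k.2) ^ 2 * ‖hat (fun p => g p j) k‖ ^ 2 := by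
      rw [hall _ (tsupport_timeD hg.smooth), integral_timeD_smul_ex hg, ← hall g subset_rfl,
        norm_mul, mul_pow, norm_neg, norm_mul, Complex.norm_I, one_mul, Complex.norm_real,
        Real.norm_eq_abs, sq_abs]
    exact le_low_frequencies hN (sq_nonneg _) hsp htm
  refine hasSum_le hpt (hasSum_hat_sq (hmem hg)) (HasSum.add ?_ (HasSum.mul_left _
    (HasSum.add (hasSum_sum fun i _ => hasSum_hat_sq (hmem (hg.spaceD _)))
      (hasSum_hat_sq (hmem hg.timeD)))))
  have : ∑ k ∈ freqBox d N N, ‖hat (fun p => g p j) k‖ ^ 2 = ∑ k ∈ freqBox d N N,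
      if k ∈ freqBox d N N then ‖hat (fun p => g p j) k‖ ^ 2 else 0 :=
    sum_congr rfl fun k hk => (if_pos hk).symm
  rw [this]
  exact hasSum_sum_of_ne_finset_zero fun k hk => if_neg hk

theorem exists_integral_sq_le (hb : IsBounded Ω) :
    ∃ R C : ℝ, 0 < R ∧ 0 < C ∧ ∀ N : ℕ, 0 < N → ∀ w : Euc d → Euc n, IsTest Ω w → ∀ j,
      ∫ x, w x j ^ 2 ≤ C * ((N : ℝ) ^ 2)⁻¹ * ((∑ i, ∫ x, partialD i w x j ^ 2) + ∫ x, w x j ^ 2)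
        + C * ∑ k ∈ freqBox d N N, ‖∫ x, w x j • ex k (R⁻¹ • x, 0)‖ ^ 2 := by
  obtain ⟨r, hr⟩ := hb.exists_norm_le
  set R : ℝ := 4 * max r 1 with hRdef
  have hR : 0 < R := by positivity
  have hcoord : ∀ x ∈ Ω, ∀ i, |x i| ≤ R / 4 := fun x hx i => by
    rw [hRdef, mul_div_cancel_left₀ _ (by norm_num : (4 : ℝ) ≠ 0)]
    exact (PiLp.norm_apply_le x i).trans ((hr x hx).trans (le_max_left _ _))
  let θ : ContDiffBump (0 : ℝ) := ⟨1 / 8, 1 / 4, by norm_num, by norm_num⟩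
  have hθ : Smooth θ := θ.contDiff
  set c1 := ∫ s, |θ s| with hc1
  set c2 := ∫ s, θ s ^ 2 with hc2
  set c3 := ∫ s, deriv θ s ^ 2 with hc3
  have hc2pos : 0 < c2 := by
    refine Continuous.integral_pos_of_hasCompactSupport_nonneg_nonzero (x := 0)
      (θ.continuous.pow 2) (θ.hasCompactSupport.mono fun s hs h => hs (by simp [h]))
      (fun s => sq_nonneg _) ?_
    rw [θ.one_of_mem_closedBall (Metric.mem_closedBall_self θ.rIn_pos.le)]
    norm_num
  have hc1' : 0 ≤ c1 := integral_nonneg fun s => abs_nonneg _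
  have hc3' : 0 ≤ c3 := integral_nonneg fun s => sq_nonneg _
  have hsupp : ∀ w : Euc d → Euc n, IsTest Ω w → tsupport (scaled R θ w) ⊆ cell d := by
    intro w hw
    have hcl : IsClosed {p : Pt d | (∀ i, |p.1 i| ≤ 1 / 4) ∧ |p.2| ≤ 1 / 4} := by
      have : {p : Pt d | (∀ i, |p.1 i| ≤ 1 / 4) ∧ |p.2| ≤ 1 / 4}
          = (⋂ i, {p : Pt d | |p.1 i| ≤ 1 / 4}) ∩ {p | |p.2| ≤ 1 / 4} := by
        ext p; simp
      rw [this]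
      refine (isClosed_iInter fun i => isClosed_le ?_ continuous_const).inter
        (isClosed_le (by fun_prop) continuous_const)
      exact ((proj (𝕜 := ℝ) i : Euc d →L[ℝ] ℝ).continuous.comp continuous_fst).abs
    refine (closure_minimal (fun p hp => ?_) hcl).trans fun p hp => ?_
    · rw [Function.mem_support, scaled] at hp
      have h1 : θ p.2 ≠ 0 := fun h => hp (by rw [h, zero_smul])
      have h2 : R • p.1 ∈ Ω := by
        by_contra h
        exact hp (by rw [image_eq_zero_of_notMem_tsupport fun h' => h (hw.support h'), smul_zero])
      refine ⟨fun i => ?_, ?_⟩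
      · have := hcoord _ h2 i
        rw [PiLp.smul_apply, smul_eq_mul, abs_mul, abs_of_pos hR] at this
        have h3 : R * |p.1 i| ≤ R * (1 / 4) := by linarith
        exact le_of_mul_le_mul_left h3 hR
      · have h3 : p.2 ∈ Function.support θ := h1
        rw [θ.support_eq, Metric.mem_ball, dist_zero_right] at h3
        exact h3.le
    · refine ⟨fun i => ?_, ?_⟩
      · have := abs_le.1 (hp.1 i)
        exact ⟨by linarith, by linarith⟩
      · have := abs_le.1 hp.2
        exact ⟨by linarith, by linarith⟩
  have hz : ∀ w : Euc d → Euc n, IsTest Ω w → ∀ p, scaled R θ w p ≠ 0 → p ∈ cell d :=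
    fun w hw p hp => hsupp w hw (subset_tsupport _ hp)
  set Q : ℝ := (R ^ d)⁻¹ with hQ
  have hQ0 : 0 < Q := by positivity
  refine ⟨R, R ^ 2 + c3 / c2 + Q * c1 ^ 2 / c2, hR, by positivity, fun N hN w hw j => ?_⟩
  have hg := isTest_scaled hR hθ θ.hasCompactSupport hw
  have main := integral_sq_le_low_frequencies hg (hsupp w hw) hN j
  have e1 := integral_cell_scaled_sq hR (hz w hw) j
  have e2 : ∀ i, ∫ p in cell d, spaceD (Pi.single i 1) (scaled R θ w) p j ^ 2
      = R ^ 2 * (Q * (∫ x, partialD i w x j ^ 2) * c2) := by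
    intro i
    rw [← integral_cell_scaled_sq hR (hz _ (hw.partialD i)) j, spaceD_scaled hw,
      ← integral_const_mul]
    refine integral_congr_ae (ae_of_all _ fun p => ?_)
    simp only [PiLp.smul_apply, smul_eq_mul, mul_pow]
  have e3 : ∫ p in cell d, timeD (scaled R θ w) p j ^ 2 = Q * (∫ x, w x j ^ 2) * c3 := by
    rw [timeD_scaled hθ, integral_cell_scaled_sq hR]
    intro p hp
    refine hsupp w hw (tsupport_timeD hg.smooth (subset_tsupport _ ?_))
    rw [Function.mem_support, timeD_scaled hθ]
    exact hp
  have e4 : ∑ k ∈ freqBox d N N, ‖hat (fun p => scaled R θ w p j) k‖ ^ 2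
      ≤ Q ^ 2 * c1 ^ 2 * ∑ k ∈ freqBox d N N, ‖∫ x, w x j • ex k (R⁻¹ • x, 0)‖ ^ 2 := by
    rw [mul_sum]
    refine sum_le_sum fun k _ => ?_
    refine (pow_le_pow_left₀ (norm_nonneg _) (norm_hat_scaled_le hR (hz w hw) j k) 2).trans
      (le_of_eq ?_)
    ring
  rw [e1, e3] at main
  simp only [e2] at main
  rw [← mul_sum, ← sum_mul, ← mul_sum] at main
  set I0 := ∫ x, w x j ^ 2
  set S := ∑ i, ∫ x, partialD i w x j ^ 2
  set K := ∑ k ∈ freqBox d N N, ‖∫ x, w x j • ex k (R⁻¹ • x, 0)‖ ^ 2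
  set ν : ℝ := ((N : ℝ) ^ 2)⁻¹
  have hν : 0 ≤ ν := by positivity
  have hI0 : 0 ≤ I0 := integral_nonneg fun x => sq_nonneg _
  have hS : 0 ≤ S := sum_nonneg fun i _ => integral_nonneg fun x => sq_nonneg _
  have hK : 0 ≤ K := sum_nonneg fun i _ => by positivity
  have h5 : I0 ≤ Q * c1 ^ 2 / c2 * K + ν * (R ^ 2 * S + c3 / c2 * I0) := by
    have h6 : Q * c2 * I0 ≤ Q * c2 * (Q * c1 ^ 2 / c2 * K + ν * (R ^ 2 * S + c3 / c2 * I0)) := by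
      have : Q * c2 * (Q * c1 ^ 2 / c2 * K + ν * (R ^ 2 * S + c3 / c2 * I0))
          = Q ^ 2 * c1 ^ 2 * K + ν * (R ^ 2 * (Q * S * c2) + Q * I0 * c3) := by
        field_simp
      rw [this]
      linarith
    exact le_of_mul_le_mul_left h6 (by positivity)
  refine h5.trans ?_
  have a1 : 0 ≤ c3 / c2 := by positivity
  have a2 : 0 ≤ Q * c1 ^ 2 / c2 := by positivity
  have b1 : ν * (R ^ 2 * S + c3 / c2 * I0)
      ≤ ν * ((R ^ 2 + c3 / c2 + Q * c1 ^ 2 / c2) * (S + I0)) := by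
    refine mul_le_mul_of_nonneg_left ?_ hν
    nlinarith [mul_nonneg a1 hS, mul_nonneg a2 hS, mul_nonneg a2 hI0, mul_nonneg (sq_nonneg R) hI0]
  have b2 : Q * c1 ^ 2 / c2 * K ≤ (R ^ 2 + c3 / c2 + Q * c1 ^ 2 / c2) * K :=
    mul_le_mul_of_nonneg_right (by nlinarith [sq_nonneg R]) hK
  nlinarith

theorem norm_sq_toLp_test {w : Euc d → Euc n} (hw : IsTest Ω w) :
    ‖(hw.memLp (Ω := Ω)).toLp w‖ ^ 2 = ∑ j, ∫ x, w x j ^ 2 := by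
  rw [norm_sq_eq_sum]
  refine sum_congr rfl fun j _ => ?_
  rw [← setIntegral_eq_integral_of_forall_compl_eq_zero (s := Ω) (f := fun x => w x j ^ 2)
    fun x hx => by rw [image_eq_zero_of_notMem_tsupport fun h => hx (hw.support h)]; simp]
  refine integral_congr_ae ?_
  filter_upwards [(hw.memLp (Ω := Ω)).coeFn_toLp] with x hx
  rw [hx]

/-- The lower order derivatives are approximated by operators of finite rank. -/
theorem H0.exists_norm_DL_sq_le (hb : IsBounded Ω) (α) (hα : ∑ i, α.1 i < m) {η} (hη : 0 < η) :
    ∃ (κ : Type) (_ : Fintype κ) (a : κ → H0 d n m Ω), ∀ v : H0 d n m Ω,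
      ‖H0.DL α v‖ ^ 2 ≤ η * ‖v‖ ^ 2 + ∑ l, inner ℝ (a l) v ^ 2 := by
  classical
  obtain ⟨R, C, hR, hC, hmain⟩ := exists_integral_sq_le (n := n) hb
  obtain ⟨N, hN⟩ := exists_nat_gt (max 1 (C * (d + 1) / η))
  have hN1 : (1 : ℝ) < N := (le_max_left _ _).trans_lt hN
  have hN0 : 0 < N := by
    rcases Nat.eq_zero_or_pos N with h | h
    · rw [h] at hN1; norm_num at hN1
    · exact h
  have hN2 : C * ((N : ℝ) ^ 2)⁻¹ * (d + 1) ≤ η := by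
    have h1 : C * (d + 1) / η ≤ N ^ 2 := ((le_max_right _ _).trans hN.le).trans (by nlinarith)
    rw [div_le_iff₀ hη] at h1
    rw [mul_right_comm, ← div_eq_mul_inv, div_le_iff₀ (by positivity)]
    linarith
  let q : Freq d → Fin n → Fin 2 → Euc d → Euc n := fun k j b x =>
    single j (if b = 0 then (ex k (R⁻¹ • x, 0)).re else (ex k (R⁻¹ • x, 0)).im)
  have hqc : ∀ k j b, Continuous (q k j b) := by
    intro k j b
    have hc : Continuous fun x : Euc d => ex k (R⁻¹ • x, 0) :=
      (continuous_ex k).comp ((continuous_const_smul R⁻¹).prodMk continuous_const)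
    refine (PiLp.continuous_toLp 2 _).comp (continuous_pi fun i => ?_)
    simp only [Pi.single_apply]
    split_ifs
    · exact Complex.continuous_re.comp hc
    · exact Complex.continuous_im.comp hc
    · exact continuous_const
  let a : freqBox d N N × Fin n × Fin 2 → H0 d n m Ω := fun l =>
    adjoint (H0.DL α) (sqrt C • (memLp_of_continuous hb (hqc l.1.1 l.2.1 l.2.2)).toLp _)
  refine ⟨freqBox d N N × Fin n × Fin 2, inferInstance, a, fun v => ?_⟩
  refine H0.induction (p := fun v => ‖H0.DL α v‖ ^ 2 ≤ η * ‖v‖ ^ 2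
    + ∑ l, inner ℝ (a l) v ^ 2) ?_ ?_ v
  · exact isClosed_le (by fun_prop) (by fun_prop)
  intro φ hφ
  set w := multiD α.1 φ with hw
  have hwt : IsTest Ω w := hφ.multiD α.1
  have hi : ∀ i, ∑ j, ∫ x, partialD i w x j ^ 2 ≤ ‖testH0 (n := n) m φ hφ‖ ^ 2 := by
    intro i
    have hs := sum_add_single α.1 i
    rw [← norm_sq_toLp_test (hwt.partialD i)]
    refine pow_le_pow_left₀ (norm_nonneg _) ?_ 2
    have : (((hwt.partialD i).memLp (Ω := Ω)).toLp _ : L2 d n Ω)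
        = H0.DL ⟨α.1 + Pi.single i 1, by rw [hs]; omega⟩ (testH0 m φ hφ) := by
      rw [H0.DL_test]
      refine toLp_congr _ _ ?_
      rw [hw, partialD_multiD hφ.smooth]
    rw [this]
    exact H0.norm_DL_le _ _
  have h0 : ∑ j, ∫ x, w x j ^ 2 ≤ ‖testH0 (n := n) m φ hφ‖ ^ 2 := by
    rw [← norm_sq_toLp_test hwt]
    exact pow_le_pow_left₀ (norm_nonneg _) (H0.norm_DL_le α (testH0 (n := n) m φ hφ)) 2
  have hitg : ∀ j, Integrable fun x => w x j := fun j =>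
    ((proj (𝕜 := ℝ) j : Euc n →L[ℝ] ℝ).continuous.comp
      hwt.smooth.continuous).integrable_of_hasCompactSupport
      (hwt.compact.mono fun x hx h => hx (by simp [h]))
  have hz : ∀ k j, C * ‖∫ x, w x j • ex k (R⁻¹ • x, 0)‖ ^ 2 = ∑ b : Fin 2, C *
      (inner ℝ ((memLp_of_continuous hb (hqc k j b)).toLp _)
        (H0.DL α (testH0 (n := n) m φ hφ)) : ℝ) ^ 2 := by
    intro k j
    have hin : ∀ b, (inner ℝ ((memLp_of_continuous hb (hqc k j b)).toLp _)
        (H0.DL α (testH0 (n := n) m φ hφ)) : ℝ) = ∫ x, w x j *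
          (if b = 0 then (ex k (R⁻¹ • x, 0)).re else (ex k (R⁻¹ • x, 0)).im) := by
      intro b
      rw [inner_toLp_DL]
      refine Eq.trans (b := ∫ x in Ω, inner ℝ (q k j b x) (w x)) ?_ ?_
      · refine integral_congr_ae ?_
        filter_upwards [(hwt.memLp (Ω := Ω)).coeFn_toLp] with x hx
        rw [← H0.DL_apply, H0.DL_test, hx]
      · rw [setIntegral_inner_test hwt]
        refine integral_congr_ae (ae_of_all _ fun x => ?_)
        simp only [q]
        rw [EuclideanSpace.inner_single_left]
        simp [mul_comm]
    have hexi : Integrable fun x => w x j • ex k (R⁻¹ • x, 0) := by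
      refine (hitg j).smul_of_top_left (memLp_top_of_bound ?_ 1
        (ae_of_all _ fun x => (norm_ex k _).le))
      exact ((continuous_ex k).comp
        ((continuous_const_smul R⁻¹).prodMk continuous_const)).aestronglyMeasurable
    rw [Fin.sum_univ_two, hin, hin, ← mul_add, ← Complex.normSq_eq_norm_sq, Complex.normSq_apply,
      ← pow_two, ← pow_two]
    congr 3
    · refine (integral_re hexi).symm.trans (integral_congr_ae (ae_of_all _ fun x => ?_))
      simp
    · refine (integral_im hexi).symm.trans (integral_congr_ae (ae_of_all _ fun x => ?_))
      simp
  have hfin : C * ∑ j, ∑ k ∈ freqBox d N N, ‖∫ x, w x j • ex k (R⁻¹ • x, 0)‖ ^ 2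
      = ∑ l, inner ℝ (a l) (testH0 (n := n) m φ hφ) ^ 2 := by
    rw [sum_prod_type, sum_comm, mul_sum, ← Finset.sum_coe_sort]
    simp only [mul_sum, sum_prod_type]
    refine sum_congr rfl fun k _ => sum_congr rfl fun j _ => ?_
    rw [hz]
    refine sum_congr rfl fun b _ => ?_
    simp only [a]
    rw [ContinuousLinearMap.adjoint_inner_left, inner_smul_left, mul_pow, conj_trivial,
      Real.sq_sqrt hC.le]
  calc ‖H0.DL α (testH0 (n := n) m φ hφ)‖ ^ 2 = ∑ j, ∫ x, w x j ^ 2 := norm_sq_toLp_test hwt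
    _ ≤ ∑ j, (C * ((N : ℝ) ^ 2)⁻¹ * ((∑ i, ∫ x, partialD i w x j ^ 2) + ∫ x, w x j ^ 2)
        + C * ∑ k ∈ freqBox d N N, ‖∫ x, w x j • ex k (R⁻¹ • x, 0)‖ ^ 2) :=
      sum_le_sum fun j _ => hmain N hN0 w hwt j
    _ = C * ((N : ℝ) ^ 2)⁻¹ * ((∑ i, ∑ j, ∫ x, partialD i w x j ^ 2) + ∑ j, ∫ x, w x j ^ 2)
        + ∑ l, inner ℝ (a l) (testH0 (n := n) m φ hφ) ^ 2 := by
      rw [sum_add_distrib, ← mul_sum, ← mul_sum, hfin, sum_add_distrib, sum_comm]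
    _ ≤ C * ((N : ℝ) ^ 2)⁻¹ * ((d + 1) * ‖testH0 (n := n) m φ hφ‖ ^ 2)
        + ∑ l, inner ℝ (a l) (testH0 (n := n) m φ hφ) ^ 2 := by
      have h7 := sum_le_sum fun i (_ : i ∈ Finset.univ) => hi i
      rw [Finset.sum_const, Finset.card_univ, card_fin, nsmul_eq_mul] at h7
      refine add_le_add_left (mul_le_mul_of_nonneg_left ?_ (by positivity)) _
      linarith
    _ ≤ _ := by
      refine add_le_add_left ?_ _
      rw [← mul_assoc]
      exact mul_le_mul_of_nonneg_right hN2 (sq_nonneg _)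

/-- Finite rank approximation in terms of the weak topology of the larger space. -/
theorem exists_norm_sq_le_gram {V H H' : Type*} [NormedAddCommGroup V] [InnerProductSpace ℝ V]
    [CompleteSpace V] [NormedAddCommGroup H] [InnerProductSpace ℝ H] [CompleteSpace H]
    [NormedAddCommGroup H'] [InnerProductSpace ℝ H'] {ι : V →L[ℝ] H}
    (hι : Injective ι) {D : V →L[ℝ] H'}
    (hD : ∀ η : ℝ, 0 < η → ∃ (κ : Type) (_ : Fintype κ) (a : κ → V), ∀ v,
      ‖D v‖ ^ 2 ≤ η * ‖v‖ ^ 2 + ∑ l, inner ℝ (a l) v ^ 2) {η} (hη : 0 < η) :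
    ∃ (κ : Type) (_ : Fintype κ) (b : κ → V), ∀ v,
      ‖D v‖ ^ 2 ≤ η * ‖v‖ ^ 2 + 2 * ∑ l, inner ℝ (gram ι v) (b l) ^ 2 := by
  obtain ⟨κ, hκ, a, ha⟩ := hD (η / 2) (by positivity)
  set δ : ℝ := η / (4 * (card κ + 1)) with hδ
  have hδ0 : 0 < δ := by positivity
  have hb : ∀ l, ∃ b, ‖a l - gram ι b‖ ^ 2 ≤ δ := by
    intro l
    obtain ⟨_, hy, ⟨y, rfl⟩⟩ := Metric.dense_iff.1 (dense_range_gram hι) (a l) (sqrt δ)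
      (by positivity)
    refine ⟨y, ?_⟩
    rw [← dist_eq_norm, dist_comm, ← Real.sq_sqrt hδ0.le]
    exact pow_le_pow_left₀ dist_nonneg (le_of_lt hy) 2
  choose b hb using hb
  refine ⟨κ, hκ, b, fun v => (ha v).trans ?_⟩
  have h1 : ∀ l, inner ℝ (a l) v ^ 2 ≤ 2 * inner ℝ (gram ι v) (b l) ^ 2 + 2 * δ * ‖v‖ ^ 2 := by
    intro l
    have e : inner ℝ (a l) v = inner ℝ (gram ι v) (b l) + inner ℝ (a l - gram ι (b l)) v := by
      rw [inner_sub_left, inner_gram_comm, real_inner_comm (gram ι (b l)) v]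
      ring
    have h2 : inner ℝ (a l - gram ι (b l)) v ^ 2 ≤ δ * ‖v‖ ^ 2 := by
      have := pow_le_pow_left₀ (abs_nonneg _) (abs_real_inner_le_norm (a l - gram ι (b l)) v) 2
      rw [sq_abs, mul_pow] at this
      exact this.trans (mul_le_mul_of_nonneg_right (hb l) (sq_nonneg _))
    rw [e]
    nlinarith [sq_nonneg (inner ℝ (gram ι v) (b l) - inner ℝ (a l - gram ι (b l)) v)]
  have h3 := sum_le_sum fun l (_ : l ∈ Finset.univ) => h1 l
  rw [sum_add_distrib, ← mul_sum, Finset.sum_const, Finset.card_univ, nsmul_eq_mul] at h3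
  have h4 : card κ * (2 * δ) ≤ η / 2 := by
    rw [hδ]
    have : (0 : ℝ) < 4 * (card κ + 1) := by positivity
    rw [← mul_div_assoc, ← mul_div_assoc, div_le_iff₀ this]
    nlinarith
  have h5 := mul_le_mul_of_nonneg_right h4 (sq_nonneg ‖v‖)
  nlinarith

end ehrling

/-! ### Functions of time with values in `L²` as functions of several variables -/

section joint

variable {X Y E : Type*} [MeasurableSpace X] [MeasurableSpace Y] {κ : Measure X} {ρ : Measure Y}
  [SFinite κ] [SFinite ρ] [NormedAddCommGroup E] [InnerProductSpace ℝ E]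

/-- The slices of `g` are the values of `U`. -/
def IsJoint (g : Lp E 2 (κ.prod ρ)) (U : Lp (Lp E 2 κ) 2 ρ) : Prop :=
  ∀ᵐ t ∂ρ, ∀ᵐ x ∂κ, g (x, t) = U t x

theorem ae_slices {p : X × Y → Prop} (h : ∀ᵐ z ∂(κ.prod ρ), p z) : ∀ᵐ t ∂ρ, ∀ᵐ x ∂κ, p (x, t) :=
  Measure.ae_ae_of_ae_prod (Measure.measurePreserving_swap.quasiMeasurePreserving.ae h)

theorem IsJoint.norm_eq {g} {U : Lp (Lp E 2 κ) 2 ρ} (h : IsJoint g U) : ‖g‖ = ‖U‖ := by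
  rw [← sq_eq_sq₀ (norm_nonneg _) (norm_nonneg _), norm_sq_eq_integral, norm_sq_eq_integral,
    integral_prod_symm _ ((Lp.memLp g).integrable_norm_pow (by norm_num))]
  refine integral_congr_ae ?_
  filter_upwards [h] with t ht
  rw [norm_sq_eq_integral]
  refine integral_congr_ae ?_
  filter_upwards [ht] with x hx
  rw [hx]

theorem IsJoint.add {g g'} {U U' : Lp (Lp E 2 κ) 2 ρ} (h : IsJoint g U)
    (h' : IsJoint g' U') : IsJoint (g + g') (U + U') := by
  filter_upwards [h, h', ae_slices (Lp.coeFn_add g g'), Lp.coeFn_add U U'] with t h1 h2 h3 h4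
  rw [h4]
  filter_upwards [h1, h2, h3, Lp.coeFn_add (U t) (U' t)] with x h5 h6 h7 h8
  rw [h7, Pi.add_apply, Pi.add_apply, h8, Pi.add_apply, h5, h6]

theorem IsJoint.smul {g} {U : Lp (Lp E 2 κ) 2 ρ} (h : IsJoint g U)
    (c : ℝ) : IsJoint (c • g) (c • U) := by
  filter_upwards [h, ae_slices (Lp.coeFn_smul c g), Lp.coeFn_smul c U] with t h1 h3 h4
  rw [h4]
  filter_upwards [h1, h3, Lp.coeFn_smul c (U t)] with x h5 h7 h8
  rw [h7, Pi.smul_apply, Pi.smul_apply, h8, Pi.smul_apply, h5]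

theorem IsJoint.sub {g g'} {U U' : Lp (Lp E 2 κ) 2 ρ} (h : IsJoint g U)
    (h' : IsJoint g' U') : IsJoint (g - g') (U - U') := by
  have := h.add (h'.smul (-1))
  simpa [sub_eq_add_neg] using this

theorem IsJoint.unique {g g'} {U : Lp (Lp E 2 κ) 2 ρ} (h : IsJoint g U)
    (h' : IsJoint g' U) : g = g' := by
  have := (h.sub h').norm_eq
  rwa [sub_self, norm_zero, norm_eq_zero, sub_eq_zero] at this

theorem IsJoint.of_tendsto {g} {U : ℕ → Lp (Lp E 2 κ) 2 ρ}
    {g₀ : Lp E 2 (κ.prod ρ)} {U₀} (h : ∀ k, IsJoint (g k) (U k))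
    (hg : Tendsto g atTop (𝓝 g₀)) (hU : Tendsto U atTop (𝓝 U₀)) : IsJoint g₀ U₀ := by
  obtain ⟨a, ha, ha'⟩ := (tendstoInMeasure_of_tendsto_Lp hg).exists_seq_tendsto_ae
  obtain ⟨b, hb, hb'⟩ := (tendstoInMeasure_of_tendsto_Lp
    (hU.comp ha.tendsto_atTop)).exists_seq_tendsto_ae
  filter_upwards [ae_slices ha', hb', ae_all_iff.2 h] with t h1 h2 h3
  obtain ⟨c, hc, hc'⟩ := (tendstoInMeasure_of_tendsto_Lp h2).exists_seq_tendsto_ae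
  filter_upwards [h1, hc', ae_all_iff.2 h3] with x h4 h5 h6
  refine tendsto_nhds_unique ((h4.comp hb.tendsto_atTop).comp hc.tendsto_atTop) ?_
  refine h5.congr fun k => ?_
  simp only [Function.comp_apply, h6]

theorem exists_isJoint [CompleteSpace E] (U) : ∃ g : Lp E 2 (κ.prod ρ), IsJoint g U := by
  refine Lp.induction (by norm_num) (fun U => ∃ g : Lp E 2 (κ.prod ρ), IsJoint g U) ?_ ?_ ?_ U
  · intro c s hs hρs
    have hmem : MemLp (fun z => s.indicator (fun _ => (1 : ℝ)) z.2 • c z.1) 2 (κ.prod ρ) := by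
      have hm : AEStronglyMeasurable
          (fun z => s.indicator (fun _ => (1 : ℝ)) z.2 • c z.1) (κ.prod ρ) :=
        (((measurable_const.indicator hs).comp measurable_snd).aestronglyMeasurable).smul
          (Lp.aestronglyMeasurable c).comp_fst
      rw [memLp_two_iff_integrable_sq_norm hm]
      have h1 : Integrable (s.indicator fun _ => (1 : ℝ)) ρ :=
        (integrable_indicator_iff hs).2 (integrableOn_const hρs.ne)
      have h2 : Integrable (fun x => ‖c x‖ ^ 2) κ := (Lp.memLp c).integrable_norm_pow (by norm_num)
      refine (h2.mul_prod h1).congr (ae_of_all _ fun z => ?_)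
      by_cases hz : z.2 ∈ s <;> simp [hz]
    refine ⟨hmem.toLp _, ?_⟩
    rw [Lp.simpleFunc.coe_indicatorConst]
    filter_upwards [ae_slices hmem.coeFn_toLp,
      indicatorConstLp_coeFn (p := 2) (hs := hs) (hμs := hρs.ne) (c := c)] with t h1 h2
    rw [h2]
    by_cases ht : t ∈ s
    · filter_upwards [h1] with x hx
      rw [hx, indicator_of_mem ht, indicator_of_mem ht, one_smul]
    · filter_upwards [h1, Lp.coeFn_zero E 2 κ] with x hx h0
      rw [hx, indicator_of_notMem ht, indicator_of_notMem ht, zero_smul, h0]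
      rfl
  · rintro f f' hf hf' - ⟨g, hg⟩ ⟨g', hg'⟩
    exact ⟨g + g', hg.add hg'⟩
  · rw [← isSeqClosed_iff_isClosed]
    intro V V₀ hV hlim
    choose g hg using hV
    have hc : CauchySeq g := by
      refine cauchySeq_iff_tendsto_dist_atTop_0.2 ?_
      refine (cauchySeq_iff_tendsto_dist_atTop_0.1 hlim.cauchySeq).congr fun k => ?_
      rw [dist_eq_norm, dist_eq_norm, ((hg _).sub (hg _)).norm_eq]
    obtain ⟨g₀, hg₀⟩ := cauchySeq_tendsto_of_complete hc
    exact ⟨g₀, IsJoint.of_tendsto hg hg₀ hlim⟩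

/-- A function with values in `L²` as a function of two variables. -/
def jointL (κ : Measure X) (ρ : Measure Y) [SFinite κ] [SFinite ρ] (E : Type*)
    [NormedAddCommGroup E] [InnerProductSpace ℝ E] [CompleteSpace E] :
    Lp (Lp E 2 κ) 2 ρ →ₗᵢ[ℝ] Lp E 2 (κ.prod ρ) where
  toFun U := (exists_isJoint U).choose
  map_add' U U' := (exists_isJoint (U + U')).choose_spec.unique
    ((exists_isJoint U).choose_spec.add (exists_isJoint U').choose_spec)
  map_smul' c U := (exists_isJoint (c • U)).choose_spec.unique
    ((exists_isJoint U).choose_spec.smul c)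
  norm_map' U := (exists_isJoint U).choose_spec.norm_eq

theorem isJoint_jointL [CompleteSpace E] (U) :
    IsJoint (jointL κ ρ E U) U := (exists_isJoint U).choose_spec

end joint

/-! ### Jets of functions in `L²(0, T; H^m_0(Ω))` -/

/-- Lebesgue measure on `Ω × (0, T)`. -/
abbrev dom {d : ℕ} (Ω : Set (Euc d)) (T : ℝ) : Measure (Pt d) :=
  (volume.restrict Ω).prod (volume.restrict (Ioo 0 T))

section jets

variable {d n m : ℕ} {Ω : Set (Euc d)} {T : ℝ}

theorem dom_eq (Ω : Set (Euc d)) (T) : dom Ω T = volume.restrict (Ω ×ˢ Ioo 0 T) :=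
  Measure.prod_restrict _ _

/-- The derivatives of a function in `L²(0, T; H^m_0(Ω))`, as functions of `(x, t)`. -/
def jetL (d n m : ℕ) (Ω : Set (Euc d)) (T : ℝ) :
    L2T T (H0 d n m Ω) →L[ℝ] Jets d n m (dom Ω T) :=
  (PiLp.continuousLinearEquiv 2 ℝ (fun _ : LIdx d m => Lp (Euc n) 2 (dom Ω T))).symm.toContinuousLinearMap.comp
    (ContinuousLinearMap.pi fun α =>
      (jointL (volume.restrict Ω) (volume.restrict (Ioo 0 T)) (Euc n)).toContinuousLinearMap.comp
        ((H0.DL α).compLpL 2 (volume.restrict (Ioo 0 T))))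

notation "𝒥" => jetL _ _ _ _ _

theorem jetL_apply (u α) :
    jetL d n m Ω T u α = jointL _ _ (Euc n) ((H0.DL α).compLpL 2 (volume.restrict (Ioo 0 T)) u) := rfl

theorem jetL_slice (u) : ∀ᵐ t ∂(volume.restrict (Ioo 0 T)),
    ∀ᵐ x ∂(volume.restrict Ω), ∀ α, jetL d n m Ω T u α (x, t) = H0.D (u t) α x := by
  have h : ∀ α, ∀ᵐ t ∂(volume.restrict (Ioo 0 T)), ∀ᵐ x ∂(volume.restrict Ω),
      𝒥 u α (x, t) = H0.D (u t) α x := by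
    intro α
    filter_upwards [isJoint_jointL ((H0.DL α).compLpL 2 (volume.restrict (Ioo 0 T)) u),
      (H0.DL α).coeFn_compLpL (p := 2) u] with t h1 h2
    filter_upwards [h1] with x hx
    rw [jetL_apply, hx, h2]
    rfl
  filter_upwards [ae_all_iff.2 h] with t ht
  exact ae_all_iff.2 ht

theorem norm_jetL_apply (u α) : ‖jetL d n m Ω T u α‖ ^ 2 = ∫ t in Ioo 0 T, ‖H0.DL α (u t)‖ ^ 2 := by
  rw [jetL_apply, LinearIsometry.norm_map, norm_sq_eq_integral]
  refine integral_congr_ae ?_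
  filter_upwards [(H0.DL α).coeFn_compLpL (p := 2) u] with t h2
  rw [h2]

/-- The derivatives of order `m`. -/
def topL (d n m : ℕ) (Ω : Set (Euc d)) (T : ℝ) :
    L2T T (H0 d n m Ω) →L[ℝ] Lp (Top d n m) 2 (dom Ω T) :=
  (topPart d n m (dom Ω T)).comp (jetL d n m Ω T)

notation "𝒯" => topL _ _ _ _ _

theorem coeFn_topL (u) : ∀ᵐ p ∂(dom Ω T), ∀ a,
    topL d n m Ω T u p a = jetL d n m Ω T u a.1.low p a.2 := coeFn_topPart _

theorem exists_norm_sq_le_topL (hd : 0 < d) (hb : IsBounded Ω) (T) :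
    ∃ C : ℝ, 0 < C ∧ ∀ u : L2T T (H0 d n m Ω), ‖u‖ ^ 2 ≤ C * ‖topL d n m Ω T u‖ ^ 2 := by
  obtain ⟨C, hC, h⟩ := H0.exists_norm_sq_le (n := n) (m := m) hd hb
  refine ⟨C, hC, fun u => ?_⟩
  have hi : ∀ α, Integrable (fun t => ‖H0.DL α (u t)‖ ^ 2) (volume.restrict (Ioo 0 T)) := fun α =>
    (((H0.DL α).comp_memLp' (Lp.memLp u)).integrable_norm_pow (by norm_num) :)
  rw [topL, ContinuousLinearMap.comp_apply, norm_sq_topPart]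
  simp only [norm_jetL_apply]
  rw [← integral_finsetSum _ fun α _ => hi α.low, norm_sq_eq_integral, ← integral_const_mul]
  exact integral_mono ((Lp.memLp u).integrable_norm_pow (by norm_num))
    ((integrable_finsetSum _ fun α _ => hi α.low).const_mul C) fun t => h (u t)

end jets

/-! ### Test functions as functions of time -/

section tests

variable {d n m : ℕ} {Ω : Set (Euc d)} {T : ℝ} {I : Set ℝ} {φ : Pt d → Euc n}

/-- A time slice of a test function, as an element of `L²(Ω)`. -/
def sliceLp (hφ : IsTest (Ω ×ˢ I) φ) (t : ℝ) : L2 d n Ω := ((hφ.slice t).memLp (Ω := Ω)).toLp _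

theorem continuous_sliceLp (hb : IsBounded Ω) (hφ : IsTest (Ω ×ˢ I) φ) :
    Continuous (sliceLp hφ) := by
  have := isFiniteMeasure_restrict hb
  have huc := hφ.compact.uniformContinuous_of_continuous hφ.smooth.continuous
  rw [Metric.uniformContinuous_iff] at huc
  set K : ℝ := (measureUnivNNReal (volume.restrict Ω) : ℝ) ^ ((2 : ℝ≥0∞).toReal⁻¹) with hK
  have hK0 : 0 ≤ K := by positivity
  rw [Metric.continuous_iff]
  intro t ε hε
  obtain ⟨δ, hδ, h⟩ := huc (ε / (K + 1)) (by positivity)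
  refine ⟨δ, hδ, fun s hs => ?_⟩
  rw [dist_eq_norm]
  have h1 : ‖sliceLp hφ s - sliceLp hφ t‖ ≤ K * (ε / (K + 1)) := by
    refine Lp.norm_le_of_ae_bound (by positivity) ?_
    filter_upwards [Lp.coeFn_sub (sliceLp hφ s) (sliceLp hφ t),
      ((hφ.slice s).memLp (Ω := Ω)).coeFn_toLp, ((hφ.slice t).memLp (Ω := Ω)).coeFn_toLp]
      with x h2 h3 h4
    rw [h2, Pi.sub_apply, sliceLp, sliceLp, h3, h4, ← dist_eq_norm]
    refine (h ?_).le
    rw [Prod.dist_eq, dist_self]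
    exact max_lt hδ hs
  refine h1.trans_lt ?_
  rw [mul_div_assoc', div_lt_iff₀ (by positivity)]
  nlinarith

theorem continuous_testH0 (hb : IsBounded Ω) (hφ : IsTest (Ω ×ˢ I) φ) :
    Continuous fun t => testH0 m (fun x => φ (x, t)) (hφ.slice t) := by
  refine Continuous.subtype_mk ((PiLp.continuous_toLp 2 _).comp (continuous_pi fun α => ?_)) _
  exact continuous_sliceLp hb (hφ.spaceD α.1)

theorem memLp_of_continuous_time {F : Type*} [NormedAddCommGroup F] {f : ℝ → F}
    (hf : Continuous f) (T) : MemLp f 2 (volume.restrict (Ioo 0 T)) := by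
  obtain ⟨C, hC⟩ := (isCompact_Icc (a := 0) (b := T)).exists_bound_of_continuousOn hf.continuousOn
  refine MemLp.of_bound hf.aestronglyMeasurable C ?_
  filter_upwards [ae_restrict_mem measurableSet_Ioo] with t ht
  exact hC t (Ioo_subset_Icc_self ht)

/-- A test function as an element of `L²(0, T; H^m_0(Ω))`. -/
def testT (m : ℕ) (T : ℝ) (hb : IsBounded Ω) (hφ : IsTest (Ω ×ˢ I) φ) :
    L2T T (H0 d n m Ω) := (memLp_of_continuous_time (continuous_testH0 hb hφ) T).toLp _

/-- A test function as an element of `L²(0, T; L²(Ω))`. -/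
def sliceT (T : ℝ) (hb : IsBounded Ω) (hφ : IsTest (Ω ×ˢ I) φ) :
    L2T T (L2 d n Ω) := (memLp_of_continuous_time (continuous_sliceLp hb hφ) T).toLp _

theorem coeFn_testT (hb : IsBounded Ω) (hφ : IsTest (Ω ×ˢ I) φ) :
    testT m T hb hφ =ᵐ[volume.restrict (Ioo 0 T)]
      fun t => testH0 m (fun x => φ (x, t)) (hφ.slice t) := MemLp.coeFn_toLp _

theorem coeFn_sliceT (hb : IsBounded Ω) (hφ : IsTest (Ω ×ˢ I) φ) :
    sliceT T hb hφ =ᵐ[volume.restrict (Ioo 0 T)] sliceLp hφ := MemLp.coeFn_toLp _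

theorem compLpL_testT (hb : IsBounded Ω) (hφ : IsTest (Ω ×ˢ I) φ) (α) :
    (H0.DL α).compLpL 2 (volume.restrict (Ioo 0 T)) (testT m T hb hφ)
      = sliceT T hb (hφ.spaceD α.1) := by
  refine Lp.ext ?_
  filter_upwards [(H0.DL α).coeFn_compLpL (p := 2) (testT m T hb hφ), coeFn_testT hb hφ,
    coeFn_sliceT hb (hφ.spaceD α.1)] with t h1 h2 h3
  rw [h1, h2, h3]
  rfl

theorem IsTest.memLp_prod {U} (hφ : IsTest U φ) (ν : Measure (Pt d))
    [IsFiniteMeasureOnCompacts ν] : MemLp φ 2 ν :=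
  hφ.smooth.continuous.memLp_of_hasCompactSupport hφ.compact

theorem jointL_sliceT (hb : IsBounded Ω) (hφ : IsTest (Ω ×ˢ I) φ) :
    jointL _ _ (Euc n) (sliceT T hb hφ) = (hφ.memLp_prod (dom Ω T)).toLp φ := by
  refine (isJoint_jointL _).unique ?_
  filter_upwards [ae_slices (hφ.memLp_prod (dom Ω T)).coeFn_toLp, coeFn_sliceT hb hφ] with t h1 h2
  rw [h2]
  filter_upwards [h1, ((hφ.slice t).memLp (Ω := Ω)).coeFn_toLp] with x h3 h4
  rw [h3, sliceLp, h4]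

theorem jetL_testT (hb : IsBounded Ω) (hφ : IsTest (Ω ×ˢ I) φ) (α) :
    jetL d n m Ω T (testT m T hb hφ) α =ᵐ[dom Ω T] spaceD α.1 φ := by
  rw [jetL_apply, compLpL_testT, jointL_sliceT]
  exact MemLp.coeFn_toLp _

theorem topL_testT (hb : IsBounded Ω) (hφ : IsTest (Ω ×ˢ I) φ) :
    ∀ᵐ p ∂(dom Ω T), ∀ a, topL d n m Ω T (testT m T hb hφ) p a = spaceD a.1.1 φ p a.2 := by
  filter_upwards [coeFn_topL (testT m T hb hφ),
    ae_all_iff.2 fun α : LIdx d m => jetL_testT (T := T) hb hφ α] with p h1 h2 a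
  rw [h1, h2]
  rfl

/-- The embedding of `L²(0, T; H^m_0(Ω))` in `L²(0, T; L²(Ω))`. -/
def valT (d n m : ℕ) (Ω : Set (Euc d)) (T : ℝ) : L2T T (H0 d n m Ω) →L[ℝ] L2T T (L2 d n Ω) :=
  (H0.DL (LIdx.zero d m)).compLpL 2 (volume.restrict (Ioo 0 T))

theorem coeFn_valT (u) : valT d n m Ω T u =ᵐ[volume.restrict (Ioo 0 T)]
    fun t => H0.D (u t) (LIdx.zero d m) := (H0.DL (LIdx.zero d m)).coeFn_compLpL (p := 2) u

/-- The Riesz representative of an element of `L²(0, T; H^{-m}(Ω))`. -/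
def rieszT (f : L2T T (Hneg d n m Ω)) : L2T T (H0 d n m Ω) :=
  (InnerProductSpace.toDual ℝ (H0 d n m Ω)).symm.lipschitz.compLp (LinearIsometryEquiv.map_zero _) f

theorem inner_sliceLp (hφ : IsTest (Ω ×ˢ I) φ) (h : L2 d n Ω) (t) :
    inner ℝ h (sliceLp hφ t) = ∫ x in Ω, inner ℝ (h x) (φ (x, t)) :=
  inner_eq_integral .rfl (MemLp.coeFn_toLp _)

theorem inner_valT_sliceT (hb : IsBounded Ω) (u)
    (hφ : IsTest (Ω ×ˢ I) φ) : inner ℝ (valT d n m Ω T u) (sliceT T hb hφ)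
      = ∫ t in Ioo 0 T, ∫ x in Ω, inner ℝ (H0.D (u t) 𝟎 x) (φ (x, t)) := by
  rw [inner_eq_integral (coeFn_valT u) (coeFn_sliceT hb hφ)]
  simp only [inner_sliceLp]

theorem inner_rieszT_testT (hb : IsBounded Ω) (f)
    (hφ : IsTest (Ω ×ˢ I) φ) : inner ℝ (rieszT f) (testT m T hb hφ)
      = ∫ t in Ioo 0 T, f t (testH0 m (fun x => φ (x, t)) (hφ.slice t)) := by
  rw [inner_def]
  refine integral_congr_ae ?_
  filter_upwards [(InnerProductSpace.toDual ℝ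
    (H0 d n m Ω)).symm.lipschitz.coeFn_compLp (LinearIsometryEquiv.map_zero _) f, coeFn_testT hb hφ] with t h1 h2
  rw [rieszT, h1, h2, Function.comp_apply]
  exact InnerProductSpace.toDual_symm_apply

theorem inner_mulOp_testT (hb : IsBounded Ω) {a M} (ha : IsBddCoeff a M (dom Ω T)) (u)
    (hφ : IsTest (Ω ×ˢ I) φ) :
    inner ℝ (mulOp ha (topL d n m Ω T u)) (topL d n m Ω T (testT m T hb hφ))
      = ∑ α : MIdx d m, ∑ β : MIdx d m, ∑ i, ∑ j, ∫ t in Ioo 0 T, ∫ x in Ω,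
          a α β i j (x, t) * H0.D (u t) β.low x j * spaceD α.1 φ (x, t) i := by
  rw [inner_mulOp]
  have hi : ∀ α β i j, Integrable (fun p => a α β i j p * 𝒯 u p (β, j)
      * 𝒯 (testT m T hb hφ) p (α, i)) (dom Ω T) := by
    intro α β i j
    simp only [mul_assoc]
    exact ((memLp_coord (Lp.memLp (𝒯 u)) (β, j)).integrable_mul
      (memLp_coord (Lp.memLp (𝒯 (testT m T hb hφ))) (α, i))).bdd_mul
      (ha.measurable α β i j) (c := M) (by
        filter_upwards [ha.bound] with p hp
        exact hp α β i j)
  rw [integral_finsetSum _ fun α _ => integrable_finsetSum _ fun β _ =>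
    integrable_finsetSum _ fun i _ => integrable_finsetSum _ fun j _ => hi α β i j]
  refine sum_congr rfl fun α _ => ?_
  rw [integral_finsetSum _ fun β _ =>
    integrable_finsetSum _ fun i _ => integrable_finsetSum _ fun j _ => hi α β i j]
  refine sum_congr rfl fun β _ => ?_
  rw [integral_finsetSum _ fun i _ => integrable_finsetSum _ fun j _ => hi α β i j]
  refine sum_congr rfl fun i _ => ?_
  rw [integral_finsetSum _ fun j _ => hi α β i j]
  refine sum_congr rfl fun j _ => ?_
  rw [integral_prod_symm _ (hi α β i j)]
  refine integral_congr_ae ?_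
  filter_upwards [ae_slices (coeFn_topL u), ae_slices (topL_testT (m := m) (T := T) hb hφ),
    jetL_slice u] with t h1 h2 h3
  refine integral_congr_ae ?_
  filter_upwards [h1, h2, h3] with x h4 h5 h6
  rw [h4, h5, h6]

theorem isWeakSolution_iff (hb : IsBounded Ω) {a M} (ha : IsBddCoeff a M (dom Ω T)) {f}
    {h : L2 d n Ω} {u} : IsWeakSolution Ω T a f h u ↔
      MemLp (fun t => H0.D (u t) 𝟎) ∞ (volume.restrict (Ioo (0 : ℝ) T)) ∧
      ∀ (φ : Pt d → Euc n) (hφ : IsTest (Ω ×ˢ Iio T) φ),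
        -inner ℝ (valT d n m Ω T u) (sliceT T hb hφ.timeD)
          + inner ℝ (mulOp ha (𝒯 u)) (𝒯 (testT m T hb hφ))
        = inner ℝ (rieszT f) (testT m T hb hφ) + inner ℝ h (sliceLp hφ 0) := by
  simp only [inner_valT_sliceT, inner_mulOp_testT, inner_rieszT_testT, inner_sliceLp]
  exact ⟨fun H => ⟨H.1, H.2⟩, fun H => ⟨H.1, H.2⟩⟩

end tests

/-! ### Weak solutions of the initial-Dirichlet problem -/

section weak

variable {d n m : ℕ} {Ω : Set (Euc d)} {T : ℝ} {φ ψ : Pt d → Euc n}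

theorem L2T.eq_zero_of_norm_sq {V : Type*} [NormedAddCommGroup V] {u : L2T T V}
    (h : ‖u‖ ^ 2 = 0) : u = 0 := norm_eq_zero.1 (pow_eq_zero_iff two_ne_zero |>.1 h)

theorem jetL_injective : Injective (jetL d n m Ω T) := by
  rw [injective_iff_map_eq_zero]
  intro u hu
  have h1 : ‖u‖ ^ 2 = ∑ α, ‖𝒥 u α‖ ^ 2 := by
    have hi : ∀ α, Integrable (fun t => ‖H0.DL α (u t)‖ ^ 2) (volume.restrict (Ioo 0 T)) :=
      fun α => ((H0.DL α).comp_memLp' (Lp.memLp u)).integrable_norm_pow (by norm_num)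
    simp only [norm_jetL_apply]
    rw [← integral_finsetSum _ fun α _ => hi α, norm_sq_eq_integral]
    simp only [H0.norm_sq]
  rw [hu] at h1
  have h2 : ‖u‖ ^ 2 = 0 := by simpa using h1
  exact L2T.eq_zero_of_norm_sq h2

/-- Test functions on `Ω × [0, T)`. -/
def testSpace (n : ℕ) (Ω : Set (Euc d)) (T : ℝ) : Submodule ℝ (Pt d → Euc n) where
  carrier := {φ | IsTest (Ω ×ˢ Iio T) φ}
  zero_mem' := ⟨contDiff_const, HasCompactSupport.zero, by simp⟩
  add_mem' h h' := ⟨h.smooth.add h'.smooth, h.compact.add h'.compact,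
    (tsupport_add _ _).trans (union_subset h.support h'.support)⟩
  smul_mem' c φ h := ⟨h.smooth.const_smul c, h.compact.mono fun x hx h => hx (by simp [h]),
    (tsupport_smul_subset_right (fun _ => c) φ).trans h.support⟩

theorem sliceT_eq (hb : IsBounded Ω) {φ'} {c : ℝ}
    (h : IsTest (Ω ×ˢ Iio T) φ) (h' : IsTest (Ω ×ˢ Iio T) φ') (h'' : IsTest (Ω ×ˢ Iio T) ψ)
    (e : ψ = φ + c • φ') : sliceT T hb h'' = sliceT T hb h + c • sliceT T hb h' := by
  refine (jointL _ _ (Euc n)).injective ?_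
  rw [map_add, map_smul, jointL_sliceT, jointL_sliceT, jointL_sliceT, ← MemLp.toLp_const_smul,
    ← MemLp.toLp_add]
  exact toLp_congr _ _ (by rw [e])

theorem testT_eq (hb : IsBounded Ω) {φ' : Pt d → Euc n} {c : ℝ}
    (h : IsTest (Ω ×ˢ Iio T) φ) (h' : IsTest (Ω ×ˢ Iio T) φ') (h'' : IsTest (Ω ×ˢ Iio T) ψ)
    (e : ψ = φ + c • φ') : testT m T hb h'' = testT m T hb h + c • testT m T hb h' := by
  refine jetL_injective (PiLp.ext fun α => ?_)
  have h1 : spaceD α.1 ψ = spaceD α.1 φ + c • spaceD α.1 φ' := by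
    have hs : Smooth (c • φ') := h'.smooth.const_smul c
    rw [e, spaceD_add h.smooth hs, spaceD_const_smul h'.smooth]
  have h2 := sliceT_eq hb (h.spaceD α.1) (h'.spaceD α.1) (h''.spaceD α.1) h1
  rw [map_add, map_smul, PiLp.add_apply, PiLp.smul_apply]
  simp only [jetL_apply, compLpL_testT]
  rw [h2, map_add, map_smul]

theorem sliceLp_eq {φ'} {c : ℝ}
    (h : IsTest (Ω ×ˢ Iio T) φ) (h' : IsTest (Ω ×ˢ Iio T) φ') (h'' : IsTest (Ω ×ˢ Iio T) ψ)
    (e : ψ = φ + c • φ') (t) : sliceLp h'' t = sliceLp h t + c • sliceLp h' t := by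
  rw [sliceLp, sliceLp, sliceLp, ← MemLp.toLp_const_smul, ← MemLp.toLp_add]
  exact toLp_congr _ _ (by subst e; rfl)

/-- A map that respects the linear combinations `φ + c φ'`. -/
theorem isLinearMap_of_add_smul {M N : Type*} [AddCommGroup M] [Module ℝ M] [AddCommGroup N]
    [Module ℝ N] {F : M → N} (h : ∀ a b (c : ℝ), F (a + c • b) = F a + c • F b) :
    IsLinearMap ℝ F := by
  have h0 : F 0 = 0 := by simpa using h 0 0 1
  exact ⟨fun a b => by simpa using h a b 1, fun c a => by simpa [h0] using h 0 a c⟩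

/-- The inclusion of the test functions. -/
def testTL (m : ℕ) (hb : IsBounded Ω) (T : ℝ) :
    testSpace n Ω T →ₗ[ℝ] L2T T (H0 d n m Ω) :=
  IsLinearMap.mk' (fun φ => testT m T hb φ.2) (isLinearMap_of_add_smul fun a b c =>
    testT_eq hb a.2 b.2 (a + c • b).2 rfl)

/-- The map `φ ↦ ∂_t φ` on test functions. -/
def timeTL (hb : IsBounded Ω) (T : ℝ) : testSpace n Ω T →ₗ[ℝ] L2T T (L2 d n Ω) :=
  IsLinearMap.mk' (fun φ => sliceT T hb (IsTest.timeD φ.2)) (isLinearMap_of_add_smul fun a b c =>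
    sliceT_eq hb (IsTest.timeD a.2) (IsTest.timeD b.2) (IsTest.timeD (a + c • b).2) (by
      have e : timeD ((a + c • b : testSpace n Ω T) : Pt d → Euc n) = timeD (a.1 + c • b.1) := rfl
      have hs : Smooth (c • b.1) := b.2.smooth.const_smul c
      rw [e, timeD_add a.2.smooth hs, timeD_const_smul b.2.smooth]))

/-- The map `φ ↦ φ(0)` on test functions. -/
def initTL (n : ℕ) (Ω : Set (Euc d)) (T : ℝ) : testSpace n Ω T →ₗ[ℝ] L2 d n Ω :=
  IsLinearMap.mk' (fun φ => sliceLp φ.2 0) (isLinearMap_of_add_smul fun a b c =>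
    sliceLp_eq a.2 b.2 (a + c • b).2 rfl 0)

theorem valT_testT (hb : IsBounded Ω) (hφ : IsTest (Ω ×ˢ Iio T) φ) :
    valT d n m Ω T (testT m T hb hφ) = sliceT T hb hφ := by
  have := compLpL_testT (m := m) (T := T) hb hφ 𝟎
  rw [valT, this]
  congr 1
  exact spaceD_zero φ

theorem inner_sliceT (hb : IsBounded Ω) (hφ : IsTest (Ω ×ˢ Iio T) φ) (hψ : IsTest (Ω ×ˢ Iio T) ψ) :
    inner ℝ (sliceT T hb hφ) (sliceT T hb hψ) = ∫ p, inner ℝ (φ p) (ψ p) ∂(dom Ω T) := by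
  rw [← (jointL _ _ (Euc n)).inner_map_map, jointL_sliceT, jointL_sliceT]
  exact inner_eq_integral (MemLp.coeFn_toLp _) (MemLp.coeFn_toLp _)

/-- The energy identity for test functions. -/
theorem inner_testT_timeD (hT : 0 < T) (hb : IsBounded Ω) (hφ : IsTest (Ω ×ˢ Iio T) φ) :
    inner ℝ (valT d n m Ω T (testT m T hb hφ)) (sliceT T hb hφ.timeD)
      = -(1 / 2) * ‖sliceLp hφ 0‖ ^ 2 := by
  have hi : Integrable (fun p => (inner ℝ (φ p) (timeD φ p) : ℝ)) (dom Ω T) :=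
    (Continuous.inner hφ.smooth.continuous
      hφ.timeD.smooth.continuous).integrable_of_hasCompactSupport
      (hφ.compact.mono fun x hx h => hx (by simp only [h, inner_zero_left]))
  rw [valT_testT, inner_sliceT, integral_prod _ hi, ← real_inner_self_eq_norm_sq, inner_sliceLp,
    ← integral_const_mul]
  refine integral_congr_ae ?_
  filter_upwards [((hφ.slice 0).memLp (Ω := Ω)).coeFn_toLp] with x hx
  rw [sliceLp, hx, setIntegral_Ioo_eq hT.le]
  have hd : ∀ t, HasDerivAt (fun s => φ (x, s)) (timeD φ (x, t)) t := fun t =>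
    ((hφ.smooth.comp (by fun_prop : Smooth fun s => (x, s))).differentiable (by simp)
      t).hasDerivAt
  have hd2 : ∀ t ∈ uIcc 0 T, HasDerivAt (fun s => (1 / 2) * (inner ℝ (φ (x, s)) (φ (x, s)) : ℝ))
      (inner ℝ (φ (x, t)) (timeD φ (x, t))) t := by
    intro t _
    have := ((hd t).inner ℝ (hd t)).const_mul (1 / 2 : ℝ)
    rwa [real_inner_comm (φ (x, t)) (timeD φ (x, t)), ← two_mul, ← mul_assoc, one_div,
      inv_mul_cancel₀ two_ne_zero, one_mul, ← one_div] at this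
  rw [intervalIntegral.integral_eq_sub_of_hasDerivAt hd2
    ((Continuous.inner (hφ.smooth.continuous.comp (by fun_prop)) (hφ.timeD.smooth.continuous.comp
      (by fun_prop))).intervalIntegrable _ _)]
  rw [image_eq_zero_of_notMem_tsupport (f := φ) (x := (x, T))
    fun h => lt_irrefl T (hφ.support h).2, inner_zero_left]
  ring

/-- The weak formulation with flux `σ`. -/
def WeakEq (hb : IsBounded Ω) (F : L2T T (H0 d n m Ω)) (h : L2 d n Ω)
    (u : L2T T (H0 d n m Ω)) (σ : Lp (Top d n m) 2 (dom Ω T)) : Prop :=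
  ∀ (φ : Pt d → Euc n) (hφ : IsTest (Ω ×ˢ Iio T) φ),
    -inner ℝ (valT d n m Ω T u) (sliceT T hb hφ.timeD) + inner ℝ σ (𝒯 (testT m T hb hφ))
      = inner ℝ F (testT m T hb hφ) + inner ℝ h (sliceLp hφ 0)

theorem exists_inner_eq_of_coercive {V H₁ H₂ H₃ Φ : Type*} [NormedAddCommGroup V]
    [InnerProductSpace ℝ V] [CompleteSpace V] [NormedAddCommGroup H₁] [InnerProductSpace ℝ H₁]
    [CompleteSpace H₁] [NormedAddCommGroup H₂] [InnerProductSpace ℝ H₂] [CompleteSpace H₂]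
    [NormedAddCommGroup H₃] [InnerProductSpace ℝ H₃] [AddCommGroup Φ] [Module ℝ Φ]
    (P : L2T T V →L[ℝ] H₁) (B : L2T T V →L[ℝ] H₂) (Q : H₂ →L[ℝ] H₂) (y : Φ →ₗ[ℝ] L2T T V)
    (τ : Φ →ₗ[ℝ] H₁) (z : Φ →ₗ[ℝ] H₃) (hE : ∀ φ, inner ℝ (P (y φ)) (τ φ) = -(1 / 2) * ‖z φ‖ ^ 2)
    {μ C} (hμ : 0 < μ) (hC : 0 < C) (hQ : ∀ w, μ * ‖w‖ ^ 2 ≤ inner ℝ (Q w) w)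
    (hP : ∀ u, ‖u‖ ^ 2 ≤ C * ‖B u‖ ^ 2) (F) (h : H₃) :
    ∃ u, ∀ φ, -inner ℝ (P u) (τ φ) + inner ℝ (Q (B u)) (B (y φ))
      = inner ℝ F (y φ) + inner ℝ h (z φ) := by
  let K := adjointPair P B Q τ (B.toLinearMap.comp y)
  let L : Φ →ₗ[ℝ] ℝ := (innerSL ℝ F).toLinearMap.comp y + (innerSL ℝ h).toLinearMap.comp z
  set c := μ / C with hc
  have hc0 : 0 < c := by positivity
  have key : ∀ φ, |L φ| ≤ (‖F‖ / c + ‖h‖ * sqrt (2 / c)) * ‖K φ‖ := by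
    intro φ
    have h1 : inner ℝ (y φ) (K φ) = (1 / 2) * ‖z φ‖ ^ 2 + inner ℝ (Q (B (y φ))) (B (y φ)) := by
      rw [inner_adjointPair, hE]
      simp only [LinearMap.comp_apply, ContinuousLinearMap.coe_coe]
      ring
    have h2 := hQ (B (y φ))
    have h3 := hP (y φ)
    have h4 := real_inner_le_norm (y φ) (K φ)
    have h8 : L φ = inner ℝ F (y φ) + inner ℝ h (z φ) := rfl
    rw [h8]
    refine (abs_add_le _ _).trans
      ((add_le_add (abs_real_inner_le_norm _ _) (abs_real_inner_le_norm _ _)).trans ?_)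
    have hx : 0 ≤ ‖y φ‖ := norm_nonneg _
    have hy : 0 ≤ ‖z φ‖ := norm_nonneg _
    have hk : 0 ≤ ‖K φ‖ := norm_nonneg _
    generalize ‖B (y φ)‖ = w at *
    generalize ‖y φ‖ = x at *
    generalize ‖z φ‖ = y at *
    generalize ‖K φ‖ = k at *
    have h5 : c * x ^ 2 + (1 / 2) * y ^ 2 ≤ x * k := by
      have : c * x ^ 2 ≤ μ * w ^ 2 := by
        rw [hc, div_mul_eq_mul_div, div_le_iff₀ hC, mul_assoc]
        exact (mul_le_mul_of_nonneg_left h3 hμ.le).trans_eq (by ring)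
      linarith
    have h6 : x ≤ k / c := by
      rw [le_div_iff₀ hc0]
      rcases eq_or_lt_of_le hx with h0 | h0
      · rw [← h0, zero_mul]; exact hk
      · nlinarith [sq_nonneg y]
    have h7 : y ≤ sqrt (2 / c) * k := by
      have : y ^ 2 ≤ (sqrt (2 / c) * k) ^ 2 := by
        rw [mul_pow, Real.sq_sqrt (by positivity)]
        have h8 : x * k ≤ k / c * k := mul_le_mul_of_nonneg_right h6 hk
        have h9 : 2 / c * k ^ 2 = 2 * (k / c * k) := by ring
        nlinarith [sq_nonneg x]
      exact le_of_sq_le_sq this (by positivity)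
    calc _ ≤ ‖F‖ * (k / c) + ‖h‖ * (sqrt (2 / c) * k) := add_le_add
          (mul_le_mul_of_nonneg_left h6 (norm_nonneg _))
          (mul_le_mul_of_nonneg_left h7 (norm_nonneg _))
      _ = _ := by ring
  obtain ⟨u, hu⟩ := exists_inner_eq_of_le_norm K L _ key
  refine ⟨u, fun φ => ?_⟩
  have := hu φ
  rwa [inner_adjointPair] at this

theorem exists_weakEq (hd : 0 < d) (hT : 0 < T) (hb : IsBounded Ω) {a M μ}
    (ha : IsBddCoeff a M (dom Ω T)) (hμ : 0 < μ) (hl : LowerBound a μ (dom Ω T)) (F)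
    (h : L2 d n Ω) : ∃ u, WeakEq hb F h u (mulOp ha (topL d n m Ω T u)) := by
  obtain ⟨C, hC, hP⟩ := exists_norm_sq_le_topL (n := n) (m := m) hd hb T
  obtain ⟨u, hu⟩ := exists_inner_eq_of_coercive (V := H0 d n m Ω) (valT d n m Ω T) (topL d n m Ω T)
    (mulOp ha) (testTL m hb T) (timeTL hb T) (initTL n Ω T)
    (fun φ => inner_testT_timeD hT hb φ.2) hμ hC (inner_mulOp_self_ge ha hl) hP F h
  exact ⟨u, fun φ hφ => hu ⟨φ, hφ⟩⟩

/-- The adjoint of an operator on `L²(0, T; V)`. -/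
def adjT {V W : Type*} [NormedAddCommGroup V] [InnerProductSpace ℝ V] [CompleteSpace V]
    [NormedAddCommGroup W] [InnerProductSpace ℝ W] [CompleteSpace W] (B : L2T T V →L[ℝ] W) :
    W →L[ℝ] L2T T V := adjoint B

section
variable {V W : Type*} [NormedAddCommGroup V] [InnerProductSpace ℝ V]

theorem L2T.inner_sub_left (F F' G : L2T T V) :
    (inner ℝ (F - F') G : ℝ) = inner ℝ F G - inner ℝ F' G :=
  _root_.inner_sub_left F F' G

theorem inner_adjT [CompleteSpace V] [NormedAddCommGroup W] [InnerProductSpace ℝ W]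
    [CompleteSpace W] (B : L2T T V →L[ℝ] W) (w v) :
    (inner ℝ (adjT B w) v : ℝ) = inner ℝ w (B v) := B.adjoint_inner_left v w

end

theorem _root_.Continuous.integrable_smul {X : Type*} [NormedAddCommGroup X] [NormedSpace ℝ X]
    {f : ℝ → X} {η : ℝ → ℝ} {ν : Measure ℝ} (hη : Continuous η) (hc : HasCompactSupport η)
    (hf : Integrable f ν) : Integrable (fun t => η t • f t) ν := by
  obtain ⟨C, hC⟩ := hη.bounded_above_of_compact_support hc
  exact Integrable.bdd_smul hf C hη.aestronglyMeasurable (ae_of_all _ hC)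

theorem isClosed_evolEq {V H : Type*} [NormedAddCommGroup V] [InnerProductSpace ℝ V]
    [CompleteSpace V] [NormedAddCommGroup H] [InnerProductSpace ℝ H] [CompleteSpace H]
    (ι : V →L[ℝ] H) (u G : L2T T V) (h : H) {θ} (hθ : Smooth θ) (hc : HasCompactSupport θ) :
    IsClosed {v | -(∫ t in Ioo 0 T, deriv θ t * inner ℝ (ι (u t)) (ι v))
      = (∫ t in Ioo 0 T, θ t * inner ℝ (G t) v) + θ 0 * inner ℝ h (ι v)} := by
  have hθ' : Continuous (deriv θ) := hθ.continuous_deriv (by simp)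
  have e1 : ∀ v, ∫ t in Ioo 0 T, deriv θ t * inner ℝ (ι (u t)) (ι v)
      = inner ℝ (ι v) (∫ t in Ioo 0 T, deriv θ t • ι (u t)) := fun v => by
    rw [← integral_inner (hθ'.integrable_smul hc.deriv (ι.integrable_comp (L2T.integrable u)))]
    simp only [inner_smul_right]
    simp_rw [real_inner_comm (ι v)]
  have e2 : ∀ v, ∫ t in Ioo 0 T, θ t * inner ℝ (G t) v = inner ℝ v (∫ t in Ioo 0 T, θ t • G t) :=
    fun v => by
      rw [← integral_inner (hθ.continuous.integrable_smul hc (L2T.integrable G))]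
      simp only [inner_smul_right]
      simp_rw [real_inner_comm v]
  simp only [e1, e2]
  exact isClosed_eq (by fun_prop) (by fun_prop)

theorem EvolEq.two_inner_le {V H W : Type*} [NormedAddCommGroup V] [InnerProductSpace ℝ V]
    [CompleteSpace V] [NormedAddCommGroup H] [InnerProductSpace ℝ H] [CompleteSpace H]
    [NormedAddCommGroup W] [InnerProductSpace ℝ W] [CompleteSpace W] {ι : V →L[ℝ] H}
    (hι : Injective ι) (hT : 0 < T) {B : L2T T V →L[ℝ] W} {σ F u} {h : H}
    (hu : EvolEq ι u (F - adjT B σ) h) : 2 * inner ℝ σ (B u) ≤ ‖h‖ ^ 2 + 2 * inner ℝ F u := by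
  have := hu.inner_nonneg hι hT
  rw [L2T.inner_sub_left, inner_adjT] at this
  linarith

theorem EvolEq.memLp_top {V H : Type*} [NormedAddCommGroup V] [InnerProductSpace ℝ V]
    [CompleteSpace V] [NormedAddCommGroup H] [InnerProductSpace ℝ H] [CompleteSpace H]
    {ι : V →L[ℝ] H} (hι : Injective ι) (hT : 0 < T) {G u : L2T T V} {h : H}
    (hu : EvolEq ι u G h) : MemLp (fun t => ι (u t)) ∞ (volume.restrict (Ioo (0 : ℝ) T)) := by
  exact memLp_top_of_bound (ι.continuous.comp_aestronglyMeasurable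
    (Lp.aestronglyMeasurable u)) _ ((hu.norm_sq_le_const hι hT).mono fun t ht =>
      Real.le_sqrt_of_sq_le ht)

variable {hb : IsBounded Ω} {F F' u u' : L2T T (H0 d n m Ω)} {h h' : L2 d n Ω}
  {σ σ' : Lp (Top d n m) 2 (dom Ω T)}

theorem WeakEq.sub (hu : WeakEq hb F h u σ) (hu' : WeakEq hb F' h' u' σ') :
    WeakEq hb (F - F') (h - h') (u - u') (σ - σ') := by
  intro φ hφ
  have h1 := hu φ hφ
  have h2 := hu' φ hφ
  rw [map_sub]
  rw [L2T.inner_sub_left, L2T.inner_sub_left, inner_sub_left, inner_sub_left]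
  linarith

theorem WeakEq.evolEq (hu : WeakEq hb F h u σ) : EvolEq (H0.DL 𝟎) u
    (F - adjT (topL d n m Ω T) σ) h := by
  intro θ hθ hc hs v
  set G := F - adjT (topL d n m Ω T) σ with hG
  refine H0.induction (isClosed_evolEq (V := H0 d n m Ω) (H0.DL 𝟎) u G h hθ hc) ?_ v
  intro ψ hψ
  have hpt : ∀ {η : ℝ → ℝ}, Smooth η → HasCompactSupport η → tsupport η ⊆ Iio T →
      IsTest (Ω ×ˢ Iio T) (fun p => η p.2 • ψ p.1) := by
    intro η hη hηc hηs
    have hsub : tsupport (fun p => η p.2 • ψ p.1) ⊆ tsupport ψ ×ˢ tsupport η := by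
      refine closure_minimal (fun p hp => ⟨subset_tsupport _ fun h => hp ?_,
        subset_tsupport _ fun h => hp ?_⟩) ((isClosed_tsupport _).prod (isClosed_tsupport _))
      · simp only [h, smul_zero]
      · simp only [h, zero_smul]
    exact ⟨(hη.comp contDiff_snd).smul (hψ.smooth.comp contDiff_fst),
      (hψ.compact.isCompact.prod hηc.isCompact).of_isClosed_subset (isClosed_tsupport _) hsub,
      hsub.trans (prod_mono hψ.support hηs)⟩
  have hφ := hpt hθ hc hs
  have htd : timeD (fun p => θ p.2 • ψ p.1) = fun p => deriv θ p.2 • ψ p.1 := by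
    funext p
    exact ((hθ.differentiable (by simp) p.2).hasDerivAt.smul_const (ψ p.1)).deriv
  have hz : H0.DL 𝟎 (testH0 m ψ hψ) = (hψ.memLp (Ω := Ω)).toLp ψ := by
    rw [H0.DL_test]
    exact toLp_congr _ _ (by simp only [LIdx.zero, multiD_zero]; rfl)
  have main := hu _ hφ
  have m1 : inner ℝ (valT d n m Ω T u) (sliceT T hb hφ.timeD) = ∫ t in Ioo 0 T, deriv θ t
      * inner ℝ (H0.DL 𝟎 (u t)) (H0.DL 𝟎 (testH0 m ψ hψ)) := by
    rw [inner_def]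
    refine integral_congr_ae ?_
    filter_upwards [coeFn_valT u, coeFn_sliceT hb hφ.timeD] with t h1 h2
    rw [h1, h2, ← H0.DL_apply, hz, ← inner_smul_right, sliceLp, ← MemLp.toLp_const_smul]
    congr 1
    exact toLp_congr _ _ (by rw [htd]; rfl)
  have m2 : ∀ G : L2T T (H0 d n m Ω), inner ℝ G (testT m T hb hφ)
      = ∫ t in Ioo 0 T, θ t * inner ℝ (G t) (testH0 m ψ hψ) := by
    intro G
    rw [inner_eq_integral .rfl (coeFn_testT (m := m) hb hφ)]
    refine congrArg _ (funext fun t => ?_)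
    rw [← inner_smul_right]
    congr 1
    refine H0.ext_D fun α => ?_
    rw [map_smul, H0.DL_test, H0.DL_test, ← MemLp.toLp_const_smul]
    refine toLp_congr _ _ ?_
    rw [← multiD_const_smul hψ.smooth]
    rfl
  have m3 : inner ℝ h (sliceLp hφ 0) = θ 0 * inner ℝ h (H0.DL 𝟎 (testH0 m ψ hψ)) := by
    rw [hz, ← inner_smul_right, sliceLp, ← MemLp.toLp_const_smul]
    rfl
  rw [← m1, ← m2 G, ← m3, hG, L2T.inner_sub_left, inner_adjT]
  linarith

theorem WeakEq.inner_le (ho : IsOpen Ω) (hT : 0 < T) (hu : WeakEq hb F h u σ) :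
    2 * inner ℝ σ (𝒯 u) ≤ ‖h‖ ^ 2 + 2 * inner ℝ F u :=
  EvolEq.two_inner_le (V := H0 d n m Ω) (H0.injective_DL_zero ho hb) hT hu.evolEq

theorem WeakEq.bounded (ho : IsOpen Ω) (hT : 0 < T) (hu : WeakEq hb F h u σ) :
    MemLp (fun t => H0.D (u t) 𝟎) ∞ (volume.restrict (Ioo (0 : ℝ) T)) :=
  EvolEq.memLp_top (V := H0 d n m Ω) (H0.injective_DL_zero ho hb) hT hu.evolEq

theorem isWeakSolution_iff_weakEq (ho : IsOpen Ω) (hb : IsBounded Ω) (hT : 0 < T) {a M}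
    (ha : IsBddCoeff a M (dom Ω T)) {f} :
    IsWeakSolution Ω T a f h u ↔ WeakEq hb (rieszT f) h u (mulOp ha (𝒯 u)) :=
  (isWeakSolution_iff hb ha).trans ⟨fun H => H.2, fun H => ⟨WeakEq.bounded ho hT H, H⟩⟩

theorem le_of_sq_le {C μ x y z w} (hC : 0 < C) (hμ : 0 < μ) (hy : 0 ≤ y)
    (hz : 0 ≤ z) (h1 : 2 * (μ * w ^ 2) ≤ z ^ 2 + 2 * (y * x)) (h2 : x ^ 2 ≤ C * w ^ 2) :
    x ≤ C / μ * y + sqrt (C / μ) * z := by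
  set c := C / μ with hc
  have hc0 : 0 < c := by positivity
  have h5 : x ^ 2 ≤ c * (z ^ 2 + y * x) := by
    have h6 : μ * w ^ 2 ≤ z ^ 2 + y * x := by nlinarith [sq_nonneg z]
    calc x ^ 2 ≤ C * w ^ 2 := h2
      _ = c * (μ * w ^ 2) := by rw [hc]; field_simp
      _ ≤ _ := mul_le_mul_of_nonneg_left h6 hc0.le
  set s := sqrt c with hs
  have hs2 : s ^ 2 = c := Real.sq_sqrt hc0.le
  have hs0 : 0 ≤ s := Real.sqrt_nonneg c
  by_contra! hlt
  have a1 : 0 ≤ c * y := by positivity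
  have a2 : 0 ≤ s * z := by positivity
  have h7 : x ^ 2 ≤ (s * z) ^ 2 + c * y * x := by rw [mul_pow, hs2]; linarith
  nlinarith

/-- A uniform bound for weak solutions. -/
theorem exists_norm_le_of_weakEq (hd : 0 < d) (ho : IsOpen Ω) (hb : IsBounded Ω) (hT : 0 < T) {μ}
    (hμ : 0 < μ) (F) (h : L2 d n Ω) : ∃ K, (F = 0 → h = 0 → K = 0) ∧ ∀ (a : Coeff d n m) (M : ℝ)
      (ha : IsBddCoeff a M (dom Ω T)), LowerBound a μ (dom Ω T) →
      ∀ u, WeakEq hb F h u (mulOp ha (𝒯 u)) → ‖u‖ ≤ K := by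
  obtain ⟨C, hC, hP⟩ := exists_norm_sq_le_topL (n := n) (m := m) hd hb T
  refine ⟨C / μ * ‖F‖ + sqrt (C / μ) * ‖h‖, fun hF hh => by simp [hF, hh], fun a M ha hl u hu => ?_⟩
  have h1 := hu.inner_le ho hT
  have h2 := inner_mulOp_self_ge ha hl (𝒯 u)
  have h3 := hP u
  have h4 := real_inner_le_norm F u
  exact le_of_sq_le hC hμ (norm_nonneg F) (norm_nonneg h) (by linarith) h3

theorem WeakEq.unique (hd : 0 < d) (ho : IsOpen Ω) (hT : 0 < T) {a M μ}
    (ha : IsBddCoeff a M (dom Ω T)) (hμ : 0 < μ) (hl : LowerBound a μ (dom Ω T))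
    (hu : WeakEq hb F h u (mulOp ha (𝒯 u))) (hu' : WeakEq hb F h u' (mulOp ha (𝒯 u'))) :
    u = u' := by
  obtain ⟨K, hK, hbd⟩ := exists_norm_le_of_weakEq hd ho hb hT hμ (0 : L2T T (H0 d n m Ω))
    (0 : L2 d n Ω)
  have h1 := hu.sub hu'
  rw [sub_self, sub_self, ← map_sub, ← map_sub] at h1
  have h2 := hbd a M ha hl _ h1
  rw [hK rfl rfl] at h2
  exact sub_eq_zero.1 (norm_le_zero_iff.1 h2)

theorem existsUnique_isWeakSolution (hd : 0 < d) (ho : IsOpen Ω) (hb : IsBounded Ω) (hT : 0 < T)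
    {a : Coeff d n m} {M μ} (ha : IsBddCoeff a M (dom Ω T)) (hμ : 0 < μ)
    (hl : LowerBound a μ (dom Ω T)) (f) (h : L2 d n Ω) : ∃! u, IsWeakSolution Ω T a f h u := by
  obtain ⟨u, hu⟩ := exists_weakEq hd hT hb ha hμ hl (rieszT f) h
  refine ⟨u, (isWeakSolution_iff_weakEq ho hb hT ha).2 hu, fun w hw => ?_⟩
  exact ((isWeakSolution_iff_weakEq ho hb hT ha).1 hw).unique hd ho hT ha hμ hl hu

end weak

/-! ### Products of Sobolev functions with cut-off functions -/

section leibniz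

variable {d n m : ℕ} {Ω : Set (Euc d)} {T : ℝ} {χ : Pt d → ℝ}
  {b : LIdx d m → LIdx d m → Pt d → ℝ}

/-- The coefficients of the Leibniz rule for `D^α (χ u)`. -/
structure IsLeibniz (n : ℕ) (χ : Pt d → ℝ) (b : LIdx d m → LIdx d m → Pt d → ℝ) :
    Prop where
  smooth : ∀ α γ, Smooth (b α γ)
  support : ∀ α γ, tsupport (b α γ) ⊆ tsupport χ
  diag : ∀ α, b α α = χ
  lower : ∀ α γ, γ ≠ α → ∑ i, α.1 i ≤ ∑ i, γ.1 i → b α γ = 0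
  eq : ∀ (α : LIdx d m) (u : Euc d → Euc n), Smooth u → ∀ x t,
    multiD α.1 (fun x => χ (x, t) • u x) x = ∑ γ, b α γ (x, t) • multiD γ.1 u x

theorem exists_isLeibniz (n m) (hχ : Smooth χ) :
    ∃ b : LIdx d m → LIdx d m → Pt d → ℝ, IsLeibniz n χ b := by
  classical
  choose F hL hF using fun α : LIdx d m => exists_multiD_smul (n := n) hχ α.1 α.2
  choose c hc1 hc2 hc3 hc4 using hL
  refine ⟨fun α => Function.update (c α) α χ, fun α γ => ?_, fun α γ => ?_,
    fun α => Function.update_self _ _ _, fun α γ h1 h2 => ?_, fun α u hu x t => ?_⟩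
  · rcases eq_or_ne γ α with rfl | h
    · rwa [Function.update_self]
    · rw [Function.update_of_ne h]
      exact hc1 α γ
  · rcases eq_or_ne γ α with rfl | h
    · rw [Function.update_self]
    · rw [Function.update_of_ne h]
      exact hc2 α γ
  · rw [Function.update_of_ne h1]
    exact hc3 α γ h2
  · rw [hF α u hu, hc4 α u hu, ← Finset.add_sum_erase _ _ (Finset.mem_univ α),
      ← Finset.add_sum_erase _ _ (Finset.mem_univ α), Function.update_self, hc3 α α le_rfl]
    simp only [Pi.zero_apply, zero_smul, zero_add]
    congr 1
    exact sum_congr rfl fun γ hγ => by rw [Function.update_of_ne (Finset.ne_of_mem_erase hγ)]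

/-- The derivatives of the product of `χ` with a function whose derivatives are `J`. -/
def leib (b : LIdx d m → LIdx d m → Pt d → ℝ) (J : LIdx d m → Pt d → Euc n)
    (α : LIdx d m) (p : Pt d) : Euc n := ∑ γ, b α γ p • J γ p

theorem IsLeibniz.spaceD_smul (h : IsLeibniz n χ b) {φ : Pt d → Euc n} (hφ : Smooth φ)
    (α) : spaceD α.1 (fun p => χ p • φ p) = leib b (fun γ => spaceD γ.1 φ) α := by
  funext p
  exact h.eq α _ (contDiff_slice hφ p.2) p.1 p.2

theorem IsLeibniz.leib_eq (h : IsLeibniz n χ b) (J : LIdx d m → Pt d → Euc n) (α p) :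
    leib b J α p = χ p • J α p + ∑ γ ∈ Finset.univ.filter fun γ =>
      ∑ i, γ.1 i < ∑ i, α.1 i, b α γ p • J γ p := by
  classical
  rw [leib, ← Finset.add_sum_erase _ _ (Finset.mem_univ α), h.diag]
  congr 1
  refine (Finset.sum_subset (fun γ hγ => ?_) fun γ hγ hn => ?_).symm
  · rw [Finset.mem_filter] at hγ
    refine Finset.mem_erase.2 ⟨?_, Finset.mem_univ _⟩
    rintro rfl
    exact lt_irrefl _ hγ.2
  · rw [h.lower α γ (Finset.ne_of_mem_erase hγ), Pi.zero_apply, zero_smul]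
    simpa using hn

theorem IsLeibniz.leib_zero (h : IsLeibniz n χ b) (J : LIdx d m → Pt d → Euc n)
    (p) : leib b J 𝟎 p = χ p • J 𝟎 p := by
  rw [h.leib_eq]
  simp [LIdx.zero]

theorem IsLeibniz.exists_bound (h : IsLeibniz n χ b) (hc : HasCompactSupport χ) :
    ∃ B, 0 ≤ B ∧ ∀ α γ p, |b α γ p| ≤ B := by
  have h1 : ∀ q : LIdx d m × LIdx d m, ∃ B, ∀ p, ‖b q.1 q.2 p‖ ≤ B := fun q =>
    (h.smooth q.1 q.2).continuous.bounded_above_of_compact_support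
      (hc.of_isClosed_subset (isClosed_tsupport _) (h.support q.1 q.2))
  choose B hB using h1
  refine ⟨∑ q, |B q|, by positivity, fun α γ p => (hB (α, γ) p).trans ((le_abs_self _).trans ?_)⟩
  exact single_le_sum (f := fun q => |B q|) (fun _ _ => abs_nonneg _) (Finset.mem_univ (α, γ))

theorem IsLeibniz.norm_leib_le {B} (hB : ∀ α γ p, |b α γ p| ≤ B) (J : LIdx d m → Pt d → Euc n)
    (α p) : ‖leib b J α p‖ ≤ B * ∑ γ, ‖J γ p‖ := by
  rw [mul_sum]
  refine norm_sum_le_of_le _ fun γ _ => ?_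
  rw [norm_smul]
  exact mul_le_mul_of_nonneg_right (hB α γ p) (norm_nonneg _)

theorem IsLeibniz.memLp_leib (h : IsLeibniz n χ b) (hc : HasCompactSupport χ) {ν : Measure (Pt d)}
    {J : LIdx d m → Pt d → Euc n} (hJ : ∀ γ, MemLp (J γ) 2 ν) (α) : MemLp (leib b J α) 2 ν := by
  obtain ⟨B, -, hB⟩ := h.exists_bound hc
  refine memLp_finsetSum _ fun γ _ => (hJ γ).of_le_mul (c := B)
    ((h.smooth α γ).continuous.aestronglyMeasurable.smul (hJ γ).1) (ae_of_all _ fun p => ?_)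
  rw [norm_smul]
  exact mul_le_mul_of_nonneg_right (hB α γ p) (norm_nonneg _)

theorem IsLeibniz.isTest_smul {U} (h : IsLeibniz n χ b) (hχ : IsTest U χ) {g : Pt d → Euc n}
    (hg : Smooth g) (α γ) : IsTest U (fun p => b α γ p • g p) :=
  hχ.of_tsupport_subset ((h.smooth α γ).smul hg)
    ((tsupport_smul_subset_left (b α γ) g).trans (h.support α γ))

theorem IsLeibniz.integral_slice (h : IsLeibniz n χ b) (hχ : IsTest (Ω ×ˢ Ioo 0 T) χ) {g}
    (hg : Smooth g) (α t) (v : H0 d n m Ω) :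
    ∫ x in Ω, inner ℝ (g x) (∑ γ, b α γ (x, t) • H0.D v γ x)
      = (-1) ^ (∑ i, α.1 i) * ∫ x in Ω, inner ℝ (multiD α.1 g x) (χ (x, t) • H0.D v 𝟎 x) := by
  have hT : ∀ γ γ' {g : Euc d → Euc n}, Smooth g → IsTest Ω fun x => b γ γ' (x, t) • g x :=
    fun γ γ' g hg => (h.isTest_smul hχ (hg.comp contDiff_fst) γ γ').slice t
  have h1 := fun γ => (hT α γ hg).memLp (Ω := Ω)
  have h2 := (hT α α (contDiff_multiD hg α.1)).memLp (Ω := Ω)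
  have hi : ∀ γ, Integrable (fun x => inner ℝ (b α γ (x, t) • g x) (H0.D v γ x))
      (volume.restrict Ω) := fun γ => by
    refine (L2.integrable_inner (𝕜 := ℝ) ((h1 γ).toLp _) (H0.D v γ)).congr ?_
    filter_upwards [(h1 γ).coeFn_toLp] with x hx
    rw [hx]
  have e1 : ∫ x in Ω, inner ℝ (g x) (∑ γ, b α γ (x, t) • H0.D v γ x)
      = ∑ γ, inner ℝ ((h1 γ).toLp _) (H0.DL γ v) := by
    simp only [inner_toLp_DL]
    rw [← integral_finsetSum _ fun γ _ => hi γ]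
    refine integral_congr_ae (ae_of_all _ fun x => ?_)
    simp only [inner_sum, real_inner_smul_left, real_inner_smul_right]
  have e2 : ∫ x in Ω, inner ℝ (multiD α.1 g x) (χ (x, t) • H0.D v 𝟎 x)
      = inner ℝ (h2.toLp _) (H0.DL 𝟎 v) := by
    rw [inner_toLp_DL]
    simp only [h.diag, real_inner_smul_left, real_inner_smul_right]
  rw [e1, e2]
  refine H0.induction (p := fun v => ∑ γ, inner ℝ ((h1 γ).toLp _) (H0.DL γ v)
    = (-1) ^ (∑ i, α.1 i) * inner ℝ (h2.toLp _) (H0.DL 𝟎 v)) ?_ (fun φ hφ => ?_) v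
  · exact isClosed_eq (by fun_prop) (by fun_prop)
  have e3 : ∀ {f : Euc d → Euc n} (hf : MemLp f 2 (volume.restrict Ω)) (γ : LIdx d m),
      inner ℝ (hf.toLp f) (H0.DL γ (testH0 m φ hφ)) = ∫ x, inner ℝ (f x) (multiD γ.1 φ x) := by
    intro f hf γ
    rw [H0.DL_test, inner_toLp_test hf (hφ.multiD γ.1)]
  simp only [e3]
  have hφχ : IsTest Ω fun x => χ (x, t) • φ x := by
    have := hT α α hφ.smooth
    rwa [h.diag] at this
  have e4 := integral_inner_multiD hg hφχ α.1
  simp only [h.eq α φ hφ.smooth, inner_sum, real_inner_smul_right] at e4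
  simp only [h.diag, real_inner_smul_left, LIdx.zero, multiD_zero]
  rw [← e4, integral_finsetSum]
  intro γ _
  simp only [← real_inner_smul_left]
  exact (Continuous.inner (hT α γ hg).smooth.continuous
    (contDiff_multiD hφ.smooth γ.1).continuous).integrable_of_hasCompactSupport
    ((hT α γ hg).compact.mono fun x hx h => hx (by simp only [h, inner_zero_left]))

theorem integrable_inner_of_memLp {X E : Type*} [MeasurableSpace X] {ν : Measure X}
    [NormedAddCommGroup E] [InnerProductSpace ℝ E] {f g : X → E} (hf : MemLp f 2 ν)
    (hg : MemLp g 2 ν) : Integrable (fun x => (inner ℝ (f x) (g x) : ℝ)) ν := by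
  refine (L2.integrable_inner (𝕜 := ℝ) (hf.toLp f) (hg.toLp g)).congr ?_
  filter_upwards [hf.coeFn_toLp, hg.coeFn_toLp] with x h1 h2
  rw [h1, h2]

theorem IsLeibniz.integral_inner_leib (h : IsLeibniz n χ b) (hχ : IsTest (Ω ×ˢ Ioo 0 T) χ) {g}
    (hg : Smooth g) (α u) :
    ∫ p, inner ℝ (g p) (leib b (fun γ => jetL d n m Ω T u γ) α p) ∂(dom Ω T)
      = (-1) ^ (∑ i, α.1 i) * ∫ p, inner ℝ (spaceD α.1 g p)
          (leib b (fun γ => jetL d n m Ω T u γ) 𝟎 p) ∂(dom Ω T) := by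
  have hi : ∀ (α : LIdx d m) {g : Pt d → Euc n}, Smooth g → Integrable (fun p =>
      (inner ℝ (g p) (leib b (fun γ => 𝒥 u γ) α p) : ℝ)) (dom Ω T) := by
    intro α g hg
    simp only [leib, inner_sum, real_inner_smul_right, ← real_inner_smul_left]
    exact integrable_finsetSum _ fun γ _ => integrable_inner_of_memLp
      ((h.isTest_smul hχ hg α γ).memLp_prod _) (Lp.memLp _)
  rw [integral_prod_symm _ (hi α hg), integral_prod_symm _ (hi _ (contDiff_spaceD hg α.1)),
    ← integral_const_mul]
  refine integral_congr_ae ?_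
  filter_upwards [jetL_slice u] with t ht
  have := h.integral_slice hχ (contDiff_slice hg t) α t (u t)
  refine Eq.trans (integral_congr_ae ?_) (this.trans ?_)
  · filter_upwards [ht] with x hx
    simp only [leib, hx]
  · congr 1
    refine integral_congr_ae ?_
    filter_upwards [ht] with x hx
    rw [h.leib_zero, hx]
    rfl

/-- The extension by zero of a function on `Ω × (0, T)`. -/
def extZero {E : Type*} [Zero E] (Ω : Set (Euc d)) (T : ℝ) (f : Pt d → E) : Pt d → E :=
  (Ω ×ˢ Ioo 0 T).indicator f

theorem integral_extZero {E F : Type*} [NormedAddCommGroup E] [NormedAddCommGroup F]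
    [NormedSpace ℝ F] (ho : IsOpen Ω) (f) (G : E → Pt d → F) (hG : ∀ p, G 0 p = 0) :
    ∫ p, G (extZero Ω T f p) p = ∫ p, G (f p) p ∂(dom Ω T) := by
  rw [dom_eq, ← integral_indicator (ho.measurableSet.prod measurableSet_Ioo)]
  refine integral_congr_ae (ae_of_all _ fun p => ?_)
  by_cases hp : p ∈ Ω ×ˢ Ioo 0 T
  · simp only [extZero, indicator_of_mem hp]
  · simp only [extZero, indicator_of_notMem hp, hG]

theorem memLp_extZero {E : Type*} [NormedAddCommGroup E] (ho : IsOpen Ω) {f : Pt d → E}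
    (hf : MemLp f 2 (dom Ω T)) : MemLp (extZero Ω T f) 2 := by
  rw [dom_eq] at hf
  exact (memLp_indicator_iff_restrict (ho.measurableSet.prod measurableSet_Ioo)).2 hf

theorem exists_boxSupp (hb : IsBounded Ω) (T) : ∃ R, 0 ≤ R ∧
    ∀ {E : Type} [Zero E] (f : Pt d → E), BoxSupp R (extZero Ω T f) := by
  obtain ⟨R, hR⟩ := hb.exists_norm_le
  refine ⟨max |R| |T|, le_max_of_le_left (abs_nonneg _), fun f p hp => ?_⟩
  have hp : p ∈ Ω ×ˢ Ioo 0 T := by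
    by_contra h
    exact hp (indicator_of_notMem h f)
  refine ⟨fun i => le_max_of_le_left ?_, le_max_of_le_right ?_⟩
  · exact ((PiLp.norm_apply_le p.1 i).trans (hR _ hp.1)).trans (le_abs_self _)
  · rw [abs_of_pos hp.2.1]
    exact hp.2.2.le.trans (le_abs_self _)

theorem exWave_dil (k : Freq d) (c : Fin n → ℂ) (a τ) : (fun p => exWave k c (dil a τ p))
      = stWave (fun j => a * (2 * π * k.1 j)) (τ * (2 * π * k.2)) c := by
  funext p
  ext i
  simp only [exWave, stWave, dil, PiLp.smul_apply, smul_eq_mul]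
  congr 6
  · exact sum_congr rfl fun j _ => by ring
  · ring

theorem symb_mul (a ξ) (α : Fin d → ℕ) :
    symb (fun j => a * ξ j) α = (a ^ (∑ i, α i) : ℝ) * symb ξ α := by
  simp only [symb, Complex.ofReal_mul, Complex.ofReal_pow]
  rw [← Finset.prod_pow_eq_pow_sum, ← Finset.prod_mul_distrib]
  exact Finset.prod_congr rfl fun j _ => by rw [← mul_pow]; ring

theorem IsLeibniz.hasOscDeriv (h : IsLeibniz n χ b) (hχ : IsTest (Ω ×ˢ Ioo 0 T) χ) (ho : IsOpen Ω)
    (hb : IsBounded Ω) (u) {ε} (hε : ε ≠ 0) :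
    HasOscDeriv m ε fun α => extZero Ω T (leib b (fun γ => jetL d n m Ω T u γ) α) := by
  classical
  intro α i k
  set E : Pt d → Pt d := dil ε⁻¹ (ε ^ (2 * m))⁻¹
  have := isFiniteMeasure_restrict hb
  have hI : ∀ β : LIdx d m, ∫ p, extZero Ω T (leib b (fun γ => 𝒥 u γ) β) p i • ex k (E p)
      = ∫ p, leib b (fun γ => 𝒥 u γ) β p i • ex k (E p) ∂(dom Ω T) := fun β =>
    integral_extZero ho _ (fun (v : Euc n) p => v i • ex k (E p)) (by simp)
  rw [hI, hI]
  have hre : ∀ (β : LIdx d m) (c : ℂ), (c * ∫ p, leib b (fun γ => 𝒥 u γ) β p i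
      • ex k (E p) ∂(dom Ω T)).re = ∫ p, inner ℝ (exWave k (Pi.single i c) (E p))
        (leib b (fun γ => 𝒥 u γ) β p) ∂(dom Ω T) := by
    intro β c
    have h1 : Integrable (fun p => leib b (fun γ => 𝒥 u γ) β p i • ex k (E p)) (dom Ω T) :=
      ((memLp_coord (h.memLp_leib hχ.compact (fun γ => Lp.memLp _) β) i).integrable
        one_le_two).smul_bdd 1 ((continuous_ex k).comp
          (continuous_dil _ _)).aestronglyMeasurable (ae_of_all _ fun p => (norm_ex k _).le)
    rw [← integral_const_mul]
    refine (integral_re (h1.const_mul c)).symm.trans (integral_congr_ae (ae_of_all _ fun p => ?_))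
    simp only [PiLp.inner_apply, exWave_apply]
    rw [sum_eq_single i (by simp +contextual) (by simp)]
    simp [real_smul]
    ring
  refine eq_of_forall_re_mul fun c => ?_
  rw [← mul_assoc, ← mul_assoc, hre]
  have hw : ∀ c : Fin n → ℂ, Smooth fun p => exWave k c (E p) := fun c => by
    rw [exWave_dil]
    exact contDiff_stWave _ _ _
  have hD : spaceD α.1 (fun p => exWave k (Pi.single i (c * (ε ^ (∑ i, α.1 i) : ℝ))) (E p))
      = fun p => exWave k (Pi.single i (symK k α.1 * c)) (E p) := by
    rw [exWave_dil, exWave_dil, spaceD_stWave, symb_mul]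
    congr 1
    funext j
    rcases eq_or_ne j i with rfl | hj
    · rw [Pi.single_eq_same, Pi.single_eq_same, symK]
      have h1 : ((ε⁻¹ ^ (∑ i, α.1 i) : ℝ) : ℂ) * ((ε ^ (∑ i, α.1 i) : ℝ) : ℂ) = 1 := by
        rw [← Complex.ofReal_mul, ← mul_pow, inv_mul_cancel₀ hε, one_pow, Complex.ofReal_one]
      linear_combination symb (fun j => 2 * π * (k.1 j : ℝ)) α.1 * c * h1
    · rw [Pi.single_eq_of_ne hj, Pi.single_eq_of_ne hj, mul_zero]
  rw [h.integral_inner_leib hχ (hw _) α u, hD, ← hre, conj_symK, ← Complex.re_ofReal_mul]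
  push_cast
  ring_nf

end leibniz

/-! ### Oscillating test functions -/

section oscillating

variable {d n m : ℕ} {Ω : Set (Euc d)} {T : ℝ} {χ : Pt d → ℝ}
  {b : LIdx d m → LIdx d m → Pt d → ℝ} {A : Coeff d n m} {M : ℝ}

theorem multiD_comp_smul {φ : Euc d → Euc n} (h : Smooth φ) (a : ℝ) (α) :
    multiD α (fun x => φ (a • x)) = fun x => a ^ (∑ i, α i) • multiD α φ (a • x) := by
  induction α using multiIndex_induction with
  | h0 => simp [multiD_zero]
  | hs α i ih =>
    have hs : Smooth fun x => φ (a • x) := h.comp (contDiff_const_smul a)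
    rw [← partialD_multiD hs, ih, ← partialD_multiD h, sum_add_single]
    funext x
    have h1 : HasFDerivAt (fun x => multiD α φ (a • x))
        ((fderiv ℝ (multiD α φ) (a • x)).comp (a • ContinuousLinearMap.id ℝ (Euc d))) x :=
      (((contDiff_multiD h α).differentiable (by simp) (a • x)).hasFDerivAt).comp x
        ((hasFDerivAt_id x).const_smul a)
    have h2 := h1.const_smul (a ^ (∑ i, α i))
    rw [partialD]
    refine (congrArg (fun L => L (single i (1 : ℝ))) h2.fderiv).trans ?_
    simp [partialD, smul_smul, pow_succ]

theorem spaceD_dil {ψ : Pt d → Euc n} (h : Smooth ψ) (a τ α p) :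
    spaceD α (fun p => ψ (dil a τ p)) p = a ^ (∑ i, α i) • spaceD α ψ (dil a τ p) :=
  congrFun (multiD_comp_smul (contDiff_slice h (τ * p.2)) a α) p.1

theorem contDiff_dil (a τ) : Smooth (dil a τ : Pt d → Pt d) := by unfold dil; fun_prop

theorem timeD_smul_dil {ψ : Pt d → Euc n} (hχ : Smooth χ) (h : Smooth ψ) (a τ p) :
    timeD (fun p => χ p • ψ (dil a τ p)) p
      = fderiv ℝ χ p (0, 1) • ψ (dil a τ p) + τ • χ p • timeD ψ (dil a τ p) := by
  have h0 : HasDerivAt (fun s => (p.1, s)) ((0 : Euc d), (1 : ℝ)) p.2 :=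
    (hasDerivAt_const _ _).prodMk (hasDerivAt_id _)
  have h1 : HasDerivAt (fun s => χ (p.1, s)) (fderiv ℝ χ p (0, 1)) p.2 :=
    ((hχ.differentiable (by simp) p).hasFDerivAt).comp_hasDerivAt p.2 h0
  have h2 : HasDerivAt (fun s => ψ (a • p.1, s)) (timeD ψ (dil a τ p)) (τ * p.2) :=
    ((h.comp (by fun_prop : Smooth fun s => (a • p.1, s))).differentiable (by simp)
      _).hasDerivAt
  have h3 : HasDerivAt (fun s => ψ (a • p.1, τ * s)) (τ • timeD ψ (dil a τ p)) p.2 := by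
    have := h2.scomp p.2 ((hasDerivAt_id p.2).const_mul τ)
    simp only [mul_one] at this
    exact this
  refine (h1.smul h3).deriv.trans ?_
  rw [add_comm, smul_comm τ]
  rfl

/-- The norm of the embedding `L^∞(ν) → L²(ν)`. -/
def bddConst {X : Type*} [MeasurableSpace X] (ν : Measure X) [IsFiniteMeasure ν] : ℝ :=
  (measureUnivNNReal ν : ℝ) ^ ((2 : ℝ≥0∞).toReal⁻¹)

theorem abs_integral_inner_le {X E : Type*} [MeasurableSpace X] {ν : Measure X} [IsFiniteMeasure ν]
    [NormedAddCommGroup E] [InnerProductSpace ℝ E] (f : Lp E 2 ν) {g C} (hC : 0 ≤ C)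
    (hg : AEStronglyMeasurable g ν) (hb : ∀ᵐ x ∂ν, ‖g x‖ ≤ C) :
    |∫ x, inner ℝ (f x) (g x) ∂ν| ≤ ‖f‖ * (bddConst ν * C) := by
  have h1 := MemLp.of_bound (p := 2) hg C hb
  have e : ∫ x, inner ℝ (f x) (g x) ∂ν = inner ℝ f (h1.toLp g) :=
    (inner_eq_integral .rfl h1.coeFn_toLp).symm
  rw [e]
  refine (abs_real_inner_le_norm _ _).trans (mul_le_mul_of_nonneg_left ?_ (norm_nonneg _))
  refine Lp.norm_le_of_ae_bound hC ?_
  filter_upwards [h1.coeFn_toLp, hb] with x h2 h3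
  rwa [h2]

theorem tendsto_inner_of_tendsto_zero {V H : Type*} [NormedAddCommGroup V] [InnerProductSpace ℝ V]
    [CompleteSpace V] [NormedAddCommGroup H] [InnerProductSpace ℝ H] [CompleteSpace H]
    {P : L2T T V →L[ℝ] H} (hP : Injective P) {x : ℕ → L2T T V} {C}
    (hx : ∀ k, ‖x k‖ ≤ C) (h : Tendsto (fun k => P (x k)) atTop (𝓝 0)) (v) :
    Tendsto (fun k => inner ℝ (x k) v) atTop (𝓝 (0 : ℝ)) := by
  have hd : Dense (Submodule.span ℝ (range (gram P)) : Set (L2T T V)) :=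
    (dense_range_gram hP).mono Submodule.subset_span
  have := tendsto_inner_of_dense (l := atTop) (y := 0) (Eventually.of_forall hx) hd (fun w hw => ?_) v
  · simpa only [inner_zero_left] using this
  · obtain ⟨y, rfl⟩ := hw
    simp only [← inner_gram_comm, inner_gram, inner_zero_left]
    simpa only [inner_zero_left] using h.inner (𝕜 := ℝ) (tendsto_const_nhds (x := P y))

theorem L2T.inner_smul_comm {V : Type*} [NormedAddCommGroup V] [InnerProductSpace ℝ V] (c)
    (F G : L2T T V) : (inner ℝ (c • F) G : ℝ) = c * inner ℝ G F := by
  rw [real_inner_smul_left, real_inner_comm]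

theorem norm_sq_eq_sum_jetL (u) : ‖u‖ ^ 2 = ∑ α, ‖jetL d n m Ω T u α‖ ^ 2 := by
  have hi : ∀ α, Integrable (fun t => ‖H0.DL α (u t)‖ ^ 2) (volume.restrict (Ioo 0 T)) :=
    fun α => ((H0.DL α).comp_memLp' (Lp.memLp u)).integrable_norm_pow (by norm_num)
  simp only [norm_jetL_apply]
  rw [← integral_finsetSum _ fun α _ => hi α, norm_sq_eq_integral]
  simp only [H0.norm_sq]

theorem WeakEq.integral_eq {hb : IsBounded Ω} {F u} {h : L2 d n Ω} {σ} (hu : WeakEq hb F h u σ) {φ}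
    (hφ : IsTest (Ω ×ˢ Iio T) φ) (h0 : ∀ x, φ (x, 0) = 0) :
    -(∫ p, inner ℝ (𝒥 u 𝟎 p) (timeD φ p) ∂(dom Ω T))
      + ∫ p, inner ℝ (σ p) (topFun (fun γ => spaceD γ.1 φ) p) ∂(dom Ω T)
      = inner ℝ F (testT m T hb hφ) := by
  have h1 := hu φ hφ
  rw [inner_sliceLp] at h1
  simp only [h0, inner_zero_right, integral_zero, add_zero] at h1
  have e : inner ℝ (valT d n m Ω T u) (sliceT T hb hφ.timeD)
      = ∫ p, inner ℝ (𝒥 u 𝟎 p) (timeD φ p) ∂(dom Ω T) := by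
    have e1 : inner ℝ (valT d n m Ω T u) (sliceT T hb hφ.timeD)
        = inner ℝ (𝒥 u 𝟎) ((hφ.timeD.memLp_prod (dom Ω T)).toLp _) := by
      rw [← jointL_sliceT hb]
      exact ((jointL _ _ (Euc n)).inner_map_map _ _).symm
    rw [e1]
    exact inner_eq_integral .rfl (MemLp.coeFn_toLp _)
  rw [← h1, e, inner_def]
  congr 1
  · refine integral_congr_ae ?_
    filter_upwards [topL_testT (m := m) (T := T) hb hφ] with p hp
    congr 1
    ext a
    exact (hp a).symm

theorem exists_bound_cellTest (m) (ψ : cellTests d n) :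
    ∃ C, 0 ≤ C ∧ ∀ (γ : LIdx d m) p, ‖spaceD γ.1 ψ.1 p‖ ≤ C := by
  choose C hC using fun γ : LIdx d m => exists_bound_of_periodic
    (contDiff_spaceD (IsCellTest.smooth ψ.2) γ.1).continuous (IsCellTest.per_space ψ.2 γ.1)
  refine ⟨∑ γ, C γ, sum_nonneg fun γ _ => (hC γ).1, fun γ p => ((hC γ).2 p).trans ?_⟩
  exact single_le_sum (f := C) (fun γ _ => (hC γ).1) (Finset.mem_univ γ)

theorem norm_sum_le_card_nsmul {ι E : Type*} [NormedAddCommGroup E] {s} {f : ι → E}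
    {c} (h : ∀ a ∈ s, ‖f a‖ ≤ c) : ‖∑ a ∈ s, f a‖ ≤ s.card • c :=
  (norm_sum_le _ _).trans (Finset.sum_le_card_nsmul _ _ _ h)

theorem norm_le_card_mul {ι : Type*} [Fintype ι] {v : EuclideanSpace ℝ ι} {c}
    (h : ∀ a, |v a| ≤ c) : ‖v‖ ≤ card ι * c := by
  classical
  have e : v = ∑ a, v a • single a (1 : ℝ) := by
    ext b
    simp [Pi.single_apply]
  rw [e, ← Finset.card_univ, ← nsmul_eq_mul]
  refine norm_sum_le_card_nsmul fun a _ => ?_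
  rw [norm_smul, PiLp.norm_single, norm_one, mul_one]
  exact h a

theorem norm_jetL_le (u α) : ‖jetL d n m Ω T u α‖ ≤ ‖u‖ := by
  refine le_of_sq_le_sq ?_ (norm_nonneg u)
  rw [norm_sq_eq_sum_jetL]
  exact single_le_sum (f := fun α => ‖𝒥 u α‖ ^ 2) (fun _ _ => sq_nonneg _) (Finset.mem_univ α)

theorem valT_injective (ho : IsOpen Ω) (hb : IsBounded Ω) : Injective (valT d n m Ω T) := by
  rw [injective_iff_map_eq_zero]
  intro u hu
  refine Lp.ext ?_
  have h0 := coeFn_valT u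
  rw [hu] at h0
  filter_upwards [h0, Lp.coeFn_zero (L2 d n Ω) 2 (volume.restrict (Ioo 0 T)),
    Lp.coeFn_zero (H0 d n m Ω) 2 (volume.restrict (Ioo 0 T))] with t h1 h2 h3
  rw [h3]
  refine H0.injective_DL_zero ho hb ?_
  rw [Pi.zero_apply, map_zero, H0.DL_apply, ← h1, h2, Pi.zero_apply]

/-- Testing the equation with `ε^m χ ψ(x/ε, t/ε^{2m})`. -/
theorem tendsto_oscillating_test (hm : 0 < m) (ho : IsOpen Ω) {hb : IsBounded Ω}
    (hχ : IsTest (Ω ×ˢ Ioo 0 T) χ) (hL : IsLeibniz n χ b) (ψ : cellTests d n) {F} {h : L2 d n Ω} {ε}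
    (hε : ∀ k, ε k ∈ Ioo (0 : ℝ) 1) (hε0 : Tendsto ε atTop (𝓝 0)) {u : ℕ → L2T T (H0 d n m Ω)}
    {σ : ℕ → Lp (Top d n m) 2 (dom Ω T)} {K} (hK : ∀ k, ‖u k‖ ≤ K) (hσ : ∀ k, ‖σ k‖ ≤ K)
    (hu : ∀ k, WeakEq hb F h (u k) (σ k)) :
    Tendsto (fun k => -((ε k ^ m)⁻¹ * ∫ p, inner ℝ (jetL d n m Ω T (u k) 𝟎 p)
        (χ p • timeD ψ.1 (dil (ε k)⁻¹ (ε k ^ (2 * m))⁻¹ p)) ∂(dom Ω T))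
      + ∫ p, inner ℝ (σ k p) (χ p • topFun (fun γ : LIdx d m => spaceD γ.1 ψ.1)
        (dil (ε k)⁻¹ (ε k ^ (2 * m))⁻¹ p)) ∂(dom Ω T)) atTop (𝓝 0) := by
  have := isFiniteMeasure_restrict hb
  have hψ : Smooth ψ.1 := IsCellTest.smooth ψ.2
  let E : ℕ → Pt d → Pt d := fun k => dil (ε k)⁻¹ (ε k ^ (2 * m))⁻¹
  have hE : ∀ k, Smooth (E k) := fun k => contDiff_dil _ _
  obtain ⟨B, hB0, hB⟩ := hL.exists_bound hχ.compact
  obtain ⟨C, hC0, hC⟩ := exists_bound_cellTest m ψ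
  have hψC : ∀ p, ‖ψ.1 p‖ ≤ C := fun p => by
    have := hC 𝟎 p
    rwa [show 𝟎.1 = 0 from rfl, spaceD_zero] at this
  have hχt : Smooth fun p => fderiv ℝ χ p (0, 1) :=
    (hχ.smooth.fderiv_right (m := ∞) (by simp)).clm_apply contDiff_const
  obtain ⟨C', hC'⟩ := hχt.continuous.bounded_above_of_compact_support
    (hχ.compact.fderiv_apply (𝕜 := ℝ) _)
  have hC'0 : 0 ≤ C' := (norm_nonneg _).trans (hC' 0)
  have hΦ : ∀ k, IsTest (Ω ×ˢ Ioo 0 T) fun p => χ p • ψ.1 (E k p) := fun k =>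
    hχ.of_tsupport_subset (hχ.smooth.smul (hψ.comp (hE k))) (tsupport_smul_subset_left χ _)
  have hΦ' : ∀ k, IsTest (Ω ×ˢ Iio T) fun p => χ p • ψ.1 (E k p) := fun k =>
    ⟨(hΦ k).smooth, (hΦ k).compact, (hΦ k).support.trans (prod_mono le_rfl Ioo_subset_Iio_self)⟩
  have hpow : ∀ k j, j ≤ m → ε k ^ m * (ε k)⁻¹ ^ j = ε k ^ (m - j) := fun k j hj => by
    rw [inv_pow, ← div_eq_mul_inv, pow_sub₀ _ (hε k).1.ne' hj, div_eq_mul_inv]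
  have hsp : ∀ k (γ : LIdx d m) p, spaceD γ.1 (fun p => χ p • ψ.1 (E k p)) p
      = leib b (fun γ p => (ε k)⁻¹ ^ (∑ i, γ.1 i) • spaceD γ.1 ψ.1 (E k p)) γ p := fun k γ p => by
    refine (congrFun (hL.spaceD_smul (hψ.comp (hE k)) γ) p).trans ?_
    exact sum_congr rfl fun γ' _ => congrArg _ (spaceD_dil hψ _ _ γ'.1 p)
  have hbd : ∀ k (γ : LIdx d m) p, ‖ε k ^ m • spaceD γ.1 (fun p => χ p • ψ.1 (E k p)) p‖
      ≤ card (LIdx d m) * (B * C) := fun k γ p => by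
    rw [hsp, leib, Finset.smul_sum]
    rw [← Finset.card_univ, ← nsmul_eq_mul]
    refine norm_sum_le_card_nsmul fun γ' _ => ?_
    rw [smul_comm, smul_smul (ε k ^ m), hpow k _ γ'.2, norm_smul, norm_smul]
    refine mul_le_mul (hB γ γ' p) ?_ (by positivity) hB0
    rw [norm_pow, Real.norm_of_nonneg (hε k).1.le]
    exact (mul_le_of_le_one_left (norm_nonneg _) (pow_le_one₀ (hε k).1.le (hε k).2.le)).trans
      (hC γ' _)
  have htop : ∀ k p (a : MIdx d m × Fin n), |(ε k ^ m • topFun (fun γ : LIdx d m =>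
      spaceD γ.1 (fun p => χ p • ψ.1 (E k p))) p - χ p • topFun (fun γ : LIdx d m =>
        spaceD γ.1 ψ.1) (E k p)) a| ≤ ε k * (card (LIdx d m) * (B * C)) := fun k p a => by
    have e : ε k ^ m • spaceD a.1.low.1 (fun p => χ p • ψ.1 (E k p)) p
        - χ p • spaceD a.1.low.1 ψ.1 (E k p) = ∑ γ ∈ Finset.univ.filter fun γ : LIdx d m =>
          ∑ i, γ.1 i < ∑ i, a.1.low.1 i, b a.1.low γ p • ε k ^ (m - ∑ i, γ.1 i)
            • spaceD γ.1 ψ.1 (E k p) := by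
      rw [hsp, hL.leib_eq, smul_add, Finset.smul_sum, smul_comm (ε k ^ m), smul_smul (ε k ^ m),
        show ∑ i, a.1.low.1 i = m from a.1.2, hpow k m le_rfl, Nat.sub_self, pow_zero, one_smul,
        add_sub_cancel_left]
      exact sum_congr rfl fun γ _ => by rw [smul_comm, smul_smul (ε k ^ m), hpow k _ γ.2]
    refine (PiLp.norm_apply_le (ε k ^ m • spaceD a.1.low.1 (fun p => χ p • ψ.1 (E k p)) p
        - χ p • spaceD a.1.low.1 ψ.1 (E k p)) a.2).trans ?_
    rw [e]
    have h2 := norm_sum_le_card_nsmul (c := ε k * (B * C)) (s := Finset.univ.filter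
      fun γ : LIdx d m => ∑ i, γ.1 i < ∑ i, a.1.low.1 i) (f := fun γ => b a.1.low γ p
        • ε k ^ (m - ∑ i, γ.1 i) • spaceD γ.1 ψ.1 (E k p)) fun γ hγ => ?_
    · refine h2.trans ?_
      rw [nsmul_eq_mul]
      have : (0 : ℝ) ≤ ε k * (B * C) := mul_nonneg (hε k).1.le (mul_nonneg hB0 hC0)
      calc _ ≤ (card (LIdx d m) : ℝ) * (ε k * (B * C)) :=
            mul_le_mul_of_nonneg_right (by exact_mod_cast Finset.card_le_univ _) this
        _ = _ := by ring
    · rw [Finset.mem_filter, show ∑ i, a.1.low.1 i = m from a.1.2] at hγ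
      rw [norm_smul, norm_smul, norm_pow, Real.norm_of_nonneg (hε k).1.le]
      have h1 : ε k ^ (m - ∑ i, γ.1 i) ≤ ε k := by
        simpa using pow_le_pow_of_le_one (hε k).1.le (hε k).2.le (show 1 ≤ m - ∑ i, γ.1 i by omega)
      calc _ ≤ B * (ε k * C) := mul_le_mul (hB _ γ p)
            (mul_le_mul h1 (hC γ _) (norm_nonneg _) (hε k).1.le)
              (mul_nonneg (pow_nonneg (hε k).1.le _) (norm_nonneg _)) hB0
        _ = _ := by ring
  set N : ℝ := card (LIdx d m) * (B * C) with hN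
  have hN0 : 0 ≤ N := by positivity
  let x : ℕ → L2T T (H0 d n m Ω) := fun k => ε k ^ m • testT m T hb (hΦ' k)
  have hjx : ∀ k α, ∀ᵐ p ∂(dom Ω T), 𝒥 (x k) α p
      = ε k ^ m • spaceD α.1 (fun p => χ p • ψ.1 (E k p)) p := fun k α => by
    have e : 𝒥 (x k) α = ε k ^ m • 𝒥 (testT m T hb (hΦ' k)) α := by rw [map_smul, PiLp.smul_apply]
    filter_upwards [Lp.coeFn_smul (ε k ^ m) (𝒥 (testT m T hb (hΦ' k)) α),
      jetL_testT (T := T) hb (hΦ' k) α] with p h1 h2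
    rw [e, h1, Pi.smul_apply, h2]
  have hx : ∀ k, ‖x k‖ ≤ sqrt (card (LIdx d m) * (bddConst (dom Ω T) * N) ^ 2) := by
    intro k
    refine Real.le_sqrt_of_sq_le ?_
    rw [norm_sq_eq_sum_jetL, ← Finset.card_univ, ← nsmul_eq_mul]
    refine Finset.sum_le_card_nsmul _ _ _ fun α _ => pow_le_pow_left₀ (norm_nonneg _) ?_ 2
    refine Lp.norm_le_of_ae_bound hN0 ?_
    filter_upwards [hjx k α] with p hp
    rw [hp]
    exact hbd k α p
  have hpm : Tendsto (fun k => ε k ^ m) atTop (𝓝 0) := by simpa [hm.ne'] using hε0.pow m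
  have hv : Tendsto (fun k => valT d n m Ω T (x k)) atTop (𝓝 0) := by
    refine squeeze_zero_norm (a := fun k => bddConst (dom Ω T) * (ε k ^ m * (B * C)))
      (fun k => ?_) (by simpa using (hpm.mul_const (B * C)).const_mul (bddConst (dom Ω T)))
    rw [← (jointL (volume.restrict Ω) (volume.restrict (Ioo 0 T)) (Euc n)).norm_map]
    refine Lp.norm_le_of_ae_bound (mul_nonneg (pow_nonneg (hε k).1.le _) (mul_nonneg hB0 hC0)) ?_
    filter_upwards [hjx k 𝟎] with p hp
    refine (congrArg norm hp).trans_le ?_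
    rw [show 𝟎.1 = 0 from rfl, spaceD_zero, norm_smul, norm_smul,
      Real.norm_of_nonneg (pow_nonneg (hε k).1.le _)]
    refine mul_le_mul_of_nonneg_left (mul_le_mul ?_ (hψC _) (norm_nonneg _) hB0)
      (pow_nonneg (hε k).1.le _)
    have := hB 𝟎 𝟎 p
    rwa [hL.diag] at this
  have hF := tendsto_inner_of_tendsto_zero (V := H0 d n m Ω) (valT_injective ho hb) hx hv F
  have hg1 : ∀ k, IsTest (Ω ×ˢ Ioo 0 T) fun p => fderiv ℝ χ p (0, 1) • ψ.1 (E k p) := fun k =>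
    hχ.of_tsupport_subset (hχt.smul (hψ.comp (hE k)))
      ((tsupport_smul_subset_left _ _).trans (tsupport_fderiv_apply_subset ℝ _))
  have hg2 : ∀ k {ζ : Pt d → Euc n}, Smooth ζ →
      IsTest (Ω ×ˢ Ioo 0 T) fun p => χ p • ζ (E k p) := fun k ζ hζ =>
    hχ.of_tsupport_subset (hχ.smooth.smul (hζ.comp (hE k))) (tsupport_smul_subset_left χ _)
  have hm1 : ∀ k, MemLp (fun p => χ p • topFun (fun γ : LIdx d m => spaceD γ.1 ψ.1) (E k p)) 2
      (dom Ω T) := fun k =>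
    memLp_topFun (v := fun (γ : LIdx d m) p => χ p • spaceD γ.1 ψ.1 (E k p)) fun γ =>
      (hg2 k (contDiff_spaceD hψ γ.1)).memLp_prod _
  have hm2 : ∀ k, MemLp (fun p => ε k ^ m • topFun (fun γ : LIdx d m =>
      spaceD γ.1 fun p => χ p • ψ.1 (E k p)) p) 2 (dom Ω T) := fun k =>
    (memLp_topFun (ν := dom Ω T) fun γ => ((hΦ k).spaceD γ.1).memLp_prod _).const_smul (ε k ^ m)
  have l1 : Tendsto (fun k => ε k ^ m * ∫ p, inner ℝ (𝒥 (u k) 𝟎 p)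
      (fderiv ℝ χ p (0, 1) • ψ.1 (E k p)) ∂(dom Ω T)) atTop (𝓝 0) := by
    refine squeeze_zero_norm (a := fun k => ε k ^ m * (K * (bddConst (dom Ω T) * (C' * C))))
      (fun k => ?_) (by simpa using hpm.mul_const _)
    rw [norm_mul, Real.norm_of_nonneg (pow_nonneg (hε k).1.le _)]
    refine mul_le_mul_of_nonneg_left ?_ (pow_nonneg (hε k).1.le _)
    refine (abs_integral_inner_le _ (mul_nonneg hC'0 hC0)
      (hg1 k).smooth.continuous.aestronglyMeasurable (ae_of_all _ fun p => ?_)).trans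
      (mul_le_mul_of_nonneg_right ((norm_jetL_le _ _).trans (hK k)) ?_)
    · rw [norm_smul]
      exact mul_le_mul (hC' p) (hψC _) (norm_nonneg _) hC'0
    · unfold bddConst
      positivity
  have l2 : Tendsto (fun k => ∫ p, inner ℝ (σ k p) (ε k ^ m • topFun (fun γ : LIdx d m =>
      spaceD γ.1 (fun p => χ p • ψ.1 (E k p))) p - χ p • topFun (fun γ : LIdx d m =>
        spaceD γ.1 ψ.1) (E k p)) ∂(dom Ω T)) atTop (𝓝 0) := by
    refine squeeze_zero_norm (a := fun k => K * (bddConst (dom Ω T)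
      * (card (MIdx d m × Fin n) * (ε k * N)))) (fun k => ?_)
      (by simpa using (((hε0.mul_const N).const_mul _).const_mul _).const_mul K)
    have hc : 0 ≤ (card (MIdx d m × Fin n) : ℝ) * (ε k * N) :=
      mul_nonneg (Nat.cast_nonneg _) (mul_nonneg (hε k).1.le hN0)
    refine (abs_integral_inner_le _ hc ((hm2 k).1.sub (hm1 k).1) (ae_of_all _ fun p =>
      norm_le_card_mul (htop k p))).trans (mul_le_mul_of_nonneg_right (hσ k) ?_)
    have : 0 ≤ bddConst (dom Ω T) := by unfold bddConst; positivity
    exact mul_nonneg this hc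
  refine Tendsto.congr (fun k => ?_) (by simpa using (hF.add l1).sub l2)
  have h1 := (hu k).integral_eq (hΦ' k) fun x => image_eq_zero_of_notMem_tsupport
    (f := fun p => χ p • ψ.1 (E k p)) (x := (x, 0)) fun hx => lt_irrefl (0 : ℝ) ((hΦ k).support hx).2.1
  have i1 := integrable_inner_of_memLp (Lp.memLp (𝒥 (u k) 𝟎)) ((hg1 k).memLp_prod (dom Ω T))
  have i2 := integrable_inner_of_memLp (Lp.memLp (𝒥 (u k) 𝟎))
    ((hg2 k (contDiff_timeD hψ)).memLp_prod (dom Ω T))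
  have e1 : ∫ p, inner ℝ (𝒥 (u k) 𝟎 p) (timeD (fun p => χ p • ψ.1 (E k p)) p) ∂(dom Ω T)
      = (∫ p, inner ℝ (𝒥 (u k) 𝟎 p)
        (fderiv ℝ χ p (0, 1) • ψ.1 (E k p)) ∂(dom Ω T)) + (ε k ^ (2 * m))⁻¹
        * ∫ p, inner ℝ (𝒥 (u k) 𝟎 p) (χ p • timeD ψ.1 (E k p)) ∂(dom Ω T) := by
    rw [← integral_const_mul, ← integral_add i1 (i2.const_mul _)]
    refine integral_congr_ae (ae_of_all _ fun p => ?_)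
    simp only []
    rw [timeD_smul_dil hχ.smooth hψ, inner_add_right, real_inner_smul_right _ _ (ε k ^ (2 * m))⁻¹]
  have e2 : ∫ p, inner ℝ (σ k p) (ε k ^ m • topFun (fun γ : LIdx d m =>
      spaceD γ.1 (fun p => χ p • ψ.1 (E k p))) p - χ p • topFun (fun γ : LIdx d m =>
        spaceD γ.1 ψ.1) (E k p)) ∂(dom Ω T)
      = ε k ^ m * (∫ p, inner ℝ (σ k p) (topFun (fun γ : LIdx d m =>
          spaceD γ.1 (fun p => χ p • ψ.1 (E k p))) p) ∂(dom Ω T))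
        - ∫ p, inner ℝ (σ k p) (χ p • topFun (fun γ : LIdx d m =>
          spaceD γ.1 ψ.1) (E k p)) ∂(dom Ω T) := by
    simp only [inner_sub_right]
    rw [integral_sub (integrable_inner_of_memLp (Lp.memLp _) (hm2 k))
      (integrable_inner_of_memLp (Lp.memLp _) (hm1 k)), ← integral_const_mul]
    simp only [real_inner_smul_right]
  have e3 : inner ℝ (x k) F = ε k ^ m * inner ℝ F (testT m T hb (hΦ' k)) :=
    L2T.inner_smul_comm _ _ _
  rw [e1] at h1
  rw [e2, e3, ← h1]
  have e4 : ε k ^ m * (ε k ^ (2 * m))⁻¹ = (ε k ^ m)⁻¹ := by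
    rw [two_mul, pow_add, mul_inv, mul_inv_cancel_left₀ (pow_ne_zero _ (hε k).1.ne')]
  rw [← e4]
  ring

end oscillating

/-! ### The flux of the limit -/

section limit

variable {d n m : ℕ} {Ω : Set (Euc d)} {T : ℝ} {χ : Pt d → ℝ}
  {b : LIdx d m → LIdx d m → Pt d → ℝ} {A : Coeff d n m} {M : ℝ}

theorem topFun_extZero (W : LIdx d m → Pt d → Euc n) (p) :
    topFun (fun α => extZero Ω T (W α)) p = extZero Ω T (topFun W) p := by
  by_cases hp : p ∈ Ω ×ˢ Ioo 0 T
  · simp only [topFun, extZero, indicator_of_mem hp]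
  · simp only [topFun, extZero, indicator_of_notMem hp]
    rfl

theorem memLp_comp_dil {E : Type*} [NormedAddCommGroup E] (hb : IsBounded Ω)
    {f : Pt d → E} (hf : AEStronglyMeasurable f volume) {C} (hC : ∀ᵐ p, ‖f p‖ ≤ C)
    {a τ} (ha : 0 < a) (hτ : 0 < τ) : (∀ᵐ p ∂(dom Ω T), ‖f (dil a τ p)‖ ≤ C) ∧
      MemLp (fun p => f (dil a τ p)) 2 (dom Ω T) := by
  have := isFiniteMeasure_restrict hb
  have hq := quasiMeasurePreserving_dil (d := d) ha hτ
  have h1 : ∀ᵐ p ∂(dom Ω T), ‖f (dil a τ p)‖ ≤ C := by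
    rw [dom_eq]
    exact ae_restrict_of_ae (hq.ae hC)
  have h2 := hf.comp_quasiMeasurePreserving hq
  refine ⟨h1, MemLp.of_bound ?_ C h1⟩
  rw [dom_eq]
  exact h2.restrict

/-- The adjoint cell problem tested with `χ u`. -/
theorem IsLeibniz.abs_oscillating_le (hm : 0 < m) (ho : IsOpen Ω) (hb : IsBounded Ω)
    (hχ : IsTest (Ω ×ˢ Ioo 0 T) χ) (hL : IsLeibniz n χ b) (hA : IsBddCoeff A M volume)
    (hAp : ∀ α β i j, IsPeriodic (A α β i j)) {α} {i} {δ} (hδ : 0 < δ)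
    {ψ}
    (hψ : ∀ w : perJets d n m, |-inner ℝ (perVal d n m w) (cellTime d n ψ)
        + inner ℝ (mulOp hA.restrict (perTop d n m w))
            (perTop d n m (cellJet d n m ψ) + constTop d n m (unitTop α i))| ≤ δ * ‖w‖)
    {R} (hR : 0 ≤ R) (hbox : ∀ {E : Type} [Zero E] (f : Pt d → E), BoxSupp R (extZero Ω T f))
    {ε} (hε : ε ∈ Ioo (0 : ℝ) 1) (u) :
    |-((ε ^ m)⁻¹ * ∫ p, inner ℝ (jetL d n m Ω T u 𝟎 p)
        (χ p • timeD ψ.1 (dil ε⁻¹ (ε ^ (2 * m))⁻¹ p)) ∂(dom Ω T))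
      + ∫ p, inner ℝ (topFun (leib b fun γ => jetL d n m Ω T u γ) p)
          (adjField A α i ψ (dil ε⁻¹ (ε ^ (2 * m))⁻¹ p)) ∂(dom Ω T)|
      ≤ δ * sqrt (card (LIdx d m) * (boxConst d R
          * ∫ p, ‖topFun (leib b fun γ => jetL d n m Ω T u γ) p‖ ^ 2 ∂(dom Ω T))) := by
  set E : Pt d → Pt d := dil ε⁻¹ (ε ^ (2 * m))⁻¹ with hE
  have hW := hL.memLp_leib (ν := dom Ω T) hχ.compact (J := fun γ => 𝒥 u γ) fun γ => Lp.memLp _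
  have h := ParabolicHomog.abs_oscillating_le hm hA hAp hδ hψ hR hε (fun γ => memLp_extZero ho (hW γ))
    (fun γ => hbox _) (hL.hasOscDeriv hχ ho hb u hε.1.ne')
  simp only [topFun_extZero] at h
  rw [integral_extZero ho _ (fun (v : Top d n m) _ => ‖v‖ ^ 2) (by simp)] at h
  obtain ⟨C, -, hC⟩ := exists_bound_adjField hA α i ψ
  obtain ⟨C', -, hC'⟩ := exists_bound_of_periodic
    (contDiff_timeD (IsCellTest.smooth ψ.2)).continuous (IsCellTest.per_time ψ.2)
  have hε' := inv_pos.2 hε.1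
  have hε2 := inv_pos.2 (pow_pos hε.1 (2 * m))
  have hadj := (memLp_comp_dil (T := T) hb (aestronglyMeasurable_adjField hA α i ψ) hC hε' hε2).2
  have htd := (memLp_comp_dil (T := T) hb (contDiff_timeD
    (IsCellTest.smooth ψ.2)).continuous.aestronglyMeasurable (ae_of_all _ hC') hε' hε2).2
  have e1 : ∑ a, ∫ p, extZero Ω T (topFun (leib b fun γ => 𝒥 u γ)) p a
      * adjField A α i ψ (E p) a = ∫ p, inner ℝ (topFun (leib b fun γ => 𝒥 u γ) p)
          (adjField A α i ψ (E p)) ∂(dom Ω T) := by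
    rw [integral_inner_eq_sum (memLp_topFun hW) hadj]
    exact sum_congr rfl fun a _ => integral_extZero ho _
      (fun (v : Top d n m) p => v a * adjField A α i ψ (E p) a) (by simp)
  have e2 : ∑ j, ∫ p, extZero Ω T (leib b (fun γ => 𝒥 u γ) 𝟎) p j
      * timeD ψ.1 (E p) j = ∫ p, inner ℝ (𝒥 u 𝟎 p) (χ p • timeD ψ.1 (E p)) ∂(dom Ω T) := by
    have e3 : ∀ p, inner ℝ (𝒥 u 𝟎 p) (χ p • timeD ψ.1 (E p))
        = inner ℝ (leib b (fun γ => 𝒥 u γ) 𝟎 p) (timeD ψ.1 (E p)) :=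
      fun p => by rw [hL.leib_zero, real_inner_smul_left, real_inner_smul_right]
    simp only [e3]
    rw [integral_inner_eq_sum (hW _) htd]
    exact sum_congr rfl fun a _ => integral_extZero ho _
      (fun (v : Euc n) p => v a * timeD ψ.1 (E p) a) (by simp)
  rw [e1, e2] at h
  exact h

theorem tendsto_inner_strong_weak {E : Type*} [NormedAddCommGroup E] [InnerProductSpace ℝ E]
    {x y : ℕ → E} {x₀ C c} (hx : Tendsto x atTop (𝓝 x₀)) (hy : ∀ k, ‖y k‖ ≤ C)
    (h : Tendsto (fun k => inner ℝ x₀ (y k)) atTop (𝓝 c)) :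
    Tendsto (fun k => inner ℝ (x k) (y k)) atTop (𝓝 c) := by
  have h1 : Tendsto (fun k => (inner ℝ (x k - x₀) (y k) : ℝ)) atTop (𝓝 0) := by
    refine squeeze_zero_norm (a := fun k => ‖x k - x₀‖ * C) (fun k => ?_) ?_
    · exact (norm_inner_le_norm (𝕜 := ℝ) _ _).trans
        (mul_le_mul_of_nonneg_left (hy k) (norm_nonneg _))
    · simpa using (tendsto_iff_norm_sub_tendsto_zero.1 hx).mul_const C
  simpa [inner_sub_left] using h1.add h

/-- The lower order terms of the Leibniz rule, paired with a bounded oscillating function. -/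
theorem tendsto_integral_lower (hm : 0 < m) (ho : IsOpen Ω) (hb : IsBounded Ω) {β}
    (hβ : Continuous β) {B} (hB : ∀ p, |β p| ≤ B) {Θ} (hΘ : AEStronglyMeasurable Θ volume) {C}
    (hC : ∀ᵐ p, ‖Θ p‖ ≤ C) (hper : IsPeriodic Θ) {ε : ℕ → ℝ} (hε : ∀ k, ε k ∈ Ioo (0 : ℝ) 1)
    (hε0 : Tendsto ε atTop (𝓝 0)) {J} {J₀ : Lp (Euc n) 2 (dom Ω T)} (hJ : Tendsto J atTop (𝓝 J₀))
    (j) :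
    Tendsto (fun k => ∫ p, β p * J k p j * Θ (dil (ε k)⁻¹ (ε k ^ (2 * m))⁻¹ p) ∂(dom Ω T)) atTop
      (𝓝 ((∫ p in cell d, Θ p) * ∫ p, β p * J₀ p j ∂(dom Ω T))) := by
  classical
  have := isFiniteMeasure_restrict hb
  have hB0 : 0 ≤ B := (abs_nonneg _).trans (hB 0)
  let g : ℕ → Pt d → Euc n := fun k p => (β p * Θ (dil (ε k)⁻¹ (ε k ^ (2 * m))⁻¹ p)) • single j 1
  have hd := fun k => memLp_comp_dil (T := T) hb hΘ hC (inv_pos.2 (hε k).1)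
    (inv_pos.2 (pow_pos (hε k).1 (2 * m)))
  have hgb : ∀ k, ∀ᵐ p ∂(dom Ω T), ‖g k p‖ ≤ B * C := fun k => by
    filter_upwards [(hd k).1] with p hp
    rw [norm_smul, PiLp.norm_single, norm_one, mul_one, norm_mul]
    exact mul_le_mul (hB p) hp (norm_nonneg _) hB0
  have hg : ∀ k, MemLp (g k) 2 (dom Ω T) := fun k => MemLp.of_bound
    ((hβ.aestronglyMeasurable.mul (hd k).2.1).smul_const _) (B * C) (hgb k)
  have he : ∀ k (f : Lp (Euc n) 2 (dom Ω T)), inner ℝ f ((hg k).toLp _)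
      = ∫ p, β p * f p j * Θ (dil (ε k)⁻¹ (ε k ^ (2 * m))⁻¹ p) ∂(dom Ω T) := fun k f => by
    rw [inner_eq_integral .rfl (hg k).coeFn_toLp]
    refine congrArg _ (funext fun p => ?_)
    rw [inner_smul_right, EuclideanSpace.inner_single_right]
    simp
    ring
  have hC0 : 0 ≤ C := by
    obtain ⟨p, hp⟩ := hC.exists
    exact (norm_nonneg _).trans hp
  have key := tendsto_inner_strong_weak (y := fun k => (hg k).toLp _)
    (C := bddConst (dom Ω T) * (B * C)) hJ (fun k => ?_)
    (c := (∫ p in cell d, Θ p) * ∫ p, β p * J₀ p j ∂(dom Ω T)) ?_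
  · simpa only [he] using key
  · refine Lp.norm_le_of_ae_bound (mul_nonneg hB0 hC0) ?_
    filter_upwards [(hg k).coeFn_toLp, hgb k] with p h1 h2
    rwa [h1]
  · simp only [he]
    obtain ⟨R, hR, hbox⟩ := exists_boxSupp hb T
    have hf : MemLp (fun p => β p * J₀ p j) 2 (dom Ω T) :=
      (memLp_coord (Lp.memLp J₀) j).of_le_mul (c := B)
        (hβ.aestronglyMeasurable.mul (aestronglyMeasurable_coord (Lp.aestronglyMeasurable J₀) j))
        (ae_of_all _ fun p => by
          rw [norm_mul]
          exact mul_le_mul_of_nonneg_right (hB p) (norm_nonneg _))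
    have h1 := tendsto_integral_oscillating hm hR (memLp_extZero ho hf) (hbox _) hΘ
      (MemLp.of_bound hΘ.restrict C (ae_restrict_of_ae hC)) hper
    have h2 := h1.comp (tendsto_nhdsWithin_iff.2 ⟨hε0, Eventually.of_forall fun k => (hε k).1⟩)
    rw [integral_extZero ho _ (fun v _ => v) (by simp)] at h2
    refine h2.congr fun k => ?_
    exact integral_extZero ho _ (fun v p => v * Θ (dil (ε k)⁻¹ (ε k ^ (2 * m))⁻¹ p)) (by simp)

end limit

section fluxLimit

variable {d n m : ℕ} {Ω : Set (Euc d)} {T : ℝ} {χ : Pt d → ℝ}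
  {b : LIdx d m → LIdx d m → Pt d → ℝ} {A : Coeff d n m} {M μ : ℝ}

theorem oscillating_eq (A ε) (α β : MIdx d m) (i j : Fin n) (p) :
    oscillating A ε α β i j p = A α β i j (dil ε⁻¹ (ε ^ (2 * m))⁻¹ p) := by
  simp only [oscillating, dil, div_eq_inv_mul]

theorem isBddCoeff_oscillating (hA : IsBddCoeff A M volume) {ε} (hε : 0 < ε) :
    IsBddCoeff (oscillating A ε) M (dom Ω T) := by
  have hq := quasiMeasurePreserving_dil (d := d) (inv_pos.2 hε) (inv_pos.2 (pow_pos hε (2 * m)))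
  rw [dom_eq]
  refine ⟨fun α β i j => ?_, ?_⟩
  · have := ((hA.measurable α β i j).comp_quasiMeasurePreserving hq).restrict (s := Ω ×ˢ Ioo 0 T)
    exact this.congr (ae_of_all _ fun p => (oscillating_eq A ε α β i j p).symm)
  · filter_upwards [ae_restrict_of_ae (hq.ae hA.bound)] with p hp α β i j
    rw [oscillating_eq]
    exact hp α β i j

theorem lowerBound_oscillating (hl : LowerBound A μ volume) {ε} (hε : 0 < ε) :
    LowerBound (oscillating A ε) μ (dom Ω T) := by
  have hq := quasiMeasurePreserving_dil (d := d) (inv_pos.2 hε) (inv_pos.2 (pow_pos hε (2 * m)))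
  rw [dom_eq]
  filter_upwards [ae_restrict_of_ae (hq.ae hl)] with p hp ξ
  simp only [oscillating_eq]
  exact hp ξ

theorem inner_flux_oscillating (A ε ξ α) (i : Fin n) (ψ p) :
    inner ℝ (ξ p) (adjField A α i ψ (dil ε⁻¹ (ε ^ (2 * m))⁻¹ p))
      = inner ℝ (flux (oscillating A ε) ξ p)
          (topFun (fun γ : LIdx d m => spaceD γ.1 ψ.1) (dil ε⁻¹ (ε ^ (2 * m))⁻¹ p))
        + flux (oscillating A ε) ξ p (α, i) := by
  have e : flux (oscillating A ε) ξ p = flux A (fun _ => ξ p) (dil ε⁻¹ (ε ^ (2 * m))⁻¹ p) := by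
    ext a
    simp only [flux, oscillating_eq]
  rw [← inner_unitTop, ← inner_add_right, e]
  exact (inner_flux_transp A (fun _ => ξ p) (totalTop α i fun γ => spaceD γ.1 ψ.1) _).symm

theorem IsLeibniz.integral_leib_eq_zero (hL : IsLeibniz n χ b) (hχ : IsTest (Ω ×ˢ Ioo 0 T) χ) (u α)
    (hα : 0 < ∑ i, α.1 i) (j) : ∫ p, leib b (fun γ => jetL d n m Ω T u γ) α p j ∂(dom Ω T) = 0 := by
  classical
  have h1 : ∀ p, spaceD α.1 (fun _ => (single j 1 : Euc n)) p = 0 :=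
    fun p => (congrFun (multiD_comp_smul (φ := fun _ => (single j 1 : Euc n))
      contDiff_const 0 α.1) p.1).trans (by rw [zero_pow hα.ne', zero_smul])
  have h2 := hL.integral_inner_leib hχ (g := fun _ => (single j 1 : Euc n)) contDiff_const α u
  simp only [h1, inner_zero_left, integral_zero, mul_zero] at h2
  simpa [EuclideanSpace.inner_single_left] using h2

theorem IsLeibniz.integral_norm_sq_le (hL : IsLeibniz n χ b) {B}
    (hB : ∀ α γ p, |b α γ p| ≤ B) (hc : HasCompactSupport χ) (u) :
    ∫ p, ‖topFun (leib b fun γ => jetL d n m Ω T u γ) p‖ ^ 2 ∂(dom Ω T)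
      ≤ (card (MIdx d m × Fin n) * B) ^ 2 * (card (LIdx d m) * ‖u‖ ^ 2) := by
  have hi : ∀ γ, Integrable (fun p => ‖𝒥 u γ p‖ ^ 2) (dom Ω T) := fun γ =>
    (Lp.memLp _).integrable_norm_pow (by norm_num)
  rw [norm_sq_eq_sum_jetL]
  simp only [norm_sq_eq_integral]
  rw [← integral_finsetSum _ fun γ _ => hi γ, ← integral_const_mul, ← integral_const_mul]
  refine integral_mono ((memLp_topFun (hL.memLp_leib hc fun γ =>
    Lp.memLp _)).integrable_norm_pow (by norm_num))
    (((integrable_finsetSum _ fun γ _ => hi γ).const_mul _).const_mul _) fun p => ?_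
  have h1 : ‖topFun (leib b fun γ => 𝒥 u γ) p‖
      ≤ card (MIdx d m × Fin n) * (B * ∑ γ, ‖𝒥 u γ p‖) :=
    norm_le_card_mul fun a => (PiLp.norm_apply_le _ a.2).trans (IsLeibniz.norm_leib_le hB _ a.1.low p)
  have h2 := sq_sum_le_card_mul_sum_sq (s := Finset.univ) (f := fun γ => ‖𝒥 u γ p‖)
  calc _ ≤ (card (MIdx d m × Fin n) * (B * ∑ γ, ‖𝒥 u γ p‖)) ^ 2 :=
        pow_le_pow_left₀ (norm_nonneg _) h1 2
    _ = (card (MIdx d m × Fin n) * B) ^ 2 * (∑ γ, ‖𝒥 u γ p‖) ^ 2 := by ring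
    _ ≤ _ := mul_le_mul_of_nonneg_left (by simpa using h2) (sq_nonneg _)

theorem eq_of_forall_abs_sub_le {x y c} (hc : 0 ≤ c) (h : ∀ δ : ℝ, 0 < δ → |x - y| ≤ δ * c) :
    x = y := by
  refine sub_eq_zero.1 (abs_nonpos_iff.1 (le_of_forall_pos_le_add fun η hη => ?_))
  refine (h (η / (c + 1)) (by positivity)).trans ?_
  rw [zero_add, div_mul_eq_mul_div, div_le_iff₀ (by positivity)]
  nlinarith

/-- The limit of the fluxes, tested with a cut-off function. -/
theorem integral_flux_limit (hm : 0 < m) (ho : IsOpen Ω) {hb : IsBounded Ω}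
    (hA : IsBddCoeff A M volume) (hμ : 0 < μ) (hl : LowerBound A μ (cellM d))
    (hAp : ∀ α β i j, IsPeriodic (A α β i j))
    {X} (hX : IsCorrector A X)
    {F} {h : L2 d n Ω} {ε} (hε : ∀ k, ε k ∈ Ioo (0 : ℝ) 1)
    (hε0 : Tendsto ε atTop (𝓝 0)) {u : ℕ → L2T T (H0 d n m Ω)} {u₀}
    {σ : ℕ → Lp (Top d n m) 2 (dom Ω T)} {σ₀} {K}
    (hK : ∀ k, ‖u k‖ ≤ K) (hσ : ∀ k, ‖σ k‖ ≤ K) (hu : ∀ k, WeakEq hb F h (u k) (σ k))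
    (hσu : ∀ k, σ k =ᵐ[dom Ω T] flux (oscillating A (ε k)) (topL d n m Ω T (u k)))
    (hs : ∀ γ : LIdx d m, ∑ i, γ.1 i < m →
      Tendsto (fun k => jetL d n m Ω T (u k) γ) atTop (𝓝 (jetL d n m Ω T u₀ γ)))
    (hw : ∀ w, Tendsto (fun k => inner ℝ (σ k) w) atTop (𝓝 (inner ℝ σ₀ w)))
    (hχ : IsTest (Ω ×ˢ Ioo 0 T) χ) (α) (i) :
    ∫ p, χ p * σ₀ p (α, i) ∂(dom Ω T) = ∑ a : MIdx d m × Fin n,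
      homogenized A X α a.1 i a.2 0 * ∫ p, χ p * jetL d n m Ω T u₀ a.1.low p a.2 ∂(dom Ω T) := by
  have := isFiniteMeasure_restrict hb
  obtain ⟨R, hR, hbox⟩ := exists_boxSupp hb T
  obtain ⟨b, hL⟩ := exists_isLeibniz n m hχ.smooth
  obtain ⟨B, hB0, hB⟩ := hL.exists_bound hχ.compact
  have hχB : ∀ p, |χ p| ≤ B := fun p => by
    have := hB 𝟎 𝟎 p
    rwa [hL.diag] at this
  set D : ℝ := (card (MIdx d m × Fin n) * B) ^ 2 * (card (LIdx d m) * K ^ 2) with hD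
  set C₁ : ℝ := sqrt (card (LIdx d m) * (boxConst d R * D)) with hC₁
  let I : MIdx d m × Fin n → ℝ := fun a => ∫ p, χ p * 𝒥 u₀ a.1.low p a.2 ∂(dom Ω T)
  refine eq_of_forall_abs_sub_le (c := C₁ + ∑ a, |I a|) (by positivity) fun δ hδ => ?_
  obtain ⟨ψ, hψ1, hψ2⟩ := exists_adjoint_corrector hm hA hμ hl hAp hX α i hδ
  obtain ⟨C, hC0, hC⟩ := exists_bound_adjField hA α i ψ
  let E : ℕ → Pt d → Pt d := fun k => dil (ε k)⁻¹ (ε k ^ (2 * m))⁻¹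
  let S : MIdx d m × Fin n → Finset (LIdx d m) := fun a =>
    Finset.univ.filter fun γ => ∑ i, γ.1 i < ∑ i, a.1.low.1 i
  let mean : MIdx d m × Fin n → ℝ := fun a => ∫ p in cell d, adjField A α i ψ p a
  have hmean : ∀ a, |mean a - homogenized A X α a.1 i a.2 0| ≤ δ := fun a => by
    have := hψ2 a.1 a.2 0
    rwa [integral_adjField hA α a.1 i a.2 ψ] at this
  have hadjm := fun a => aestronglyMeasurable_coord (aestronglyMeasurable_adjField hA α i ψ) a
  have hadjC : ∀ a, ∀ᵐ p, ‖adjField A α i ψ p a‖ ≤ C := fun a =>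
    hC.mono fun p hp => (PiLp.norm_apply_le _ a).trans hp
  have hadj := fun k => (memLp_comp_dil (T := T) hb (aestronglyMeasurable_adjField hA α i ψ) hC
    (inv_pos.2 (hε k).1) (inv_pos.2 (pow_pos (hε k).1 (2 * m)))).2
  have l1 := tendsto_oscillating_test hm ho hχ hL ψ hε hε0 hK hσ hu
  have hg : MemLp (fun p => χ p • unitTop (n := n) α i) 2 (dom Ω T) := MemLp.of_bound
    (hχ.smooth.continuous.aestronglyMeasurable.smul_const _) B (ae_of_all _ fun p => by
      rw [norm_smul, norm_unitTop, mul_one]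
      exact hχB p)
  have l2 : Tendsto (fun k => ∫ p, χ p * σ k p (α, i) ∂(dom Ω T)) atTop
      (𝓝 (∫ p, χ p * σ₀ p (α, i) ∂(dom Ω T))) := by
    have he : ∀ s : Lp (Top d n m) 2 (dom Ω T),
        inner ℝ s (hg.toLp _) = ∫ p, χ p * s p (α, i) ∂(dom Ω T) := fun s => by
      simp only [inner_eq_integral .rfl hg.coeFn_toLp, real_inner_smul_right, inner_unitTop]
    simpa only [he] using hw (hg.toLp _)
  have l3 : Tendsto (fun k => ∑ a, ∑ γ ∈ S a, ∫ p, b a.1.low γ p * 𝒥 (u k) γ p a.2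
      * adjField A α i ψ (E k p) a ∂(dom Ω T)) atTop (𝓝 (∑ a, ∑ γ ∈ S a, mean a
        * ∫ p, b a.1.low γ p * 𝒥 u₀ γ p a.2 ∂(dom Ω T))) := by
    refine tendsto_finsetSum _ fun a _ => tendsto_finsetSum _ fun γ hγ => ?_
    rw [Finset.mem_filter, show ∑ i, a.1.low.1 i = m from a.1.2] at hγ
    exact tendsto_integral_lower hm ho hb (hL.smooth a.1.low γ).continuous (hB _ γ) (hadjm a)
      (hadjC a) ((isPeriodic_adjField hAp α i ψ).map fun v => v a) hε hε0 (hs γ hγ.2) a.2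
  have hbJ : ∀ (v : L2T T (H0 d n m Ω)) (β γ : LIdx d m) j, MemLp (fun p => b β γ p
      * 𝒥 v γ p j) 2 (dom Ω T) := fun v β γ j =>
    (memLp_coord (Lp.memLp _) j).of_le_mul (c := B) ((hL.smooth β
      γ).continuous.aestronglyMeasurable.mul (aestronglyMeasurable_coord
        (Lp.aestronglyMeasurable _) j)) (ae_of_all _ fun p => by
          rw [norm_mul]
          exact mul_le_mul_of_nonneg_right (hB β γ p) (norm_nonneg _))
  have hzero : ∀ a, ∑ γ ∈ S a, ∫ p, b a.1.low γ p * 𝒥 u₀ γ p a.2 ∂(dom Ω T) = -I a := fun a => by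
    have h1 := hL.integral_leib_eq_zero hχ u₀ a.1.low
      (by rw [show ∑ i, a.1.low.1 i = m from a.1.2]; exact hm) a.2
    have h2 : ∀ p, leib b (fun γ => 𝒥 u₀ γ) a.1.low p a.2 = b a.1.low a.1.low p * 𝒥 u₀ a.1.low p a.2
          + ∑ γ ∈ S a, b a.1.low γ p * 𝒥 u₀ γ p a.2 := fun p => by
      rw [hL.leib_eq, hL.diag]
      simp [S]
    simp only [h2] at h1
    rw [integral_add ((hbJ u₀ _ _ _).integrable one_le_two) (integrable_finsetSum _ fun γ _ =>
      (hbJ u₀ _ _ _).integrable one_le_two), integral_finsetSum _ fun γ _ =>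
      (hbJ u₀ _ _ _).integrable one_le_two, hL.diag] at h1
    linarith
  have hid : ∀ k, ∫ p, inner ℝ (topFun (leib b fun γ => 𝒥 (u k) γ) p)
        (adjField A α i ψ (E k p)) ∂(dom Ω T)
      = (∫ p, inner ℝ (σ k p) (χ p • topFun (fun γ : LIdx d m => spaceD γ.1 ψ.1) (E k p)) ∂(dom Ω T))
        + (∫ p, χ p * σ k p (α, i) ∂(dom Ω T))
        + ∑ a, ∑ γ ∈ S a, ∫ p, b a.1.low γ p * 𝒥 (u k) γ p a.2
            * adjField A α i ψ (E k p) a ∂(dom Ω T) := fun k => by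
    have i1 : MemLp (fun p => χ p • topFun (fun γ => spaceD γ.1 ψ.1) (E k p)) 2 (dom Ω T) :=
      memLp_topFun (v := fun (γ : LIdx d m) p => χ p • spaceD γ.1 ψ.1 (E k p)) fun γ =>
        (hχ.of_tsupport_subset (hχ.smooth.smul ((contDiff_spaceD (IsCellTest.smooth ψ.2) γ.1).comp
          (contDiff_dil _ _))) (tsupport_smul_subset_left χ _)).memLp_prod _
    have i2 : Integrable (fun p => χ p * σ k p (α, i)) (dom Ω T) := by
      simpa only [real_inner_smul_right, inner_unitTop] using
        integrable_inner_of_memLp (Lp.memLp (σ k)) hg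
    have i3 : ∀ a γ, Integrable (fun p => b a.1.low γ p
        * 𝒥 (u k) γ p a.2 * adjField A α i ψ (E k p) a) (dom Ω T) := fun a γ =>
      (hbJ (u k) _ _ _).integrable_mul (memLp_coord (hadj k) a)
    have i4 := integrable_inner_of_memLp (Lp.memLp (σ k)) i1
    have i5 : Integrable (fun p => inner ℝ (σ k p) (χ p • topFun (fun γ : LIdx d m =>
        spaceD γ.1 ψ.1) (E k p)) + χ p * σ k p (α, i)) (dom Ω T) := i4.add i2
    simp only [← integral_finsetSum _ fun γ _ => i3 _ γ]
    rw [← integral_finsetSum _ fun a _ => integrable_finsetSum _ fun γ _ => i3 a γ,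
      ← integral_add i4 i2, ← integral_add i5 (integrable_finsetSum _ fun a _ =>
          integrable_finsetSum _ fun γ _ => i3 a γ)]
    refine integral_congr_ae ?_
    filter_upwards [coeFn_topL (u k), hσu k] with p h1 h2
    have e := inner_flux_oscillating A (ε k) (𝒯 (u k)) α i ψ p
    rw [← h2] at e
    rw [real_inner_smul_right, ← mul_add, ← e, PiLp.inner_apply, PiLp.inner_apply, mul_sum,
      ← sum_add_distrib]
    refine sum_congr rfl fun a _ => ?_
    rw [topFun_apply, hL.leib_eq, h1]
    simp only [PiLp.add_apply, PiLp.smul_apply, WithLp.ofLp_sum, Finset.sum_apply, smul_eq_mul,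
      RCLike.inner_apply, conj_trivial, S, E, ← sum_mul]
    ring
  have hlim := (l1.add l2).add l3
  rw [zero_add] at hlim
  have hbound : |(∫ p, χ p * σ₀ p (α, i) ∂(dom Ω T)) + ∑ a, ∑ γ ∈ S a, mean a
        * ∫ p, b a.1.low γ p * 𝒥 u₀ γ p a.2 ∂(dom Ω T)| ≤ δ * C₁ := by
    refine le_of_tendsto hlim.abs (Eventually.of_forall fun k => ?_)
    have h1 := hL.abs_oscillating_le hm ho hb hχ hA hAp hδ hψ1 hR hbox (hε k) (u k)
    rw [hid k] at h1
    refine (Eq.trans_le ?_ h1).trans (mul_le_mul_of_nonneg_left (Real.sqrt_le_sqrt ?_) hδ.le)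
    · congr 1
      ring
    · refine mul_le_mul_of_nonneg_left (mul_le_mul_of_nonneg_left ?_ ?_) (Nat.cast_nonneg _)
      · refine (hL.integral_norm_sq_le hB hχ.compact (u k)).trans ?_
        have hKk := pow_le_pow_left₀ (norm_nonneg (u k)) (hK k) 2
        exact mul_le_mul_of_nonneg_left (mul_le_mul_of_nonneg_left hKk (Nat.cast_nonneg _))
          (sq_nonneg _)
      · unfold boxConst
        positivity
  simp only [← mul_sum, hzero] at hbound
  have e : (∫ p, χ p * σ₀ p (α, i) ∂(dom Ω T)) - ∑ a, homogenized A X α a.1 i a.2 0 * I a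
      = ((∫ p, χ p * σ₀ p (α, i) ∂(dom Ω T)) + ∑ a, mean a * -I a)
        + ∑ a, (mean a - homogenized A X α a.1 i a.2 0) * I a := by
    simp only [sub_mul, mul_neg, Finset.sum_sub_distrib, Finset.sum_neg_distrib]
    ring
  rw [e, mul_add]
  refine (abs_add_le _ _).trans (add_le_add hbound ((Finset.abs_sum_le_sum_abs _ _).trans ?_))
  rw [mul_sum]
  refine sum_le_sum fun a _ => ?_
  rw [abs_mul]
  exact mul_le_mul_of_nonneg_right (hmean a) (abs_nonneg _)

end fluxLimit

/-! ### Compactness -/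

section compactness

variable {T : ℝ}

theorem exists_weak_subseq {E : Type*} [NormedAddCommGroup E] [InnerProductSpace ℝ E]
    [CompleteSpace E] [TopologicalSpace.SeparableSpace E] {x : ℕ → E} {C}
    (hx : ∀ k, ‖x k‖ ≤ C) : ∃ (y : E) (φ : ℕ → ℕ), StrictMono φ ∧
      ∀ v, Tendsto (fun k => inner ℝ (x (φ k)) v) atTop (𝓝 (inner ℝ y v)) := by
  obtain ⟨a, -, φ, hφ, ha⟩ := WeakDual.isSeqCompact_closedBall ℝ E 0 C
    (x := fun k => StrongDual.toWeakDual (InnerProductSpace.toDual ℝ E (x k))) fun k => by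
      simpa using hx k
  refine ⟨(InnerProductSpace.toDual ℝ E).symm (WeakDual.toStrongDual a), φ, hφ, fun v => ?_⟩
  rw [InnerProductSpace.toDual_symm_apply]
  exact ((WeakDual.eval_continuous v).tendsto a).comp ha

theorem L2T.exists_weak_subseq {V : Type*} [NormedAddCommGroup V] [InnerProductSpace ℝ V]
    [CompleteSpace V] [TopologicalSpace.SeparableSpace V] {x : ℕ → L2T T V} {C}
    (hx : ∀ k, ‖x k‖ ≤ C) : ∃ (y : L2T T V) (φ : ℕ → ℕ), StrictMono φ ∧
      ∀ v, Tendsto (fun k => inner ℝ v (x (φ k))) atTop (𝓝 (inner ℝ v y)) := by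
  have : Fact ((2 : ℝ≥0∞) ≠ (⊤ : ℝ≥0∞)) := ⟨ENNReal.ofNat_ne_top⟩
  obtain ⟨y, φ, h1, h2⟩ := ParabolicHomog.exists_weak_subseq hx
  exact ⟨y, φ, h1, fun v => by simpa only [real_inner_comm v] using h2 v⟩

theorem L2T.exists_norm_le {V W : Type*} [NormedAddCommGroup V] [InnerProductSpace ℝ V]
    [NormedAddCommGroup W] [InnerProductSpace ℝ W] (B : L2T T V →L[ℝ] W) :
    ∃ C, 0 < C ∧ ∀ u, ‖B u‖ ≤ C * ‖u‖ :=
  B.bound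

theorem L2T.exists_eq_inner {V : Type*} [NormedAddCommGroup V] [InnerProductSpace ℝ V]
    [CompleteSpace V] (l : StrongDual ℝ (L2T T V)) : ∃ w, ∀ v, l v = inner ℝ w v :=
  ⟨(InnerProductSpace.toDual ℝ _).symm l, fun _ => InnerProductSpace.toDual_symm_apply.symm⟩

variable {V H H' W : Type*} [NormedAddCommGroup V] [InnerProductSpace ℝ V] [CompleteSpace V]
  [NormedAddCommGroup H] [InnerProductSpace ℝ H] [CompleteSpace H] [NormedAddCommGroup H']
  [InnerProductSpace ℝ H'] [NormedAddCommGroup W] [InnerProductSpace ℝ W] [CompleteSpace W]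

theorem inner_indicator_eq (G : L2T T V) (v) {t} (ht : t ∈ Ioo 0 T) :
    inner ℝ (∫ s in (0 : ℝ)..t, G s) v = inner ℝ G
      (indicatorConstLp 2 (measurableSet_Ioc (a := 0) (b := t)) (measure_ne_top _ _) v) := by
  have hss : Ioc 0 t ⊆ Ioo 0 T := fun s hs => ⟨hs.1, hs.2.trans_lt ht.2⟩
  rw [real_inner_comm, real_inner_comm _ G, L2.inner_indicatorConstLp_eq_inner_setIntegral,
    intervalIntegral.integral_of_le ht.1.le, Measure.restrict_restrict measurableSet_Ioc,
    inter_eq_left.2 hss]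

/-- Strong convergence of solutions of evolution equations with weakly convergent fluxes. -/
theorem tendsto_integral_norm_sq {ι : V →L[ℝ] H} (hι : Injective ι) {D : V →L[ℝ] H'}
    (hD : ∀ η : ℝ, 0 < η → ∃ (κ : Type) (_ : Fintype κ) (a : κ → V), ∀ v,
      ‖D v‖ ^ 2 ≤ η * ‖v‖ ^ 2 + ∑ l, inner ℝ (a l) v ^ 2) (hT : 0 < T) {u : ℕ → L2T T V}
    {u₀ F} {B : L2T T V →L[ℝ] W} {σ : ℕ → W} {σ₀} {h : H} {K}
    (hu : ∀ k, EvolEq ι (u k) (F - adjT B (σ k)) h) (hu₀ : EvolEq ι u₀ (F - adjT B σ₀) h)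
    (hK : ∀ k, ‖u k‖ ≤ K) (hσ : ∀ k, ‖σ k‖ ≤ K)
    (hw : ∀ w, Tendsto (fun k => inner ℝ (σ k) w) atTop (𝓝 (inner ℝ σ₀ w))) :
    Tendsto (fun k => ∫ t in Ioo 0 T, ‖D ((u k - u₀ : L2T T V) t)‖ ^ 2) atTop (𝓝 0) := by
  let w : ℕ → L2T T V := fun k => u k - u₀
  let G : ℕ → L2T T V := fun k => adjT B (σ₀ - σ k)
  have hwK : ∀ k, ‖w k‖ ≤ K + ‖u₀‖ := fun k => (norm_sub_le _ _).trans (by gcongr; exact hK k)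
  have hGK : ∀ k, ‖G k‖ ≤ ‖adjT B‖ * (‖σ₀‖ + K) := fun k => ((adjT B).le_opNorm _).trans
    (mul_le_mul_of_nonneg_left ((norm_sub_le _ _).trans (by gcongr; exact hσ k)) (norm_nonneg _))
  have hGw : ∀ v, Tendsto (fun k => inner ℝ (G k) v) atTop (𝓝 0) := fun v => by
    simp only [G, inner_adjT, inner_sub_left]
    simpa using (tendsto_const_nhds (x := inner ℝ σ₀ (B v))).sub (hw (B v))
  have hgram : ∀ᵐ t ∂(volume.restrict (Ioo 0 T)), ∀ k v, inner ℝ (gram ι (w k t)) v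
      = inner ℝ (G k) (indicatorConstLp 2 (measurableSet_Ioc (a := 0) (b := t))
        (measure_ne_top _ _) v) := by
    filter_upwards [ae_all_iff.2 fun k => (hu k).integral_eq hT, hu₀.integral_eq hT,
      ae_all_iff.2 fun k => Lp.coeFn_sub (u k) u₀, ae_restrict_mem measurableSet_Ioo]
      with t h1 h2 h3 ht k v
    rw [← inner_indicator_eq _ _ ht]
    congr 1
    have hG : G k = (F - adjT B (σ k)) - (F - adjT B σ₀) := by
      simp only [G, map_sub]
      abel
    rw [h3, Pi.sub_apply, map_sub, h1 k, h2, add_sub_add_left_eq_sub, hG,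
      ← intervalIntegral.integral_sub (L2T.intervalIntegrable _ ⟨ht.1.le, ht.2.le⟩)
        (L2T.intervalIntegrable _ ⟨ht.1.le, ht.2.le⟩)]
    rw [intervalIntegral.integral_of_le ht.1.le, intervalIntegral.integral_of_le ht.1.le]
    have hss : Ioc 0 t ⊆ Ioo 0 T := fun s hs => ⟨hs.1, hs.2.trans_lt ht.2⟩
    refine (integral_congr_ae (ae_mono (Measure.restrict_mono_set _ hss) ?_)).symm
    exact Lp.coeFn_sub _ _
  have hlim : ∀ v, Tendsto (fun k => ∫ t in Ioo 0 T, inner ℝ (gram ι (w k t)) v ^ 2) atTop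
      (𝓝 0) := by
    intro v
    have hmeas : ∀ k, AEStronglyMeasurable (fun t => (inner ℝ (gram ι (w k t)) v : ℝ) ^ 2)
        (volume.restrict (Ioo 0 T)) := fun k => by
      have := ((gram ι).continuous.comp_aestronglyMeasurable
        (Lp.aestronglyMeasurable (w k))).inner (𝕜 := ℝ) (aestronglyMeasurable_const (b := v))
      exact this.pow 2
    set c : ℝ := ‖adjT B‖ * (‖σ₀‖ + K) * (‖v‖
      * (volume.restrict (Ioo 0 T)).real univ ^ (1 / (2 : ℝ≥0∞).toReal)) with hc
    have := tendsto_integral_of_dominated_convergence (fun _ => c ^ 2) hmeas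
      (integrable_const _) (f := fun _ => (0 : ℝ)) (fun k => ?_) ?_
    · simpa using this
    · filter_upwards [hgram] with t ht
      rw [ht, Real.norm_of_nonneg (sq_nonneg _), ← sq_abs]
      refine pow_le_pow_left₀ (abs_nonneg _) ((abs_real_inner_le_norm _ _).trans ?_) 2
      refine mul_le_mul (hGK k) (norm_indicatorConstLp_le.trans ?_) (norm_nonneg _)
        ((norm_nonneg _).trans (hGK k))
      refine mul_le_mul_of_nonneg_left ?_ (norm_nonneg _)
      exact Real.rpow_le_rpow measureReal_nonneg (measureReal_mono (subset_univ _)) (by positivity)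
    · filter_upwards [hgram] with t ht
      simp only [ht]
      simpa using (hGw _).pow 2
  have hitg : ∀ k, Integrable (fun t => ‖w k t‖ ^ 2) (volume.restrict (Ioo 0 T)) := fun k =>
    (Lp.memLp (w k)).integrable_norm_pow (by norm_num)
  have hint2 : ∀ k v, Integrable (fun t => (inner ℝ (gram ι (w k t)) v : ℝ) ^ 2)
      (volume.restrict (Ioo 0 T)) := fun k v =>
    ((((innerSL ℝ v).comp (gram ι)).comp_memLp' (Lp.memLp (w k))).integrable_sq).congr
      (ae_of_all _ fun t => by simp [real_inner_comm v])
  rw [Metric.tendsto_atTop]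
  intro e he
  set L : ℝ := (K + ‖u₀‖) ^ 2 with hL
  have hL0 : 0 ≤ L := sq_nonneg _
  obtain ⟨κ, hκ, b, hb⟩ := exists_norm_sq_le_gram hι hD (η := e / (2 * (L + 1))) (by positivity)
  have hsum : Tendsto (fun k => 2 * ∑ l, ∫ t in Ioo 0 T, inner ℝ (gram ι (w k t)) (b l) ^ 2) atTop
      (𝓝 0) := by
    simpa using (tendsto_finsetSum Finset.univ fun l _ => hlim (b l)).const_mul (2 : ℝ)
  obtain ⟨N, hN⟩ := (Metric.tendsto_atTop.1 hsum) (e / 2) (by positivity)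
  refine ⟨N, fun k hk => ?_⟩
  have h1 := hN k hk
  rw [Real.dist_0_eq_abs] at h1 ⊢
  rw [abs_of_nonneg (integral_nonneg fun t => sq_nonneg _)]
  have h2 : ∫ t in Ioo 0 T, ‖D (w k t)‖ ^ 2 ≤ e / (2 * (L + 1)) * ‖w k‖ ^ 2
      + 2 * ∑ l, ∫ t in Ioo 0 T, inner ℝ (gram ι (w k t)) (b l) ^ 2 := by
    rw [norm_sq_eq_integral, ← integral_const_mul, ← integral_finsetSum _ fun l _ => hint2 k (b l),
      ← integral_const_mul, ← integral_add ((hitg k).const_mul _)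
        ((integrable_finsetSum _ fun l _ => hint2 k (b l)).const_mul 2)]
    exact integral_mono ((D.comp_memLp' (Lp.memLp (w k))).integrable_norm_pow (by norm_num))
      (((hitg k).const_mul _).add ((integrable_finsetSum _ fun l _ => hint2 k (b l)).const_mul 2))
      fun t => hb (w k t)
  have h3 : ‖w k‖ ^ 2 ≤ L := pow_le_pow_left₀ (norm_nonneg _) (hwK k) 2
  have h4 : e / (2 * (L + 1)) * ‖w k‖ ^ 2 ≤ e / 2 := by
    refine (mul_le_mul_of_nonneg_left h3 (by positivity)).trans ?_
    rw [div_mul_eq_mul_div, div_le_div_iff₀ (by positivity) two_pos]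
    nlinarith
  linarith [(abs_lt.1 h1).2]

end compactness

/-! ### Homogenization -/

section homogenization

variable {d n m : ℕ} {Ω : Set (Euc d)} {T : ℝ} {A : Coeff d n m} {M M' μ : ℝ}

theorem separableSpace_H0 (d n m Ω) : TopologicalSpace.SeparableSpace (H0 d n m Ω) := by
  have : Fact ((2 : ℝ≥0∞) ≠ (⊤ : ℝ≥0∞)) := ⟨ENNReal.ofNat_ne_top⟩
  have : SecondCountableTopology (JetSpace d n m Ω) :=
    (PiLp.homeomorph 2 fun _ : LIdx d m => L2 d n Ω).secondCountableTopology
  exact TopologicalSpace.SecondCountableTopology.to_separableSpace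

/-- A field on `Ω × (0, T)` is determined by its integrals against cut-off functions. -/
theorem ae_eq_flux_of_integral_eq (ho : IsOpen Ω) (hb : IsBounded Ω) {a}
    (ha : ∀ α β i j p, a α β i j p = a α β i j 0) {σ : Lp (Top d n m) 2 (dom Ω T)}
    {u}
    (h : ∀ χ : Pt d → ℝ, IsTest (Ω ×ˢ Ioo 0 T) χ → ∀ α i, ∫ p, χ p * σ p (α, i) ∂(dom Ω T)
      = ∑ b : MIdx d m × Fin n, a α b.1 i b.2 0
        * ∫ p, χ p * jetL d n m Ω T u b.1.low p b.2 ∂(dom Ω T)) :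
    σ =ᵐ[dom Ω T] flux a (topL d n m Ω T u) := by
  have := isFiniteMeasure_restrict hb
  have hU : IsOpen (Ω ×ˢ Ioo 0 T) := ho.prod isOpen_Ioo
  have key : ∀ α i, ∀ᵐ p ∂(dom Ω T), σ p (α, i) = ∑ b : MIdx d m × Fin n, a α b.1 i b.2 0
      * 𝒥 u b.1.low p b.2 := by
    intro α i
    have h1 : Integrable (fun p => σ p (α, i)) (dom Ω T) :=
      (memLp_coord (Lp.memLp σ) (α, i)).integrable one_le_two
    have h2 : ∀ b : MIdx d m × Fin n, Integrable (fun p => 𝒥 u b.1.low p b.2)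
        (dom Ω T) := fun b => (memLp_coord (Lp.memLp _) b.2).integrable one_le_two
    have hi : IntegrableOn (fun p => σ p (α, i) - ∑ b : MIdx d m × Fin n, a α b.1 i b.2 0
        * 𝒥 u b.1.low p b.2) (Ω ×ˢ Ioo 0 T) := by
      rw [IntegrableOn, ← dom_eq]
      exact h1.sub (integrable_finsetSum _ fun b _ => (h2 b).const_mul _)
    have h0 := hU.ae_eq_zero_of_integral_contDiff_smul_eq_zero (hi.locallyIntegrableOn)
      fun χ hχ hc hs => ?_
    · have h3 := (ae_restrict_iff' hU.measurableSet).2 h0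
      rw [← dom_eq] at h3
      filter_upwards [h3] with p hp using sub_eq_zero.1 hp
    · rw [← setIntegral_eq_integral_of_forall_compl_eq_zero (s := Ω ×ˢ Ioo 0 T) fun p hp => by
        rw [image_eq_zero_of_notMem_tsupport fun h => hp (hs h), zero_smul], ← dom_eq]
      obtain ⟨C, hC⟩ := hχ.continuous.bounded_above_of_compact_support hc
      have hm : ∀ {f : Pt d → ℝ}, Integrable f (dom Ω T) →
          Integrable (fun p => χ p * f p) (dom Ω T) := fun hf =>
        hf.bdd_mul (c := C) hχ.continuous.aestronglyMeasurable (ae_of_all _ hC)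
      simp only [smul_eq_mul, mul_sub, mul_sum, mul_left_comm (χ _)]
      rw [integral_sub (hm h1) (integrable_finsetSum _ fun b _ => (hm (h2 b)).const_mul _),
        integral_finsetSum _ fun b _ => (hm (h2 b)).const_mul _, h χ ⟨hχ, hc, hs⟩ α i]
      simp only [integral_const_mul, sub_self]
  filter_upwards [coeFn_topL u, ae_all_iff.2 fun q : MIdx d m × Fin n => key q.1 q.2] with p h1 h2
  ext q
  rw [h2 q]
  simp only [flux, h1, sum_prod_type, fun β j => ha q.1 β q.2 j p]

theorem exists_subseq_homogenization (hd : 0 < d) (hm : 0 < m) (ho : IsOpen Ω)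
    (hb : IsBounded Ω) (hT : 0 < T) (hA : IsBddCoeff A M volume) (hμ : 0 < μ)
    (hl : LowerBound A μ volume) (hAp : ∀ α β i j, IsPeriodic (A α β i j))
    {X} (hX : IsCorrector A X)
    (ha : IsBddCoeff (homogenized A X) M' (dom Ω T)) (hla : LowerBound (homogenized A X) μ (dom Ω T))
    {F} {h : L2 d n Ω} {ε} (hε : ∀ k, ε k ∈ Ioo (0 : ℝ) 1)
    (hε0 : Tendsto ε atTop (𝓝 0)) {u : ℕ → L2T T (H0 d n m Ω)} {u₀}
    (hu : ∀ k, WeakEq hb F h (u k)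
      (mulOp (isBddCoeff_oscillating hA (hε k).1) (topL d n m Ω T (u k))))
    (hu₀ : WeakEq hb F h u₀ (mulOp ha (topL d n m Ω T u₀))) :
    ∃ φ : ℕ → ℕ, (∀ w, Tendsto (fun k => inner ℝ w (u (φ k))) atTop (𝓝 (inner ℝ w u₀))) ∧
      ∀ γ : LIdx d m, ∑ i, γ.1 i < m →
        Tendsto (fun k => jetL d n m Ω T (u (φ k) - u₀) γ) atTop (𝓝 0) := by
  obtain ⟨K, -, hK⟩ := exists_norm_le_of_weakEq hd ho hb hT hμ F h
  have hKu : ∀ k, ‖u k‖ ≤ K := fun k => hK _ _ _ (lowerBound_oscillating hl (hε k).1) _ (hu k)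
  let σ : ℕ → Lp (Top d n m) 2 (dom Ω T) := fun k =>
    mulOp (isBddCoeff_oscillating hA (hε k).1) (𝒯 (u k))
  obtain ⟨C, hC0, hC⟩ := L2T.exists_norm_le (V := H0 d n m Ω) (topL d n m Ω T)
  set K' : ℝ := max K (fluxConst d n m M * (C * K)) with hK'
  have hKu' : ∀ k, ‖u k‖ ≤ K' := fun k => (hKu k).trans (le_max_left _ _)
  have hσ : ∀ k, ‖σ k‖ ≤ K' := fun k => by
    refine ((norm_mulOp_le _ _).trans (mul_le_mul_of_nonneg_left ?_
      (fluxConst_nonneg d n m M))).trans (le_max_right _ _)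
    exact (hC _).trans (mul_le_mul_of_nonneg_left (hKu k) hC0.le)
  have := separableSpace_H0 d n m Ω
  obtain ⟨u', φ, hφ, hw⟩ := L2T.exists_weak_subseq (V := H0 d n m Ω) hKu
  have : Fact ((2 : ℝ≥0∞) ≠ (⊤ : ℝ≥0∞)) := ⟨ENNReal.ofNat_ne_top⟩
  obtain ⟨σ', φ', hφ', hwσ⟩ := exists_weak_subseq fun k => hσ (φ k)
  have hw' : ∀ w, Tendsto (fun k => inner ℝ w (u (φ (φ' k)))) atTop (𝓝 (inner ℝ w u')) :=
    fun w => (hw w).comp hφ'.tendsto_atTop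
  have heq : WeakEq hb F h u' σ' := by
    intro ψ hψ
    have h1 := hw' (adjT (valT d n m Ω T) (sliceT T hb hψ.timeD))
    simp only [inner_adjT, real_inner_comm _ (sliceT T hb hψ.timeD)] at h1
    refine tendsto_nhds_unique (h1.neg.add (hwσ (𝒯 (testT m T hb hψ)))) ?_
    refine tendsto_const_nhds.congr fun k => ?_
    exact (hu (φ (φ' k)) ψ hψ).symm
  have hs : ∀ γ, ∑ i, γ.1 i < m → Tendsto (fun k => 𝒥 (u (φ (φ' k)) - u') γ) atTop (𝓝 0) := by
    intro γ hγ
    have h1 := tendsto_integral_norm_sq (V := H0 d n m Ω) (H0.injective_DL_zero ho hb) (D := H0.DL γ)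
      (fun η hη => H0.exists_norm_DL_sq_le hb γ hγ hη) hT (B := topL d n m Ω T)
      (fun k => (hu (φ (φ' k))).evolEq) heq.evolEq (fun k => hKu' _) (fun k => hσ _) hwσ
    simp only [← norm_jetL_apply] at h1
    rw [tendsto_zero_iff_norm_tendsto_zero]
    have h2 := h1.sqrt
    simpa only [Real.sqrt_zero, Real.sqrt_sq (norm_nonneg _)] using h2
  have hε' : Tendsto (fun k => ε (φ (φ' k))) atTop (𝓝 0) :=
    hε0.comp (hφ.tendsto_atTop.comp hφ'.tendsto_atTop)
  have hσ' : σ' = mulOp ha (𝒯 u') := by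
    refine Lp.ext ((ae_eq_flux_of_integral_eq ho hb (fun _ _ _ _ _ => rfl)
      fun χ hχ α i => ?_).trans (coeFn_mulOp ha _).symm)
    refine integral_flux_limit hm ho hA hμ (ae_restrict_of_ae hl) hAp hX (fun k => hε _) hε'
      (fun k => hKu' (φ (φ' k))) (fun k => hσ (φ (φ' k))) (fun k => hu (φ (φ' k)))
      (fun k => coeFn_mulOp _ _) (fun γ hγ => ?_) hwσ hχ α i
    rw [tendsto_iff_norm_sub_tendsto_zero]
    have := (hs γ hγ).norm
    simpa only [map_sub, PiLp.sub_apply, norm_zero] using this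
  rw [hσ'] at heq
  have hu' : u' = u₀ := heq.unique hd ho hT ha hμ hla hu₀
  rw [hu'] at hw' hs
  exact ⟨fun k => φ (φ' k), hw', hs⟩

theorem eLpNorm_sobolevNorm_le (hm : 0 < m) (u u₀) :
    eLpNorm (fun t => H0.sobolevNorm (m - 1) (u t - u₀ t)) 2 (volume.restrict (Ioo (0 : ℝ) T))
      ≤ ∑ γ ∈ Finset.univ.filter fun γ : LIdx d m => ∑ i, γ.1 i < m,
        ‖jetL d n m Ω T (u - u₀) γ‖ₑ := by
  have h1 : ∀ γ, ‖𝒥 (u - u₀) γ‖ₑ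
      = eLpNorm (fun t => ‖H0.DL γ (u t - u₀ t)‖) 2 (volume.restrict (Ioo (0 : ℝ) T)) := by
    intro γ
    rw [jetL_apply, ← ofReal_norm, LinearIsometry.norm_map, ofReal_norm, Lp.enorm_def, eLpNorm_norm]
    refine eLpNorm_congr_ae ?_
    filter_upwards [(H0.DL γ).coeFn_compLpL (p := 2) (u - u₀), Lp.coeFn_sub u u₀] with t h1 h2
    rw [h1, h2, Pi.sub_apply]
  simp only [h1]
  refine (eLpNorm_mono_real (g := fun t => ∑ γ ∈ Finset.univ.filter fun γ : LIdx d m =>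
    ∑ i, γ.1 i < m, ‖H0.DL γ (u t - u₀ t)‖) fun t => ?_).trans ?_
  · rw [H0.sobolevNorm, Real.norm_of_nonneg (Real.sqrt_nonneg _), ← Finset.sum_filter]
    have e : (Finset.univ.filter fun γ => ∑ i, γ.1 i ≤ m - 1)
        = Finset.univ.filter fun γ : LIdx d m => ∑ i, γ.1 i < m :=
      Finset.filter_congr fun γ _ => by omega
    rw [e]
    refine Real.sqrt_le_iff.2 ⟨sum_nonneg fun _ _ => norm_nonneg _, ?_⟩
    exact Finset.sum_sq_le_sq_sum_of_nonneg fun γ _ => norm_nonneg _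
  · have := eLpNorm_sum_le (p := 2) (μ := volume.restrict (Ioo (0 : ℝ) T))
      (s := Finset.univ.filter fun γ => ∑ i, γ.1 i < m)
      (f := fun γ t => ‖H0.DL γ (u t - u₀ t)‖) (fun γ _ =>
        ((H0.DL γ).continuous.comp_aestronglyMeasurable ((Lp.aestronglyMeasurable u).sub
          (Lp.aestronglyMeasurable u₀))).norm) one_le_two
    refine (eLpNorm_congr_ae (ae_of_all _ fun t => ?_)).trans_le this
    simp

end homogenization

end ParabolicHomog

end

theorem theorem2p1 (d n m : ℕ) (hd : 0 < d) (hm : 0 < m) (μ : ℝ) (hμ : 0 < μ) :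
    ∃ μ₀ : ℝ, 0 < μ₀ ∧ ∀ A : Coeff d n m,
      IsElliptic A μ (1 / μ) → (∀ α β i j, IsPeriodic (A α β i j)) →
      (∃ X, IsCorrector A X) ∧
      (∀ X X', IsCorrector A X → IsCorrector A X' → ∀ γ j α, X γ j α =ᵐ[volume] X' γ j α) ∧
      ∀ X, IsCorrector A X →
        IsElliptic (homogenized A X) μ μ₀ ∧
        ∀ (Ω : Set (Euc d)) (T : ℝ), IsBoundedLipschitzDomain Ω → 0 < T →
        ∀ (f : L2T T (Hneg d n m Ω)) (h : L2 d n Ω),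
          (∀ ε : ℝ, 0 < ε → ∃! u, IsWeakSolution Ω T (oscillating A ε) f h u) ∧
          (∃! u, IsWeakSolution Ω T (homogenized A X) f h u) ∧
          ∀ (u : ℝ → L2T T (H0 d n m Ω)) (u₀ : L2T T (H0 d n m Ω)),
            (∀ ε : ℝ, 0 < ε → IsWeakSolution Ω T (oscillating A ε) f h (u ε)) →
            IsWeakSolution Ω T (homogenized A X) f h u₀ →
              (∀ l : StrongDual ℝ (L2T T (H0 d n m Ω)),
                Tendsto (fun ε => l (u ε)) (𝓝[>] 0) (𝓝 (l u₀))) ∧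
              Tendsto (fun ε => eLpNorm (fun t => H0.sobolevNorm (m - 1) (u ε t - u₀ t)) 2
                (volume.restrict (Ioo (0 : ℝ) T))) (𝓝[>] 0) (𝓝 0) := by
  have hM : 0 ≤ fluxConst d n m (1 / μ) ^ 2 / μ := by positivity
  refine ⟨fluxConst d n m (1 / μ) ^ 2 / μ + 1, by linarith, fun A hell hAp => ?_⟩
  have hA : IsBddCoeff A (1 / μ) volume := hell.isBddCoeff Measure.AbsolutelyContinuous.rfl
  have hl : LowerBound A μ volume := hell.lower
  have hlc : LowerBound A μ (cellM d) := ae_restrict_of_ae hell.lower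
  refine ⟨exists_isCorrector hm hA hμ hlc hAp,
    fun X X' hX hX' => hX.unique hm hA hμ hlc hAp hX', fun X hX => ?_⟩
  have hh := isElliptic_homogenized hm hA hμ hlc hAp hX
  refine ⟨⟨hh.measurable, hh.lower, hh.upper.mono fun p hp α β i j =>
    (hp α β i j).trans (by linarith)⟩, fun Ω T hΩ hT f h => ?_⟩
  have ho := hΩ.isOpen
  have hb := hΩ.isBounded
  have hac : dom Ω T ≪ volume := by
    rw [dom_eq]
    exact Measure.restrict_le_self.absolutelyContinuous
  have ha := hh.isBddCoeff hac
  have hla : LowerBound (homogenized A X) μ (dom Ω T) := hac.ae_le hh.lower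
  refine ⟨fun ε hε => existsUnique_isWeakSolution hd ho hb hT (isBddCoeff_oscillating hA hε) hμ
    (lowerBound_oscillating hl hε) f h, existsUnique_isWeakSolution hd ho hb hT ha hμ hla f h,
    fun u u₀ hu hu₀ => ?_⟩
  have key : ∀ x : ℕ → ℝ, Tendsto x atTop (𝓝[>] 0) → ∃ φ : ℕ → ℕ,
      (∀ w, Tendsto (fun k => inner ℝ w (u (x (φ k)))) atTop (𝓝 (inner ℝ w u₀))) ∧
      ∀ γ : LIdx d m, ∑ i, γ.1 i < m →
        Tendsto (fun k => jetL d n m Ω T (u (x (φ k)) - u₀) γ) atTop (𝓝 0) := by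
    intro x hx
    obtain ⟨N, hN⟩ := eventually_atTop.1 (hx.eventually (Ioo_mem_nhdsGT one_pos))
    have hε : ∀ k, x (k + N) ∈ Ioo (0 : ℝ) 1 := fun k => hN _ (Nat.le_add_left _ _)
    obtain ⟨φ, h1, h2⟩ := exists_subseq_homogenization hd hm ho hb hT hA hμ hl hAp hX ha hla hε
      ((tendsto_add_atTop_iff_nat N).2 (hx.mono_right nhdsWithin_le_nhds))
      (fun k => (isWeakSolution_iff_weakEq ho hb hT _).1 (hu _ (hε k).1))
      ((isWeakSolution_iff_weakEq ho hb hT ha).1 hu₀)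
    exact ⟨fun k => φ k + N, h1, h2⟩
  refine ⟨fun l => tendsto_of_subseq_tendsto fun x hx => ?_,
    tendsto_of_subseq_tendsto fun x hx => ?_⟩
  · obtain ⟨φ, h1, -⟩ := key x hx
    obtain ⟨w, hw⟩ := L2T.exists_eq_inner (V := H0 d n m Ω) l
    exact ⟨φ, by simpa only [hw] using h1 w⟩
  · obtain ⟨φ, -, h2⟩ := key x hx
    refine ⟨φ, tendsto_of_tendsto_of_tendsto_of_le_of_le tendsto_const_nhds ?_ (fun k => zero_le)
      fun k => eLpNorm_sobolevNorm_le hm (u (x (φ k))) u₀⟩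
    have := tendsto_finsetSum (Finset.univ.filter fun γ : LIdx d m => ∑ i, γ.1 i < m)
      fun γ hγ => (h2 γ (Finset.mem_filter.1 hγ).2).enorm
    simpa using this
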